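/- All (Lie) conformal superalgebras are over $\mathbb C$: $\mathbb Z/2\mathbb Z$-graded vector spaces with an even operator $\partial$ and bilinear products $a_{(n)}b$ ($n\ge 0$, zero for $n\gg0$, even), satisfying $(\partial a)_{(n)}b=-n\,a_{(n-1)}b$, $a_{(n)}\partial b=\partial(a_{(n)}b)+n\,a_{(n-1)}b$, skew-symmetry $a_{(n)}b=-(-1)^{p(a)p(b)}\sum_{j\ge0}(-1)^{j+n}\frac{\partial^j}{j!}(b_{(n+j)}a)$ and the Jacobi identity $a_{(m)}(b_{(n)}c)=\sum_{j=0}^m\binom mj(a_{(j)}b)_{(m+n-j)}c+(-1)^{p(a)p(b)}b_{(n)}(a_{(m)}c)$; write $[a_\lambda b]=\sum_n\frac{\lambda^n}{n!}a_{(n)}b$. Homomorphisms are even linear maps respecting $\partial$ and all products. The $N=2$ conformal superalgebra is $\mathbb C[\partial]\otimes V$, where $V$ has even basis $L,J$ and odd basis $G^+,G^-$, with $[L_\lambda L]=(\partial+2\lambda)L$, $[L_\lambda J]=(\partial+\lambda)J$, $[L_\lambda G^\pm]=(\partial+\tfrac32\lambda)G^\pm$, $[J_\lambda J]=0$, $[J_\lambda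 G^\pm]=\pm G^\pm$, $[G^\pm{}_\lambda G^\pm]=0$, $[G^+{}_\lambda G^-]=L+\tfrac12(\partial+2\lambda)J$. The $N=4$ conformal superalgebra is $\mathbb C[\partial]\otimes V$, where $V$ has even basis $L,J^1,J^2,J^3$ and odd basis $G^1,G^2,\overline G^1,\overline G^2$. Let $\sigma^1,\sigma^2,\sigma^3$ be the Pauli matrices, and identify $J^s$ with $\tfrac12\sigma^s$. The brackets are $[L_\lambda L]=(\partial+2\lambda)L$, $[L_\lambda J^s]=(\partial+\lambda)J^s$, $[L_\lambda G^a]=(\partial+\tfrac32\lambda)G^a$, $[L_\lambda\overline G^a]=(\partial+\tfrac32\lambda)\overline G^a$, $[J^m{}_\lambda J^n]=J^mJ^n-J^nJ^m$, $[J^s{}_\lambda G^a]=-\tfrac12\sum_b\sigma^s_{ab}G^b$, $[J^s{}_\lambda\overline G^a]=\tfrac12\sum_b\sigma^s_{ba}\overline G^b$, $[G^a{}_\lambda G^b]=[\overline G^a{}_\lambda\overline G^b]=0$, $[G^a{}_\lambda\overline G^b]=2\delta_{ab}L-2(\partial+2\lambda)\sum_s\sigma^s_{ab}J^s$. Fix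 primitive $m$th roots of unity $\xi_m\in\mathbb C$ with $\xi_{\ell m}^\ell=\xi_m$ for all $\ell,m\ge1$. For an automorphism $\sigma$ of a conformal superalgebra $\mathcal A$ with $\sigma^m=1$, $m\ge1$, the twisted loop algebra is $$\mathcal L(\mathcal A,\sigma)=\bigoplus_{i\in\mathbb Z}\{a\in\mathcal A:\sigma(a)=\xi_m^i a\}\otimes t^{i/m}\subseteq\mathcal A\otimes\mathbb C[t^{\pm1/m}],$$ a conformal superalgebra over $\mathbb C$ with derivation $\partial\otimes1+1\otimes\frac d{dt}$ and products $(a\otimes f)_{(n)}(b\otimes g)=\sum_{j\ge0}(a_{(n+j)}b)\otimes\frac1{j!}\frac{d^jf}{dt^j}\,g$. **Corollary.** 1. Let $\omega$ be the automorphism of the $N=2$ conformal superalgebra $\mathcal A$ with $L\mapsto L$, $J\mapsto-J$, $G^\pm\mapsto G^\mp$; it exists and $\omega^2=1$. There are exactly two $\mathbb C$-isomorphism classes of twisted loop algebras of $\mathcal A$: $\mathcal L(\mathcal A,\mathrm{id})\not\cong\mathcal L(\mathcal A,\omega)$, and every twisted loop algebra of $\mathcal A$ is isomorphic to one of these two.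 2. Let $\mathcal A$ be the $N=4$ conformal superalgebra. There are infinitely many $\mathbb C$-isomorphism classes of twisted loop algebras of $\mathcal A$. The group $\mathrm{SL}_2(\mathbb C)$ acts on $\mathcal A$ by automorphisms $\rho_X$ that fix $L$ and all $J^s$ and act by the matrix $X$ with respect to each of the bases $(G^1,\overline G^2)$ and $(G^2,-\overline G^1)$; and there is a bijection from the set of conjugacy classes of elements of finite order in $\mathrm{PGL}_2(\mathbb C)$ to the set of isomorphism classes of twisted loop algebras of $\mathcal A$ that sends the class of the image of $X$ to the class of $\mathcal L(\mathcal A,\rho_X)$, for every $X\in\mathrm{SL}_2(\mathbb C)$ of finite order. 3. Every twisted loop algebra of the $N=2$ or of the $N=4$ conformal superalgebra has a universal central extension, and two of these twisted loop algebras are isomorphic if and only if their universal central extensions are isomorphic. Here a central extension of $\mathcal B$ is a surjective homomorphism $\pi:\mathcal E\to\mathcal B$ of Lie conformal superalgebras such that $a_{(n)}b=0$ for all $a\in\ker\pi$, $b\in\mathcal E$, $n\ge0$, and it is universal if it has exactly one morphism (homomorphism compatible with the projections to $\mathcal B$) to every central extension of $\mathcal B$. -/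

import Mathlib

noncomputable section

open scoped TensorProduct Polynomial MatrixGroups
open scoped Nat

namespace SuperConf

/-! ## Conformal superalgebras over the complex numbers -/

/-- The data carried by a `ℂ`-conformal superalgebra: a complex vector space, its even part
`part 0` and odd part `part 1`, the derivation `∂`, and the `n`-products.  The products are bundled
as `a, b ↦ (n ↦ a₍ₙ₎b)`, a bilinear map with values in finitely supported sequences, so that
`a₍ₙ₎b = 0` for `n ≫ 0` is built in.  The axioms are `ConfData.IsLie` below. -/
structure ConfData where
  carrier : Type
  [addCommGroup : AddCommGroup carrier]
  [module : Module ℂ carrier]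
  part : ZMod 2 → Submodule ℂ carrier
  der : carrier →ₗ[ℂ] carrier
  prod : carrier →ₗ[ℂ] carrier →ₗ[ℂ] (ℕ →₀ carrier)

attribute [instance] ConfData.addCommGroup ConfData.module

/-- The sign `p(a,b) = (-1)^{p(a)p(b)}` for parities `i`, `j`. -/
def koszul (i j : ZMod 2) : ℂ := if i = 1 ∧ j = 1 then -1 else 1

/-- The divided power `T^{(j)} = T^j / j!`. -/
def dpow {M : Type} [AddCommGroup M] [Module ℂ M] (T : M →ₗ[ℂ] M) (j : ℕ) : M →ₗ[ℂ] M :=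
  ((j ! : ℂ)⁻¹) • (T ^ j)

/-- The axioms of a Lie conformal superalgebra over `ℂ` (with zero derivation on `ℂ`).
In `der_prod` and `prod_der` the last term is `0` for `n = 0`, because of the factor `n`. -/
structure ConfData.IsLie (A : ConfData) : Prop where
  isCompl : IsCompl (A.part 0) (A.part 1)
  der_mem : ∀ i, ∀ a ∈ A.part i, A.der a ∈ A.part i
  prod_mem : ∀ i j, ∀ a ∈ A.part i, ∀ b ∈ A.part j, ∀ n, A.prod a b n ∈ A.part (i + j)
  der_prod : ∀ a b n, A.prod (A.der a) b n = -((n : ℂ) • A.prod a b (n - 1))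
  prod_der : ∀ a b n, A.prod a (A.der b) n = A.der (A.prod a b n) + (n : ℂ) • A.prod a b (n - 1)
  skew : ∀ i j, ∀ a ∈ A.part i, ∀ b ∈ A.part j, ∀ n,
    A.prod a b n =
      -(koszul i j • ∑ᶠ l : ℕ, (-1 : ℂ) ^ (l + n) • dpow A.der l (A.prod b a (n + l)))
  jacobi : ∀ i j, ∀ a ∈ A.part i, ∀ b ∈ A.part j, ∀ c m n,
    A.prod a (A.prod b c n) m =
      (∑ l ∈ Finset.range (m + 1), (m.choose l : ℂ) • A.prod (A.prod a b l) c (m + n - l))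
        + koszul i j • A.prod b (A.prod a c m) n

/-- Homomorphisms: even linear maps that respect the `n`-products and the derivations. -/
structure IsConfHom {A B : ConfData} (f : A.carrier →ₗ[ℂ] B.carrier) : Prop where
  map_part : ∀ i, ∀ a ∈ A.part i, f a ∈ B.part i
  map_prod : ∀ a b n, f (A.prod a b n) = B.prod (f a) (f b) n
  map_der : ∀ a, f (A.der a) = B.der (f a)

theorem IsConfHom.id (A : ConfData) : IsConfHom (LinearMap.id : A.carrier →ₗ[ℂ] A.carrier) :=
  ⟨fun _ _ h => h, fun _ _ _ => rfl, fun _ => rfl⟩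

theorem IsConfHom.comp {A B C : ConfData} {g : B.carrier →ₗ[ℂ] C.carrier}
    {f : A.carrier →ₗ[ℂ] B.carrier} (hg : IsConfHom g) (hf : IsConfHom f) :
    IsConfHom (g ∘ₗ f) where
  map_part i a h := hg.map_part i _ (hf.map_part i a h)
  map_prod a b n := by simp [hf.map_prod, hg.map_prod]
  map_der a := by simp [hf.map_der, hg.map_der]

/-- An isomorphism: a linear equivalence that is, with its inverse, a homomorphism. -/
def IsConfIso {A B : ConfData} (e : A.carrier ≃ₗ[ℂ] B.carrier) : Prop :=
  IsConfHom (e : A.carrier →ₗ[ℂ] B.carrier) ∧ IsConfHom (e.symm : B.carrier →ₗ[ℂ] A.carrier)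

/-- `A` and `B` are isomorphic as `ℂ`-conformal superalgebras. -/
def Iso (A B : ConfData) : Prop := ∃ e : A.carrier ≃ₗ[ℂ] B.carrier, IsConfIso e

theorem Iso.refl (A : ConfData) : Iso A A :=
  ⟨LinearEquiv.refl ℂ _, IsConfHom.id A, IsConfHom.id A⟩

theorem Iso.symm {A B : ConfData} : Iso A B → Iso B A := fun ⟨e, h⟩ => ⟨e.symm, h.2, h.1⟩

theorem Iso.trans {A B C : ConfData} : Iso A B → Iso B C → Iso A C := fun ⟨e, h⟩ ⟨f, k⟩ =>
  ⟨e.trans f, k.1.comp h.1, h.2.comp k.2⟩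

/-- The automorphism group of `A` as a `ℂ`-conformal superalgebra. -/
def Aut (A : ConfData) : Subgroup (A.carrier ≃ₗ[ℂ] A.carrier) where
  carrier := {e | IsConfIso e}
  one_mem' := ⟨IsConfHom.id A, IsConfHom.id A⟩
  mul_mem' h k := ⟨h.1.comp k.1, k.2.comp h.2⟩
  inv_mem' h := ⟨h.2, h.1⟩

/-! ## Central extensions -/

/-- The centre: all `a` with `a₍ₙ₎b = 0` for all `b` and `n`. -/
def centre (A : ConfData) : Submodule ℂ A.carrier := LinearMap.ker A.prod

/-- `π : E → B` is a central extension of `B` by a Lie conformal superalgebra `E`. -/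
structure IsCentralExt (B E : ConfData) (π : E.carrier →ₗ[ℂ] B.carrier) : Prop where
  isLie : E.IsLie
  isHom : IsConfHom π
  surjective : Function.Surjective π
  ker_le : LinearMap.ker π ≤ centre E

/-- `π : E → B` is a universal central extension: it is a central extension with exactly one
morphism to every other central extension of `B`. -/
def IsUniversalCentralExt (B E : ConfData) (π : E.carrier →ₗ[ℂ] B.carrier) : Prop :=
  IsCentralExt B E π ∧
    ∀ (F : ConfData) (μ : F.carrier →ₗ[ℂ] B.carrier), IsCentralExt B F μ →
      ∃! f : E.carrier →ₗ[ℂ] F.carrier, IsConfHom f ∧ μ ∘ₗ f = π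

/-! ## Twisted loop algebras -/

/-- A compatible choice of primitive roots of unity `ξ_m`, that is, `ξ_{lm}^l = ξ_m`. -/
structure RootSystem where
  root : ℕ → ℂ
  primitive : ∀ m, 0 < m → IsPrimitiveRoot (root m) m
  compatible : ∀ l m, 0 < l → 0 < m → root (l * m) ^ l = root m

/-- The ring `ℂ[t^q | q ∈ ℚ]`, the union of the rings `ℂ[t^{1/m}, t^{-1/m}]`. -/
abbrev SHat : Type := AddMonoidAlgebra ℂ ℚ

/-- The monomial `t^q`. -/
def tpow (q : ℚ) : SHat := AddMonoidAlgebra.single q 1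

/-- The derivation `d/dt`, with `d/dt (t^q) = q t^{q-1}`. -/
def deltaT : SHat →ₗ[ℂ] SHat :=
  (Finsupp.lsum ℂ fun q : ℚ => (q : ℂ) • AddMonoidAlgebra.lsingle (q - 1)) ∘ₗ
    (AddMonoidAlgebra.coeffLinearEquiv ℂ : SHat ≃ₗ[ℂ] (ℚ →₀ ℂ)).toLinearMap

theorem deltaT_tpow (q : ℚ) : deltaT (tpow q) = (q : ℂ) • tpow (q - 1) := by
  simp [deltaT, tpow, AddMonoidAlgebra.coeffLinearEquiv]

theorem tpow_mul (p q : ℚ) : tpow p * tpow q = tpow (p + q) := by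
  simp [tpow, AddMonoidAlgebra.single_mul_single]

/-- The pair `(f, g)` is sent to the sequence `j ↦ (d/dt)^{(j)}(f) g`. -/
def derSeq : SHat →ₗ[ℂ] SHat →ₗ[ℂ] (ℕ → SHat) :=
  LinearMap.mk₂ ℂ (fun f g j => dpow deltaT j f * g)
    (by intros; ext1 j; simp [add_mul]) (by intros; ext1 j; simp)
    (by intros; ext1 j; simp [mul_add]) (by intros; ext1 j; simp)

section

variable (A : ConfData)

/-- For `x : A` and a sequence `h`, the element `∑_{j ≤ N} x ⊗ h j`, with the `j`th summand
placed at index `N - j`. -/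
def spread (N : ℕ) : A.carrier →ₗ[ℂ] (ℕ → SHat) →ₗ[ℂ] (ℕ →₀ A.carrier ⊗[ℂ] SHat) :=
  LinearMap.mk₂ ℂ (fun x h => ∑ j ∈ Finset.range (N + 1), Finsupp.single (N - j) (x ⊗ₜ[ℂ] h j))
    (by intros; simp [TensorProduct.add_tmul, Finset.sum_add_distrib])
    (by intros; simp [← TensorProduct.smul_tmul', Finset.smul_sum])
    (by intros; simp [TensorProduct.tmul_add, Finset.sum_add_distrib])
    (by intros; simp [Finset.smul_sum])

/-- The `n`-products of the base change `A ⊗ ℂ[t^q | q ∈ ℚ]`; see `hatProd_tmul`. -/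
def hatProd : (A.carrier ⊗[ℂ] SHat) →ₗ[ℂ] (A.carrier ⊗[ℂ] SHat) →ₗ[ℂ]
    (ℕ →₀ A.carrier ⊗[ℂ] SHat) :=
  (TensorProduct.map₂ A.prod derSeq).compr₂
    (TensorProduct.lift (Finsupp.lsum ℂ (spread A)))

theorem spread_apply (N : ℕ) (x : A.carrier) (h : ℕ → SHat) (n : ℕ) :
    spread A N x h n = if n ≤ N then x ⊗ₜ[ℂ] h (N - n) else 0 := by
  have h0 : spread A N x h n =
      ∑ j ∈ Finset.range (N + 1), if N - j = n then x ⊗ₜ[ℂ] h j else 0 := by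
    change (∑ j ∈ Finset.range (N + 1), Finsupp.single (N - j) (x ⊗ₜ[ℂ] h j)) n = _
    rw [Finsupp.finsetSum_apply]
    exact Finset.sum_congr rfl fun j _ => by rw [Finsupp.single_apply]
  rw [h0]
  split_ifs with hn
  · rw [Finset.sum_eq_single (N - n)]
    · rw [if_pos (by omega)]
    · intro j hj hne
      rw [if_neg]
      have := Finset.mem_range.mp hj
      omega
    · intro hj
      exact absurd (Finset.mem_range.mpr (by omega)) hj
  · exact Finset.sum_eq_zero fun j _ => if_neg (by omega)

/-- `(a ⊗ f)₍ₙ₎(b ⊗ g) = ∑_j (a₍ₙ₊ⱼ₎b) ⊗ (d/dt)^{(j)}(f) g`. -/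
theorem hatProd_tmul (a b : A.carrier) (f g : SHat) (n : ℕ) :
    hatProd A (a ⊗ₜ f) (b ⊗ₜ g) n =
      ∑ᶠ j : ℕ, A.prod a b (n + j) ⊗ₜ[ℂ] (dpow deltaT j f * g) := by
  have h1 : hatProd A (a ⊗ₜ f) (b ⊗ₜ g) n =
      (A.prod a b).sum fun N x => if n ≤ N then x ⊗ₜ[ℂ] derSeq f g (N - n) else 0 := by
    simp [hatProd, Finsupp.sum, spread_apply, Finsupp.finsetSum_apply, LinearMap.sum_apply]
  rw [h1, Finsupp.sum, ← Finset.sum_filter]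
  rw [finsum_eq_sum_of_support_subset
    (s := ((A.prod a b).support.filter (n ≤ ·)).image (· - n))]
  · rw [Finset.sum_image]
    · refine Finset.sum_congr rfl fun N hN => ?_
      have : n + (N - n) = N := by have := (Finset.mem_filter.mp hN).2; omega
      rw [this]
      rfl
    · intro x hx y hy hxy
      have := (Finset.mem_filter.mp hx).2
      have := (Finset.mem_filter.mp hy).2
      simp only at hxy
      omega
  · intro j hj
    simp only [Finset.coe_image, Set.mem_image, Finset.mem_coe, Finset.mem_filter,
      Finsupp.mem_support_iff]
    refine ⟨n + j, ⟨?_, by omega⟩, by omega⟩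
    intro h0
    apply hj
    simp [h0]

/-- The derivation `∂ ⊗ 1 + 1 ⊗ d/dt` of `A ⊗ ℂ[t^q | q ∈ ℚ]`. -/
def hatDer : (A.carrier ⊗[ℂ] SHat) →ₗ[ℂ] (A.carrier ⊗[ℂ] SHat) :=
  TensorProduct.map A.der LinearMap.id + TensorProduct.map LinearMap.id deltaT

/-- The even and odd parts `A_i ⊗ ℂ[t^q | q ∈ ℚ]`. -/
def hatPart (i : ZMod 2) : Submodule ℂ (A.carrier ⊗[ℂ] SHat) :=
  LinearMap.range (TensorProduct.map (A.part i).subtype (LinearMap.id : SHat →ₗ[ℂ] SHat))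

/-- An automorphism `σ` of `A` together with a period `m` of it: `σ ^ m = 1`, `m > 0`. -/
structure Twist where
  σ : Aut A
  m : ℕ
  pos : 0 < m
  pow_eq_one : σ ^ m = 1

end

section

variable {A : ConfData} (ξ : RootSystem)

/-- The space `⨁_{i ∈ ℤ} A_i ⊗ t^{i/m}` with `A_i = {a | σ a = ξ_m^i a}`. -/
def loopSpace (d : Twist A) : Submodule ℂ (A.carrier ⊗[ℂ] SHat) :=
  Submodule.span ℂ {x | ∃ (i : ℤ) (a : A.carrier),
    d.σ.1 a = (ξ.root d.m ^ i) • a ∧ x = a ⊗ₜ[ℂ] tpow ((i : ℚ) / d.m)}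

theorem dpow_tpow (j : ℕ) (q : ℚ) : ∃ c : ℂ, dpow deltaT j (tpow q) = c • tpow (q - j) := by
  have key : ∀ j : ℕ, ∃ c : ℂ, (deltaT ^ j) (tpow q) = c • tpow (q - j) := by
    intro j
    induction j with
    | zero => exact ⟨1, by simp⟩
    | succ j ih =>
      obtain ⟨c, hc⟩ := ih
      refine ⟨c * ((q - j : ℚ) : ℂ), ?_⟩
      rw [pow_succ', Module.End.mul_apply, hc, map_smul, deltaT_tpow, smul_smul]
      congr 2
      push_cast
      ring
  obtain ⟨c, hc⟩ := key j
  exact ⟨(j ! : ℂ)⁻¹ * c, by simp [dpow, hc, smul_smul]⟩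

theorem root_zpow_sub (d : Twist A) (i : ℤ) (j : ℕ) :
    ξ.root d.m ^ (i - j * d.m) = ξ.root d.m ^ i := by
  have h := ξ.primitive d.m d.pos
  have h0 : ξ.root d.m ≠ 0 := h.ne_zero d.pos.ne'
  rw [zpow_sub₀ h0, mul_comm (j : ℤ), zpow_mul, zpow_natCast (ξ.root d.m) d.m, h.pow_eq_one,
    one_zpow, div_one]

theorem mem_loopSpace (d : Twist A) (i : ℤ) (j : ℕ) (a : A.carrier)
    (h : d.σ.1 a = (ξ.root d.m ^ i) • a) :
    a ⊗ₜ[ℂ] tpow ((i : ℚ) / d.m - j) ∈ loopSpace ξ d := by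
  apply Submodule.subset_span
  refine ⟨i - j * d.m, a, by rw [root_zpow_sub]; exact h, ?_⟩
  have : (d.m : ℚ) ≠ 0 := by exact_mod_cast d.pos.ne'
  congr 2
  push_cast
  field_simp

theorem hatDer_mem (d : Twist A) {x : A.carrier ⊗[ℂ] SHat} (hx : x ∈ loopSpace ξ d) :
    hatDer A x ∈ loopSpace ξ d := by
  induction hx using Submodule.span_induction with
  | mem x hx =>
    obtain ⟨i, a, ha, rfl⟩ := hx
    have h1 : d.σ.1 (A.der a) = (ξ.root d.m ^ i) • A.der a := by
      have := d.σ.2.1.map_der a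
      simp only [LinearEquiv.coe_coe] at this
      rw [this, ha, map_smul]
    simp only [hatDer, LinearMap.add_apply, TensorProduct.map_tmul, LinearMap.id_apply,
      deltaT_tpow, TensorProduct.tmul_smul]
    refine add_mem ?_ (Submodule.smul_mem _ _ ?_)
    · simpa using mem_loopSpace ξ d i 0 _ h1
    · simpa using mem_loopSpace ξ d i 1 _ ha
  | zero => simp
  | add x y _ _ hx hy => rw [map_add]; exact add_mem hx hy
  | smul c x _ hx => rw [map_smul]; exact Submodule.smul_mem _ _ hx

theorem hatProd_mem (d : Twist A) {x y : A.carrier ⊗[ℂ] SHat} (hx : x ∈ loopSpace ξ d)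
    (hy : y ∈ loopSpace ξ d) (n : ℕ) : hatProd A x y n ∈ loopSpace ξ d := by
  induction hx using Submodule.span_induction with
  | mem x hx =>
    obtain ⟨i, a, ha, rfl⟩ := hx
    induction hy using Submodule.span_induction with
    | mem y hy =>
      obtain ⟨k, b, hb, rfl⟩ := hy
      rw [hatProd_tmul]
      refine finsum_induction (· ∈ loopSpace ξ d) (zero_mem _)
        (fun _ _ => add_mem) fun j => ?_
      have hroot : ξ.root d.m ≠ 0 := (ξ.primitive d.m d.pos).ne_zero d.pos.ne'
      have h1 : d.σ.1 (A.prod a b (n + j)) = (ξ.root d.m ^ (i + k)) • A.prod a b (n + j) := by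
        have := d.σ.2.1.map_prod a b (n + j)
        simp only [LinearEquiv.coe_coe] at this
        rw [this, ha, hb]
        simp [smul_smul, zpow_add₀ hroot, mul_comm]
      obtain ⟨c, hc⟩ := dpow_tpow j ((i : ℚ) / d.m)
      rw [hc, smul_mul_assoc, tpow_mul, TensorProduct.tmul_smul]
      refine Submodule.smul_mem _ _ ?_
      convert mem_loopSpace ξ d (i + k) j _ h1 using 3
      push_cast
      ring
    | zero => simp
    | add x y _ _ hx hy => rw [map_add, Finsupp.add_apply]; exact add_mem hx hy
    | smul c x _ hx => rw [map_smul, Finsupp.smul_apply]; exact Submodule.smul_mem _ _ hx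
  | zero => simp
  | add x y _ _ hx hy =>
    rw [map_add, LinearMap.add_apply, Finsupp.add_apply]; exact add_mem hx hy
  | smul c x _ hx =>
    rw [map_smul, LinearMap.smul_apply, Finsupp.smul_apply]; exact Submodule.smul_mem _ _ hx

/-- The twisted loop algebra `L(A, σ)` as a `ℂ`-conformal superalgebra: the subspace `loopSpace`
of `A ⊗ ℂ[t^q | q ∈ ℚ]` with the restricted grading, derivation and `n`-products. -/
def loop (d : Twist A) : ConfData where
  carrier := loopSpace ξ d
  part i := (hatPart A i).comap (loopSpace ξ d).subtype
  der := (hatDer A).restrict fun _ hx => hatDer_mem ξ d hx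
  prod := LinearMap.mk₂ ℂ
    (fun x y => Finsupp.onFinset (hatProd A x.1 y.1).support
      (fun n => ⟨hatProd A x.1 y.1 n, hatProd_mem ξ d x.2 y.2 n⟩)
      (fun n hn => Finsupp.mem_support_iff.mpr fun h => hn (Subtype.ext h)))
    (by intros; ext; simp) (by intros; ext; simp) (by intros; ext; simp) (by intros; ext; simp)

/-- Being isomorphic, as an equivalence relation on the twisted loop algebras of `A`. -/
def loopSetoid (A : ConfData) : Setoid (Twist A) where
  r d e := Iso (loop ξ d) (loop ξ e)
  iseqv := ⟨fun _ => Iso.refl _, Iso.symm, Iso.trans⟩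

/-- The set of `ℂ`-isomorphism classes of twisted loop algebras of `A`. -/
def LoopClass (A : ConfData) : Type := Quotient (loopSetoid ξ A)

/-- The isomorphism class of `L(A, σ)`, where `σ ^ m = 1`. -/
def loopClass (σ : Aut A) (m : ℕ) (pos : 0 < m) (h : σ ^ m = 1) : LoopClass ξ A :=
  Quotient.mk (loopSetoid ξ A) ⟨σ, m, pos, h⟩

end

/-! ## Free conformal superalgebras given by a table of `λ`-brackets

Polynomials in `∂` and `λ` are elements of `ℂ[X][X]`: the inner variable is `∂`, the outer `λ`. -/

/-- The variable `∂`. -/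
def dd : ℂ[X][X] := Polynomial.C Polynomial.X

/-- The variable `λ`. -/
def lam : ℂ[X][X] := Polynomial.X

section Free

variable {ι : Type} [Fintype ι]

/-- The `λ`-bracket on `ℂ[∂] ⊗ V`, where `V` has basis `ι` and the brackets of basis elements are
given by `T`: `[p(∂)v_i _λ q(∂)v_j] = p(-λ) q(∂+λ) [v_i _λ v_j]`. -/
def lamBracket (T : ι → ι → ι → ℂ[X][X]) :
    (ι → ℂ[X]) →ₗ[ℂ] (ι → ℂ[X]) →ₗ[ℂ] (ι → ℂ[X][X]) :=
  LinearMap.mk₂ ℂ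
    (fun a b k => ∑ i, ∑ j,
      Polynomial.aeval (-lam) (a i) * Polynomial.aeval (dd + lam) (b j) * T i j k)
    (by intros; ext1 k; simp [add_mul, Finset.sum_add_distrib])
    (by intros; ext1 k; simp [Finset.smul_sum])
    (by intros; ext1 k; simp [mul_add, add_mul, Finset.sum_add_distrib])
    (by intros; ext1 k; simp [Finset.smul_sum])

/-- The coefficients of `λ^n / n!` of a (vector of) polynomials in `λ`. -/
def dividedCoeff : (ι → ℂ[X][X]) →ₗ[ℂ] (ℕ →₀ (ι → ℂ[X])) where
  toFun p := Finsupp.onFinset (Finset.univ.biUnion fun k => (p k).support)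
    (fun n k => (n ! : ℂ) • (p k).coeff n) (by
      intro n hn
      by_contra h
      apply hn
      ext1 k
      have : (p k).coeff n = 0 := by
        by_contra h'
        exact h (Finset.mem_biUnion.mpr ⟨k, Finset.mem_univ k, Polynomial.mem_support_iff.mpr h'⟩)
      simp [this])
  map_add' p q := by ext1 n; ext1 k; simp
  map_smul' c p := by
    ext1 n; ext1 k
    simp [smul_comm c]

/-- The conformal superalgebra `ℂ[∂] ⊗ V` with basis `ι` of `V` of parities `par` and
`λ`-brackets `T`: here `∂` is multiplication by the variable, and
`[a _λ b] = ∑_n λ^n/n! a₍ₙ₎b`. -/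
def freeConf (par : ι → ZMod 2) (T : ι → ι → ι → ℂ[X][X]) : ConfData where
  carrier := ι → ℂ[X]
  part i := ⨅ k ∈ {k | par k ≠ i}, LinearMap.ker (LinearMap.proj k : (ι → ℂ[X]) →ₗ[ℂ] ℂ[X])
  der := LinearMap.pi fun k => LinearMap.mulLeft ℂ Polynomial.X ∘ₗ LinearMap.proj k
  prod := (lamBracket T).compr₂ dividedCoeff

end Free

/-! ## The `N = 2` conformal superalgebra -/

/-- The basis `L, J, G⁺, G⁻`. -/
inductive I2
  | L | J | Gp | Gm
  deriving DecidableEq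

instance : Fintype I2 := ⟨{.L, .J, .Gp, .Gm}, fun x => by cases x <;> simp⟩

def par2 : I2 → ZMod 2
  | .L => 0
  | .J => 0
  | .Gp => 1
  | .Gm => 1

/-- The `λ`-brackets of `N = 2`.  The brackets in the order opposite to the usual list are those
forced by skew-symmetry, `[b _λ a] = -p(a,b) [a _{-λ-∂} b]`. -/
def table2 : I2 → I2 → I2 → ℂ[X][X]
  | .L, .L => Pi.single .L (dd + 2 * lam)
  | .L, .J => Pi.single .J (dd + lam)
  | .J, .L => Pi.single .J lam
  | .L, .Gp => Pi.single .Gp (dd + (3 / 2 : ℂ) • lam)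
  | .L, .Gm => Pi.single .Gm (dd + (3 / 2 : ℂ) • lam)
  | .Gp, .L => Pi.single .Gp ((1 / 2 : ℂ) • dd + (3 / 2 : ℂ) • lam)
  | .Gm, .L => Pi.single .Gm ((1 / 2 : ℂ) • dd + (3 / 2 : ℂ) • lam)
  | .J, .J => 0
  | .J, .Gp => Pi.single .Gp 1
  | .J, .Gm => Pi.single .Gm (-1)
  | .Gp, .J => Pi.single .Gp (-1)
  | .Gm, .J => Pi.single .Gm 1
  | .Gp, .Gp => 0
  | .Gm, .Gm => 0
  | .Gp, .Gm => Pi.single .L 1 + Pi.single .J ((1 / 2 : ℂ) • (dd + 2 * lam))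
  | .Gm, .Gp => Pi.single .L 1 - Pi.single .J ((1 / 2 : ℂ) • (dd + 2 * lam))

/-- The classical `N = 2` conformal superalgebra. -/
def N2 : ConfData := freeConf par2 table2

/-- The basis element `v` of `V`, as an element of `N2`. -/
def gen2 (v : I2) : N2.carrier := (Pi.single v 1 : I2 → ℂ[X])

/-- The conditions `L ↦ L`, `J ↦ -J`, `G⁺ ↦ G⁻`, `G⁻ ↦ G⁺` that determine `ω`. -/
def IsOmega (ω : Aut N2) : Prop :=
  ω.1 (gen2 .L) = gen2 .L ∧ ω.1 (gen2 .J) = -gen2 .J ∧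
    ω.1 (gen2 .Gp) = gen2 .Gm ∧ ω.1 (gen2 .Gm) = gen2 .Gp

/-! ## The `N = 4` conformal superalgebra -/

/-- The basis `L, J^s, G^a, Ḡ^a` (`s = 1, 2, 3`, `a = 1, 2`, indexed from `0`). -/
inductive I4
  | L
  | J (s : Fin 3)
  | G (a : Fin 2)
  | Gbar (a : Fin 2)
  deriving DecidableEq, Fintype

def par4 : I4 → ZMod 2
  | .L => 0
  | .J _ => 0
  | .G _ => 1
  | .Gbar _ => 1

/-- The Pauli spin matrices. -/
def pauli : Fin 3 → Matrix (Fin 2) (Fin 2) ℂ :=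
  ![!![0, 1; 1, 0], !![0, -Complex.I; Complex.I, 0], !![1, 0; 0, -1]]

/-- The matrices `J^s = σ^s / 2`. -/
def Jmat (s : Fin 3) : Matrix (Fin 2) (Fin 2) ℂ := (1 / 2 : ℂ) • pauli s

/-- The `r`th coordinate of a traceless matrix `M` in the basis `J^1, J^2, J^3`. -/
def Jcoord (M : Matrix (Fin 2) (Fin 2) ℂ) (r : Fin 3) : ℂ := (M * pauli r).trace

theorem sum_Jcoord (M : Matrix (Fin 2) (Fin 2) ℂ) (h : M.trace = 0) :
    ∑ r, Jcoord M r • Jmat r = M := by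
  have h' : M 1 1 = -M 0 0 := by
    rw [Matrix.trace_fin_two] at h
    linear_combination h
  ext i j
  fin_cases i <;> fin_cases j <;>
    simp [Fin.sum_univ_three, Jcoord, Jmat, pauli, Matrix.trace_fin_two, Matrix.mul_apply,
      Matrix.vecHead, Matrix.vecTail, h'] <;> ring_nf <;> simp <;> ring

/-- A scalar as a constant polynomial in `∂` and `λ`. -/
def cst (c : ℂ) : ℂ[X][X] := Polynomial.C (Polynomial.C c)

/-- The `λ`-brackets of `N = 4`.  The brackets in the order opposite to the usual list are those
forced by skew-symmetry, `[b _λ a] = -p(a,b) [a _{-λ-∂} b]`. -/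
def table4 : I4 → I4 → I4 → ℂ[X][X]
  | .L, .L => Pi.single .L (dd + 2 * lam)
  | .L, .J s => Pi.single (.J s) (dd + lam)
  | .J s, .L => Pi.single (.J s) lam
  | .J m, .J n => ∑ s, Pi.single (.J s) (cst (Jcoord (Jmat m * Jmat n - Jmat n * Jmat m) s))
  | .L, .G a => Pi.single (.G a) (dd + (3 / 2 : ℂ) • lam)
  | .L, .Gbar a => Pi.single (.Gbar a) (dd + (3 / 2 : ℂ) • lam)
  | .G a, .L => Pi.single (.G a) ((1 / 2 : ℂ) • dd + (3 / 2 : ℂ) • lam)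
  | .Gbar a, .L => Pi.single (.Gbar a) ((1 / 2 : ℂ) • dd + (3 / 2 : ℂ) • lam)
  | .J s, .G a => ∑ b, Pi.single (.G b) (cst (-(1 / 2) * pauli s a b))
  | .G a, .J s => ∑ b, Pi.single (.G b) (cst (1 / 2 * pauli s a b))
  | .J s, .Gbar a => ∑ b, Pi.single (.Gbar b) (cst (1 / 2 * pauli s b a))
  | .Gbar a, .J s => ∑ b, Pi.single (.Gbar b) (cst (-(1 / 2) * pauli s b a))
  | .G _, .G _ => 0
  | .Gbar _, .Gbar _ => 0
  | .G a, .Gbar b => Pi.single .L (if a = b then 2 else 0) -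
      ∑ s, Pi.single (.J s) (2 * (dd + 2 * lam) * cst (pauli s a b))
  | .Gbar b, .G a => Pi.single .L (if a = b then 2 else 0) +
      ∑ s, Pi.single (.J s) (2 * (dd + 2 * lam) * cst (pauli s a b))

/-- The `N = 4` conformal superalgebra. -/
def N4 : ConfData := freeConf par4 table4

/-- The basis element `v` of `V`, as an element of `N4`. -/
def gen4 (v : I4) : N4.carrier := (Pi.single v 1 : I4 → ℂ[X])

/-- The conditions that determine the action `ρ` of `SL₂(ℂ)` on the `N = 4` conformal superalgebra
by automorphisms: `L` and the `J^s` are fixed, and `X` acts by the matrix `X` on each of the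
planes with bases `(G^1, Ḡ^2)` and `(G^2, -Ḡ^1)`. -/
def IsOuterAction (ρ : SL(2, ℂ) →* Aut N4) : Prop :=
  ∀ X : SL(2, ℂ),
    (ρ X).1 (gen4 .L) = gen4 .L ∧
    (∀ s, (ρ X).1 (gen4 (.J s)) = gen4 (.J s)) ∧
    (ρ X).1 (gen4 (.G 0)) = X.1 0 0 • gen4 (.G 0) + X.1 1 0 • gen4 (.Gbar 1) ∧
    (ρ X).1 (gen4 (.Gbar 1)) = X.1 0 1 • gen4 (.G 0) + X.1 1 1 • gen4 (.Gbar 1) ∧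
    (ρ X).1 (gen4 (.G 1)) = X.1 0 0 • gen4 (.G 1) - X.1 1 0 • gen4 (.Gbar 0) ∧
    (ρ X).1 (gen4 (.Gbar 0)) = -(X.1 0 1 • gen4 (.G 1)) + X.1 1 1 • gen4 (.Gbar 0)

/-- The conjugacy classes of elements of finite order in `PGL₂(ℂ)`. -/
def FinOrderClasses : Type :=
  {c : ConjClasses PGL(2, ℂ) // ∃ g : PGL(2, ℂ), IsOfFinOrder g ∧ ConjClasses.mk g = c}

end SuperConf

end

noncomputable section

open scoped TensorProduct Polynomial MatrixGroups
open scoped Nat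
set_option linter.unusedSimpArgs false

namespace SuperConf

/-! ## Divided powers -/

section DividedPowers

variable {M N P : Type} [AddCommGroup M] [Module ℂ M] [AddCommGroup N] [Module ℂ N]
  [AddCommGroup P] [Module ℂ P]

/-! Write e for the character of ℚ with e(i/m) = ξ_m^i (`expQ`). Inside A ⊗ ℂ[t^q | q ∈ ℚ] the
twisted loop algebra of σ is the fixed space of σ ⊗ (t^q ↦ e(-q) t^q) (`mem_loopSpace_iff`). Hence
the chosen period of σ does not matter, the Lie axioms descend from the base change (`hat_isLie`,
`loop_isLie`), and an isomorphism of base changes that intertwines the two actions restricts to loop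
algebras (`loop_iso_of_hat`). In both algebras the λ-brackets of generators are affine in ∂ and λ,
so every axiom becomes a list of identities between structure constants (`AffTable.isLie`). For N =
4 these are checked in a matrix model (`K4`): L, the currents sl₂, and the 2×2 matrices as odd part,
with sl₂ acting on the left and the outer SL₂ on the right through the transpose.

Automorphisms are controlled by the Virasoro element: L_(0) = ∂, and L_(1) is the grading by
conformal weight. An automorphism fixes L and is the ∂-linear extension of a matrix on generators
(`IsVir.exists_const`). For N = 2 this leaves the scalings of G⁺, G⁻ by a, a⁻¹, and their products
with ω (`I2.aut_cases`). For N = 4 it leaves products of an inner automorphism, g ∈ SL₂ acting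
through the currents, and an outer one, X ∈ SL₂ (`K4.exists_inner_mul_outer`).

Isomorphisms come from conjugation and gauge transformations. A torus element e(q) of the group of
currents is removed by rescaling odd generators by powers t^{±q}, at the price of adding to L a
multiple of t⁻¹ times a current. For N = 2 the scalings thus give the untwisted algebra, and
everything in the other coset is conjugate to ω. For N = 4 a σ of finite order has an inner factor
of finite order, hence diagonalizable, hence removable; only X remains (`K4.loop_iso_outerTwist`).
As -X differs from X by the inner automorphism -1, the class depends only on the conjugacy class of
X in PGL₂.

Non-isomorphism uses invariants expressed by products and ∂ alone. For N = 2, some element of the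
untwisted algebra acts by its 0-product as the identity on a non-zero odd element, namely J on G⁺.
In the loop algebra of ω the J-coefficient of an element changes sign under the Galois action, so it
cannot be the constant ±1 that such an action requires. For N = 4, one looks at eigenvalues p, -p of
operators χ(∂ - l_(0)), where χ imitates multiplication by t, on two odd elements with a common
non-zero eigenvalue under some h_(0). The leading ∂-coefficients of these elements solve a 2×2 first
order system and are parallel, so a Wronskian gives an exact difference 2p of two leading exponents;
the Galois action confines the exponents to ±q + ℤ, where X has eigenvalues e(±q). This recovers
e(2q) up to inversion, which is the conjugacy class in PGL₂ (`K4.HasSpectral.expQ_eq`,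
`K4.expQ_eq_of_iso`).

The universal central extension of a perfect algebra is the space of formal products modulo those
that vanish in every central extension (`UCE.isUniversal`). For its products to vanish in high
degree, a bound valid in all central extensions simultaneously is needed; the Jacobi identity with
lifts of L ⊗ t^m supplies it (`IsVir.localAt_elt`). Loop algebras have zero centre, so the kernel of
a central extension is the full centre of the extension, and the loop algebra is recovered from it
as the quotient by the centre. -/

theorem dpow_apply (T : M →ₗ[ℂ] M) (j : ℕ) (x : M) :
    dpow T j x = ((j ! : ℂ)⁻¹) • (T ^ j) x := rfl

@[simp] theorem dpow_zero (T : M →ₗ[ℂ] M) (x : M) : dpow T 0 x = x := by simp [dpow_apply]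

theorem apply_dpow (T : M →ₗ[ℂ] M) (j : ℕ) (x : M) :
    T (dpow T j x) = ((j + 1 : ℕ) : ℂ) • dpow T (j + 1) x := by
  rw [dpow_apply, dpow_apply, map_smul, smul_smul, pow_succ', Module.End.mul_apply,
    Nat.factorial_succ]
  congr 1
  have : (j ! : ℂ) ≠ 0 := by exact_mod_cast Nat.factorial_ne_zero j
  have : ((j + 1 : ℕ) : ℂ) ≠ 0 := by exact_mod_cast Nat.succ_ne_zero j
  push_cast at *
  field_simp

theorem dpow_apply_self (T : M →ₗ[ℂ] M) (j : ℕ) (x : M) :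
    dpow T j (T x) = ((j + 1 : ℕ) : ℂ) • dpow T (j + 1) x := by
  rw [← apply_dpow, dpow_apply, dpow_apply, map_smul, ← Module.End.mul_apply,
    ← Module.End.mul_apply, ← pow_succ, ← pow_succ']

theorem dpow_succ (T : M →ₗ[ℂ] M) (j : ℕ) (x : M) :
    dpow T (j + 1) x = ((j + 1 : ℕ) : ℂ)⁻¹ • T (dpow T j x) := by
  rw [apply_dpow, smul_smul, inv_mul_cancel₀, one_smul]
  exact_mod_cast Nat.succ_ne_zero j

theorem dpow_dpow (T : M →ₗ[ℂ] M) (i j : ℕ) (x : M) :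
    dpow T i (dpow T j x) = ((i + j).choose i : ℂ) • dpow T (i + j) x := by
  rw [dpow_apply, dpow_apply, dpow_apply, map_smul, smul_smul, smul_smul, ← Module.End.mul_apply,
    ← pow_add]
  congr 1
  have h : ((i + j).choose i * i ! * j ! : ℂ) = (i + j)! := by
    rw [Nat.choose_symm_add]
    exact_mod_cast Nat.add_choose_mul_factorial_mul_factorial i j
  have hi : (i ! : ℂ) ≠ 0 := by exact_mod_cast Nat.factorial_ne_zero i
  have hj : (j ! : ℂ) ≠ 0 := by exact_mod_cast Nat.factorial_ne_zero j
  have hij : ((i + j)! : ℂ) ≠ 0 := by exact_mod_cast Nat.factorial_ne_zero (i + j)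
  field_simp
  linear_combination -h

theorem dpow_leibniz (μ : M →ₗ[ℂ] N →ₗ[ℂ] P) (S : M →ₗ[ℂ] M) (T : N →ₗ[ℂ] N) (U : P →ₗ[ℂ] P)
    (h : ∀ x y, U (μ x y) = μ (S x) y + μ x (T y)) (l : ℕ) (x : M) (y : N) :
    dpow U l (μ x y) = ∑ ij ∈ Finset.HasAntidiagonal.antidiagonal l, μ (dpow S ij.1 x) (dpow T ij.2 y) := by
  induction l with
  | zero => simp
  | succ l ih =>
    have h0 : ((l + 1 : ℕ) : ℂ) ≠ 0 := by exact_mod_cast Nat.succ_ne_zero l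
    -- After multiplication by `l + 1`, the weight of the pair `(i, j)` splits as `i + j`, and each
    -- of the two halves is a shifted sum over the pairs with sum `l`.
    have key : ((l + 1 : ℕ) : ℂ) • dpow U (l + 1) (μ x y) = ((l + 1 : ℕ) : ℂ) •
        ∑ ij ∈ Finset.HasAntidiagonal.antidiagonal (l + 1), μ (dpow S ij.1 x) (dpow T ij.2 y) := by
      rw [← apply_dpow, ih, map_sum, Finset.smul_sum]
      have h1 : ∑ ij ∈ Finset.HasAntidiagonal.antidiagonal (l + 1),
          ((l + 1 : ℕ) : ℂ) • μ (dpow S ij.1 x) (dpow T ij.2 y) =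
          ∑ ij ∈ Finset.HasAntidiagonal.antidiagonal (l + 1), (ij.1 : ℂ) • μ (dpow S ij.1 x) (dpow T ij.2 y) +
          ∑ ij ∈ Finset.HasAntidiagonal.antidiagonal (l + 1), (ij.2 : ℂ) • μ (dpow S ij.1 x) (dpow T ij.2 y) := by
        rw [← Finset.sum_add_distrib]
        refine Finset.sum_congr rfl fun ij hij => ?_
        rw [← add_smul]
        congr 1
        exact_mod_cast (Finset.HasAntidiagonal.mem_antidiagonal.mp hij).symm
      rw [h1, Finset.Nat.sum_antidiagonal_succ, Finset.Nat.sum_antidiagonal_succ']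
      simp only [h, apply_dpow, Finset.sum_add_distrib, map_smul, LinearMap.smul_apply]
      simp
    simpa [smul_right_injective _ h0] using
      smul_right_injective P h0 key

end DividedPowers

/-! ## Finite sums -/

section Sums

variable {M : Type} [AddCommGroup M] [Module ℂ M]

omit [Module ℂ M] in
theorem finsum_eq_sum_range (g : ℕ → M) (N : ℕ) (h : ∀ k, N ≤ k → g k = 0) :
    ∑ᶠ k, g k = ∑ k ∈ Finset.range N, g k := by
  apply finsum_eq_sum_of_support_subset
  intro k hk
  by_contra hk'
  exact hk (h k (by simpa using hk'))

omit [Module ℂ M] in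
theorem sum_range_range_eq_sum_antidiagonal (g : ℕ → ℕ → M) (N : ℕ)
    (h₁ : ∀ i s, N ≤ i → g i s = 0) (h₂ : ∀ i s, N ≤ s → g i s = 0) :
    ∑ i ∈ Finset.range N, ∑ s ∈ Finset.range N, g i s =
      ∑ u ∈ Finset.range (2 * N), ∑ is ∈ Finset.HasAntidiagonal.antidiagonal u, g is.1 is.2 := by
  rw [← Finset.sum_product', ← Finset.sum_fiberwise_of_maps_to (g := fun x : ℕ × ℕ => x.1 + x.2)
    (t := Finset.range (2 * N))]
  · refine Finset.sum_congr rfl fun u _ => ?_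
    refine Finset.sum_subset ?_ ?_
    · intro x hx
      exact Finset.HasAntidiagonal.mem_antidiagonal.mpr (Finset.mem_filter.mp hx).2
    · intro x hx hx'
      have hx := Finset.HasAntidiagonal.mem_antidiagonal.mp hx
      by_cases h : N ≤ x.1
      · exact h₁ _ _ h
      · refine h₂ _ _ ?_
        by_contra h'
        refine hx' (Finset.mem_filter.mpr ⟨Finset.mem_product.mpr ⟨?_, ?_⟩, hx⟩) <;>
          simp only [Finset.mem_range] <;> omega
  · intro x hx
    have := Finset.mem_product.mp hx
    simp only [Finset.mem_range] at this ⊢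
    omega

/-- Vandermonde's identity with values in a module. -/
theorem sum_choose_mul_choose (m u : ℕ) (G : ℕ → M) :
    ∑ l ∈ Finset.range (m + 1), ∑ i ∈ Finset.range (u + 1),
        ((m.choose l : ℂ) * (u.choose i : ℂ)) • G (l + i) =
      ∑ p ∈ Finset.range (m + u + 1), ((m + u).choose p : ℂ) • G p := by
  -- The identity (X + 1)^m (X + 1)^u = (X + 1)^(m + u), pushed through the linear map X^n ↦ G n.
  let ψ : ℂ[X] →ₗ[ℂ] M := Polynomial.lsum fun n => LinearMap.toSpanSingleton ℂ M (G n)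
  have hψ : ∀ (c : ℂ) n, ψ (Polynomial.C c * Polynomial.X ^ n) = c • G n := by
    intro c n
    simp [ψ, Polynomial.lsum_apply, Polynomial.C_mul_X_pow_eq_monomial]
  have hp : ∀ k : ℕ, (Polynomial.X + 1 : ℂ[X]) ^ k =
      ∑ l ∈ Finset.range (k + 1), Polynomial.C (k.choose l : ℂ) * Polynomial.X ^ l := by
    intro k
    rw [add_pow]
    refine Finset.sum_congr rfl fun l _ => ?_
    simp [mul_comm]
  have h := congrArg ψ (pow_add (Polynomial.X + 1 : ℂ[X]) m u)
  rw [hp, hp, hp, Finset.sum_mul_sum, map_sum, map_sum] at h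
  simp only [map_sum, hψ] at h
  rw [h]
  refine Finset.sum_congr rfl fun l _ => Finset.sum_congr rfl fun i _ => ?_
  rw [← hψ]
  congr 1
  simp only [map_mul]
  ring

end Sums

/-! ## Sequences of products -/

section Sequences

variable {M : Type} [AddCommGroup M] [Module ℂ M]

omit [Module ℂ M] in
theorem exists_bound (p : ℕ →₀ M) : ∃ N, ∀ k, N ≤ k → p k = 0 := by
  refine ⟨p.support.sup id + 1, fun k hk => ?_⟩
  by_contra h
  have := Finset.le_sup (f := id) (Finsupp.mem_support_iff.mpr h)
  simp only [id] at this
  omega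

/-- The map `p ↦ ∑_l U_l (p (n + l))`. -/
def opSum (U : ℕ → M →ₗ[ℂ] M) (n : ℕ) : (ℕ →₀ M) →ₗ[ℂ] M :=
  Finsupp.lsum ℂ fun k => if n ≤ k then U (k - n) else 0

theorem opSum_single (U : ℕ → M →ₗ[ℂ] M) (n k : ℕ) (z : M) :
    opSum U n (Finsupp.single k z) = if n ≤ k then U (k - n) z else 0 := by
  simp only [opSum, Finsupp.lsum_single]
  split_ifs <;> rfl

theorem opSum_eq_sum_range (U : ℕ → M →ₗ[ℂ] M) (n N : ℕ) (p : ℕ →₀ M)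
    (h : ∀ k, N ≤ k → p k = 0) :
    opSum U n p = ∑ l ∈ Finset.range N, U l (p (n + l)) := by
  have h1 : opSum U n p = ∑ k ∈ Finset.range (n + N), if n ≤ k then U (k - n) (p k) else 0 := by
    rw [opSum, Finsupp.lsum_apply, Finsupp.sum_of_support_subset]
    · refine Finset.sum_congr rfl fun k _ => ?_
      split_ifs <;> rfl
    · intro k hk
      rw [Finset.mem_range]
      by_contra h'
      exact (Finsupp.mem_support_iff.mp hk) (h k (by omega))
    · simp
  rw [h1, Finset.sum_range_add, Finset.sum_eq_zero, zero_add]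
  · refine Finset.sum_congr rfl fun l _ => ?_
    simp
  · intro k hk
    rw [Finset.mem_range] at hk
    rw [if_neg (by omega)]

theorem opSum_eq_finsum (U : ℕ → M →ₗ[ℂ] M) (n : ℕ) (p : ℕ →₀ M) :
    opSum U n p = ∑ᶠ l : ℕ, U l (p (n + l)) := by
  obtain ⟨N, hN⟩ := exists_bound p
  rw [opSum_eq_sum_range U n N p hN, finsum_eq_sum_range _ N]
  intro k hk
  rw [hN _ (by omega), map_zero]

/-- The sequence of products of `a` and `∂ b`, given that of `a` and `b`. -/
def seqDer (T : M →ₗ[ℂ] M) : (ℕ →₀ M) →ₗ[ℂ] (ℕ →₀ M) :=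
  Finsupp.lsum ℂ fun k => Finsupp.lsingle k ∘ₗ T + ((k + 1 : ℕ) : ℂ) • Finsupp.lsingle (k + 1)

theorem seqDer_single (T : M →ₗ[ℂ] M) (k : ℕ) (z : M) :
    seqDer T (Finsupp.single k z) =
      Finsupp.single k (T z) + ((k + 1 : ℕ) : ℂ) • Finsupp.single (k + 1) z := by
  simp [seqDer]

theorem seqDer_apply (T : M →ₗ[ℂ] M) (p : ℕ →₀ M) (n : ℕ) :
    seqDer T p n = T (p n) + (n : ℂ) • p (n - 1) := by
  induction p using Finsupp.induction_linear with
  | zero => simp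
  | add p q hp hq => simp only [map_add, Finsupp.add_apply, hp, hq, smul_add]; abel
  | single k z =>
    rw [seqDer_single]
    rcases n with _ | n
    · simp only [Finsupp.coe_add, Pi.add_apply, Finsupp.smul_apply, Finsupp.single_apply]
      split_ifs <;> simp at *
    · simp only [Finsupp.coe_add, Pi.add_apply, Finsupp.smul_apply, Nat.add_sub_cancel,
        Finsupp.single_apply, add_left_inj]
      congr 1
      · split_ifs <;> simp
      · split_ifs with h
        · rw [h]
        · simp

/-- The map `p ↦ ∑_l (-1)^{l+n} T^{(l)} (p (n + l))` of the skew-symmetry identity. -/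
def skewOp (T : M →ₗ[ℂ] M) (n : ℕ) : (ℕ →₀ M) →ₗ[ℂ] M :=
  opSum (fun l => (-1 : ℂ) ^ (l + n) • dpow T l) n

theorem skewOp_single (T : M →ₗ[ℂ] M) (n k : ℕ) (z : M) :
    skewOp T n (Finsupp.single k z) = if n ≤ k then (-1 : ℂ) ^ k • dpow T (k - n) z else 0 := by
  rw [skewOp, opSum_single]
  split_ifs with h
  · rw [LinearMap.smul_apply, Nat.sub_add_cancel h]
  · rfl

/-- A summation by parts. It is what carries skew-symmetry from `x`, `y` to `∂x`, `y`. -/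
theorem skewOp_seqDer (T : M →ₗ[ℂ] M) (n : ℕ) (p : ℕ →₀ M) :
    skewOp T n (seqDer T p) = -((n : ℂ) • skewOp T (n - 1) p) := by
  induction p using Finsupp.induction_linear with
  | zero => simp
  | add p q hp hq => simp only [map_add, hp, hq, smul_add, neg_add]
  | single k z =>
    rw [seqDer_single, map_add, map_smul, skewOp_single, skewOp_single, skewOp_single]
    rcases n with _ | n
    · simp only [zero_le, if_true, dpow_apply_self, tsub_zero]
      rw [pow_succ]
      module
    · rcases lt_trichotomy k n with h | h | h
      · rw [if_neg (by omega), if_neg (by omega), if_neg (by omega)]; simp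
      · subst h
        rw [if_neg (by omega), if_pos (by omega), if_pos (by omega)]
        simp [pow_succ]
      · obtain ⟨d, rfl⟩ := Nat.exists_eq_add_of_lt h
        rw [if_pos (by omega), if_pos (by omega), if_pos (by omega)]
        have e1 : n + d + 1 - (n + 1) = d := by omega
        have e2 : n + d + 1 + 1 - (n + 1) = d + 1 := by omega
        have e3 : n + d + 1 - (n + 1 - 1) = d + 1 := by omega
        rw [e1, e2, e3, dpow_apply_self, pow_succ _ (n + d + 1)]
        push_cast
        module

/-- The sequence `n ↦ skewOp T n p`. -/
def skewSeq (T : M →ₗ[ℂ] M) : (ℕ →₀ M) →ₗ[ℂ] (ℕ →₀ M) :=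
  Finsupp.lsum ℂ fun k => ∑ n ∈ Finset.range (k + 1), (-1 : ℂ) ^ k • Finsupp.lsingle n ∘ₗ dpow T (k - n)

theorem skewSeq_single (T : M →ₗ[ℂ] M) (k : ℕ) (z : M) :
    skewSeq T (Finsupp.single k z) =
      ∑ n ∈ Finset.range (k + 1), (-1 : ℂ) ^ k • Finsupp.single n (dpow T (k - n) z) := by
  rw [skewSeq, Finsupp.lsum_single, LinearMap.sum_apply]
  rfl

theorem skewSeq_apply (T : M →ₗ[ℂ] M) (p : ℕ →₀ M) (n : ℕ) : skewSeq T p n = skewOp T n p := by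
  induction p using Finsupp.induction_linear with
  | zero => simp
  | add p q hp hq => simp only [map_add, Finsupp.add_apply, hp, hq]
  | single k z =>
    rw [skewSeq_single, skewOp_single, Finsupp.finsetSum_apply]
    simp only [Finsupp.smul_apply, Finsupp.single_apply, smul_ite, smul_zero, Finset.sum_ite_eq',
      Finset.mem_range, Nat.lt_succ_iff]

theorem alternating_sum_choose (r : ℕ) :
    ∑ i ∈ Finset.range (r + 1), (-1 : ℂ) ^ i * (r.choose i : ℂ) = if r = 0 then 1 else 0 := by
  exact_mod_cast congrArg (Int.cast : ℤ → ℂ) (Int.alternating_sum_range_choose (n := r))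

/-- Exchanging the two factors twice changes nothing: the coefficients of the composite are
alternating sums of binomial coefficients, which vanish except for one term. -/
theorem skewOp_skewSeq (T : M →ₗ[ℂ] M) (p : ℕ →₀ M) (n : ℕ) : skewOp T n (skewSeq T p) = p n := by
  induction p using Finsupp.induction_linear with
  | zero => simp
  | add p q hp hq => simp only [map_add, Finsupp.add_apply, hp, hq]
  | single k z =>
    rw [skewSeq_single, map_sum]
    simp only [map_smul, skewOp_single]
    rcases lt_or_ge k n with h | h
    · rw [Finset.sum_eq_zero, Finsupp.single_apply, if_neg (by omega)]
      intro j hj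
      rw [Finset.mem_range] at hj
      rw [if_neg (by omega), smul_zero]
    · obtain ⟨r, rfl⟩ := Nat.exists_eq_add_of_le h
      rw [add_assoc, Finset.sum_range_add, Finset.sum_eq_zero, zero_add]
      · have h1 : ∀ i ∈ Finset.range (r + 1), ((-1 : ℂ) ^ (n + r) •
            if n ≤ n + i then (-1 : ℂ) ^ (n + i) • dpow T (n + i - n) (dpow T (n + r - (n + i)) z)
              else 0) = ((-1 : ℂ) ^ (n + r) * (-1) ^ n) •
                ((-1 : ℂ) ^ i * (r.choose i : ℂ)) • dpow T r z := by
          intro i hi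
          rw [Finset.mem_range] at hi
          rw [if_pos (by omega), Nat.add_sub_cancel_left, Nat.add_sub_add_left, dpow_dpow,
            Nat.add_sub_cancel' (by omega : i ≤ r), pow_add _ n i]
          module
        rw [Finset.sum_congr rfl h1, ← Finset.smul_sum, ← Finset.sum_smul, alternating_sum_choose]
        rcases r with _ | r
        · have : (-1 : ℂ) ^ n * (-1) ^ n = 1 := by rw [← mul_pow]; simp
          simp [this]
        · simp
      · intro j hj
        rw [Finset.mem_range] at hj
        rw [if_neg (by omega), smul_zero]

end Sequences

/-! ## Skew-symmetry and the Jacobi identity for single elements -/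

section Axioms

variable {C : ConfData}

/-- The sesquilinearity axioms. -/
structure IsSesqui (C : ConfData) : Prop where
  der_prod : ∀ a b n, C.prod (C.der a) b n = -((n : ℂ) • C.prod a b (n - 1))
  prod_der : ∀ a b n, C.prod a (C.der b) n = C.der (C.prod a b n) + (n : ℂ) • C.prod a b (n - 1)

theorem IsSesqui.prod_der_eq (h : IsSesqui C) (a b : C.carrier) :
    C.prod a (C.der b) = seqDer C.der (C.prod a b) := by
  ext n; rw [h.prod_der, seqDer_apply]

/-- Skew-symmetry for the pair `x`, `y`, with sign `κ`. -/
def SkewAt (C : ConfData) (κ : ℂ) (x y : C.carrier) : Prop :=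
  C.prod x y = -(κ • skewSeq C.der (C.prod y x))

theorem skewAt_iff (κ : ℂ) (x y : C.carrier) :
    SkewAt C κ x y ↔ ∀ n, C.prod x y n =
      -(κ • ∑ᶠ l : ℕ, (-1 : ℂ) ^ (l + n) • dpow C.der l (C.prod y x (n + l))) := by
  rw [SkewAt, Finsupp.ext_iff]
  refine forall_congr' fun n => ?_
  rw [Finsupp.neg_apply, Finsupp.smul_apply, skewSeq_apply, skewOp, opSum_eq_finsum]
  rfl

namespace SkewAt

variable {κ : ℂ} {x x' y : C.carrier}

/-- Since `skewSeq` is an involution, skew-symmetry for one order of the factors gives it for the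
other. The closure properties therefore need to be proved in the left argument only. -/
theorem symm (hκ : κ * κ = 1) (h : SkewAt C κ x y) : SkewAt C κ y x := by
  rw [SkewAt] at h ⊢
  ext n
  rw [h, Finsupp.neg_apply, Finsupp.smul_apply, map_neg, map_smul, Finsupp.neg_apply,
    Finsupp.smul_apply, skewSeq_apply, skewOp_skewSeq, smul_neg, smul_smul, hκ, one_smul, neg_neg]

theorem add_left (h : SkewAt C κ x y) (h' : SkewAt C κ x' y) : SkewAt C κ (x + x') y := by
  rw [SkewAt] at *
  rw [map_add, LinearMap.add_apply, h, h', map_add, map_add, smul_add, neg_add]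

theorem smul_left (c : ℂ) (h : SkewAt C κ x y) : SkewAt C κ (c • x) y := by
  rw [SkewAt] at *
  rw [map_smul, LinearMap.smul_apply, h, map_smul, map_smul, smul_neg, smul_comm c]

theorem zero_left : SkewAt C κ 0 y := by simp [SkewAt]

theorem der_left (hC : IsSesqui C) (h : SkewAt C κ x y) : SkewAt C κ (C.der x) y := by
  rw [SkewAt] at *
  ext n
  rw [hC.der_prod, h, hC.prod_der_eq, Finsupp.neg_apply, Finsupp.smul_apply, Finsupp.neg_apply,
    Finsupp.smul_apply, skewSeq_apply, skewSeq_apply, skewOp_seqDer]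
  module

end SkewAt

/-- The Jacobi identity for `x`, `y`, `z`, with sign `κ`. -/
def JacobiAt (C : ConfData) (κ : ℂ) (x y z : C.carrier) : Prop :=
  ∀ m n, C.prod x (C.prod y z n) m =
    (∑ l ∈ Finset.range (m + 1), (m.choose l : ℂ) • C.prod (C.prod x y l) z (m + n - l))
      + κ • C.prod y (C.prod x z m) n

namespace JacobiAt

variable {κ : ℂ} {x x' y y' z z' : C.carrier}

theorem add_left (h : JacobiAt C κ x y z) (h' : JacobiAt C κ x' y z) :
    JacobiAt C κ (x + x') y z := by
  intro m n
  simp only [map_add, LinearMap.add_apply, Finsupp.add_apply, h m n, h' m n, smul_add,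
    Finset.sum_add_distrib]
  abel

theorem add_middle (h : JacobiAt C κ x y z) (h' : JacobiAt C κ x y' z) :
    JacobiAt C κ x (y + y') z := by
  intro m n
  simp only [map_add, LinearMap.add_apply, Finsupp.add_apply, h m n, h' m n, smul_add,
    Finset.sum_add_distrib]
  abel

theorem add_right (h : JacobiAt C κ x y z) (h' : JacobiAt C κ x y z') :
    JacobiAt C κ x y (z + z') := by
  intro m n
  simp only [map_add, Finsupp.add_apply, h m n, h' m n, smul_add, Finset.sum_add_distrib]
  abel

theorem smul_left (c : ℂ) (h : JacobiAt C κ x y z) : JacobiAt C κ (c • x) y z := by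
  intro m n
  simp only [map_smul, LinearMap.smul_apply, Finsupp.smul_apply, h m n, smul_add, Finset.smul_sum,
    smul_comm c]

theorem smul_middle (c : ℂ) (h : JacobiAt C κ x y z) : JacobiAt C κ x (c • y) z := by
  intro m n
  simp only [map_smul, LinearMap.smul_apply, Finsupp.smul_apply, h m n, smul_add, Finset.smul_sum,
    smul_comm c]

theorem smul_right (c : ℂ) (h : JacobiAt C κ x y z) : JacobiAt C κ x y (c • z) := by
  intro m n
  simp only [map_smul, Finsupp.smul_apply, h m n, smul_add, Finset.smul_sum, smul_comm c]

theorem zero_left : JacobiAt C κ 0 y z := by intro m n; simp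
theorem zero_middle : JacobiAt C κ x 0 z := by intro m n; simp
theorem zero_right : JacobiAt C κ x y 0 := by intro m n; simp

theorem der_left (hC : IsSesqui C) (h : JacobiAt C κ x y z) : JacobiAt C κ (C.der x) y z := by
  intro m n
  rcases m with _ | m
  · simp [hC.der_prod]
  · rw [hC.der_prod, hC.der_prod, Finset.sum_range_succ']
    simp only [hC.der_prod, Nat.add_sub_cancel, h m n, map_neg, map_smul, LinearMap.neg_apply,
      LinearMap.smul_apply, Finsupp.neg_apply, Finsupp.smul_apply, Nat.cast_zero, zero_smul,
      map_zero, LinearMap.zero_apply, Finsupp.zero_apply, neg_zero, smul_zero, add_zero,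
      smul_add, smul_neg, neg_add, Finset.smul_sum, Finset.sum_neg_distrib]
    congr 2
    · refine Finset.sum_congr rfl fun l _ => ?_
      rw [smul_smul, smul_smul, show m + 1 + n - (l + 1) = m + n - l by omega]
      congr 1
      exact_mod_cast Nat.add_one_mul_choose_eq m l
    · rw [smul_comm]

/-- On the right, ∂ falls on both factors of `x_(l) y`; the resulting coefficients -(m + n - l) and,
after a shift of `l`, m - l add up to the constant -n. -/
theorem der_middle (hC : IsSesqui C) (h : JacobiAt C κ x y z) : JacobiAt C κ x (C.der y) z := by
  intro m n
  set G : ℕ → C.carrier := fun l => C.prod (C.prod x y l) z (m + n - l - 1) with hG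
  have h1 : ∑ l ∈ Finset.range (m + 1), (m.choose l : ℂ) •
      C.prod (C.prod x (C.der y) l) z (m + n - l) =
      ∑ l ∈ Finset.range (m + 1), (m.choose l : ℂ) • (-((m + n - l : ℕ) : ℂ) • G l) +
      ∑ l ∈ Finset.range (m + 1), (m.choose l : ℂ) • ((l : ℂ) •
        C.prod (C.prod x y (l - 1)) z (m + n - l)) := by
    rw [← Finset.sum_add_distrib]
    refine Finset.sum_congr rfl fun l _ => ?_
    rw [hC.prod_der, map_add, map_smul, LinearMap.add_apply, LinearMap.smul_apply,
      Finsupp.add_apply, Finsupp.smul_apply, hC.der_prod, smul_add, neg_smul]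
  have h2 : ∑ l ∈ Finset.range (m + 1), (m.choose l : ℂ) • ((l : ℂ) •
        C.prod (C.prod x y (l - 1)) z (m + n - l)) =
      ∑ l ∈ Finset.range (m + 1), (m.choose l : ℂ) • ((m - l : ℕ) : ℂ) • G l := by
    rw [Finset.sum_range_succ', Finset.sum_range_succ]
    simp only [Nat.cast_zero, zero_smul, smul_zero, add_zero, Nat.sub_self, Nat.add_sub_cancel]
    refine Finset.sum_congr rfl fun l _ => ?_
    rw [smul_smul, smul_smul, hG, show m + n - (l + 1) = m + n - l - 1 by omega]
    congr 1
    exact_mod_cast Nat.choose_succ_right_eq m l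
  have h3 : ∑ l ∈ Finset.range (m + 1), (m.choose l : ℂ) •
      C.prod (C.prod x (C.der y) l) z (m + n - l) =
      -((n : ℂ) • ∑ l ∈ Finset.range (m + 1), (m.choose l : ℂ) • G l) := by
    rw [h1, h2, ← Finset.sum_add_distrib, Finset.smul_sum, ← Finset.sum_neg_distrib]
    refine Finset.sum_congr rfl fun l hl => ?_
    rw [Finset.mem_range] at hl
    rw [show m + n - l = (m - l) + n by omega]
    push_cast
    module
  rw [h3, hC.der_prod, hC.der_prod, map_neg, map_smul, Finsupp.neg_apply, Finsupp.smul_apply]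
  rcases n with _ | n
  · simp
  · rw [Nat.add_sub_cancel, h m n]
    have h4 : ∀ l, G l = C.prod (C.prod x y l) z (m + n - l) := fun l => by
      simp only [hG]
      rw [show m + (n + 1) - l - 1 = m + n - l by omega]
    simp only [h4]
    module

/-- The coefficient m + n - l splits as (m - l) + n. The first part produces the identity at (m - 1,
n), the second that at (m, n - 1), and ∂ of the identity at (m, n) is the rest. -/
theorem der_right (hC : IsSesqui C) (h : JacobiAt C κ x y z) : JacobiAt C κ x y (C.der z) := by
  intro m n
  have h1 : ∑ l ∈ Finset.range (m + 1), (m.choose l : ℂ) •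
      C.prod (C.prod x y l) (C.der z) (m + n - l) =
      C.der (∑ l ∈ Finset.range (m + 1), (m.choose l : ℂ) • C.prod (C.prod x y l) z (m + n - l)) +
      ((m : ℂ) • ∑ l ∈ Finset.range (m - 1 + 1), ((m - 1).choose l : ℂ) •
        C.prod (C.prod x y l) z (m - 1 + n - l) +
      (n : ℂ) • ∑ l ∈ Finset.range (m + 1), (m.choose l : ℂ) •
        C.prod (C.prod x y l) z (m + (n - 1) - l)) := by
    have h2 : (m : ℂ) • ∑ l ∈ Finset.range (m - 1 + 1), ((m - 1).choose l : ℂ) •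
        C.prod (C.prod x y l) z (m - 1 + n - l) = ∑ l ∈ Finset.range (m + 1),
        (m.choose l : ℂ) • ((m - l : ℕ) : ℂ) • C.prod (C.prod x y l) z (m + n - l - 1) := by
      rcases m with _ | m
      · simp
      · rw [Finset.sum_range_succ _ (m + 1), Nat.sub_self, Nat.cast_zero, zero_smul, smul_zero,
          add_zero, Nat.add_sub_cancel, Finset.smul_sum]
        refine Finset.sum_congr rfl fun l hl => ?_
        rw [Finset.mem_range] at hl
        rw [smul_smul, smul_smul, show m + 1 + n - l - 1 = m + n - l by omega]
        congr 1
        have := Nat.choose_mul_succ_eq m l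
        rw [mul_comm] at this
        exact_mod_cast this
    have h3 : (n : ℂ) • ∑ l ∈ Finset.range (m + 1), (m.choose l : ℂ) •
        C.prod (C.prod x y l) z (m + (n - 1) - l) = ∑ l ∈ Finset.range (m + 1),
        (m.choose l : ℂ) • (n : ℂ) • C.prod (C.prod x y l) z (m + n - l - 1) := by
      rcases n with _ | n
      · simp
      · rw [Finset.smul_sum]
        refine Finset.sum_congr rfl fun l hl => ?_
        rw [Finset.mem_range] at hl
        rw [smul_comm, show m + (n + 1) - l - 1 = m + (n + 1 - 1) - l by omega]
    rw [h2, h3, map_sum, ← Finset.sum_add_distrib, ← Finset.sum_add_distrib]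
    refine Finset.sum_congr rfl fun l hl => ?_
    rw [Finset.mem_range] at hl
    rw [hC.prod_der, map_smul, show ((m + n - l : ℕ) : ℂ) = ((m - l : ℕ) : ℂ) + (n : ℂ) by
      rw [show m + n - l = m - l + n by omega]; push_cast; rfl]
    module
  rw [h1, hC.prod_der, map_add, map_smul, Finsupp.add_apply, Finsupp.smul_apply, hC.prod_der,
    hC.prod_der, map_add, map_smul, Finsupp.add_apply, Finsupp.smul_apply, hC.prod_der,
    h m n, h m (n - 1), h (m - 1) n, map_add, map_smul]
  module

end JacobiAt

end Axioms

/-! ## The base change to `ℂ[t^q | q ∈ ℚ]` -/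

section Hat

theorem SHat.induction {motive : SHat → Prop} (f : SHat) (h0 : motive 0)
    (hadd : ∀ f g, motive f → motive g → motive (f + g))
    (hmono : ∀ (c : ℂ) q, motive (c • tpow q)) : motive f := by
  refine AddMonoidAlgebra.induction_linear f h0 hadd fun q c => ?_
  have := hmono c q
  rwa [tpow, AddMonoidAlgebra.smul_single, smul_eq_mul, mul_one] at this

theorem tpow_zero : tpow 0 = 1 := rfl

theorem deltaT_mul (f g : SHat) : deltaT (f * g) = deltaT f * g + f * deltaT g := by
  induction f using SHat.induction with
  | h0 => simp
  | hadd f f' hf hf' => simp only [add_mul, map_add, hf, hf']; abel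
  | hmono c p =>
    induction g using SHat.induction with
    | h0 => simp
    | hadd g g' hg hg' => simp only [mul_add, map_add, hg, hg']; abel
    | hmono d q =>
      simp only [smul_mul_assoc, mul_smul_comm, map_smul, tpow_mul, deltaT_tpow]
      rw [show p - 1 + q = p + q - 1 by ring, show p + (q - 1) = p + q - 1 by ring]
      push_cast
      module

theorem deltaT_one : deltaT 1 = 0 := by
  rw [← tpow_zero, deltaT_tpow]; simp

theorem dpow_deltaT_mul (l : ℕ) (f g : SHat) :
    dpow deltaT l (f * g) =
      ∑ ij ∈ Finset.HasAntidiagonal.antidiagonal l, dpow deltaT ij.1 f * dpow deltaT ij.2 g :=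
  dpow_leibniz (LinearMap.mul ℂ SHat) deltaT deltaT deltaT deltaT_mul l f g

variable (A : ConfData)

/-- The base change `A ⊗ ℂ[t^q | q ∈ ℚ]`. -/
abbrev hat : ConfData where
  carrier := A.carrier ⊗[ℂ] SHat
  part := hatPart A
  der := hatDer A
  prod := hatProd A

variable {A}

/-- Multiplication by an element of `ℂ[t^q | q ∈ ℚ]`. -/
def sm : SHat →ₗ[ℂ] (A.carrier ⊗[ℂ] SHat) →ₗ[ℂ] (A.carrier ⊗[ℂ] SHat) :=
  (LinearMap.lTensorHom A.carrier) ∘ₗ (LinearMap.mul ℂ SHat)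

@[simp] theorem sm_tmul (f g : SHat) (a : A.carrier) : sm f (a ⊗ₜ[ℂ] g) = a ⊗ₜ (f * g) := rfl

theorem tmul_eq_sm (f : SHat) (a : A.carrier) : a ⊗ₜ[ℂ] f = sm f (a ⊗ₜ[ℂ] 1) := by simp

theorem sm_sm (f g : SHat) (x : A.carrier ⊗[ℂ] SHat) : sm f (sm g x) = sm (f * g) x := by
  induction x using TensorProduct.induction_on with
  | zero => simp
  | tmul a h => simp [mul_assoc]
  | add x y hx hy => simp only [map_add, hx, hy]

theorem sm_one (x : A.carrier ⊗[ℂ] SHat) : sm 1 x = x := by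
  induction x using TensorProduct.induction_on with
  | zero => simp
  | tmul a h => simp
  | add x y hx hy => simp only [map_add, hx, hy]

@[simp] theorem hatDer_tmul (a : A.carrier) (f : SHat) :
    hatDer A (a ⊗ₜ f) = A.der a ⊗ₜ f + a ⊗ₜ deltaT f := by
  simp [hatDer]

theorem hatDer_sm (f : SHat) (x : A.carrier ⊗[ℂ] SHat) :
    hatDer A (sm f x) = sm (deltaT f) x + sm f (hatDer A x) := by
  induction x using TensorProduct.induction_on with
  | zero => simp
  | tmul a h => simp [deltaT_mul, TensorProduct.tmul_add]; abel
  | add x y hx hy => simp only [map_add, hx, hy]; abel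

theorem dpow_hatDer_sm (l : ℕ) (f : SHat) (x : A.carrier ⊗[ℂ] SHat) :
    dpow (hatDer A) l (sm f x) = ∑ ij ∈ Finset.HasAntidiagonal.antidiagonal l,
      sm (dpow deltaT ij.1 f) (dpow (hatDer A) ij.2 x) :=
  dpow_leibniz sm deltaT (hatDer A) (hatDer A) hatDer_sm l f x

theorem hatProd_tmul_tmul (a b : A.carrier) (f g : SHat) :
    hatProd A (a ⊗ₜ f) (b ⊗ₜ g) =
      (A.prod a b).sum fun N x => spread A N x (derSeq f g) := by
  simp [hatProd, Finsupp.sum, LinearMap.sum_apply]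

theorem hatProd_tmul_range (a b : A.carrier) (f g : SHat) (n N : ℕ)
    (h : ∀ k, N ≤ k → A.prod a b k = 0) :
    hatProd A (a ⊗ₜ f) (b ⊗ₜ g) n =
      ∑ j ∈ Finset.range N, A.prod a b (n + j) ⊗ₜ[ℂ] (dpow deltaT j f * g) := by
  rw [hatProd_tmul, finsum_eq_sum_range _ N]
  intro k hk
  rw [h _ (by omega), TensorProduct.zero_tmul]

/-- In the left factor, multiplication by a function acts through its Taylor expansion; in the right
factor it is linear. These two rules reduce all axioms for the base change to elements `a ⊗ 1`. -/
theorem hatProd_sm_left (f : SHat) (x y : A.carrier ⊗[ℂ] SHat) (n : ℕ) :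
    hatProd A (sm f x) y n = opSum (fun l => sm (dpow deltaT l f)) n (hatProd A x y) := by
  induction x using TensorProduct.induction_on with
  | zero => simp
  | add x x' hx hx' => simp only [map_add, LinearMap.add_apply, Finsupp.add_apply, hx, hx']
  | tmul a f₀ =>
    induction y using TensorProduct.induction_on with
    | zero => simp
    | add y y' hy hy' => simp only [map_add, Finsupp.add_apply, hy, hy']
    | tmul b g =>
      rw [sm_tmul, hatProd_tmul_tmul, hatProd_tmul_tmul]
      simp only [Finsupp.sum, map_sum, Finsupp.finsetSum_apply]
      refine Finset.sum_congr rfl fun N _ => ?_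
      rw [spread_apply]
      change _ = opSum _ n (∑ j ∈ Finset.range (N + 1),
        Finsupp.single (N - j) (A.prod a b N ⊗ₜ[ℂ] (dpow deltaT j f₀ * g)))
      simp only [map_sum, opSum_single, sm_tmul]
      change (if n ≤ N then A.prod a b N ⊗ₜ[ℂ] (dpow deltaT (N - n) (f * f₀) * g) else 0) = _
      split_ifs with h
      · obtain ⟨r, rfl⟩ := Nat.exists_eq_add_of_le h
        rw [Nat.add_sub_cancel_left, mul_comm f, dpow_deltaT_mul, Finset.sum_mul,
          TensorProduct.tmul_sum, Finset.Nat.sum_antidiagonal_eq_sum_range_succ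
            (fun i j => A.prod a b (n + r) ⊗ₜ[ℂ] (dpow deltaT i f₀ * dpow deltaT j f * g)),
          show n + r + 1 = r + 1 + n by omega, Finset.sum_range_add, Finset.sum_eq_zero
            (s := Finset.range n), add_zero]
        · refine Finset.sum_congr rfl fun j hj => ?_
          rw [Finset.mem_range] at hj
          rw [if_pos (by omega), show n + r - j - n = r - j by omega]
          congr 1; ring
        · intro j hj
          rw [Finset.mem_range] at hj
          rw [if_neg (by omega)]
      · rw [Finset.sum_eq_zero]
        intro j _
        rw [if_neg (by omega)]

theorem hatProd_sm_right (g : SHat) (x y : A.carrier ⊗[ℂ] SHat) (n : ℕ) :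
    hatProd A x (sm g y) n = sm g (hatProd A x y n) := by
  induction x using TensorProduct.induction_on with
  | zero => simp
  | add x x' hx hx' => simp only [map_add, LinearMap.add_apply, Finsupp.add_apply, hx, hx']
  | tmul a f₀ =>
    induction y using TensorProduct.induction_on with
    | zero => simp
    | add y y' hy hy' => simp only [map_add, Finsupp.add_apply, hy, hy']
    | tmul b g₀ =>
      obtain ⟨N, hN⟩ := exists_bound (A.prod a b)
      rw [sm_tmul, hatProd_tmul_range _ _ _ _ _ N hN, hatProd_tmul_range _ _ _ _ _ N hN, map_sum]
      refine Finset.sum_congr rfl fun j _ => ?_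
      rw [sm_tmul]
      congr 1; ring

theorem hatProd_tmul_one (a b : A.carrier) (n : ℕ) :
    hatProd A (a ⊗ₜ 1) (b ⊗ₜ 1) n = A.prod a b n ⊗ₜ 1 := by
  obtain ⟨N, hN⟩ := exists_bound (A.prod a b)
  rw [hatProd_tmul_range _ _ _ _ _ (N + 1) fun k hk => hN k (by omega), Finset.sum_range_succ',
    Finset.sum_eq_zero]
  · simp
  · intro j _
    rw [dpow_succ]
    have : ∀ j, deltaT (dpow deltaT j 1) = 0 := by
      intro j
      induction j with
      | zero => simp [deltaT_one]
      | succ j ih => rw [dpow_succ, ih]; simp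
    rw [this]; simp

theorem hat_isSesqui (hA : IsSesqui A) : IsSesqui (hat A) := by
  constructor
  · intro (x : A.carrier ⊗[ℂ] SHat) (y : A.carrier ⊗[ℂ] SHat) n
    change hatProd A (hatDer A x) y n = -((n : ℂ) • hatProd A x y (n - 1))
    induction x using TensorProduct.induction_on with
    | zero => simp
    | add x x' hx hx' =>
      simp only [map_add, LinearMap.add_apply, Finsupp.add_apply, hx, hx']; module
    | tmul a f =>
      induction y using TensorProduct.induction_on with
      | zero => simp
      | add y y' hy hy' => simp only [map_add, Finsupp.add_apply, hy, hy']; module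
      | tmul b g =>
        obtain ⟨N, hN⟩ := exists_bound (A.prod a b)
        have hN' : ∀ k, N + 1 ≤ k → A.prod (A.der a) b k = 0 := fun k hk => by
          rw [hA.der_prod, hN _ (by omega)]; simp
        rw [hatDer_tmul, map_add, LinearMap.add_apply, Finsupp.add_apply,
          hatProd_tmul_range _ _ _ _ _ _ hN', hatProd_tmul_range _ _ _ _ _ _ hN,
          hatProd_tmul_range _ _ _ _ _ (N + 1) fun k hk => hN k (by omega),
          Finset.sum_range_succ', Finset.sum_range_succ', add_right_comm, ← Finset.sum_add_distrib]
        simp only [hA.der_prod, dpow_apply_self, dpow_zero, add_zero]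
        rw [smul_add, neg_add, Finset.smul_sum, ← Finset.sum_neg_distrib]
        congr 1
        · refine Finset.sum_congr rfl fun j _ => ?_
          rcases n with _ | n
          · simp [TensorProduct.neg_tmul, TensorProduct.smul_tmul']
          · rw [show n + 1 + (j + 1) - 1 = n + 1 + j by omega,
              show n + 1 - 1 + (j + 1) = n + 1 + j by omega, smul_mul_assoc,
              TensorProduct.tmul_smul, TensorProduct.neg_tmul, ← TensorProduct.smul_tmul']
            push_cast
            module
  · intro (x : A.carrier ⊗[ℂ] SHat) (y : A.carrier ⊗[ℂ] SHat) n
    change hatProd A x (hatDer A y) n = hatDer A (hatProd A x y n) + (n : ℂ) • hatProd A x y (n - 1)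
    induction x using TensorProduct.induction_on with
    | zero => simp
    | add x x' hx hx' =>
      simp only [map_add, LinearMap.add_apply, Finsupp.add_apply, hx, hx']; module
    | tmul a f =>
      induction y using TensorProduct.induction_on with
      | zero => simp
      | add y y' hy hy' => simp only [map_add, Finsupp.add_apply, hy, hy']; module
      | tmul b g =>
        obtain ⟨N, hN⟩ := exists_bound (A.prod a b)
        have hN' : ∀ k, N + 1 ≤ k → A.prod a (A.der b) k = 0 := fun k hk => by
          rw [hA.prod_der, hN _ (by omega), hN _ (by omega)]; simp
        have hN'' : ∀ k, N + 1 ≤ k → A.prod a b k = 0 := fun k hk => hN k (by omega)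
        rw [hatDer_tmul, map_add, Finsupp.add_apply,
          hatProd_tmul_range _ _ _ _ _ _ hN', hatProd_tmul_range _ _ _ _ _ _ hN'',
          hatProd_tmul_range _ _ _ _ _ _ hN'', hatProd_tmul_range _ _ _ _ _ _ hN'', map_sum]
        simp only [hatDer_tmul, deltaT_mul, apply_dpow, hA.prod_der, TensorProduct.add_tmul,
          TensorProduct.tmul_add, Finset.sum_add_distrib]
        have h1 : ∑ j ∈ Finset.range (N + 1),
            (((n + j : ℕ) : ℂ) • A.prod a b (n + j - 1)) ⊗ₜ[ℂ] (dpow deltaT j f * g) =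
            ∑ j ∈ Finset.range (N + 1), A.prod a b (n + j) ⊗ₜ[ℂ]
              ((((j + 1 : ℕ) : ℂ) • dpow deltaT (j + 1) f) * g) +
            (n : ℂ) • ∑ j ∈ Finset.range (N + 1),
              A.prod a b (n - 1 + j) ⊗ₜ[ℂ] (dpow deltaT j f * g) := by
          rw [Finset.sum_range_succ', Finset.sum_range_succ' (fun j => A.prod a b (n - 1 + j) ⊗ₜ[ℂ] _),
            Finset.sum_range_succ (fun j => A.prod a b (n + j) ⊗ₜ[ℂ] _), hN (n + N) (by omega),
            TensorProduct.zero_tmul, smul_add, ← add_assoc, Finset.smul_sum, add_zero,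
            add_zero (∑ j ∈ Finset.range N, _), ← Finset.sum_add_distrib]
          congr 1
          refine Finset.sum_congr rfl fun j _ => ?_
          rcases n with _ | n
          · simp [TensorProduct.smul_tmul']
          · rw [show n + 1 + (j + 1) - 1 = n + 1 + j by omega,
              show n + 1 - 1 + (j + 1) = n + 1 + j by omega, smul_mul_assoc,
              TensorProduct.tmul_smul, ← TensorProduct.smul_tmul']
            push_cast
            module
        rw [h1]
        abel

/-- The Leibniz rule for the divided powers of the derivation, applied on the side where `f` stands
in the right factor, produces exactly the Taylor expansion of `f` on the side where it stands in the
left factor. -/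
theorem skewAt_sm_left {κ : ℂ} {x y : A.carrier ⊗[ℂ] SHat} (f : SHat)
    (h : SkewAt (hat A) κ x y) : SkewAt (hat A) κ (sm f x) y := by
  have h' : hatProd A x y = -(κ • skewSeq (hatDer A) (hatProd A y x)) := h
  have hr : hatProd A y (sm f x) = Finsupp.mapRange.linearMap (sm f) (hatProd A y x) := by
    ext n; simp [hatProd_sm_right]
  change hatProd A (sm f x) y = -(κ • skewSeq (hatDer A) (hatProd A y (sm f x)))
  rw [hr]
  ext n
  rw [hatProd_sm_left, h', map_neg, map_smul, Finsupp.neg_apply, Finsupp.smul_apply]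
  congr 2
  generalize hatProd A y x = p
  induction p using Finsupp.induction_linear with
  | zero => simp
  | add p q hp hq => simp only [map_add, Finsupp.add_apply, hp, hq]
  | single k z =>
    rw [skewSeq_apply, Finsupp.mapRange.linearMap_apply, Finsupp.mapRange_single, skewOp_single,
      skewSeq_single, map_sum]
    simp only [map_smul, opSum_single]
    split_ifs with h
    · obtain ⟨r, rfl⟩ := Nat.exists_eq_add_of_le h
      rw [Nat.add_sub_cancel_left, dpow_hatDer_sm, Finset.Nat.sum_antidiagonal_eq_sum_range_succ
          (fun i j => sm (dpow deltaT i f) (dpow (hatDer A) j z)), add_assoc,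
        Finset.sum_range_add, Finset.sum_eq_zero, zero_add, Finset.smul_sum]
      · refine Finset.sum_congr rfl fun i hi => ?_
        rw [Finset.mem_range] at hi
        rw [if_pos (by omega), Nat.add_sub_cancel_left, Nat.add_sub_add_left]
      · intro j hj
        rw [Finset.mem_range] at hj
        rw [if_neg (by omega), smul_zero]
    · refine Finset.sum_eq_zero fun j hj => ?_
      rw [Finset.mem_range] at hj
      rw [if_neg (by omega), smul_zero]

theorem jacobiAt_hat_iff {κ : ℂ} {x y z : A.carrier ⊗[ℂ] SHat} :
    JacobiAt (hat A) κ x y z ↔ ∀ m n, hatProd A x (hatProd A y z n) m =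
    (∑ l ∈ Finset.range (m + 1), (m.choose l : ℂ) • hatProd A (hatProd A x y l) z (m + n - l))
      + κ • hatProd A y (hatProd A x z m) n :=
  Iff.rfl

theorem jacobiAt_sm_right {κ : ℂ} {x y z : A.carrier ⊗[ℂ] SHat} (f : SHat)
    (h : JacobiAt (hat A) κ x y z) : JacobiAt (hat A) κ x y (sm f z) := by
  rw [jacobiAt_hat_iff] at h ⊢
  intro m n
  have h' := h m n
  simp only [hatProd_sm_right, h', map_add, map_sum, map_smul]

theorem jacobiAt_sm_middle {κ : ℂ} {x y z : A.carrier ⊗[ℂ] SHat} (f : SHat)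
    (h : JacobiAt (hat A) κ x y z) : JacobiAt (hat A) κ x (sm f y) z := by
  rw [jacobiAt_hat_iff] at h ⊢
  intro m n
  have h' := h m
  obtain ⟨N₁, hN₁⟩ := exists_bound (hatProd A y z)
  obtain ⟨N₂, hN₂⟩ := exists_bound (hatProd A y (hatProd A x z m))
  have hb : ∀ l, ∃ N, ∀ k, N ≤ k → hatProd A (hatProd A x y l) z k = 0 := fun l => exists_bound _
  choose N₃ hN₃ using hb
  set N := N₁ + N₂ + (∑ l ∈ Finset.range (m + 1), N₃ l) with hN
  have h1 : ∀ l ∈ Finset.range (m + 1), hatProd A (hatProd A x (sm f y) l) z (m + n - l) =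
      ∑ j ∈ Finset.range N, sm (dpow deltaT j f) (hatProd A (hatProd A x y l) z (m + n - l + j)) := by
    intro l hl
    rw [hatProd_sm_right, hatProd_sm_left, opSum_eq_sum_range _ _ N]
    intro k hk
    have := Finset.single_le_sum (f := N₃) (fun _ _ => Nat.zero_le _) hl
    exact hN₃ l k (by omega)
  rw [Finset.sum_congr rfl fun l hl => by rw [h1 l hl]]
  rw [hatProd_sm_left, hatProd_sm_left, opSum_eq_sum_range _ _ N _ fun k hk => hN₁ k (by omega),
    opSum_eq_sum_range _ _ N _ fun k hk => hN₂ k (by omega), map_sum]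
  simp only [Finset.smul_sum, Finsupp.finsetSum_apply, hatProd_sm_right, h', map_add, map_sum,
    map_smul, Finset.sum_add_distrib]
  congr 1
  rw [Finset.sum_comm]
  refine Finset.sum_congr rfl fun l hl => Finset.sum_congr rfl fun j _ => ?_
  rw [Finset.mem_range] at hl
  rw [show m + (n + j) - l = m + n - l + j by omega]

/-- In `((fx)_(l) y)_(k) z` the function is expanded twice, with orders `i` and `s`. Collecting by
`u = i + s`, the divided powers combine with a binomial coefficient, and Vandermonde's identity
turns the sum over `l` and `i` into the Jacobi sum for `m + u`. -/
theorem jacobiAt_sm_left {κ : ℂ} {x y z : A.carrier ⊗[ℂ] SHat} (f : SHat)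
    (h : JacobiAt (hat A) κ x y z) : JacobiAt (hat A) κ (sm f x) y z := by
  rw [jacobiAt_hat_iff] at h ⊢
  intro m n
  have h' := fun m => h m n
  obtain ⟨N₁, hN₁⟩ := exists_bound (hatProd A x y)
  obtain ⟨N₂, hN₂⟩ := exists_bound (hatProd A x z)
  obtain ⟨N₄, hN₄⟩ := exists_bound (hatProd A x (hatProd A y z n))
  have hb : ∀ l, ∃ N, ∀ k, N ≤ k → hatProd A (hatProd A x y l) z k = 0 := fun l => exists_bound _
  choose N₃ hN₃ using hb
  -- One truncation for all the Taylor sums; it is finite because only finitely many products `x_(l)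
  -- y` are non-zero.
  set N := N₁ + N₂ + N₄ + (∑ l ∈ Finset.range N₁, N₃ l) with hN
  have hF : ∀ p k, N ≤ k → hatProd A (hatProd A x y p) z k = 0 := by
    intro p k hk
    by_cases hp : p < N₁
    · have := Finset.single_le_sum (f := N₃) (fun _ _ => Nat.zero_le _) (Finset.mem_range.mpr hp)
      exact hN₃ p k (by omega)
    · rw [hN₁ p (by omega)]; simp
  have h1 : ∀ l ∈ Finset.range (m + 1), hatProd A (hatProd A (sm f x) y l) z (m + n - l) =
      ∑ u ∈ Finset.range (2 * N), ∑ i ∈ Finset.range (u + 1), (u.choose i : ℂ) •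
        sm (dpow deltaT u f) (hatProd A (hatProd A x y (l + i)) z (m + u + n - (l + i))) := by
    intro l hl
    rw [Finset.mem_range] at hl
    rw [hatProd_sm_left, opSum_eq_sum_range _ _ N _ fun k hk => hN₁ k (by omega)]
    simp only [map_sum, LinearMap.sum_apply, Finsupp.finsetSum_apply, hatProd_sm_left]
    have h2 : ∀ i ∈ Finset.range N, opSum (fun s => sm (dpow deltaT s (dpow deltaT i f))) (m + n - l)
        (hatProd A (hatProd A x y (l + i)) z) = ∑ s ∈ Finset.range N,
          ((s + i).choose i : ℂ) • sm (dpow deltaT (s + i) f)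
            (hatProd A (hatProd A x y (l + i)) z (m + n - l + s)) := by
      intro i _
      rw [opSum_eq_sum_range _ _ N _ fun k hk => hF _ k hk]
      refine Finset.sum_congr rfl fun s _ => ?_
      rw [dpow_dpow, map_smul, LinearMap.smul_apply, Nat.choose_symm_add]
    rw [Finset.sum_congr rfl h2, sum_range_range_eq_sum_antidiagonal (N := N)]
    · refine Finset.sum_congr rfl fun u _ => ?_
      rw [Finset.Nat.sum_antidiagonal_eq_sum_range_succ (fun i s => ((s + i).choose i : ℂ) •
        sm (dpow deltaT (s + i) f) (hatProd A (hatProd A x y (l + i)) z (m + n - l + s)))]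
      refine Finset.sum_congr rfl fun i hi => ?_
      rw [Finset.mem_range] at hi
      rw [show u - i + i = u by omega, show m + n - l + (u - i) = m + u + n - (l + i) by omega]
    · intro i s hi
      rw [hN₁ (l + i) (by omega)]; simp
    · intro i s hs
      rw [hF _ _ (by omega)]; simp
  rw [Finset.sum_congr rfl fun l hl => by rw [h1 l hl],
    hatProd_sm_left, opSum_eq_sum_range _ _ (2 * N) _ fun k hk => hN₄ k (by omega),
    hatProd_sm_left, opSum_eq_sum_range _ _ (2 * N) _ fun k hk => hN₂ k (by omega)]
  simp only [h', map_add, map_sum, map_smul, Finset.sum_add_distrib, Finset.smul_sum,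
    Finsupp.finsetSum_apply, hatProd_sm_right]
  congr 1
  rw [Finset.sum_comm (s := Finset.range (m + 1))]
  refine Finset.sum_congr rfl fun u _ => ?_
  simp only [smul_smul]
  rw [sum_choose_mul_choose m u
    (fun p => sm (dpow deltaT u f) (hatProd A (hatProd A x y p) z (m + u + n - p)))]

theorem hatPart_eq_span (i : ZMod 2) : hatPart A i =
    Submodule.span ℂ {x | ∃ a ∈ A.part i, ∃ f : SHat, x = a ⊗ₜ[ℂ] f} := by
  rw [hatPart, TensorProduct.range_map]
  refine le_antisymm (Submodule.map₂_le.mpr ?_) (Submodule.span_le.mpr ?_)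
  · rintro _ ⟨a, rfl⟩ f _
    exact Submodule.subset_span ⟨a, a.2, f, rfl⟩
  · rintro _ ⟨a, ha, f, rfl⟩
    exact Submodule.apply_mem_map₂ _ ⟨⟨a, ha⟩, rfl⟩ ⟨f, rfl⟩

theorem tmul_mem_hatPart {i : ZMod 2} {a : A.carrier} (ha : a ∈ A.part i) (f : SHat) :
    a ⊗ₜ[ℂ] f ∈ hatPart A i := by
  rw [hatPart_eq_span]; exact Submodule.subset_span ⟨a, ha, f, rfl⟩

theorem hatPart_induction {i : ZMod 2} {motive : A.carrier ⊗[ℂ] SHat → Prop}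
    (h0 : motive 0) (hadd : ∀ x y, motive x → motive y → motive (x + y))
    (htmul : ∀ a ∈ A.part i, ∀ f, motive (a ⊗ₜ f)) {x : A.carrier ⊗[ℂ] SHat}
    (hx : x ∈ hatPart A i) : motive x := by
  rw [hatPart_eq_span] at hx
  induction hx using Submodule.span_induction with
  | mem x hx => obtain ⟨a, ha, f, rfl⟩ := hx; exact htmul a ha f
  | zero => exact h0
  | add x y _ _ hx hy => exact hadd x y hx hy
  | smul c x hx' hx =>
    rw [← hatPart_eq_span] at hx'
    clear hx
    revert c
    rw [hatPart_eq_span] at hx'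
    induction hx' using Submodule.span_induction with
    | mem x hx =>
      obtain ⟨a, ha, f, rfl⟩ := hx
      intro c
      rw [TensorProduct.smul_tmul']
      exact htmul _ (Submodule.smul_mem _ c ha) f
    | zero => intro c; rw [smul_zero]; exact h0
    | add x y _ _ hx hy => intro c; rw [smul_add]; exact hadd _ _ (hx c) (hy c)
    | smul d x _ hx => intro c; rw [smul_smul]; exact hx _

/-- The sum of an even and an odd element. -/
theorem exists_parts {M : Type} [AddCommGroup M] [Module ℂ M] {p q : Submodule ℂ M}
    (h : IsCompl p q) (x : M) : ∃ a ∈ p, ∃ b ∈ q, a + b = x :=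
  Submodule.mem_sup.mp (h.sup_eq_top ▸ Submodule.mem_top)

/-- The parity involution, `1` on the even part and `-1` on the odd part. -/
theorem exists_parity {M : Type} [AddCommGroup M] [Module ℂ M] {p q : Submodule ℂ M}
    (h : IsCompl p q) : ∃ P : M →ₗ[ℂ] M, (∀ a ∈ p, P a = a) ∧ ∀ a ∈ q, P a = -a := by
  refine ⟨p.projection q h - q.projection p h.symm, fun a ha => ?_, fun a ha => ?_⟩
  · have h1 := Submodule.projection_apply_left h ⟨a, ha⟩
    have h2 := (Submodule.projection_apply_eq_zero_iff h.symm).mpr ha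
    simp only at h1
    rw [LinearMap.sub_apply, h1, h2, sub_zero]
  · have h1 := Submodule.projection_apply_left h.symm ⟨a, ha⟩
    have h2 := (Submodule.projection_apply_eq_zero_iff h).mpr ha
    simp only at h1
    rw [LinearMap.sub_apply, h1, h2, zero_sub]

theorem eq_zero_of_eq_neg {M : Type} [AddCommGroup M] [Module ℂ M] {x : M} (h : x = -x) :
    x = 0 := by
  have : (2 : ℂ) • x = 0 := by
    rw [two_smul]; nth_rewrite 1 [h]; simp
  simpa using this

/-- The parity involution extends to the base change, where it is 1 on one part and -1 on the other;
an element of both parts equals its own negative. -/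
theorem hat_isCompl (h : IsCompl (A.part 0) (A.part 1)) :
    IsCompl (hatPart A 0) (hatPart A 1) := by
  obtain ⟨P, hP0, hP1⟩ := exists_parity h
  refine ⟨Submodule.disjoint_def.mpr fun x hx0 hx1 => ?_, codisjoint_iff.mpr ?_⟩
  · have h0 : TensorProduct.map P LinearMap.id x = x := by
      refine hatPart_induction (motive := fun x => TensorProduct.map P LinearMap.id x = x)
        (by simp) (fun x y hx hy => by rw [map_add, hx, hy])
        (fun a ha f => ?_) hx0
      simp [hP0 a ha]
    have h1 : TensorProduct.map P LinearMap.id x = -x := by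
      refine hatPart_induction (motive := fun x => TensorProduct.map P LinearMap.id x = -x)
        (by simp) (fun x y hx hy => by rw [map_add, hx, hy, neg_add])
        (fun a ha f => ?_) hx1
      simp [hP1 a ha, TensorProduct.neg_tmul]
    exact eq_zero_of_eq_neg (h0.symm.trans h1)
  · rw [eq_top_iff]
    intro x _
    induction x using TensorProduct.induction_on with
    | zero => exact zero_mem _
    | add x y hx hy => exact add_mem (hx trivial) (hy trivial)
    | tmul a f =>
      obtain ⟨a₀, h₀, a₁, h₁, rfl⟩ := exists_parts h a
      rw [TensorProduct.add_tmul]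
      exact Submodule.add_mem_sup (tmul_mem_hatPart h₀ f) (tmul_mem_hatPart h₁ f)

theorem koszul_mul_self (i j : ZMod 2) : koszul i j * koszul i j = 1 := by
  unfold koszul; split_ifs <;> simp

theorem koszul_comm (i j : ZMod 2) : koszul i j = koszul j i := by
  unfold koszul; simp only [and_comm]

theorem ConfData.IsLie.isSesqui (h : A.IsLie) : IsSesqui A := ⟨h.der_prod, h.prod_der⟩

theorem ConfData.IsLie.skewAt (h : A.IsLie) {i j : ZMod 2} {a b : A.carrier} (ha : a ∈ A.part i)
    (hb : b ∈ A.part j) : SkewAt A (koszul i j) a b :=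
  (skewAt_iff _ _ _).mpr (h.skew i j a ha b hb)

theorem ConfData.IsLie.jacobiAt (h : A.IsLie) {i j : ZMod 2} {a b : A.carrier} (ha : a ∈ A.part i)
    (hb : b ∈ A.part j) (c : A.carrier) : JacobiAt A (koszul i j) a b c :=
  h.jacobi i j a ha b hb c

theorem skewAt_tmul_one {κ : ℂ} {a b : A.carrier} (h : SkewAt A κ a b) :
    SkewAt (hat A) κ (a ⊗ₜ 1) (b ⊗ₜ 1) := by
  have hp : ∀ a b : A.carrier, hatProd A (a ⊗ₜ 1) (b ⊗ₜ 1) =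
      Finsupp.mapRange.linearMap ((TensorProduct.mk ℂ A.carrier SHat).flip 1) (A.prod a b) := by
    intro a b; ext n; rw [hatProd_tmul_one]; simp
  change hatProd A (a ⊗ₜ 1) (b ⊗ₜ 1) = -(κ • skewSeq (hatDer A) (hatProd A (b ⊗ₜ 1) (a ⊗ₜ 1)))
  rw [hp, hp]
  have h' : A.prod a b = -(κ • skewSeq A.der (A.prod b a)) := h
  rw [h', map_neg, map_smul]
  congr 2
  generalize A.prod b a = p
  induction p using Finsupp.induction_linear with
  | zero => simp
  | add p q hp hq => simp only [map_add, hp, hq]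
  | single k z =>
    have hd : ∀ j, dpow (hatDer A) j (z ⊗ₜ[ℂ] (1 : SHat)) = dpow A.der j z ⊗ₜ 1 := by
      intro j
      induction j with
      | zero => simp
      | succ j ih =>
        rw [dpow_succ, ih, dpow_succ, hatDer_tmul, deltaT_one, TensorProduct.tmul_zero, add_zero,
          TensorProduct.smul_tmul']
    have hs : ∀ (k : ℕ) (z : A.carrier), Finsupp.mapRange.linearMap
        ((TensorProduct.mk ℂ A.carrier SHat).flip 1) (Finsupp.single k z) =
        Finsupp.single k (z ⊗ₜ[ℂ] (1 : SHat)) := by intro k z; simp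
    rw [skewSeq_single, map_sum, hs, skewSeq_single]
    refine Finset.sum_congr rfl fun n _ => ?_
    rw [map_smul, hs, hd]

theorem jacobiAt_tmul_one {κ : ℂ} {a b c : A.carrier} (h : JacobiAt A κ a b c) :
    JacobiAt (hat A) κ (a ⊗ₜ 1) (b ⊗ₜ 1) (c ⊗ₜ 1) := by
  rw [jacobiAt_hat_iff]
  intro m n
  simp only [hatProd_tmul_one, h m n, TensorProduct.add_tmul, TensorProduct.sum_tmul,
    TensorProduct.smul_tmul']

/-- Both sides of skew-symmetry and of the Jacobi identity are additive, and both identities survive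
multiplication of each argument by a function. On elements `a ⊗ 1` they are the identities of `A`.
-/
theorem hat_isLie (h : A.IsLie) : (hat A).IsLie where
  isCompl := hat_isCompl h.isCompl
  der_mem i x hx := by
    refine hatPart_induction (motive := fun x => hatDer A x ∈ hatPart A i) (by simp)
      (fun x y hx hy => by rw [map_add]; exact add_mem hx hy) (fun a ha f => ?_) hx
    rw [hatDer_tmul]
    exact add_mem (tmul_mem_hatPart (h.der_mem i a ha) f) (tmul_mem_hatPart ha _)
  prod_mem i j x hx y hy n := by
    refine hatPart_induction (motive := fun x => hatProd A x y n ∈ hatPart A (i + j)) (by simp)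
      (fun x y hx hy => by simpa using add_mem hx hy) (fun a ha f => ?_) hx
    refine hatPart_induction (motive := fun y => hatProd A (a ⊗ₜ f) y n ∈ hatPart A (i + j)) (by simp)
      (fun x y hx hy => by simpa using add_mem hx hy) (fun b hb g => ?_) hy
    obtain ⟨N, hN⟩ := exists_bound (A.prod a b)
    rw [hatProd_tmul_range _ _ _ _ _ N hN]
    exact sum_mem fun l _ => tmul_mem_hatPart (h.prod_mem i j a ha b hb _) _
  der_prod := (hat_isSesqui h.isSesqui).der_prod
  prod_der := (hat_isSesqui h.isSesqui).prod_der
  skew i j x hx y hy := by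
    rw [← skewAt_iff (C := hat A)]
    refine hatPart_induction (motive := fun x => SkewAt (hat A) (koszul i j) x y) SkewAt.zero_left
      (fun _ _ => SkewAt.add_left) (fun a ha f => ?_) hx
    refine SkewAt.symm (koszul_mul_self i j) ?_
    refine hatPart_induction (motive := fun y => SkewAt (hat A) (koszul i j) y (a ⊗ₜ f))
      SkewAt.zero_left (fun _ _ => SkewAt.add_left) (fun b hb g => ?_) hy
    rw [tmul_eq_sm g]
    refine skewAt_sm_left g (SkewAt.symm (koszul_mul_self i j) ?_)
    rw [tmul_eq_sm f]
    exact skewAt_sm_left f (skewAt_tmul_one (h.skewAt ha hb))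
  jacobi i j x hx y hy z := by
    change JacobiAt (hat A) (koszul i j) x y z
    refine hatPart_induction (motive := fun x => JacobiAt (hat A) (koszul i j) x y z)
      JacobiAt.zero_left (fun _ _ => JacobiAt.add_left) (fun a ha f => ?_) hx
    rw [tmul_eq_sm f]
    refine jacobiAt_sm_left f ?_
    refine hatPart_induction (motive := fun y => JacobiAt (hat A) (koszul i j) (a ⊗ₜ 1) y z)
      JacobiAt.zero_middle (fun _ _ => JacobiAt.add_middle) (fun b hb g => ?_) hy
    rw [tmul_eq_sm g]
    refine jacobiAt_sm_middle g ?_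
    refine TensorProduct.induction_on
      (motive := fun z => JacobiAt (hat A) (koszul i j) (a ⊗ₜ 1) (b ⊗ₜ 1) z) z
      JacobiAt.zero_right (fun c k => ?_) (fun _ _ => JacobiAt.add_right)
    rw [tmul_eq_sm k]
    exact jacobiAt_sm_right k (jacobiAt_tmul_one (h.jacobiAt ha hb c))

end Hat

/-! ## Roots of unity and the Galois action on `ℂ[t^q | q ∈ ℚ]` -/

section Galois

variable (ξ : RootSystem)

/-- The character `q ↦ exp(2πi q)` of `ℚ` with `i/m ↦ ξ_m^i`. -/
def expQ (q : ℚ) : ℂ := ξ.root q.den ^ q.num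

theorem RootSystem.ne_zero {m : ℕ} (hm : 0 < m) : ξ.root m ≠ 0 :=
  (ξ.primitive m hm).ne_zero hm.ne'

/-- The value is computed from the reduced fraction; compatibility of the roots of unity makes every
other way of writing the fraction give the same result. -/
theorem expQ_div (i : ℤ) {m : ℕ} (hm : 0 < m) : expQ ξ ((i : ℚ) / m) = ξ.root m ^ i := by
  set q : ℚ := (i : ℚ) / m with hq
  have h1 : (q.den : ℤ) ∣ (m : ℤ) := by
    have := Rat.den_dvd i m
    rwa [Rat.divInt_eq_div, Int.cast_natCast] at this
  obtain ⟨l, hl⟩ := Int.natCast_dvd_natCast.mp h1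
  have hm0 : (m : ℚ) ≠ 0 := by exact_mod_cast hm.ne'
  have hl0 : 0 < l := Nat.pos_of_ne_zero fun h => by simp [h] at hl; omega
  have hi : i = l * q.num := by
    have h2 : q * m = i := by rw [hq]; field_simp
    have h3 : q * q.den = q.num := Rat.mul_den_eq_num q
    have : (i : ℚ) = l * q.num := by
      rw [← h2, ← h3, hl]; push_cast; ring
    exact_mod_cast this
  rw [expQ, ← ξ.compatible l q.den hl0 q.den_pos, mul_comm l, ← hl, hi, zpow_mul, zpow_natCast]

theorem expQ_ne_zero (q : ℚ) : expQ ξ q ≠ 0 := zpow_ne_zero _ (ξ.ne_zero q.den_pos)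

theorem expQ_add (p q : ℚ) : expQ ξ (p + q) = expQ ξ p * expQ ξ q := by
  have hm : 0 < p.den * q.den := Nat.mul_pos p.den_pos q.den_pos
  have hp : (p.den : ℚ) ≠ 0 := by exact_mod_cast p.den_pos.ne'
  have hq : (q.den : ℚ) ≠ 0 := by exact_mod_cast q.den_pos.ne'
  have h1 : p = ((p.num * q.den : ℤ) : ℚ) / (p.den * q.den : ℕ) := by
    push_cast; rw [mul_div_mul_right _ _ hq, Rat.num_div_den]
  have h2 : q = ((q.num * p.den : ℤ) : ℚ) / (p.den * q.den : ℕ) := by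
    push_cast; rw [mul_comm (p.den : ℚ), mul_div_mul_right _ _ hp, Rat.num_div_den]
  have h3 : p + q = ((p.num * q.den + q.num * p.den : ℤ) : ℚ) / (p.den * q.den : ℕ) := by
    rw [Int.cast_add, add_div, ← h1, ← h2]
  have e1 := (congrArg (expQ ξ) h1).trans (expQ_div ξ _ hm)
  have e2 := (congrArg (expQ ξ) h2).trans (expQ_div ξ _ hm)
  rw [h3, expQ_div ξ _ hm, e1, e2, zpow_add₀ (ξ.ne_zero hm)]

theorem expQ_zero : expQ ξ 0 = 1 := by simp [expQ]

theorem expQ_neg (q : ℚ) : expQ ξ (-q) = (expQ ξ q)⁻¹ := by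
  refine eq_inv_of_mul_eq_one_left ?_
  rw [← expQ_add, neg_add_cancel, expQ_zero]

theorem expQ_nat_mul (n : ℕ) (q : ℚ) : expQ ξ (n * q) = expQ ξ q ^ n := by
  induction n with
  | zero => simp [expQ_zero]
  | succ n ih => rw [Nat.cast_succ, add_mul, one_mul, expQ_add, ih, pow_succ]

theorem expQ_eq_one_iff (q : ℚ) : expQ ξ q = 1 ↔ ∃ n : ℤ, q = n := by
  rw [expQ, (ξ.primitive q.den q.den_pos).zpow_eq_one_iff_dvd]
  constructor
  · intro h
    refine ⟨q.num, ?_⟩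
    have h1 : q.den ∣ q.num.natAbs := Int.natCast_dvd.mp h
    have h2 : q.den = 1 := Nat.eq_one_of_dvd_coprimes q.reduced.symm (dvd_refl _) h1
    rw [← Rat.num_div_den q, h2]; simp
  · rintro ⟨n, rfl⟩
    simp

theorem expQ_int (n : ℤ) : expQ ξ n = 1 := (expQ_eq_one_iff ξ n).mpr ⟨n, rfl⟩

theorem expQ_eq_iff (p q : ℚ) : expQ ξ p = expQ ξ q ↔ ∃ n : ℤ, p = q + n := by
  have h : expQ ξ p = expQ ξ q ↔ expQ ξ (p - q) = 1 := by
    rw [sub_eq_add_neg, expQ_add, expQ_neg, mul_inv_eq_one₀ (expQ_ne_zero ξ q)]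
  rw [h, expQ_eq_one_iff]
  refine exists_congr fun n => ?_
  rw [sub_eq_iff_eq_add, add_comm]

/-- All roots of unity are values of the character, so an eigenvalue of an automorphism of finite
order has a rational logarithm `q`, and `t^q` is available to gauge it away. -/
theorem exists_expQ_eq {a : ℂ} {n : ℕ} (hn : 0 < n) (h : a ^ n = 1) : ∃ q, expQ ξ q = a := by
  have : NeZero n := ⟨hn.ne'⟩
  obtain ⟨i, _, hi⟩ := (ξ.primitive n hn).eq_pow_of_pow_eq_one h
  exact ⟨((i : ℤ) : ℚ) / n, by rw [expQ_div ξ _ hn, zpow_natCast, hi]⟩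

/-- The automorphism `t^q ↦ exp(-2πi q) t^q`. -/
def galois : SHat →ₐ[ℂ] SHat :=
  AddMonoidAlgebra.lift ℂ SHat ℚ
    { toFun := fun q => expQ ξ (-q.toAdd) • tpow q.toAdd
      map_one' := by simp [expQ_zero, tpow_zero]
      map_mul' := fun p q => by
        simp only [toAdd_mul, neg_add, expQ_add]
        rw [smul_mul_smul_comm, tpow_mul] }

theorem galois_tpow (q : ℚ) : galois ξ (tpow q) = expQ ξ (-q) • tpow q := by
  simp [galois, tpow]

theorem galois_deltaT (f : SHat) : galois ξ (deltaT f) = deltaT (galois ξ f) := by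
  induction f using SHat.induction with
  | h0 => simp
  | hadd f g hf hg => simp only [map_add, hf, hg]
  | hmono c q =>
    simp only [map_smul, deltaT_tpow, galois_tpow]
    have : expQ ξ (-(q - 1)) = expQ ξ (-q) := by
      rw [expQ_eq_iff]; exact ⟨1, by push_cast; ring⟩
    rw [this, smul_comm (q : ℂ)]

/-- The coefficient of `t^q`. -/
def tcoeff (q : ℚ) : SHat →ₗ[ℂ] ℂ :=
  Finsupp.lapply q ∘ₗ (AddMonoidAlgebra.coeffLinearEquiv ℂ : SHat ≃ₗ[ℂ] (ℚ →₀ ℂ)).toLinearMap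

theorem tcoeff_tpow (p q : ℚ) : tcoeff q (tpow p) = if p = q then 1 else 0 := by
  simp [tcoeff, tpow, AddMonoidAlgebra.coeffLinearEquiv, Finsupp.single_apply]

theorem tcoeff_galois (q : ℚ) (f : SHat) : tcoeff q (galois ξ f) = expQ ξ (-q) * tcoeff q f := by
  induction f using SHat.induction with
  | h0 => simp
  | hadd f g hf hg => simp only [map_add, hf, hg, mul_add]
  | hmono c p =>
    simp only [map_smul, galois_tpow, tcoeff_tpow, smul_eq_mul]
    split_ifs with h
    · rw [h]; ring
    · simp

theorem tcoeff_ext {f g : SHat} (h : ∀ q, tcoeff q f = tcoeff q g) : f = g := by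
  apply AddMonoidAlgebra.coeff_injective
  ext q
  exact h q

variable {A : ConfData}

/-- The coefficient of `t^q` of an element of `A ⊗ ℂ[t^q | q ∈ ℚ]`. -/
def compQ (q : ℚ) : A.carrier ⊗[ℂ] SHat →ₗ[ℂ] A.carrier :=
  (TensorProduct.rid ℂ A.carrier).toLinearMap ∘ₗ LinearMap.lTensor A.carrier (tcoeff q)

theorem compQ_tmul (q : ℚ) (a : A.carrier) (f : SHat) :
    compQ q (a ⊗ₜ[ℂ] f) = tcoeff q f • a := by
  simp [compQ]

/-- Allowing every larger index set makes it possible to add two such expansions. -/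
theorem exists_sum_compQ (x : A.carrier ⊗[ℂ] SHat) :
    ∃ s : Finset ℚ, ∀ s', s ⊆ s' → x = ∑ q ∈ s', compQ q x ⊗ₜ[ℂ] tpow q := by
  classical
  induction x using TensorProduct.induction_on with
  | zero => exact ⟨∅, by simp⟩
  | add x y hx hy =>
    obtain ⟨s, hs⟩ := hx
    obtain ⟨t, ht⟩ := hy
    refine ⟨s ∪ t, fun s' h => ?_⟩
    simp only [map_add, TensorProduct.add_tmul, Finset.sum_add_distrib]
    rw [← hs s' (Finset.union_subset_left h), ← ht s' (Finset.union_subset_right h)]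
  | tmul a f =>
    induction f using SHat.induction with
    | h0 => exact ⟨∅, by simp⟩
    | hadd f g hf hg =>
      obtain ⟨s, hs⟩ := hf
      obtain ⟨t, ht⟩ := hg
      refine ⟨s ∪ t, fun s' h => ?_⟩
      simp only [TensorProduct.tmul_add, map_add, TensorProduct.add_tmul, Finset.sum_add_distrib]
      rw [← hs s' (Finset.union_subset_left h), ← ht s' (Finset.union_subset_right h)]
    | hmono c p =>
      refine ⟨{p}, fun s' h => ?_⟩
      rw [Finset.sum_eq_single p]
      · rw [compQ_tmul, map_smul, tcoeff_tpow, if_pos rfl, smul_eq_mul, mul_one,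
          TensorProduct.smul_tmul]
      · intro q _ hq
        rw [compQ_tmul, map_smul, tcoeff_tpow, if_neg hq.symm]
        simp
      · intro hp
        exact absurd (h (Finset.mem_singleton_self p)) hp

/-- The map `σ ⊗ galois`, whose fixed points are the elements of `L(A, σ)`. -/
def twisted (d : Twist A) : A.carrier ⊗[ℂ] SHat →ₗ[ℂ] A.carrier ⊗[ℂ] SHat :=
  TensorProduct.map (d.σ.1 : A.carrier →ₗ[ℂ] A.carrier) (galois ξ).toLinearMap

theorem twisted_tmul (d : Twist A) (a : A.carrier) (f : SHat) :
    twisted ξ d (a ⊗ₜ f) = d.σ.1 a ⊗ₜ galois ξ f := rfl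

theorem Twist.pow_apply (d : Twist A) (a : A.carrier) (c : ℂ) (h : d.σ.1 a = c • a) :
    a = (c ^ d.m) • a := by
  have h1 : ∀ k : ℕ, (d.σ.1 ^ k) a = c ^ k • a := by
    intro k
    induction k with
    | zero => simp
    | succ k ih => rw [pow_succ', LinearEquiv.mul_apply, ih, map_smul, h, smul_smul, pow_succ]
  have h2 : d.σ.1 ^ d.m = 1 := by
    have := congrArg Subtype.val d.pow_eq_one
    simpa using this
  rw [← h1, h2, LinearEquiv.coe_one, id]

/-- Descent: being fixed means that each coefficient of `t^q` is an eigenvector of σ for e(q). The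
right-hand side involves σ only, so the period `d.m` has no influence on the loop algebra. -/
theorem mem_loopSpace_iff (d : Twist A) (x : A.carrier ⊗[ℂ] SHat) :
    x ∈ loopSpace ξ d ↔ twisted ξ d x = x := by
  constructor
  · intro hx
    induction hx using Submodule.span_induction with
    | mem x hx =>
      obtain ⟨i, a, ha, rfl⟩ := hx
      rw [twisted_tmul, galois_tpow, ha, expQ_neg, expQ_div ξ i d.pos, TensorProduct.smul_tmul,
        smul_smul, mul_inv_cancel₀ (zpow_ne_zero _ (ξ.ne_zero d.pos)), one_smul]
    | zero => simp
    | add x y _ _ hx hy => rw [map_add, hx, hy]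
    | smul c x _ hx => rw [map_smul, hx]
  · intro hx
    have h1 : ∀ q (y : A.carrier ⊗[ℂ] SHat),
        compQ q (twisted ξ d y) = expQ ξ (-q) • d.σ.1 (compQ q y) := by
      intro q y
      induction y using TensorProduct.induction_on with
      | zero => simp
      | add y z hy hz => simp only [map_add, smul_add, hy, hz]
      | tmul a f =>
        rw [twisted_tmul, compQ_tmul, compQ_tmul, tcoeff_galois, map_smul, smul_smul]
    obtain ⟨s, hs⟩ := exists_sum_compQ x
    rw [hs s (Finset.Subset.refl s)]
    refine sum_mem fun q _ => ?_
    by_cases h0 : compQ q x = 0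
    · rw [h0, TensorProduct.zero_tmul]; exact zero_mem _
    have h2 : d.σ.1 (compQ q x) = expQ ξ q • compQ q x := by
      have := h1 q x
      rw [hx, expQ_neg] at this
      rw [this, smul_smul, mul_inv_cancel₀ (expQ_ne_zero ξ q), one_smul, ← this]
    -- The period of σ bounds the denominators: a non-zero coefficient of `t^q` forces `q` to be a
    -- multiple of 1/m.
    have h3 : expQ ξ (d.m * q) = 1 := by
      rw [expQ_nat_mul]
      by_contra h
      have h4 := d.pow_apply _ _ h2
      have h5 : (1 - expQ ξ q ^ d.m) • compQ q x = 0 := by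
        rw [sub_smul, one_smul, ← h4, sub_self]
      rcases smul_eq_zero.mp h5 with h6 | h6
      · exact h (sub_eq_zero.mp h6).symm
      · exact h0 h6
    obtain ⟨i, hi⟩ := (expQ_eq_one_iff ξ _).mp h3
    have hm : (d.m : ℚ) ≠ 0 := by exact_mod_cast d.pos.ne'
    have hq : q = (i : ℚ) / d.m := by rw [← hi]; field_simp
    refine Submodule.subset_span ⟨i, compQ q x, ?_, by rw [← hq]⟩
    rw [h2, hq, expQ_div ξ i d.pos]

end Galois

/-! ## Twisted loop algebras are Lie conformal superalgebras -/

section Loop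

variable {A : ConfData} (ξ : RootSystem) (d : Twist A)

/-- The inclusion of `L(A, σ)` into `A ⊗ ℂ[t^q | q ∈ ℚ]`. -/
def loopVal : (loop ξ d).carrier →ₗ[ℂ] A.carrier ⊗[ℂ] SHat := (loopSpace ξ d).subtype

theorem loopVal_injective : Function.Injective (loopVal ξ d) := Subtype.val_injective

theorem loopVal_mem (x : (loop ξ d).carrier) : loopVal ξ d x ∈ loopSpace ξ d := x.2

theorem exists_loopVal {x : A.carrier ⊗[ℂ] SHat} (hx : x ∈ loopSpace ξ d) :
    ∃ y, loopVal ξ d y = x := ⟨⟨x, hx⟩, rfl⟩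

theorem loopVal_prod (x y : (loop ξ d).carrier) (n : ℕ) :
    loopVal ξ d ((loop ξ d).prod x y n) = hatProd A (loopVal ξ d x) (loopVal ξ d y) n := rfl

theorem loopVal_der (x : (loop ξ d).carrier) :
    loopVal ξ d ((loop ξ d).der x) = hatDer A (loopVal ξ d x) := rfl

theorem mem_loop_part (x : (loop ξ d).carrier) (i : ZMod 2) :
    x ∈ (loop ξ d).part i ↔ loopVal ξ d x ∈ hatPart A i := Iff.rfl

theorem map_dpow {M N : Type} [AddCommGroup M] [Module ℂ M] [AddCommGroup N] [Module ℂ N]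
    (f : M →ₗ[ℂ] N) (S : M →ₗ[ℂ] M) (T : N →ₗ[ℂ] N) (h : ∀ x, f (S x) = T (f x)) (j : ℕ) (x : M) :
    f (dpow S j x) = dpow T j (f x) := by
  induction j with
  | zero => simp
  | succ j ih => rw [dpow_succ, map_smul, h, ih, dpow_succ]

/-- Stated after application of `f`, so that it serves both an injective `f` and a family of maps
that is only jointly injective, as for the universal central extension. -/
theorem SkewAt.map_eq {C D : ConfData} (f : C.carrier →ₗ[ℂ] D.carrier)
    (hprod : ∀ x y n, f (C.prod x y n) = D.prod (f x) (f y) n)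
    (hder : ∀ x, f (C.der x) = D.der (f x)) {κ : ℂ} {x y : C.carrier}
    (h : SkewAt D κ (f x) (f y)) (n : ℕ) :
    f (C.prod x y n) = f ((-(κ • skewSeq C.der (C.prod y x))) n) := by
  rw [SkewAt] at h
  rw [hprod, h, Finsupp.neg_apply, Finsupp.smul_apply, Finsupp.neg_apply, Finsupp.smul_apply,
    map_neg, map_smul, skewSeq_apply, skewSeq_apply, skewOp, skewOp]
  obtain ⟨N, hN⟩ := exists_bound (C.prod y x)
  rw [opSum_eq_sum_range _ _ N _ hN, opSum_eq_sum_range _ _ N _ fun k hk => by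
    rw [← hprod, hN k hk, map_zero], map_sum]
  congr 2
  refine Finset.sum_congr rfl fun l _ => ?_
  rw [LinearMap.smul_apply, LinearMap.smul_apply, map_smul, map_dpow f _ _ hder, hprod]

theorem SkewAt.of_injective {C D : ConfData} (f : C.carrier →ₗ[ℂ] D.carrier)
    (hf : Function.Injective f) (hprod : ∀ x y n, f (C.prod x y n) = D.prod (f x) (f y) n)
    (hder : ∀ x, f (C.der x) = D.der (f x)) {κ : ℂ} {x y : C.carrier}
    (h : SkewAt D κ (f x) (f y)) : SkewAt C κ x y :=
  Finsupp.ext fun n => hf (h.map_eq f hprod hder n)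

theorem JacobiAt.map_eq {C D : ConfData} (f : C.carrier →ₗ[ℂ] D.carrier)
    (hprod : ∀ x y n, f (C.prod x y n) = D.prod (f x) (f y) n)
    {κ : ℂ} {x y z : C.carrier}
    (h : JacobiAt D κ (f x) (f y) (f z)) (m n : ℕ) : f (C.prod x (C.prod y z n) m) =
      f ((∑ l ∈ Finset.range (m + 1), (m.choose l : ℂ) • C.prod (C.prod x y l) z (m + n - l))
        + κ • C.prod y (C.prod x z m) n) := by
  simp only [hprod, h m n, map_add, map_sum, map_smul]

theorem JacobiAt.of_injective {C D : ConfData} (f : C.carrier →ₗ[ℂ] D.carrier)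
    (hf : Function.Injective f) (hprod : ∀ x y n, f (C.prod x y n) = D.prod (f x) (f y) n)
    {κ : ℂ} {x y z : C.carrier}
    (h : JacobiAt D κ (f x) (f y) (f z)) : JacobiAt C κ x y z :=
  fun m n => hf (h.map_eq f hprod m n)

/-- Even and odd components of elements of `L(A, σ)` lie in `L(A, σ)`. -/
theorem loop_isCompl (h : A.IsLie) : IsCompl ((loop ξ d).part 0) ((loop ξ d).part 1) := by
  have hc := hat_isCompl h.isCompl
  refine ⟨Submodule.disjoint_def.mpr fun x h0 h1 => ?_, codisjoint_iff.mpr ?_⟩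
  · exact loopVal_injective ξ d (Submodule.disjoint_def.mp hc.disjoint _ h0 h1)
  · rw [eq_top_iff]
    intro x _
    obtain ⟨a, ha, b, hb, hab⟩ := exists_parts hc (loopVal ξ d x)
    have hσ : ∀ i, ∀ y ∈ hatPart A i, twisted ξ d y ∈ hatPart A i := by
      intro i y hy
      refine hatPart_induction (motive := fun y => twisted ξ d y ∈ hatPart A i) (by simp)
        (fun x y hx hy => by rw [map_add]; exact add_mem hx hy) (fun a ha f => ?_) hy
      exact tmul_mem_hatPart (d.σ.2.1.map_part i a ha) _
    have hx := (mem_loopSpace_iff ξ d _).mp (loopVal_mem ξ d x)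
    rw [← hab, map_add] at hx
    have h0 : twisted ξ d a - a = 0 := by
      refine Submodule.disjoint_def.mp hc.disjoint _ (sub_mem (hσ 0 a ha) ha) ?_
      have : twisted ξ d a - a = b - twisted ξ d b := by
        rw [sub_eq_sub_iff_add_eq_add, hx, add_comm]
      rw [this]
      exact sub_mem hb (hσ 1 b hb)
    have ha' : twisted ξ d a = a := sub_eq_zero.mp h0
    have hb' : twisted ξ d b = b := by rw [ha'] at hx; exact add_left_cancel hx
    obtain ⟨a', rfl⟩ := exists_loopVal ξ d ((mem_loopSpace_iff ξ d a).mpr ha')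
    obtain ⟨b', rfl⟩ := exists_loopVal ξ d ((mem_loopSpace_iff ξ d b).mpr hb')
    rw [← map_add] at hab
    rw [← loopVal_injective ξ d hab]
    exact Submodule.add_mem_sup ha hb

theorem loop_isLie (h : A.IsLie) : (loop ξ d).IsLie where
  isCompl := loop_isCompl ξ d h
  der_mem i x hx := (hat_isLie h).der_mem i _ hx
  prod_mem i j x hx y hy n := (hat_isLie h).prod_mem i j _ hx _ hy n
  der_prod x y n := loopVal_injective ξ d <| by
    rw [map_neg, map_smul, loopVal_prod, loopVal_der, loopVal_prod]
    exact (hat_isLie h).der_prod _ _ n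
  prod_der x y n := loopVal_injective ξ d <| by
    rw [map_add, map_smul, loopVal_prod, loopVal_der, loopVal_der, loopVal_prod, loopVal_prod]
    exact (hat_isLie h).prod_der _ _ n
  skew i j x hx y hy := by
    rw [← skewAt_iff]
    exact SkewAt.of_injective (D := hat A) (loopVal ξ d) (loopVal_injective ξ d)
      (loopVal_prod ξ d) (loopVal_der ξ d) ((hat_isLie h).skewAt hx hy)
  jacobi i j x hx y hy z :=
    JacobiAt.of_injective (D := hat A) (loopVal ξ d) (loopVal_injective ξ d)
      (loopVal_prod ξ d) ((hat_isLie h).jacobiAt hx hy _)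

variable {ξ d}

/-- A homomorphism of base changes that is compatible with the Galois actions restricts to twisted
loop algebras. -/
theorem exists_loop_hom {B : ConfData} {e : Twist B}
    (Θ : A.carrier ⊗[ℂ] SHat →ₗ[ℂ] B.carrier ⊗[ℂ] SHat)
    (hΘ : IsConfHom (A := hat A) (B := hat B) Θ)
    (h : ∀ x, Θ (twisted ξ d x) = twisted ξ e (Θ x)) :
    ∃ f : (loop ξ d).carrier →ₗ[ℂ] (loop ξ e).carrier, IsConfHom f ∧
      ∀ x, loopVal ξ e (f x) = Θ (loopVal ξ d x) := by
  have hm : ∀ x ∈ loopSpace ξ d, Θ x ∈ loopSpace ξ e := by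
    intro x hx
    rw [mem_loopSpace_iff] at hx ⊢
    rw [← h, hx]
  let f : (loop ξ d).carrier →ₗ[ℂ] (loop ξ e).carrier := Θ.restrict hm
  have hf : ∀ x, loopVal ξ e (f x) = Θ (loopVal ξ d x) := fun x => rfl
  refine ⟨f, ⟨fun i x hx => ?_, fun x y n => loopVal_injective ξ e ?_,
    fun x => loopVal_injective ξ e ?_⟩, hf⟩
  · exact hΘ.map_part i _ hx
  · rw [hf, loopVal_prod, loopVal_prod, hf, hf]
    exact hΘ.map_prod _ _ n
  · rw [hf, loopVal_der, loopVal_der, hf]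
    exact hΘ.map_der _

theorem loop_iso_of_hat {B : ConfData} {e : Twist B}
    (Θ : A.carrier ⊗[ℂ] SHat →ₗ[ℂ] B.carrier ⊗[ℂ] SHat)
    (Θ' : B.carrier ⊗[ℂ] SHat →ₗ[ℂ] A.carrier ⊗[ℂ] SHat)
    (hΘ : IsConfHom (A := hat A) (B := hat B) Θ) (hΘ' : IsConfHom (A := hat B) (B := hat A) Θ')
    (h₁ : ∀ x, Θ' (Θ x) = x) (h₂ : ∀ x, Θ (Θ' x) = x)
    (h : ∀ x, Θ (twisted ξ d x) = twisted ξ e (Θ x)) : Iso (loop ξ d) (loop ξ e) := by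
  obtain ⟨f, hf, hf'⟩ := exists_loop_hom Θ hΘ h
  obtain ⟨g, hg, hg'⟩ := exists_loop_hom (ξ := ξ) (d := e) (e := d) Θ' hΘ' fun x => by
    rw [← h₁ (twisted ξ d (Θ' x)), h, h₂]
  refine ⟨LinearEquiv.ofLinearMap f g ?_ ?_, hf, hg⟩
  · ext x
    apply loopVal_injective ξ e
    simp [hf', hg', h₂]
  · ext x
    apply loopVal_injective ξ d
    simp [hf', hg', h₁]

end Loop

/-! ## Free conformal superalgebras with affine `λ`-brackets -/

/-- A table of `λ`-brackets `[v_i _λ v_j] = ∑_k (a_{ijk} + b_{ijk} ∂ + c_{ijk} λ) v_k`. -/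
structure AffTable (ι : Type) [Fintype ι] [DecidableEq ι] where
  par : ι → ZMod 2
  T : ι → ι → ι → ℂ[X][X]
  a : ι → ι → ι → ℂ
  b : ι → ι → ι → ℂ
  c : ι → ι → ι → ℂ
  T_eq : ∀ i j k, T i j k = cst (a i j k) + cst (b i j k) * dd + cst (c i j k) * lam

/-- The bilinear map with structure constants `s`, over a commutative `ℂ`-algebra. -/
def form {ι : Type} [Fintype ι] {S : Type} [CommRing S] [Algebra ℂ S] (s : ι → ι → ι → ℂ)
    (u w : ι → S) : ι → S :=
  fun k => ∑ i, ∑ j, s i j k • (u i * w j)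

namespace AffTable

variable {ι : Type} [Fintype ι] [DecidableEq ι] (t : AffTable ι)

/-- The conformal superalgebra with the given `λ`-brackets. -/
abbrev conf : ConfData := freeConf t.par t.T

/-- The coordinates of an element. -/
def crd : t.conf.carrier →ₗ[ℂ] (ι → ℂ[X]) := LinearMap.id

/-- The element with given coordinates. -/
def ofCrd : (ι → ℂ[X]) →ₗ[ℂ] t.conf.carrier := LinearMap.id

@[simp] theorem crd_ofCrd (x : ι → ℂ[X]) : t.crd (t.ofCrd x) = x := rfl

theorem crd_injective : Function.Injective t.crd := fun _ _ h => h

/-- The basis element `v_i`. -/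
def gen (i : ι) : t.conf.carrier := t.ofCrd (Pi.single i 1)

@[simp] theorem crd_gen (i : ι) : t.crd (t.gen i) = Pi.single i 1 := rfl

@[simp] theorem crd_der (x : t.conf.carrier) (k : ι) :
    t.crd (t.conf.der x) k = Polynomial.X * t.crd x k := rfl

theorem crd_prod (x y : t.conf.carrier) (n : ℕ) (k : ι) :
    t.crd (t.conf.prod x y n) k =
      (n ! : ℂ) • (lamBracket t.T (t.crd x) (t.crd y) k).coeff n := rfl

theorem mem_part (x : t.conf.carrier) (i : ZMod 2) :
    x ∈ t.conf.part i ↔ ∀ k, t.par k ≠ i → t.crd x k = 0 := by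
  change t.crd x ∈ (⨅ k ∈ {k | t.par k ≠ i},
    LinearMap.ker (LinearMap.proj k : (ι → ℂ[X]) →ₗ[ℂ] ℂ[X])) ↔ _
  simp only [Submodule.mem_iInf, LinearMap.mem_ker]
  rfl

theorem lamBracket_apply (x y : ι → ℂ[X]) (k : ι) :
    lamBracket t.T x y k = ∑ i, ∑ j,
      Polynomial.aeval (-lam) (x i) * Polynomial.aeval (dd + lam) (y j) * t.T i j k := rfl

theorem isSesqui : IsSesqui t.conf := by
  have hder : ∀ (x : t.conf.carrier), t.crd (t.conf.der x) = fun k => Polynomial.X * t.crd x k :=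
    fun x => rfl
  constructor
  · intro x y n
    apply t.crd_injective
    ext1 k
    have h : lamBracket t.T (t.crd (t.conf.der x)) (t.crd y) k =
        -(lam * lamBracket t.T (t.crd x) (t.crd y) k) := by
      rw [hder, lamBracket_apply, lamBracket_apply, Finset.mul_sum, ← Finset.sum_neg_distrib]
      refine Finset.sum_congr rfl fun i _ => ?_
      rw [Finset.mul_sum, ← Finset.sum_neg_distrib]
      refine Finset.sum_congr rfl fun j _ => ?_
      rw [map_mul, Polynomial.aeval_X]
      ring
    rw [crd_prod, h, map_neg, map_smul, Pi.neg_apply, Pi.smul_apply, crd_prod,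
      Polynomial.coeff_neg, lam]
    rcases n with _ | n
    · simp
    · rw [Polynomial.coeff_X_mul, Nat.add_sub_cancel, Nat.factorial_succ]
      push_cast
      module
  · intro x y n
    apply t.crd_injective
    ext1 k
    have h : lamBracket t.T (t.crd x) (t.crd (t.conf.der y)) k =
        dd * lamBracket t.T (t.crd x) (t.crd y) k + lam * lamBracket t.T (t.crd x) (t.crd y) k := by
      rw [hder, lamBracket_apply, lamBracket_apply, ← add_mul, Finset.mul_sum]
      refine Finset.sum_congr rfl fun i _ => ?_
      rw [Finset.mul_sum]
      refine Finset.sum_congr rfl fun j _ => ?_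
      rw [map_mul, Polynomial.aeval_X]
      ring
    rw [crd_prod, h, map_add, map_smul, Pi.add_apply, Pi.smul_apply, crd_der, crd_prod, crd_prod,
      Polynomial.coeff_add, lam, dd, Polynomial.coeff_C_mul]
    rcases n with _ | n
    · simp
    · rw [Polynomial.coeff_X_mul, Nat.add_sub_cancel, Nat.factorial_succ, mul_smul_comm]
      push_cast
      module

theorem isCompl : IsCompl (t.conf.part 0) (t.conf.part 1) := by
  refine ⟨Submodule.disjoint_def.mpr fun x h0 h1 => ?_, codisjoint_iff.mpr ?_⟩
  · rw [mem_part] at h0 h1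
    apply t.crd_injective
    ext1 k
    rw [map_zero, Pi.zero_apply]
    by_cases h : t.par k = 0
    · exact h1 k (by rw [h]; decide)
    · exact h0 k h
  · rw [eq_top_iff]
    intro x _
    have hx : x = t.ofCrd (fun k => if t.par k = 0 then t.crd x k else 0) +
        t.ofCrd (fun k => if t.par k = 0 then 0 else t.crd x k) := by
      apply t.crd_injective
      ext1 k
      simp only [map_add, crd_ofCrd, Pi.add_apply]
      split_ifs <;> simp
    rw [hx]
    refine Submodule.add_mem_sup ?_ ?_
    · rw [mem_part]
      intro k hk
      simp [hk]
    · rw [mem_part]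
      intro k hk
      have : t.par k = 0 := by
        revert hk; generalize t.par k = p; revert p; decide
      simp [this]

theorem gen_mem_part (i : ι) : t.gen i ∈ t.conf.part (t.par i) := by
  rw [mem_part]
  intro k hk
  rw [crd_gen, Pi.single_eq_of_ne]
  rintro rfl
  exact hk rfl

variable {t}

theorem part_induction {p : ZMod 2} {motive : t.conf.carrier → Prop} (h0 : motive 0)
    (hadd : ∀ x y, motive x → motive y → motive (x + y))
    (hsmul : ∀ (c : ℂ) x, motive x → motive (c • x))
    (hder : ∀ x, motive x → motive (t.conf.der x))
    (hgen : ∀ i, t.par i = p → motive (t.gen i)) {x : t.conf.carrier} (hx : x ∈ t.conf.part p) :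
    motive x := by
  have hsum : x = ∑ k, t.ofCrd (Pi.single k (t.crd x k)) := by
    apply t.crd_injective
    rw [map_sum]
    simp only [crd_ofCrd]
    exact (Finset.univ_sum_single _).symm
  rw [hsum]
  refine Finset.sum_induction _ motive hadd h0 fun k _ => ?_
  by_cases hk : t.par k = p
  · generalize t.crd x k = f
    induction f using Polynomial.induction_on' with
    | add f g hf hg => rw [Pi.single_add, map_add]; exact hadd _ _ hf hg
    | monomial n c =>
      induction n with
      | zero =>
        have : t.ofCrd (Pi.single k (Polynomial.monomial 0 c)) = c • t.gen k := by
          apply t.crd_injective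
          rw [map_smul, crd_ofCrd, crd_gen, ← Pi.single_smul, Polynomial.smul_eq_C_mul, mul_one]
          rfl
        rw [this]
        exact hsmul c _ (hgen k hk)
      | succ n ih =>
        have : t.ofCrd (Pi.single k (Polynomial.monomial (n + 1) c)) =
            t.conf.der (t.ofCrd (Pi.single k (Polynomial.monomial n c))) := by
          apply t.crd_injective
          ext1 l
          rw [crd_der, crd_ofCrd, crd_ofCrd]
          by_cases hl : l = k
          · subst hl
            simp [Polynomial.X_mul_monomial]
          · simp [hl]
        rw [this]
        exact hder _ ih
  · rw [(mem_part t x p).mp hx k hk, Pi.single_zero, map_zero]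
    exact h0

theorem conf_induction {motive : t.conf.carrier → Prop} (h0 : motive 0)
    (hadd : ∀ x y, motive x → motive y → motive (x + y))
    (hsmul : ∀ (c : ℂ) x, motive x → motive (c • x))
    (hder : ∀ x, motive x → motive (t.conf.der x))
    (hgen : ∀ i, motive (t.gen i)) (x : t.conf.carrier) : motive x := by
  obtain ⟨a, ha, b, hb, rfl⟩ := exists_parts t.isCompl x
  exact hadd _ _ (part_induction h0 hadd hsmul hder (fun i _ => hgen i) ha)
    (part_induction h0 hadd hsmul hder (fun i _ => hgen i) hb)

variable (t)

/-- The element `∑_i w_i v_i`. -/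
def vec (w : ι → ℂ) : t.conf.carrier := t.ofCrd fun k => Polynomial.C (w k)

@[simp] theorem crd_vec (w : ι → ℂ) (k : ι) : t.crd (t.vec w) k = Polynomial.C (w k) := rfl

theorem vec_single (i : ι) : t.vec (Pi.single i 1) = t.gen i := by
  apply t.crd_injective
  ext1 k
  rw [crd_vec, crd_gen]
  by_cases h : k = i
  · subst h; simp
  · simp [h]

theorem vec_add (u w : ι → ℂ) : t.vec (u + w) = t.vec u + t.vec w := by
  apply t.crd_injective; ext1 k; simp

theorem vec_smul (c : ℂ) (w : ι → ℂ) : t.vec (c • w) = c • t.vec w := by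
  apply t.crd_injective; ext1 k; simp [Polynomial.smul_eq_C_mul]

theorem vec_zero : t.vec 0 = 0 := by
  apply t.crd_injective; ext1 k; simp

theorem vec_neg (w : ι → ℂ) : t.vec (-w) = -t.vec w := by
  apply t.crd_injective; ext1 k; simp

theorem vec_sub (u w : ι → ℂ) : t.vec (u - w) = t.vec u - t.vec w := by
  apply t.crd_injective; ext1 k; simp

theorem lamBracket_vec (u w : ι → ℂ) (k : ι) :
    lamBracket t.T (t.crd (t.vec u)) (t.crd (t.vec w)) k =
      Polynomial.C (Polynomial.C (form t.a u w k) + Polynomial.C (form t.b u w k) * Polynomial.X) +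
        Polynomial.C (Polynomial.C (form t.c u w k)) * Polynomial.X := by
  rw [lamBracket_apply]
  simp only [crd_vec, Polynomial.aeval_C, form, T_eq, map_sum, smul_eq_mul, map_mul,
    Finset.sum_mul, map_add]
  rw [← Finset.sum_add_distrib, ← Finset.sum_add_distrib]
  refine Finset.sum_congr rfl fun i _ => ?_
  rw [← Finset.sum_add_distrib, ← Finset.sum_add_distrib]
  refine Finset.sum_congr rfl fun j _ => ?_
  simp only [cst, dd, lam, Polynomial.algebraMap_apply, Algebra.algebraMap_self, RingHom.id_apply]
  ring

theorem prod_vec_zero (u w : ι → ℂ) : t.conf.prod (t.vec u) (t.vec w) 0 =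
    t.vec (form t.a u w) + t.conf.der (t.vec (form t.b u w)) := by
  apply t.crd_injective
  ext1 k
  rw [crd_prod, lamBracket_vec, map_add t.crd, Pi.add_apply, crd_der]
  simp [Polynomial.X_mul_C]

theorem prod_vec_one (u w : ι → ℂ) : t.conf.prod (t.vec u) (t.vec w) 1 = t.vec (form t.c u w) := by
  apply t.crd_injective
  ext1 k
  rw [crd_prod, lamBracket_vec]
  simp [Polynomial.coeff_C]

theorem prod_vec_add_two (u w : ι → ℂ) (n : ℕ) : t.conf.prod (t.vec u) (t.vec w) (n + 2) = 0 := by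
  apply t.crd_injective
  ext1 k
  rw [crd_prod, lamBracket_vec]
  simp [Polynomial.coeff_C]

/-- Skew-symmetry in terms of structure constants. -/
structure SkewCoeff (κ : ℂ) (u w : ι → ℂ) : Prop where
  hc : form t.c u w = κ • form t.c w u
  ha : form t.a u w = -(κ • form t.a w u)
  hb : form t.b u w = -(κ • (form t.b w u - form t.c w u))

/-- The Jacobi identity in terms of structure constants. -/
structure JacobiCoeff (κ : ℂ) (x y z : ι → ℂ) : Prop where
  aa : form t.a x (form t.a y z) = form t.a (form t.a x y) z + κ • form t.a y (form t.a x z)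
  ab : form t.b x (form t.a y z) + form t.a x (form t.b y z) = form t.b (form t.a x y) z +
    κ • (form t.b y (form t.a x z) + form t.a y (form t.b x z))
  bb : form t.b x (form t.b y z) = κ • form t.b y (form t.b x z)
  ca : form t.c x (form t.a y z) + form t.a x (form t.b y z) = form t.c (form t.a x y) z -
    form t.a (form t.b x y) z + form t.a (form t.c x y) z + κ • form t.a y (form t.c x z)
  cb : form t.c x (form t.b y z) + form t.b x (form t.b y z) = form t.b (form t.c x y) z -
    form t.b (form t.b x y) z + κ • form t.b y (form t.c x z)
  ac : form t.a x (form t.c y z) = form t.c (form t.a x y) z - form t.a (form t.b x y) z +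
    κ • (form t.c y (form t.a x z) + form t.a y (form t.b x z))
  bc : form t.b x (form t.c y z) = -form t.b (form t.b x y) z +
    κ • (form t.c y (form t.b x z) + form t.b y (form t.b x z))
  cc : form t.c x (form t.c y z) = form t.c (form t.c x y) z - (2 : ℂ) • form t.c (form t.b x y) z +
    κ • form t.c y (form t.c x z)
  cb' : form t.c x (form t.b y z) = form t.c (form t.c x y) z - form t.c (form t.b x y) z
  bc' : form t.c (form t.b x y) z = κ • form t.c y (form t.b x z)

variable {t}

theorem SkewCoeff.skewAt {κ : ℂ} {u w : ι → ℂ} (h : t.SkewCoeff κ u w) :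
    SkewAt t.conf κ (t.vec u) (t.vec w) := by
  rw [SkewAt]
  have hb : ∀ k, 2 ≤ k → t.conf.prod (t.vec w) (t.vec u) k = 0 := by
    intro k hk
    obtain ⟨n, rfl⟩ := Nat.exists_eq_add_of_le' hk
    exact t.prod_vec_add_two w u n
  ext1 n
  rw [Finsupp.neg_apply, Finsupp.smul_apply, skewSeq_apply, skewOp, opSum_eq_sum_range _ _ 2 _ hb,
    Finset.sum_range_succ, Finset.sum_range_one]
  rcases n with _ | _ | n
  · simp only [add_zero, zero_add, pow_zero, pow_one, LinearMap.smul_apply, dpow_zero, dpow_succ,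
      prod_vec_zero, prod_vec_one, h.ha, h.hb, vec_neg, vec_smul, vec_sub, map_neg, map_smul, map_sub]
    simp
    module
  · simp only [add_zero, zero_add, prod_vec_one, prod_vec_add_two, h.hc, vec_smul]
    simp
  · simp only [prod_vec_add_two, show n + 1 + 1 + 1 = n + 1 + 2 by rfl,
      show n + 1 + 1 = n + 2 by rfl]
    simp

/-- Products of constant vectors vanish from degree 2 on, so the identity has content only for m + n
≤ 2, where it is assembled from the listed relations between coefficients; everything beyond is 0 =
0. -/
theorem JacobiCoeff.jacobiAt {κ : ℂ} {x y z : ι → ℂ} (h : t.JacobiCoeff κ x y z) :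
    JacobiAt t.conf κ (t.vec x) (t.vec y) (t.vec z) := by
  intro m n
  have hd := t.isSesqui.der_prod
  have hd' := t.isSesqui.prod_der
  have p2 : ∀ u w, t.conf.prod (t.vec u) (t.vec w) 2 = 0 := fun u w => t.prod_vec_add_two u w 0
  have pn : ∀ u w n, t.conf.prod (t.vec u) (t.vec w) (n + 1 + 1) = 0 := t.prod_vec_add_two
  obtain ⟨aa, ab, bb, ca, cb, ac, bc, cc, cb', bc'⟩ := h
  replace aa := congrArg t.vec aa
  replace ab := congrArg (fun w => t.conf.der (t.vec w)) ab
  replace bb := congrArg (fun w => t.conf.der (t.conf.der (t.vec w))) bb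
  replace ca := congrArg t.vec ca
  replace cb := congrArg (fun w => t.conf.der (t.vec w)) cb
  replace ac := congrArg t.vec ac
  replace bc := congrArg (fun w => t.conf.der (t.vec w)) bc
  replace cc := congrArg t.vec cc
  replace cb' := congrArg t.vec cb'
  replace bc' := congrArg t.vec bc'
  simp only [vec_add, vec_sub, vec_neg, vec_smul, map_add, map_sub, map_neg, map_smul]
    at aa ab bb ca cb ac bc cc cb' bc'
  rcases m with _ | _ | _ | m
  · rcases n with _ | _ | _ | n
    · simp only [zero_add, Finset.sum_range_one, Nat.choose_self, Nat.cast_one, one_smul,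
        Nat.sub_zero, prod_vec_zero, map_add, LinearMap.add_apply, Finsupp.add_apply, hd, hd',
        Nat.cast_zero, zero_smul]
      linear_combination (norm := module) aa + ab + bb
    · simp only [zero_add, Finset.sum_range_one, Nat.choose_self, Nat.cast_one, one_smul, add_zero,
        Nat.sub_zero, prod_vec_zero, prod_vec_one, map_add, LinearMap.add_apply, Finsupp.add_apply,
        hd, hd', Nat.sub_self]
      linear_combination (norm := module) ac + bc
    · simp only [zero_add, Finset.sum_range_one, Nat.choose_self, Nat.cast_one, one_smul, add_zero,
        Nat.sub_zero, prod_vec_zero, prod_vec_one, map_add, LinearMap.add_apply, Finsupp.add_apply,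
        hd, hd', p2, map_zero, Nat.reduceAdd, Finsupp.zero_apply, Nat.add_one_sub_one,
        Nat.reduceSub]
      push_cast
      linear_combination (norm := module) (2 : ℂ) • bc'
    · simp only [pn, zero_add, Finset.sum_range_one, Nat.choose_self, Nat.cast_one, one_smul,
        Nat.sub_zero, prod_vec_zero, map_add, LinearMap.add_apply, Finsupp.add_apply, hd, hd',
        map_zero, Finsupp.zero_apply, Nat.add_sub_cancel, smul_zero, add_zero, neg_zero]
  · rcases n with _ | _ | n
    · simp only [zero_add, Finset.sum_range_succ, Finset.sum_range_zero, Nat.choose_self,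
        Nat.cast_one, one_smul, Nat.sub_zero, prod_vec_zero, prod_vec_one, map_add,
        LinearMap.add_apply, Finsupp.add_apply, hd, hd', Nat.choose_zero_right, Nat.sub_self,
        add_zero]
      linear_combination (norm := module) ca + cb
    · simp only [zero_add, Finset.sum_range_succ, Finset.sum_range_zero, Nat.choose_self,
        Nat.cast_one, one_smul, Nat.sub_zero, prod_vec_zero, prod_vec_one, map_add,
        LinearMap.add_apply, Finsupp.add_apply, hd, Nat.choose_zero_right, Nat.reduceAdd, p2,
        Nat.reduceSub]
      push_cast
      linear_combination (norm := module) cc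
    · simp only [zero_add, Finset.sum_range_succ, Finset.sum_range_zero, Nat.choose_self,
        Nat.cast_one, one_smul, Nat.sub_zero, prod_vec_zero, prod_vec_one, map_add,
        LinearMap.add_apply, Finsupp.add_apply, hd, Nat.choose_zero_right, pn,
        show 1 + (n + 1 + 1) - 0 = n + 1 + 1 + 1 by omega,
        show 1 + (n + 1 + 1) - 1 = n + 1 + 1 by omega, map_zero, Finsupp.zero_apply,
        Nat.add_sub_cancel, smul_zero, neg_zero, add_zero,
        show 1 + (n + 1 + 1) = n + 1 + 1 + 1 by omega]
  · rcases n with _ | n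
    · simp only [zero_add, Finset.sum_range_succ, Finset.sum_range_zero, Nat.choose_self,
        Nat.cast_one, one_smul, Nat.sub_zero, prod_vec_zero, prod_vec_one, map_add,
        LinearMap.add_apply, Finsupp.add_apply, hd, hd', Nat.choose_zero_right, Nat.reduceAdd, p2,
        Nat.reduceSub, map_zero, Finsupp.zero_apply, LinearMap.zero_apply, add_zero,
        Nat.choose_one_right, Nat.add_one_sub_one]
      push_cast
      linear_combination (norm := module) (2 : ℂ) • cb'
    · rcases n with _ | n
      · simp only [zero_add, Finset.sum_range_succ, Finset.sum_range_zero, Nat.choose_self,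
          Nat.cast_one, one_smul, Nat.sub_zero, prod_vec_zero, prod_vec_one, map_add,
          LinearMap.add_apply, Finsupp.add_apply, hd, Nat.choose_zero_right, Nat.reduceAdd, p2,
          Nat.reduceSub, map_zero, Finsupp.zero_apply, LinearMap.zero_apply, add_zero,
          Nat.choose_one_right, Nat.add_one_sub_one, pn _ _ 1, smul_zero, neg_zero]
      · simp only [pn, map_zero, Finsupp.zero_apply, smul_zero, add_zero]
        symm
        refine Finset.sum_eq_zero fun l hl => ?_
        rw [Finset.mem_range] at hl
        rcases l with _ | _ | l
        · rw [prod_vec_zero, map_add, LinearMap.add_apply, Finsupp.add_apply, hd,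
            show 0 + 1 + 1 + (n + 1 + 1) - 0 = n + 1 + 1 + 1 + 1 by omega, pn, Nat.add_sub_cancel,
            pn]
          simp
        · rw [zero_add, prod_vec_one, show 1 + 1 + (n + 1 + 1) - 1 = n + 1 + 1 + 1 by omega, pn,
            smul_zero]
        · rw [pn]; simp
  · have e1 : t.conf.prod (t.vec x) (t.conf.prod (t.vec y) (t.vec z) n) (m + 1 + 1 + 1) = 0 := by
      rcases n with _ | _ | n
      · rw [prod_vec_zero, map_add (t.conf.prod (t.vec x)), Finsupp.add_apply, hd', pn, pn,
          map_zero]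
        simp [pn]
      · rw [zero_add, prod_vec_one, pn]
      · rw [pn]; simp
    rw [e1, pn]
    simp only [map_zero, Finsupp.zero_apply, smul_zero, add_zero]
    symm
    refine Finset.sum_eq_zero fun l hl => ?_
    rw [Finset.mem_range] at hl
    rcases l with _ | _ | l
    · rw [prod_vec_zero, map_add, LinearMap.add_apply, Finsupp.add_apply, hd,
        show m + 1 + 1 + 1 + n - 0 = m + n + 1 + 1 + 1 by omega, pn, Nat.add_sub_cancel, pn]
      simp
    · rw [zero_add, prod_vec_one, show m + 1 + 1 + 1 + n - 1 = m + n + 1 + 1 by omega, pn,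
        smul_zero]
    · rw [pn]; simp

/-- The axioms of a Lie conformal superalgebra, on basis elements and in terms of structure
constants. -/
theorem isLie (hder : ∀ i j k, t.par k ≠ t.par i + t.par j →
      t.a i j k = 0 ∧ t.b i j k = 0 ∧ t.c i j k = 0)
    (hskew : ∀ i j, t.SkewCoeff (koszul (t.par i) (t.par j)) (Pi.single i 1) (Pi.single j 1))
    (hjac : ∀ i j k, t.JacobiCoeff (koszul (t.par i) (t.par j)) (Pi.single i 1) (Pi.single j 1)
      (Pi.single k 1)) : t.conf.IsLie where
  isCompl := t.isCompl
  der_mem i x hx := by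
    rw [mem_part] at hx ⊢
    intro k hk
    rw [crd_der, hx k hk, mul_zero]
  prod_mem i j x hx y hy n := by
    rw [mem_part] at hx hy ⊢
    intro r hr
    rw [crd_prod, lamBracket_apply, Finset.sum_eq_zero, Polynomial.coeff_zero, smul_zero]
    intro k _
    refine Finset.sum_eq_zero fun l _ => ?_
    by_cases hk : t.par k = i
    · by_cases hl : t.par l = j
      · obtain ⟨h1, h2, h3⟩ := hder k l r (by rw [hk, hl]; exact hr)
        rw [t.T_eq, h1, h2, h3]
        simp [cst]
      · rw [hy l hl]; simp
    · rw [hx k hk]; simp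
  der_prod := t.isSesqui.der_prod
  prod_der := t.isSesqui.prod_der
  skew i j x hx y hy := by
    rw [← skewAt_iff]
    refine part_induction (motive := fun x => SkewAt t.conf (koszul i j) x y) SkewAt.zero_left
      (fun _ _ => SkewAt.add_left) (fun c _ => SkewAt.smul_left c)
      (fun _ => SkewAt.der_left t.isSesqui) (fun k hk => ?_) hx
    refine SkewAt.symm (koszul_mul_self i j) ?_
    refine part_induction (motive := fun y => SkewAt t.conf (koszul i j) y (t.gen k))
      SkewAt.zero_left (fun _ _ => SkewAt.add_left) (fun c _ => SkewAt.smul_left c)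
      (fun _ => SkewAt.der_left t.isSesqui) (fun l hl => ?_) hy
    have := (hskew l k).skewAt
    rwa [hk, hl, koszul_comm, vec_single, vec_single] at this
  jacobi i j x hx y hy z := by
    refine part_induction (motive := fun x => JacobiAt t.conf (koszul i j) x y z)
      JacobiAt.zero_left (fun _ _ => JacobiAt.add_left) (fun c _ => JacobiAt.smul_left c)
      (fun _ => JacobiAt.der_left t.isSesqui) (fun k hk => ?_) hx
    refine part_induction (motive := fun y => JacobiAt t.conf (koszul i j) (t.gen k) y z)
      JacobiAt.zero_middle (fun _ _ => JacobiAt.add_middle) (fun c _ => JacobiAt.smul_middle c)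
      (fun _ => JacobiAt.der_middle t.isSesqui) (fun l hl => ?_) hy
    refine conf_induction (motive := fun z => JacobiAt t.conf (koszul i j) (t.gen k) (t.gen l) z)
      JacobiAt.zero_right (fun _ _ => JacobiAt.add_right) (fun c _ => JacobiAt.smul_right c)
      (fun _ => JacobiAt.der_right t.isSesqui) (fun r => ?_) z
    have := (hjac k l r).jacobiAt
    rwa [hk, hl, vec_single, vec_single, vec_single] at this

end AffTable

/-! ## The matrix model of the `N = 4` conformal superalgebra -/

/-- The basis of the matrix model: `L`, the standard basis of `sl₂` and the matrix units
`x_{ij}` that span the odd part. -/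
inductive K4
  | L | E | H | F | x11 | x12 | x21 | x22
  deriving DecidableEq

instance : Fintype K4 :=
  ⟨{.L, .E, .H, .F, .x11, .x12, .x21, .x22}, fun x => by cases x <;> simp⟩

theorem K4.sum_univ {M : Type*} [AddCommMonoid M] (f : K4 → M) : ∑ i, f i =
    f .L + f .E + f .H + f .F + f .x11 + f .x12 + f .x21 + f .x22 := by
  have : (Finset.univ : Finset K4) = {.L, .E, .H, .F, .x11, .x12, .x21, .x22} := rfl
  rw [this]
  simp [add_assoc]

theorem I2.sum_univ {M : Type*} [AddCommMonoid M] (f : I2 → M) : ∑ i, f i =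
    f .L + f .J + f .Gp + f .Gm := by
  have : (Finset.univ : Finset I2) = {.L, .J, .Gp, .Gm} := rfl
  rw [this]
  simp [add_assoc]

namespace K4

def par : K4 → ZMod 2
  | .L | .E | .H | .F => 0
  | .x11 | .x12 | .x21 | .x22 => 1

/-- The coefficients of `1` in the `λ`-brackets. -/
def ca : K4 → K4 → K4 → ℂ
  | .E, .F => Pi.single .H 1
  | .F, .E => Pi.single .H (-1)
  | .H, .E => Pi.single .E 2
  | .E, .H => Pi.single .E (-2)
  | .H, .F => Pi.single .F (-2)
  | .F, .H => Pi.single .F 2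
  | .E, .x21 => Pi.single .x11 1
  | .E, .x22 => Pi.single .x12 1
  | .F, .x11 => Pi.single .x21 1
  | .F, .x12 => Pi.single .x22 1
  | .H, .x11 => Pi.single .x11 1
  | .H, .x12 => Pi.single .x12 1
  | .H, .x21 => Pi.single .x21 (-1)
  | .H, .x22 => Pi.single .x22 (-1)
  | .x21, .E => Pi.single .x11 (-1)
  | .x22, .E => Pi.single .x12 (-1)
  | .x11, .F => Pi.single .x21 (-1)
  | .x12, .F => Pi.single .x22 (-1)
  | .x11, .H => Pi.single .x11 (-1)
  | .x12, .H => Pi.single .x12 (-1)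
  | .x21, .H => Pi.single .x21 1
  | .x22, .H => Pi.single .x22 1
  | .x11, .x22 => Pi.single .L (-2)
  | .x22, .x11 => Pi.single .L (-2)
  | .x12, .x21 => Pi.single .L 2
  | .x21, .x12 => Pi.single .L 2
  | _, _ => 0

/-- The coefficients of `∂ + 2λ` in the brackets of odd elements. -/
def co : K4 → K4 → K4 → ℂ
  | .x11, .x22 => Pi.single .H (-1)
  | .x22, .x11 => Pi.single .H 1
  | .x12, .x21 => Pi.single .H 1
  | .x21, .x12 => Pi.single .H (-1)
  | .x12, .x11 => Pi.single .E (-2)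
  | .x11, .x12 => Pi.single .E 2
  | .x21, .x22 => Pi.single .F (-2)
  | .x22, .x21 => Pi.single .F 2
  | _, _ => 0

/-- The coefficients of `∂` in the `λ`-brackets. -/
def cb : K4 → K4 → K4 → ℂ
  | .L, i => Pi.single i 1
  | .x11, .L => Pi.single .x11 (1 / 2)
  | .x12, .L => Pi.single .x12 (1 / 2)
  | .x21, .L => Pi.single .x21 (1 / 2)
  | .x22, .L => Pi.single .x22 (1 / 2)
  | i, j => co i j

/-- The conformal weights. -/
def wt : K4 → ℂ
  | .L => 2
  | .E | .H | .F => 1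
  | .x11 | .x12 | .x21 | .x22 => 3 / 2

/-- The coefficients of `λ` in the `λ`-brackets. -/
def cc : K4 → K4 → K4 → ℂ
  | .L, i => Pi.single i (wt i)
  | i, .L => Pi.single i (wt i)
  | i, j => 2 * co i j

/-- The `λ`-brackets of the matrix model. -/
def table : AffTable K4 where
  par := par
  T i j k := cst (ca i j k) + cst (cb i j k) * dd + cst (cc i j k) * lam
  a := ca
  b := cb
  c := cc
  T_eq _ _ _ := rfl

section

variable {S : Type} [CommRing S] [Algebra ℂ S] (u w : K4 → S)

/-- The vector with given coordinates. -/
def mk (l e h f p q r s : S) : K4 → S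
  | .L => l
  | .E => e
  | .H => h
  | .F => f
  | .x11 => p
  | .x12 => q
  | .x21 => r
  | .x22 => s

/-- The coefficient ring is arbitrary because the same formulas serve constant vectors and vectors
of functions of `t`. -/
theorem form_a : form table.a u w = mk
    ((2 : ℂ) • (u .x12 * w .x21 + u .x21 * w .x12 - u .x11 * w .x22 - u .x22 * w .x11))
    ((2 : ℂ) • (u .H * w .E - u .E * w .H))
    (u .E * w .F - u .F * w .E)
    ((2 : ℂ) • (u .F * w .H - u .H * w .F))
    (u .E * w .x21 - u .x21 * w .E + u .H * w .x11 - u .x11 * w .H)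
    (u .E * w .x22 - u .x22 * w .E + u .H * w .x12 - u .x12 * w .H)
    (u .F * w .x11 - u .x11 * w .F - u .H * w .x21 + u .x21 * w .H)
    (u .F * w .x12 - u .x12 * w .F - u .H * w .x22 + u .x22 * w .H) := by
  ext1 k
  simp only [form, table, sum_univ, ca]
  cases k <;> simp [mk] <;> algebra

theorem form_b : form table.b u w = mk
    (u .L * w .L)
    (u .L * w .E + (2 : ℂ) • (u .x11 * w .x12 - u .x12 * w .x11))
    (u .L * w .H + (u .x22 * w .x11 - u .x11 * w .x22 + u .x12 * w .x21 - u .x21 * w .x12))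
    (u .L * w .F + (2 : ℂ) • (u .x22 * w .x21 - u .x21 * w .x22))
    (u .L * w .x11 + (1 / 2 : ℂ) • (u .x11 * w .L))
    (u .L * w .x12 + (1 / 2 : ℂ) • (u .x12 * w .L))
    (u .L * w .x21 + (1 / 2 : ℂ) • (u .x21 * w .L))
    (u .L * w .x22 + (1 / 2 : ℂ) • (u .x22 * w .L)) := by
  ext1 k
  simp only [form, table, sum_univ, cb, co]
  cases k <;> simp [mk] <;> algebra

theorem form_c : form table.c u w = mk
    ((2 : ℂ) • (u .L * w .L))
    (u .L * w .E + u .E * w .L + (4 : ℂ) • (u .x11 * w .x12 - u .x12 * w .x11))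
    (u .L * w .H + u .H * w .L +
      (2 : ℂ) • (u .x22 * w .x11 - u .x11 * w .x22 + u .x12 * w .x21 - u .x21 * w .x12))
    (u .L * w .F + u .F * w .L + (4 : ℂ) • (u .x22 * w .x21 - u .x21 * w .x22))
    ((3 / 2 : ℂ) • (u .L * w .x11 + u .x11 * w .L))
    ((3 / 2 : ℂ) • (u .L * w .x12 + u .x12 * w .L))
    ((3 / 2 : ℂ) • (u .L * w .x21 + u .x21 * w .L))
    ((3 / 2 : ℂ) • (u .L * w .x22 + u .x22 * w .L)) := by
  ext1 k
  simp only [form, table, sum_univ, cc, co, wt]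
  cases k <;> simp [mk] <;> algebra

end

/-- Replaces a basis element by a vector with free coordinates, so that each axiom becomes a
polynomial identity for each parity pattern instead of a large number of numerical cases. -/
theorem exists_even (i : K4) (hi : par i = 0) :
    ∃ l e h f, (Pi.single i 1 : K4 → ℂ) = mk l e h f 0 0 0 0 := by
  refine ⟨(Pi.single i 1 : K4 → ℂ) .L, (Pi.single i 1 : K4 → ℂ) .E, (Pi.single i 1 : K4 → ℂ) .H,
    (Pi.single i 1 : K4 → ℂ) .F, ?_⟩
  ext1 k
  cases i <;> cases k <;> first | rfl | (exact absurd hi (by decide))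

theorem exists_odd (i : K4) (hi : par i = 1) :
    ∃ p q r s, (Pi.single i 1 : K4 → ℂ) = mk 0 0 0 0 p q r s := by
  refine ⟨(Pi.single i 1 : K4 → ℂ) .x11, (Pi.single i 1 : K4 → ℂ) .x12,
    (Pi.single i 1 : K4 → ℂ) .x21, (Pi.single i 1 : K4 → ℂ) .x22, ?_⟩
  ext1 k
  cases i <;> cases k <;> first | rfl | (exact absurd hi (by decide))

theorem par_eq (i : K4) : par i = 0 ∨ par i = 1 := by cases i <;> decide

theorem skewCoeff_even (l e h f : ℂ) (w : K4 → ℂ) :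
    table.SkewCoeff 1 (mk l e h f 0 0 0 0) w := by
  constructor <;> simp only [form_a, form_b, form_c] <;> ext1 k <;> cases k <;> simp [mk] <;> ring

theorem skewCoeff_odd (p q r s p' q' r' s' : ℂ) :
    table.SkewCoeff (-1) (mk 0 0 0 0 p q r s) (mk 0 0 0 0 p' q' r' s') := by
  constructor <;> simp only [form_a, form_b, form_c] <;> ext1 k <;> cases k <;> simp [mk] <;> ring

set_option maxHeartbeats 1000000 in
theorem jacobiCoeff_even (l e h f : ℂ) (y z : K4 → ℂ) :
    table.JacobiCoeff 1 (mk l e h f 0 0 0 0) y z := by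
  constructor <;> simp only [form_a, form_b, form_c] <;> ext1 k <;> cases k <;>
    simp only [mk, Pi.add_apply, Pi.sub_apply, Pi.neg_apply, Pi.smul_apply, smul_eq_mul] <;> ring

set_option maxHeartbeats 1000000 in
theorem jacobiCoeff_odd_even (p q r s l e h f : ℂ) (z : K4 → ℂ) :
    table.JacobiCoeff 1 (mk 0 0 0 0 p q r s) (mk l e h f 0 0 0 0) z := by
  constructor <;> simp only [form_a, form_b, form_c] <;> ext1 k <;> cases k <;>
    simp only [mk, Pi.add_apply, Pi.sub_apply, Pi.neg_apply, Pi.smul_apply, smul_eq_mul] <;> ring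

set_option maxHeartbeats 1000000 in
theorem jacobiCoeff_odd_odd (p q r s p' q' r' s' : ℂ) (z : K4 → ℂ) :
    table.JacobiCoeff (-1) (mk 0 0 0 0 p q r s) (mk 0 0 0 0 p' q' r' s') z := by
  constructor <;> simp only [form_a, form_b, form_c] <;> ext1 k <;> cases k <;>
    simp only [mk, Pi.add_apply, Pi.sub_apply, Pi.neg_apply, Pi.smul_apply, smul_eq_mul] <;> ring

theorem isLie : table.conf.IsLie := by
  have k0 : ∀ j, koszul 0 j = 1 := fun j => if_neg (by simp)
  have k1 : koszul 1 0 = 1 := if_neg (by simp)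
  have k2 : koszul 1 1 = -1 := if_pos ⟨rfl, rfl⟩
  refine AffTable.isLie (fun i j k => ?_) (fun i j => ?_) (fun i j k => ?_)
  · change par k ≠ par i + par j → ca i j k = 0 ∧ cb i j k = 0 ∧ cc i j k = 0
    intro h
    cases i <;> cases j <;> cases k <;>
      first | exact absurd rfl h | simp [ca, cb, cc, co]
  · change table.SkewCoeff (koszul (par i) (par j)) _ _
    rcases par_eq i with hi | hi
    · obtain ⟨l, e, h, f, he⟩ := exists_even i hi
      rw [hi, k0, he]
      exact skewCoeff_even ..
    · obtain ⟨p, q, r, s, ho⟩ := exists_odd i hi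
      rcases par_eq j with hj | hj
      · obtain ⟨l, e, h, f, he⟩ := exists_even j hj
        rw [hi, hj, k1, ho, he]
        constructor <;> simp only [form_a, form_b, form_c] <;> ext1 k <;> cases k <;>
          simp [mk] <;> ring
      · obtain ⟨p', q', r', s', ho'⟩ := exists_odd j hj
        rw [hi, hj, k2, ho, ho']
        exact skewCoeff_odd ..
  · change table.JacobiCoeff (koszul (par i) (par j)) _ _ _
    rcases par_eq i with hi | hi
    · obtain ⟨l, e, h, f, he⟩ := exists_even i hi
      rw [hi, k0, he]
      exact jacobiCoeff_even ..
    · obtain ⟨p, q, r, s, ho⟩ := exists_odd i hi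
      rcases par_eq j with hj | hj
      · obtain ⟨l, e, h, f, he⟩ := exists_even j hj
        rw [hi, hj, k1, ho, he]
        exact jacobiCoeff_odd_even ..
      · obtain ⟨p', q', r', s', ho'⟩ := exists_odd j hj
        rw [hi, hj, k2, ho, ho']
        exact jacobiCoeff_odd_odd ..

end K4

/-! ## The table of the `N = 2` conformal superalgebra -/

namespace I2

/-- The coefficients of `1` in the `λ`-brackets. -/
def ca : I2 → I2 → I2 → ℂ
  | .J, .Gp => Pi.single .Gp 1
  | .J, .Gm => Pi.single .Gm (-1)
  | .Gp, .J => Pi.single .Gp (-1)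
  | .Gm, .J => Pi.single .Gm 1
  | .Gp, .Gm => Pi.single .L 1
  | .Gm, .Gp => Pi.single .L 1
  | _, _ => 0

/-- The coefficients of `∂` in the `λ`-brackets. -/
def cb : I2 → I2 → I2 → ℂ
  | .L, i => Pi.single i 1
  | .Gp, .L => Pi.single .Gp (1 / 2)
  | .Gm, .L => Pi.single .Gm (1 / 2)
  | .Gp, .Gm => Pi.single .J (1 / 2)
  | .Gm, .Gp => Pi.single .J (-(1 / 2))
  | _, _ => 0

/-- The conformal weights. -/
def wt : I2 → ℂ
  | .L => 2
  | .J => 1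
  | .Gp | .Gm => 3 / 2

/-- The coefficients of `λ` in the `λ`-brackets. -/
def cc : I2 → I2 → I2 → ℂ
  | .L, i => Pi.single i (wt i)
  | i, .L => Pi.single i (wt i)
  | .Gp, .Gm => Pi.single .J 1
  | .Gm, .Gp => Pi.single .J (-1)
  | _, _ => 0

/-- The `λ`-brackets of the `N = 2` conformal superalgebra. -/
def table : AffTable I2 where
  par := par2
  T := table2
  a := ca
  b := cb
  c := cc
  T_eq i j k := by
    have h1 : cst 1 = 1 := by simp [cst]
    have h0 : cst 0 = 0 := by simp [cst]
    have hn : cst (-1) = -1 := by simp [cst]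
    have h2 : cst 2 = 2 := by rw [cst, map_ofNat, map_ofNat]
    have hs : ∀ c x, cst c * x = c • x := fun c x => (Algebra.smul_def c x).symm
    cases i <;> cases j <;> cases k <;>
      simp [table2, ca, cb, cc, wt, h1, h0, hn, h2, hs, Pi.single_apply, smul_add, neg_smul]
    all_goals algebra

section

variable {S : Type} [CommRing S] [Algebra ℂ S] (u w : I2 → S)

/-- The vector with given coordinates. -/
def mk (l j p m : S) : I2 → S
  | .L => l
  | .J => j
  | .Gp => p
  | .Gm => m

theorem form_a : form table.a u w = mk
    (u .Gp * w .Gm + u .Gm * w .Gp)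
    0
    (u .J * w .Gp - u .Gp * w .J)
    (u .Gm * w .J - u .J * w .Gm) := by
  ext1 k
  simp only [form, table, sum_univ, ca]
  cases k <;> simp [mk] <;> algebra

theorem form_b : form table.b u w = mk
    (u .L * w .L)
    (u .L * w .J + (1 / 2 : ℂ) • (u .Gp * w .Gm - u .Gm * w .Gp))
    (u .L * w .Gp + (1 / 2 : ℂ) • (u .Gp * w .L))
    (u .L * w .Gm + (1 / 2 : ℂ) • (u .Gm * w .L)) := by
  ext1 k
  simp only [form, table, sum_univ, cb]
  cases k <;> simp [mk] <;> algebra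

theorem form_c : form table.c u w = mk
    ((2 : ℂ) • (u .L * w .L))
    (u .L * w .J + u .J * w .L + (u .Gp * w .Gm - u .Gm * w .Gp))
    ((3 / 2 : ℂ) • (u .L * w .Gp + u .Gp * w .L))
    ((3 / 2 : ℂ) • (u .L * w .Gm + u .Gm * w .L)) := by
  ext1 k
  simp only [form, table, sum_univ, cc, wt]
  cases k <;> simp [mk] <;> algebra

end

theorem exists_even (i : I2) (hi : par2 i = 0) :
    ∃ l j, (Pi.single i 1 : I2 → ℂ) = mk l j 0 0 := by
  refine ⟨(Pi.single i 1 : I2 → ℂ) .L, (Pi.single i 1 : I2 → ℂ) .J, ?_⟩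
  ext1 k
  cases i <;> cases k <;> first | rfl | (exact absurd hi (by decide))

theorem exists_odd (i : I2) (hi : par2 i = 1) :
    ∃ p m, (Pi.single i 1 : I2 → ℂ) = mk 0 0 p m := by
  refine ⟨(Pi.single i 1 : I2 → ℂ) .Gp, (Pi.single i 1 : I2 → ℂ) .Gm, ?_⟩
  ext1 k
  cases i <;> cases k <;> first | rfl | (exact absurd hi (by decide))

theorem par_eq (i : I2) : par2 i = 0 ∨ par2 i = 1 := by cases i <;> decide

theorem jacobiCoeff_even (l j : ℂ) (y z : I2 → ℂ) : table.JacobiCoeff 1 (mk l j 0 0) y z := by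
  constructor <;> simp only [form_a, form_b, form_c] <;> ext1 k <;> cases k <;>
    simp only [mk, Pi.add_apply, Pi.sub_apply, Pi.neg_apply, Pi.smul_apply, smul_eq_mul] <;> ring

theorem jacobiCoeff_odd_even (p q l j : ℂ) (z : I2 → ℂ) :
    table.JacobiCoeff 1 (mk 0 0 p q) (mk l j 0 0) z := by
  constructor <;> simp only [form_a, form_b, form_c] <;> ext1 k <;> cases k <;>
    simp only [mk, Pi.add_apply, Pi.sub_apply, Pi.neg_apply, Pi.smul_apply, smul_eq_mul] <;> ring

theorem jacobiCoeff_odd_odd (p q p' q' : ℂ) (z : I2 → ℂ) :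
    table.JacobiCoeff (-1) (mk 0 0 p q) (mk 0 0 p' q') z := by
  constructor <;> simp only [form_a, form_b, form_c] <;> ext1 k <;> cases k <;>
    simp only [mk, Pi.add_apply, Pi.sub_apply, Pi.neg_apply, Pi.smul_apply, smul_eq_mul] <;> ring

theorem isLie : table.conf.IsLie := by
  have k0 : ∀ j, koszul 0 j = 1 := fun j => if_neg (by simp)
  have k1 : koszul 1 0 = 1 := if_neg (by simp)
  have k2 : koszul 1 1 = -1 := if_pos ⟨rfl, rfl⟩
  refine AffTable.isLie (fun i j k => ?_) (fun i j => ?_) (fun i j k => ?_)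
  · change par2 k ≠ par2 i + par2 j → ca i j k = 0 ∧ cb i j k = 0 ∧ cc i j k = 0
    intro h
    cases i <;> cases j <;> cases k <;>
      first | exact absurd rfl h | simp [ca, cb, cc]
  · change table.SkewCoeff (koszul (par2 i) (par2 j)) _ _
    rcases par_eq i with hi | hi
    · obtain ⟨l, e, he⟩ := exists_even i hi
      rw [hi, k0, he]
      constructor <;> simp only [form_a, form_b, form_c] <;> ext1 k <;> cases k <;>
        simp [mk] <;> ring
    · obtain ⟨p, q, ho⟩ := exists_odd i hi
      rcases par_eq j with hj | hj
      · obtain ⟨l, e, he⟩ := exists_even j hj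
        rw [hi, hj, k1, ho, he]
        constructor <;> simp only [form_a, form_b, form_c] <;> ext1 k <;> cases k <;>
          simp [mk] <;> ring
      · obtain ⟨p', q', ho'⟩ := exists_odd j hj
        rw [hi, hj, k2, ho, ho']
        constructor <;> simp only [form_a, form_b, form_c] <;> ext1 k <;> cases k <;>
          simp [mk] <;> ring
  · change table.JacobiCoeff (koszul (par2 i) (par2 j)) _ _ _
    rcases par_eq i with hi | hi
    · obtain ⟨l, e, he⟩ := exists_even i hi
      rw [hi, k0, he]
      exact jacobiCoeff_even ..
    · obtain ⟨p, q, ho⟩ := exists_odd i hi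
      rcases par_eq j with hj | hj
      · obtain ⟨l, e, he⟩ := exists_even j hj
        rw [hi, hj, k1, ho, he]
        exact jacobiCoeff_odd_even ..
      · obtain ⟨p', q', ho'⟩ := exists_odd j hj
        rw [hi, hj, k2, ho, ho']
        exact jacobiCoeff_odd_odd ..

end I2

/-! ## Homomorphisms from free conformal superalgebras -/

namespace AffTable

section Lift

variable {ι : Type} [Fintype ι] [DecidableEq ι] (t : AffTable ι) (C : ConfData)
  (g : ι → C.carrier)

/-- The `∂`-linear map that sends `v_i` to `g i`. -/
def lift : t.conf.carrier →ₗ[ℂ] C.carrier :=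
  (∑ i, (LinearMap.applyₗ (g i)) ∘ₗ (Polynomial.aeval C.der).toLinearMap ∘ₗ
    (LinearMap.proj i : (ι → ℂ[X]) →ₗ[ℂ] ℂ[X])) ∘ₗ t.crd

theorem lift_apply (x : t.conf.carrier) :
    t.lift C g x = ∑ i, Polynomial.aeval C.der (t.crd x i) (g i) := by
  simp [lift, LinearMap.sum_apply]

theorem lift_der (x : t.conf.carrier) : t.lift C g (t.conf.der x) = C.der (t.lift C g x) := by
  simp only [lift_apply, crd_der, map_sum, map_mul, Polynomial.aeval_X, Module.End.mul_apply]

theorem lift_vec (w : ι → ℂ) : t.lift C g (t.vec w) = ∑ i, w i • g i := by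
  rw [lift_apply]
  refine Finset.sum_congr rfl fun i _ => ?_
  rw [crd_vec, Polynomial.aeval_C, Module.algebraMap_end_apply]

theorem lift_gen (i : ι) : t.lift C g (t.gen i) = g i := by
  rw [← vec_single, lift_vec, Finset.sum_eq_single i]
  · simp
  · intro j _ hj; simp [hj]
  · simp

variable {C g}

/-- Sesquilinearity holds on both sides, so compatibility with products spreads from generators to
their derivatives and linear combinations, first in one argument and then in the other. -/
theorem lift_isConfHom (hC : IsSesqui C) (hder : ∀ i, ∀ a ∈ C.part i, C.der a ∈ C.part i)
    (hpar : ∀ i, g i ∈ C.part (t.par i))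
    (h : ∀ i j n, t.lift C g (t.conf.prod (t.gen i) (t.gen j) n) = C.prod (g i) (g j) n) :
    IsConfHom (A := t.conf) (t.lift C g) where
  map_part p x hx := by
    refine part_induction (motive := fun x => t.lift C g x ∈ C.part p) (by simp)
      (fun x y hx hy => ?_) (fun c x hx => ?_) (fun x hx => ?_) (fun i hi => ?_) hx
    · rw [map_add]; exact add_mem hx hy
    · rw [map_smul]; exact Submodule.smul_mem _ _ hx
    · rw [lift_der]; exact hder _ _ hx
    · rw [lift_gen, ← hi]; exact hpar i
  map_prod x y := by
    refine conf_induction (motive := fun x => ∀ n, t.lift C g (t.conf.prod x y n) =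
      C.prod (t.lift C g x) (t.lift C g y) n) (by simp) (fun x y hx hy n => ?_)
      (fun c x hx n => ?_) (fun x hx n => ?_) (fun i => ?_) x
    · simp only [map_add, LinearMap.add_apply, Finsupp.add_apply, hx, hy]
    · simp only [map_smul, LinearMap.smul_apply, Finsupp.smul_apply, hx]
    · rw [t.isSesqui.der_prod, lift_der, hC.der_prod, map_neg, map_smul, hx]
    · refine conf_induction (motive := fun y => ∀ n, t.lift C g (t.conf.prod (t.gen i) y n) =
        C.prod (t.lift C g (t.gen i)) (t.lift C g y) n) (by simp) (fun x y hx hy n => ?_)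
        (fun c x hx n => ?_) (fun x hx n => ?_) (fun j n => ?_) y
      · simp only [map_add, Finsupp.add_apply, hx, hy]
      · simp only [map_smul, Finsupp.smul_apply, hx]
      · rw [t.isSesqui.prod_der, lift_der, hC.prod_der, map_add, map_smul, lift_der, hx, hx]
      · rw [h, lift_gen, lift_gen]
  map_der := t.lift_der C g

end Lift

theorem vec_sum {ι κ : Type} [Fintype ι] [DecidableEq ι] (t : AffTable ι) (s : Finset κ)
    (f : κ → ι → ℂ) : t.vec (∑ i ∈ s, f i) = ∑ i ∈ s, t.vec (f i) :=
  map_sum (⟨⟨t.vec, t.vec_add⟩, t.vec_smul⟩ : (ι → ℂ) →ₗ[ℂ] t.conf.carrier) f s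

section Const

variable {ι κ : Type} [Fintype ι] [DecidableEq ι] [Fintype κ] [DecidableEq κ]
  {t : AffTable ι} {t' : AffTable κ}

/-- A linear map of the spaces of generators that respects the structure constants. -/
structure IsConstHom (t : AffTable ι) (t' : AffTable κ) (M : (ι → ℂ) →ₗ[ℂ] (κ → ℂ)) : Prop where
  par : ∀ i k, t'.par k ≠ t.par i → M (Pi.single i 1) k = 0
  ha : ∀ x y, form t'.a (M x) (M y) = M (form t.a x y)
  hb : ∀ x y, form t'.b (M x) (M y) = M (form t.b x y)
  hc : ∀ x y, form t'.c (M x) (M y) = M (form t.c x y)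

/-- The `∂`-linear extension of a linear map of the spaces of generators. -/
def constMap (t : AffTable ι) (t' : AffTable κ) (M : (ι → ℂ) →ₗ[ℂ] (κ → ℂ)) :
    t.conf.carrier →ₗ[ℂ] t'.conf.carrier :=
  t.lift t'.conf fun i => t'.vec (M (Pi.single i 1))

theorem constMap_vec (M : (ι → ℂ) →ₗ[ℂ] (κ → ℂ)) (w : ι → ℂ) :
    constMap t t' M (t.vec w) = t'.vec (M w) := by
  rw [constMap, lift_vec]
  conv_rhs => rw [LinearMap.pi_apply_eq_sum_univ M w, vec_sum]
  refine Finset.sum_congr rfl fun i _ => ?_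
  have : (fun j => if i = j then (1 : ℂ) else 0) = Pi.single i 1 := by
    ext j; simp [Pi.single_apply, eq_comm]
  rw [this, vec_smul]

theorem constMap_gen (M : (ι → ℂ) →ₗ[ℂ] (κ → ℂ)) (i : ι) :
    constMap t t' M (t.gen i) = t'.vec (M (Pi.single i 1)) := by
  rw [← vec_single, constMap_vec]

theorem constMap_der (M : (ι → ℂ) →ₗ[ℂ] (κ → ℂ)) (x : t.conf.carrier) :
    constMap t t' M (t.conf.der x) = t'.conf.der (constMap t t' M x) := lift_der ..

theorem der_mem_part (t : AffTable ι) (i : ZMod 2) (x : t.conf.carrier) (hx : x ∈ t.conf.part i) :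
    t.conf.der x ∈ t.conf.part i := by
  rw [mem_part] at hx ⊢
  intro k hk
  rw [crd_der, hx k hk, mul_zero]

theorem IsConstHom.isConfHom {M : (ι → ℂ) →ₗ[ℂ] (κ → ℂ)} (h : IsConstHom t t' M) :
    IsConfHom (A := t.conf) (B := t'.conf) (constMap t t' M) := by
  refine t.lift_isConfHom t'.isSesqui t'.der_mem_part (fun i => ?_) (fun i j n => ?_)
  · rw [mem_part]
    intro k hk
    rw [crd_vec, h.par i k hk, map_zero]
  · change constMap t t' M _ = _
    rw [← vec_single, ← vec_single]
    rcases n with _ | _ | n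
    · rw [prod_vec_zero, prod_vec_zero, h.ha, h.hb, map_add, constMap_der, constMap_vec,
        constMap_vec]
    · rw [zero_add, prod_vec_one, prod_vec_one, h.hc, constMap_vec]
    · rw [prod_vec_add_two, prod_vec_add_two, map_zero]

theorem conf_hom_ext {C : ConfData} {f g : t.conf.carrier →ₗ[ℂ] C.carrier}
    (hf : ∀ x, f (t.conf.der x) = C.der (f x)) (hg : ∀ x, g (t.conf.der x) = C.der (g x))
    (h : ∀ i, f (t.gen i) = g (t.gen i)) (x : t.conf.carrier) : f x = g x := by
  refine conf_induction (motive := fun x => f x = g x) (by simp) (fun x y hx hy => ?_)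
    (fun c x hx => ?_) (fun x hx => ?_) h x
  · rw [map_add, map_add, hx, hy]
  · rw [map_smul, map_smul, hx]
  · rw [hf, hg, hx]

theorem constMap_constMap {M : (ι → ℂ) →ₗ[ℂ] (κ → ℂ)} {M' : (κ → ℂ) →ₗ[ℂ] (ι → ℂ)}
    (h : ∀ w, M' (M w) = w) (x : t.conf.carrier) : constMap t' t M' (constMap t t' M x) = x := by
  refine conf_hom_ext (f := constMap t' t M' ∘ₗ constMap t t' M) (g := LinearMap.id)
    (fun x => ?_) (fun x => rfl) (fun i => ?_) x
  · simp [constMap_der]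
  · rw [LinearMap.comp_apply, constMap_gen, constMap_vec, h, vec_single, LinearMap.id_apply]

/-- Mutually inverse maps of generators that respect the structure constants give an
isomorphism. -/
theorem exists_equiv {M : (ι → ℂ) →ₗ[ℂ] (κ → ℂ)} {M' : (κ → ℂ) →ₗ[ℂ] (ι → ℂ)}
    (hM : IsConstHom t t' M) (h : ∀ w, M' (M w) = w) (h' : ∀ w, M (M' w) = w)
    (hpar : ∀ k i, t.par i ≠ t'.par k → M' (Pi.single k 1) i = 0) :
    ∃ e : t.conf.carrier ≃ₗ[ℂ] t'.conf.carrier, IsConfIso e ∧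
      ∀ w, e (t.vec w) = t'.vec (M w) := by
  have hM' : IsConstHom t' t M' := by
    refine ⟨hpar, fun x y => ?_, fun x y => ?_, fun x y => ?_⟩
    · rw [← h (form t.a _ _), ← hM.ha, h', h']
    · rw [← h (form t.b _ _), ← hM.hb, h', h']
    · rw [← h (form t.c _ _), ← hM.hc, h', h']
  refine ⟨LinearEquiv.ofLinearMap (constMap t t' M) (constMap t' t M') ?_ ?_,
    ⟨hM.isConfHom, hM'.isConfHom⟩, constMap_vec M⟩
  · exact LinearMap.ext fun x => constMap_constMap h' x
  · exact LinearMap.ext fun x => constMap_constMap h x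

end Const

end AffTable

/-! ## Base change of homomorphisms -/

theorem hat_map_isConfHom {A B : ConfData} {f : A.carrier →ₗ[ℂ] B.carrier} (hf : IsConfHom f) :
    IsConfHom (A := hat A) (B := hat B) (TensorProduct.map f LinearMap.id) where
  map_part i x hx := by
    refine hatPart_induction (motive := fun x => TensorProduct.map f LinearMap.id x ∈ hatPart B i)
      (by simp) (fun x y hx hy => by rw [map_add]; exact add_mem hx hy) (fun a ha g => ?_) hx
    exact tmul_mem_hatPart (hf.map_part i a ha) _
  map_prod (x : A.carrier ⊗[ℂ] SHat) (y : A.carrier ⊗[ℂ] SHat) n := by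
    induction x using TensorProduct.induction_on with
    | zero => simp
    | add x x' hx hx' => simp only [map_add, LinearMap.add_apply, Finsupp.add_apply, hx, hx']
    | tmul a u =>
      induction y using TensorProduct.induction_on with
      | zero => simp
      | add y y' hy hy' => simp only [map_add, Finsupp.add_apply, hy, hy']
      | tmul b v =>
        obtain ⟨N, hN⟩ := exists_bound (A.prod a b)
        change TensorProduct.map f LinearMap.id (hatProd A _ _ n) = hatProd B (f a ⊗ₜ u) (f b ⊗ₜ v) n
        rw [hatProd_tmul_range _ _ _ _ _ N hN, hatProd_tmul_range _ _ _ _ _ N fun k hk => by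
          rw [← hf.map_prod, hN k hk, map_zero], map_sum]
        refine Finset.sum_congr rfl fun j _ => ?_
        rw [TensorProduct.map_tmul, hf.map_prod]
        rfl
  map_der (x : A.carrier ⊗[ℂ] SHat) := by
    induction x using TensorProduct.induction_on with
    | zero => simp
    | add x x' hx hx' => simp only [map_add, hx, hx']
    | tmul a u => simp [hf.map_der]

/-- Isomorphic algebras with automorphisms have isomorphic twisted loop algebras. -/
theorem loop_iso_of_equiv (ξ : RootSystem) {A B : ConfData} {e : A.carrier ≃ₗ[ℂ] B.carrier}
    (he : IsConfIso e) {d : Twist A} {d' : Twist B} (h : ∀ a, e (d.σ.1 a) = d'.σ.1 (e a)) :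
    Iso (loop ξ d) (loop ξ d') := by
  refine loop_iso_of_hat _ _ (hat_map_isConfHom he.1) (hat_map_isConfHom he.2)
    (fun x => ?_) (fun x => ?_) (fun x => ?_)
  all_goals
    induction x using TensorProduct.induction_on with
    | zero => simp
    | add x x' hx hx' => simp only [map_add, hx, hx']
    | tmul a u => simp [twisted_tmul, h]

/-! ## Homomorphisms of base changes of free conformal superalgebras -/

theorem sm_der_hat {A : ConfData} (a : A.carrier) (f : SHat) :
    A.der a ⊗ₜ[ℂ] f = hatDer A (a ⊗ₜ f) - a ⊗ₜ deltaT f := by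
  rw [hatDer_tmul, add_sub_cancel_right]

namespace AffTable

variable {ι κ : Type} [Fintype ι] [DecidableEq ι] [Fintype κ] [DecidableEq κ]
  (t : AffTable ι) {t' : AffTable κ}

/-- The element `∑_i v_i ⊗ w_i`. -/
def vecS : (ι → SHat) →ₗ[ℂ] t.conf.carrier ⊗[ℂ] SHat :=
  ∑ i, (TensorProduct.mk ℂ t.conf.carrier SHat (t.gen i)) ∘ₗ LinearMap.proj i

theorem vecS_apply (w : ι → SHat) : t.vecS w = ∑ i, t.gen i ⊗ₜ[ℂ] w i := by
  simp [vecS, LinearMap.sum_apply]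

theorem vecS_single (i : ι) (f : SHat) : t.vecS (Pi.single i f) = t.gen i ⊗ₜ f := by
  rw [vecS_apply, Finset.sum_eq_single i]
  · simp
  · intro j _ hj; simp [hj]
  · simp

theorem vec_eq_sum (w : ι → ℂ) : t.vec w = ∑ i, w i • t.gen i := by
  conv_lhs => rw [← Finset.univ_sum_single w, vec_sum]
  refine Finset.sum_congr rfl fun i _ => ?_
  rw [← vec_single, ← vec_smul, ← Pi.single_smul, smul_eq_mul, mul_one]

theorem vec_tmul (w : ι → ℂ) (f : SHat) : t.vec w ⊗ₜ[ℂ] f = t.vecS fun k => w k • f := by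
  rw [vecS_apply, vec_eq_sum, TensorProduct.sum_tmul]
  refine Finset.sum_congr rfl fun i _ => ?_
  rw [TensorProduct.smul_tmul]

theorem sm_vecS (f : SHat) (w : ι → SHat) : sm f (t.vecS w) = t.vecS fun k => f * w k := by
  simp [vecS_apply, sm_tmul]

theorem form_single (s : ι → ι → ι → ℂ) (i j : ι) :
    form s (Pi.single i 1 : ι → ℂ) (Pi.single j 1) = s i j := by
  ext1 k
  simp [form, Pi.single_apply]

theorem form_apply_eq {S : Type} [CommRing S] [Algebra ℂ S] (s : ι → ι → ι → ℂ) (u w : ι → S) :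
    form s u w = ∑ i, ∑ j, fun k => s i j k • (u i * w j) := by
  ext1 k
  simp [form, Finset.sum_apply]

theorem hatProd_gen (i j : ι) (f g : SHat) (n : ℕ) :
    hatProd t.conf (t.gen i ⊗ₜ f) (t.gen j ⊗ₜ g) n =
      t.conf.prod (t.gen i) (t.gen j) n ⊗ₜ (f * g) +
        t.conf.prod (t.gen i) (t.gen j) (n + 1) ⊗ₜ (deltaT f * g) := by
  rw [hatProd_tmul_range _ _ _ _ n 2, Finset.sum_range_succ, Finset.sum_range_one]
  · rw [dpow_zero, dpow_succ, dpow_zero]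
    simp
  · intro k hk
    obtain ⟨m, rfl⟩ := Nat.exists_eq_add_of_le' hk
    rw [← vec_single, ← vec_single, prod_vec_add_two]

theorem hatProd_vecS (u w : ι → SHat) (n : ℕ) : hatProd t.conf (t.vecS u) (t.vecS w) n =
    ∑ i, ∑ j, hatProd t.conf (t.gen i ⊗ₜ u i) (t.gen j ⊗ₜ w j) n := by
  simp only [vecS_apply, map_sum, LinearMap.sum_apply, Finsupp.finsetSum_apply]
  exact Finset.sum_comm

/-- Two corrections appear beside the constant brackets. The Taylor term of the 1-product
differentiates the left coefficients; and ∂ ⊗ 1 is the derivation of the base change minus d/dt,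
which differentiates the coefficients of the result. -/
theorem hatProd_vecS_zero (u w : ι → SHat) : hatProd t.conf (t.vecS u) (t.vecS w) 0 =
    t.vecS (form t.a u w + form t.c (fun i => deltaT (u i)) w -
      fun k => deltaT (form t.b u w k)) + hatDer t.conf (t.vecS (form t.b u w)) := by
  have hδ : (fun k => deltaT (form t.b u w k)) =
      ∑ i, ∑ j, fun k => t.b i j k • deltaT (u i * w j) := by
    ext1 k
    simp [form, Finset.sum_apply]
  rw [hatProd_vecS, hδ, form_apply_eq t.a, form_apply_eq t.b, form_apply_eq t.c]
  simp only [map_add, map_sub, map_sum]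
  simp only [← Finset.sum_add_distrib, ← Finset.sum_sub_distrib]
  refine Finset.sum_congr rfl fun i _ => Finset.sum_congr rfl fun j _ => ?_
  rw [hatProd_gen, ← vec_single, ← vec_single, prod_vec_zero, zero_add, prod_vec_one,
    form_single, form_single, form_single, TensorProduct.add_tmul, sm_der_hat, vec_tmul, vec_tmul,
    vec_tmul, vec_tmul]
  abel

theorem hatProd_vecS_one (u w : ι → SHat) : hatProd t.conf (t.vecS u) (t.vecS w) 1 =
    t.vecS (form t.c u w) := by
  rw [hatProd_vecS, form_apply_eq t.c]
  simp only [map_sum]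
  refine Finset.sum_congr rfl fun i _ => Finset.sum_congr rfl fun j _ => ?_
  rw [hatProd_gen, ← vec_single, ← vec_single, prod_vec_one, prod_vec_add_two,
    form_single, vec_tmul, TensorProduct.zero_tmul, add_zero]

theorem hatProd_vecS_add_two (u w : ι → SHat) (n : ℕ) :
    hatProd t.conf (t.vecS u) (t.vecS w) (n + 2) = 0 := by
  rw [hatProd_vecS]
  refine Finset.sum_eq_zero fun i _ => Finset.sum_eq_zero fun j _ => ?_
  rw [hatProd_gen, ← vec_single, ← vec_single, prod_vec_add_two, prod_vec_add_two]
  simp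

variable {t}

theorem hat_induction {motive : t.conf.carrier ⊗[ℂ] SHat → Prop} (h0 : motive 0)
    (hadd : ∀ x y, motive x → motive y → motive (x + y))
    (hsm : ∀ f x, motive x → motive (sm f x))
    (hder : ∀ x, motive x → motive (hatDer t.conf x))
    (hgen : ∀ i, motive (t.gen i ⊗ₜ 1)) (x : t.conf.carrier ⊗[ℂ] SHat) : motive x := by
  induction x using TensorProduct.induction_on with
  | zero => exact h0
  | add x y hx hy => exact hadd _ _ hx hy
  | tmul a f =>
    rw [tmul_eq_sm]
    apply hsm
    refine conf_induction (motive := fun a => motive (a ⊗ₜ 1)) (by simpa using h0)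
      (fun x y hx hy => ?_) (fun c x hx => ?_) (fun x hx => ?_) hgen a
    · rw [TensorProduct.add_tmul]; exact hadd _ _ hx hy
    · have := hsm (c • 1) _ hx
      rwa [sm_tmul, smul_mul_assoc, one_mul, ← TensorProduct.smul_tmul] at this
    · have := hder _ hx
      rwa [hatDer_tmul, deltaT_one, TensorProduct.tmul_zero, add_zero] at this

variable (t t') in
/-- The conditions on images `U(v_i)` of generators to define a homomorphism of base changes. -/
structure IsLoopHom (U : (ι → ℂ) →ₗ[ℂ] (κ → SHat)) : Prop where
  par : ∀ i k, t'.par k ≠ t.par i → U (Pi.single i 1) k = 0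
  ha : ∀ x y, form t'.a (U x) (U y) + form t'.c (fun i => deltaT (U x i)) (U y) -
    (fun k => deltaT (form t'.b (U x) (U y) k)) = U (form t.a x y)
  hb : ∀ x y, form t'.b (U x) (U y) = U (form t.b x y)
  hc : ∀ x y, form t'.c (U x) (U y) = U (form t.c x y)

variable (t t') in
/-- The extension of `U`, linear over `ℂ[t^q]` and compatible with the derivations. -/
def loopMap (U : (ι → ℂ) →ₗ[ℂ] (κ → SHat)) :
    t.conf.carrier ⊗[ℂ] SHat →ₗ[ℂ] t'.conf.carrier ⊗[ℂ] SHat :=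
  TensorProduct.lift (sm.flip ∘ₗ t.lift (hat t'.conf) fun i => t'.vecS (U (Pi.single i 1)))

theorem loopMap_tmul (U : (ι → ℂ) →ₗ[ℂ] (κ → SHat)) (a : t.conf.carrier) (f : SHat) :
    loopMap t t' U (a ⊗ₜ f) =
      sm f (t.lift (hat t'.conf) (fun i => t'.vecS (U (Pi.single i 1))) a) := rfl

theorem loopMap_sm (U : (ι → ℂ) →ₗ[ℂ] (κ → SHat)) (f : SHat) (x : t.conf.carrier ⊗[ℂ] SHat) :
    loopMap t t' U (sm f x) = sm f (loopMap t t' U x) := by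
  induction x using TensorProduct.induction_on with
  | zero => simp
  | add x y hx hy => simp only [map_add, hx, hy]
  | tmul a g => rw [sm_tmul, loopMap_tmul, loopMap_tmul, sm_sm]

theorem loopMap_der (U : (ι → ℂ) →ₗ[ℂ] (κ → SHat)) (x : t.conf.carrier ⊗[ℂ] SHat) :
    loopMap t t' U (hatDer t.conf x) = hatDer t'.conf (loopMap t t' U x) := by
  induction x using TensorProduct.induction_on with
  | zero => simp
  | add x y hx hy => simp only [map_add, hx, hy]
  | tmul a g =>
    rw [hatDer_tmul, map_add, loopMap_tmul, loopMap_tmul, loopMap_tmul, hatDer_sm, lift_der,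
      add_comm]

theorem loopMap_gen (U : (ι → ℂ) →ₗ[ℂ] (κ → SHat)) (i : ι) (f : SHat) :
    loopMap t t' U (t.gen i ⊗ₜ f) = sm f (t'.vecS (U (Pi.single i 1))) := by
  rw [loopMap_tmul, lift_gen]

theorem loopMap_vecS (U : (ι → ℂ) →ₗ[ℂ] (κ → SHat)) (w : ι → SHat) :
    loopMap t t' U (t.vecS w) = t'.vecS (∑ i, fun k => w i * U (Pi.single i 1) k) := by
  rw [vecS_apply, map_sum, map_sum]
  refine Finset.sum_congr rfl fun i _ => ?_
  rw [loopMap_gen, sm_vecS]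

theorem lift_vec_vecS (U : (ι → ℂ) →ₗ[ℂ] (κ → SHat)) (w : ι → ℂ) :
    t.lift (hat t'.conf) (fun i => t'.vecS (U (Pi.single i 1))) (t.vec w) = t'.vecS (U w) := by
  rw [lift_vec]
  conv_rhs => rw [LinearMap.pi_apply_eq_sum_univ U w, map_sum]
  refine Finset.sum_congr rfl fun i _ => ?_
  have : (fun j => if i = j then (1 : ℂ) else 0) = Pi.single i 1 := by
    ext j; simp [Pi.single_apply, eq_comm]
  rw [this, map_smul]

theorem vecS_mem_hatPart {w : ι → SHat} {p : ZMod 2} (h : ∀ k, t.par k ≠ p → w k = 0) :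
    t.vecS w ∈ hatPart t.conf p := by
  rw [vecS_apply]
  refine Submodule.sum_mem _ fun i _ => ?_
  by_cases hi : t.par i = p
  · exact tmul_mem_hatPart (hi ▸ t.gen_mem_part i) _
  · rw [h i hi, TensorProduct.tmul_zero]; exact zero_mem _

theorem sm_mem_hatPart {A : ConfData} {p : ZMod 2} {x : A.carrier ⊗[ℂ] SHat}
    (hx : x ∈ hatPart A p) (f : SHat) : sm f x ∈ hatPart A p := by
  refine hatPart_induction (motive := fun x => sm f x ∈ hatPart A p) (by simp)
    (fun x y hx hy => by rw [map_add]; exact add_mem hx hy) (fun a ha g => ?_) hx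
  exact tmul_mem_hatPart ha _

/-- The conditions make the ∂-linear extension of `U` a homomorphism from the algebra itself into
the target base change. Extension of scalars keeps it one, since both sides expand with the same
Taylor coefficients. -/
theorem IsLoopHom.isConfHom (hLie : t'.conf.IsLie) {U : (ι → ℂ) →ₗ[ℂ] (κ → SHat)}
    (h : IsLoopHom t t' U) :
    IsConfHom (A := hat t.conf) (B := hat t'.conf) (loopMap t t' U) := by
  have hθ : IsConfHom (A := t.conf) (B := hat t'.conf)
      (t.lift (hat t'.conf) fun i => t'.vecS (U (Pi.single i 1))) := by
    refine t.lift_isConfHom (hat_isLie hLie).isSesqui (hat_isLie hLie).der_mem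
      (fun i => vecS_mem_hatPart (h.par i)) (fun i j n => ?_)
    change _ = hatProd t'.conf _ _ n
    rcases n with _ | _ | n
    · rw [hatProd_vecS_zero, h.ha, h.hb, ← vec_single, ← vec_single, prod_vec_zero, map_add,
        lift_der, lift_vec_vecS, lift_vec_vecS]
    · rw [zero_add, hatProd_vecS_one, h.hc, ← vec_single, ← vec_single, prod_vec_one,
        lift_vec_vecS]
    · rw [hatProd_vecS_add_two, ← vec_single, ← vec_single, prod_vec_add_two, map_zero]
  refine ⟨fun p x hx => ?_, fun (x : t.conf.carrier ⊗[ℂ] SHat) (y : t.conf.carrier ⊗[ℂ] SHat) n => ?_,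
    loopMap_der U⟩
  · refine hatPart_induction (motive := fun x => loopMap t t' U x ∈ hatPart t'.conf p) (by simp)
      (fun x y hx hy => by rw [map_add]; exact add_mem hx hy) (fun a ha g => ?_) hx
    exact sm_mem_hatPart (hθ.map_part p a ha) g
  · change loopMap t t' U (hatProd t.conf x y n) = hatProd t'.conf _ _ n
    induction x using TensorProduct.induction_on with
    | zero => simp
    | add x x' hx hx' => simp only [map_add, LinearMap.add_apply, Finsupp.add_apply, hx, hx']
    | tmul a f =>
      induction y using TensorProduct.induction_on with
      | zero => simp
      | add y y' hy hy' => simp only [map_add, Finsupp.add_apply, hy, hy']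
      | tmul b g =>
        have hb : ∀ k, hatProd t'.conf
            (t.lift (hat t'.conf) (fun i => t'.vecS (U (Pi.single i 1))) a)
            (t.lift (hat t'.conf) (fun i => t'.vecS (U (Pi.single i 1))) b) k =
            t.lift (hat t'.conf) (fun i => t'.vecS (U (Pi.single i 1))) (t.conf.prod a b k) :=
          fun k => (hθ.map_prod a b k).symm
        obtain ⟨N, hN⟩ := exists_bound (t.conf.prod a b)
        rw [loopMap_tmul, loopMap_tmul, hatProd_sm_right, hatProd_sm_left,
          opSum_eq_sum_range _ _ N _ fun k hk => by rw [hb, hN k hk, map_zero],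
          hatProd_tmul_range _ _ _ _ _ N hN, map_sum, map_sum]
        refine Finset.sum_congr rfl fun j _ => ?_
        rw [loopMap_tmul, hb, sm_sm, mul_comm]

theorem loopMap_loopMap {U : (ι → ℂ) →ₗ[ℂ] (κ → SHat)} {V : (κ → ℂ) →ₗ[ℂ] (ι → SHat)}
    (h : ∀ i, ∑ k, (fun j => U (Pi.single i 1) k * V (Pi.single k 1) j) = Pi.single i 1)
    (x : t.conf.carrier ⊗[ℂ] SHat) : loopMap t' t V (loopMap t t' U x) = x := by
  refine hat_induction (motive := fun x => loopMap t' t V (loopMap t t' U x) = x) (by simp)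
    (fun x y hx hy => ?_) (fun f x hx => ?_) (fun x hx => ?_) (fun i => ?_) x
  · rw [map_add, map_add, hx, hy]
  · rw [loopMap_sm, loopMap_sm, hx]
  · rw [loopMap_der, loopMap_der, hx]
  · rw [loopMap_gen, sm_one, loopMap_vecS, h, vecS_single]

theorem twisted_sm (ξ : RootSystem) {A : ConfData} (d : Twist A) (f : SHat)
    (x : A.carrier ⊗[ℂ] SHat) : twisted ξ d (sm f x) = sm (galois ξ f) (twisted ξ d x) := by
  induction x using TensorProduct.induction_on with
  | zero => simp
  | add x y hx hy => simp only [map_add, hx, hy]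
  | tmul a g => rw [sm_tmul, twisted_tmul, twisted_tmul, sm_tmul, map_mul]

theorem twisted_der (ξ : RootSystem) {A : ConfData} (d : Twist A)
    (x : A.carrier ⊗[ℂ] SHat) : twisted ξ d (hatDer A x) = hatDer A (twisted ξ d x) := by
  induction x using TensorProduct.induction_on with
  | zero => simp
  | add x y hx hy => simp only [map_add, hx, hy]
  | tmul a g =>
    have := d.σ.2.1.map_der a
    simp only [LinearEquiv.coe_coe] at this
    rw [hatDer_tmul, map_add, twisted_tmul, twisted_tmul, twisted_tmul, hatDer_tmul, galois_deltaT,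
      this]

/-- Twisted loop algebras that are related by a gauge transformation are isomorphic. -/
theorem loop_iso_of_loopHom (ξ : RootSystem) (hLie : t.conf.IsLie) {d e : Twist t.conf}
    {U V : (ι → ℂ) →ₗ[ℂ] (ι → SHat)} (hU : IsLoopHom t t U) (hV : IsLoopHom t t V)
    (h₁ : ∀ i, ∑ k, (fun j => U (Pi.single i 1) k * V (Pi.single k 1) j) = Pi.single i 1)
    (h₂ : ∀ i, ∑ k, (fun j => V (Pi.single i 1) k * U (Pi.single k 1) j) = Pi.single i 1)
    (h : ∀ i, loopMap t t U (d.σ.1 (t.gen i) ⊗ₜ 1) = twisted ξ e (t.vecS (U (Pi.single i 1)))) :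
    Iso (loop ξ d) (loop ξ e) := by
  refine loop_iso_of_hat _ _ (hU.isConfHom hLie) (hV.isConfHom hLie) (loopMap_loopMap h₁)
    (loopMap_loopMap h₂) fun x => ?_
  refine hat_induction (motive := fun x => loopMap t t U (twisted ξ d x) =
    twisted ξ e (loopMap t t U x)) (by simp) (fun x y hx hy => ?_) (fun f x hx => ?_)
    (fun x hx => ?_) (fun i => ?_) x
  · simp only [map_add, hx, hy]
  · rw [twisted_sm, loopMap_sm, hx, loopMap_sm, twisted_sm]
  · rw [twisted_der, loopMap_der, hx, loopMap_der, twisted_der]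
  · rw [twisted_tmul, map_one, h, loopMap_gen, sm_one]

end AffTable

/-! ## Universal central extensions -/

section CentralExt

variable {B F : ConfData} {μ : F.carrier →ₗ[ℂ] B.carrier}

theorem ConfData.IsLie.prod_eq_zero_of_mem_centre (h : F.IsLie) {x y : F.carrier} {i j : ZMod 2}
    (hx : x ∈ F.part i) (hy : y ∈ F.part j) (hz : F.prod x y = 0) : F.prod y x = 0 := by
  have := h.skewAt hy hx
  rw [SkewAt, hz] at this
  simpa using this

theorem exists_hom_parts (h : F.IsLie) (x : F.carrier) :
    ∃ a ∈ F.part 0, ∃ b ∈ F.part 1, a + b = x := exists_parts h.isCompl x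

theorem IsCentralExt.ker_parts (h : IsCentralExt B F μ) (hB : B.IsLie) {a b : F.carrier}
    (ha : a ∈ F.part 0) (hb : b ∈ F.part 1) (hab : μ (a + b) = 0) : μ a = 0 ∧ μ b = 0 := by
  rw [map_add] at hab
  have h1 : μ a = 0 := by
    refine Submodule.disjoint_def.mp hB.isCompl.disjoint _ (h.isHom.map_part 0 a ha) ?_
    rw [eq_neg_of_add_eq_zero_left hab]
    exact Submodule.neg_mem _ (h.isHom.map_part 1 b hb)
  refine ⟨h1, ?_⟩
  rwa [h1, zero_add] at hab

theorem IsCentralExt.prod_left (h : IsCentralExt B F μ) {z : F.carrier} (hz : μ z = 0)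
    (y : F.carrier) : F.prod z y = 0 := by
  have h0 : F.prod z = 0 := h.ker_le hz
  rw [h0, LinearMap.zero_apply]

/-- Centrality is required on the left only. The kernel is graded, because even and odd part of an
element of the kernel have images in complementary parts, and skew-symmetry then moves its
components to the right. -/
theorem IsCentralExt.prod_right (h : IsCentralExt B F μ) (hB : B.IsLie) {z : F.carrier}
    (hz : μ z = 0) (y : F.carrier) : F.prod y z = 0 := by
  obtain ⟨a, ha, b, hb, rfl⟩ := exists_hom_parts h.isLie z
  obtain ⟨c, hc, d, hd, rfl⟩ := exists_hom_parts h.isLie y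
  obtain ⟨h1, h2⟩ := h.ker_parts hB ha hb hz
  have k1 := h.prod_left h1
  have k2 := h.prod_left h2
  simp only [map_add, LinearMap.add_apply,
    h.isLie.prod_eq_zero_of_mem_centre ha hc (k1 c), h.isLie.prod_eq_zero_of_mem_centre ha hd (k1 d),
    h.isLie.prod_eq_zero_of_mem_centre hb hc (k2 c), h.isLie.prod_eq_zero_of_mem_centre hb hd (k2 d),
    add_zero]

/-- In a central extension, products depend only on the images in the base. -/
theorem IsCentralExt.prod_congr (h : IsCentralExt B F μ) (hB : B.IsLie) {x x' y y' : F.carrier}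
    (hx : μ x = μ x') (hy : μ y = μ y') : F.prod x y = F.prod x' y' := by
  have h1 := h.prod_left (z := x - x') (by rw [map_sub, hx, sub_self]) y
  have h2 := h.prod_right hB (z := y - y') (by rw [map_sub, hy, sub_self]) x'
  rw [map_sub, LinearMap.sub_apply, sub_eq_zero] at h1
  rw [map_sub, sub_eq_zero] at h2
  rw [h1, h2]

theorem IsCentralExt.exists_lift_mem (h : IsCentralExt B F μ) (hB : B.IsLie) {i : ZMod 2}
    {b : B.carrier} (hb : b ∈ B.part i) : ∃ x ∈ F.part i, μ x = b := by
  obtain ⟨x, rfl⟩ := h.surjective b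
  obtain ⟨c, hc, d, hd, rfl⟩ := exists_hom_parts h.isLie x
  have hc' := h.isHom.map_part 0 c hc
  have hd' := h.isHom.map_part 1 d hd
  have hi : i = 0 ∨ i = 1 := by clear hb; revert i; decide
  rw [map_add] at hb ⊢
  rcases hi with rfl | rfl
  · refine ⟨c, hc, ?_⟩
    have : μ d ∈ B.part 0 := by
      have := sub_mem hb hc'
      rwa [add_sub_cancel_left] at this
    rw [Submodule.disjoint_def.mp hB.isCompl.disjoint _ this hd', add_zero]
  · refine ⟨d, hd, ?_⟩
    have : μ c ∈ B.part 1 := by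
      have := sub_mem hb hd'
      rwa [add_sub_cancel_right] at this
    rw [Submodule.disjoint_def.mp hB.isCompl.disjoint _ hc' this, zero_add]

/-- The Jacobi identity for an even first element. -/
theorem ConfData.IsLie.jacobiAt_even (h : F.IsLie) {a : F.carrier} (ha : a ∈ F.part 0)
    (b c : F.carrier) : JacobiAt F 1 a b c := by
  obtain ⟨b₀, hb₀, b₁, hb₁, rfl⟩ := exists_hom_parts h b
  have h0 := h.jacobiAt ha hb₀ c
  have h1 := h.jacobiAt ha hb₁ c
  have k0 : ∀ j, koszul 0 j = 1 := fun j => if_neg (by simp)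
  rw [k0] at h0 h1
  exact h0.add_middle h1

end CentralExt

/-- `B` is spanned by products. -/
def IsPerfect (B : ConfData) : Prop :=
  Submodule.span ℂ {x | ∃ a b n, x = B.prod a b n} = ⊤

/-- Products of lifts of `a` and `b` vanish from degree `N` on, in all central extensions. -/
def LocalAt (B : ConfData) (N : ℕ) (a b : B.carrier) : Prop :=
  ∀ (F : ConfData) (μ : F.carrier →ₗ[ℂ] B.carrier), IsCentralExt B F μ →
    ∀ x y, μ x = a → μ y = b → ∀ n, N ≤ n → F.prod x y n = 0

/-! ### Construction of the universal central extension -/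

namespace UCE

/-- A central extension of `B`. -/
structure Ext (B : ConfData) where
  F : ConfData
  μ : F.carrier →ₗ[ℂ] B.carrier
  isExt : IsCentralExt B F μ

variable {B : ConfData}

/-- A linear section of a central extension. -/
def Ext.sec (X : Ext B) : B.carrier →ₗ[ℂ] X.F.carrier :=
  (X.μ.exists_rightInverse_of_surjective (LinearMap.range_eq_top.mpr X.isExt.surjective)).choose

theorem Ext.μ_sec (X : Ext B) (b : B.carrier) : X.μ (X.sec b) = b :=
  LinearMap.congr_fun (X.μ.exists_rightInverse_of_surjective
    (LinearMap.range_eq_top.mpr X.isExt.surjective)).choose_spec b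

/-- The trivial central extension. -/
def Ext.triv (hB : B.IsLie) : Ext B :=
  ⟨B, LinearMap.id, hB, IsConfHom.id B, Function.surjective_id, by simp⟩

/-- The evaluation of formal products in a central extension. -/
def Ext.ev (X : Ext B) : (ℕ →₀ B.carrier ⊗[ℂ] B.carrier) →ₗ[ℂ] X.F.carrier :=
  Finsupp.lsum ℂ fun n => TensorProduct.lift
    ((X.F.prod.compl₁₂ X.sec X.sec).compr₂ (Finsupp.lapply n))

theorem Ext.ev_single (X : Ext B) (n : ℕ) (a b : B.carrier) :
    X.ev (Finsupp.single n (a ⊗ₜ b)) = X.F.prod (X.sec a) (X.sec b) n := by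
  simp [Ext.ev]

theorem Ext.ev_single_lift (X : Ext B) (hB : B.IsLie) (n : ℕ) (x y : X.F.carrier) :
    X.ev (Finsupp.single n (X.μ x ⊗ₜ X.μ y)) = X.F.prod x y n := by
  rw [X.ev_single, X.isExt.prod_congr hB (X.μ_sec _) (X.μ_sec _)]

variable (B) in
/-- The formal products that vanish in all central extensions. -/
def kernel : Submodule ℂ (ℕ →₀ B.carrier ⊗[ℂ] B.carrier) := ⨅ X : Ext B, LinearMap.ker X.ev

theorem kernel_le (X : Ext B) : kernel B ≤ LinearMap.ker X.ev := iInf_le _ X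

variable (B) in
/-- The underlying space of the universal central extension. -/
abbrev Space : Type := (ℕ →₀ B.carrier ⊗[ℂ] B.carrier) ⧸ kernel B

/-- The class of the formal product of `a` and `b` in degree `n`. -/
def br (a b : B.carrier) (n : ℕ) : Space B := (kernel B).mkQ (Finsupp.single n (a ⊗ₜ b))

theorem space_induction {motive : Space B → Prop} (h0 : motive 0)
    (hadd : ∀ x y, motive x → motive y → motive (x + y))
    (hbr : ∀ a b n, motive (br a b n)) (x : Space B) : motive x := by
  obtain ⟨x, rfl⟩ := (kernel B).mkQ_surjective x
  induction x using Finsupp.induction_linear with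
  | zero => simpa using h0
  | add x y hx hy => rw [map_add]; exact hadd _ _ hx hy
  | single n z =>
    induction z using TensorProduct.induction_on with
    | zero => simpa using h0
    | add x y hx hy => rw [Finsupp.single_add, map_add]; exact hadd _ _ hx hy
    | tmul a b => exact hbr a b n

/-- The morphism from the universal central extension. -/
def hom (X : Ext B) : Space B →ₗ[ℂ] X.F.carrier :=
  (kernel B).liftQ X.ev (kernel_le X)

theorem hom_br (X : Ext B) (a b : B.carrier) (n : ℕ) :
    hom X (br a b n) = X.F.prod (X.sec a) (X.sec b) n := by
  rw [hom, br, Submodule.mkQ_apply, Submodule.liftQ_apply, X.ev_single]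

theorem hom_br_lift (X : Ext B) (hB : B.IsLie) (x y : X.F.carrier) (n : ℕ) :
    hom X (br (X.μ x) (X.μ y) n) = X.F.prod x y n := by
  rw [hom, br, Submodule.mkQ_apply, Submodule.liftQ_apply, X.ev_single_lift hB]

/-- The maps to all central extensions are jointly injective by construction. Every identity in the
universal extension may thus be verified in each central extension separately. -/
theorem ext_hom {x y : Space B} (h : ∀ X : Ext B, hom X x = hom X y) : x = y := by
  obtain ⟨x, rfl⟩ := (kernel B).mkQ_surjective x
  obtain ⟨y, rfl⟩ := (kernel B).mkQ_surjective y
  rw [← sub_eq_zero, ← map_sub, Submodule.mkQ_apply, Submodule.Quotient.mk_eq_zero, kernel,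
    Submodule.mem_iInf]
  intro X
  have := h X
  rwa [hom, Submodule.mkQ_apply, Submodule.mkQ_apply, Submodule.liftQ_apply,
    Submodule.liftQ_apply, ← sub_eq_zero, ← map_sub] at this

/-- The derivation on formal products. -/
def preDer : (ℕ →₀ B.carrier ⊗[ℂ] B.carrier) →ₗ[ℂ] (ℕ →₀ B.carrier ⊗[ℂ] B.carrier) :=
  Finsupp.mapRange.linearMap
    (TensorProduct.map B.der LinearMap.id + TensorProduct.map LinearMap.id B.der)

theorem preDer_single (n : ℕ) (a b : B.carrier) :
    preDer (Finsupp.single n (a ⊗ₜ[ℂ] b)) =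
      Finsupp.single n (B.der a ⊗ₜ b) + Finsupp.single n (a ⊗ₜ B.der b) := by
  simp [preDer, ← Finsupp.single_add]

theorem ev_preDer (X : Ext B) (hB : B.IsLie) (x : ℕ →₀ B.carrier ⊗[ℂ] B.carrier) :
    X.ev (preDer x) = X.F.der (X.ev x) := by
  induction x using Finsupp.induction_linear with
  | zero => simp
  | add x y hx hy => simp only [map_add, hx, hy]
  | single n z =>
    induction z using TensorProduct.induction_on with
    | zero => simp
    | add x y hx hy => simp only [Finsupp.single_add, map_add, hx, hy]
    | tmul a b =>
      obtain ⟨x, rfl⟩ := X.isExt.surjective a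
      obtain ⟨y, rfl⟩ := X.isExt.surjective b
      rw [preDer_single, map_add, ← X.isExt.isHom.map_der, ← X.isExt.isHom.map_der,
        X.ev_single_lift hB, X.ev_single_lift hB, X.ev_single_lift hB, X.isExt.isLie.der_prod,
        X.isExt.isLie.prod_der]
      abel

/-- The derivation of the universal central extension. -/
def der (hB : B.IsLie) : Space B →ₗ[ℂ] Space B :=
  (kernel B).mapQ (kernel B) preDer fun x hx => by
    simp only [kernel, Submodule.mem_iInf, Submodule.mem_comap, LinearMap.mem_ker] at hx ⊢
    intro X
    rw [ev_preDer X hB, hx X, map_zero]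

theorem hom_der (X : Ext B) (hB : B.IsLie) (x : Space B) :
    hom X (der hB x) = X.F.der (hom X x) := by
  obtain ⟨x, rfl⟩ := (kernel B).mkQ_surjective x
  exact ev_preDer X hB x

/-- The projection of the universal central extension. -/
def proj (hB : B.IsLie) : Space B →ₗ[ℂ] B.carrier := hom (Ext.triv hB)

theorem proj_br (hB : B.IsLie) (a b : B.carrier) (n : ℕ) : proj hB (br a b n) = B.prod a b n :=
  hom_br_lift (Ext.triv hB) hB a b n

theorem μ_hom (X : Ext B) (hB : B.IsLie) (x : Space B) : X.μ (hom X x) = proj hB x := by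
  refine space_induction (motive := fun x => X.μ (hom X x) = proj hB x) (by simp)
    (fun x y hx hy => by simp only [map_add, hx, hy]) (fun a b n => ?_) x
  rw [hom_br, X.isExt.isHom.map_prod, X.μ_sec, X.μ_sec, proj_br]

section

variable (hB : B.IsLie) (hloc : ∀ a b : B.carrier, ∃ N, LocalAt B N a b)

-- A formal product is zero only if it vanishes in every central extension, so a bound for a single
-- extension would not suffice; this is why `LocalAt` quantifies over all of them.
include hloc in
theorem br_eq_zero (a b : B.carrier) : ∃ N, ∀ n, N ≤ n → br a b n = 0 := by
  obtain ⟨N, hN⟩ := hloc a b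
  refine ⟨N, fun n hn => ext_hom fun X => ?_⟩
  rw [hom_br, map_zero]
  exact hN X.F X.μ X.isExt _ _ (X.μ_sec a) (X.μ_sec b) n hn

/-- The sequence of formal products of `a` and `b`. -/
def brSeq : B.carrier →ₗ[ℂ] B.carrier →ₗ[ℂ] (ℕ →₀ Space B) :=
  LinearMap.mk₂ ℂ (fun a b => Finsupp.onFinset (Finset.range (br_eq_zero hloc a b).choose)
    (br a b) fun n hn => by
      by_contra h
      rw [Finset.mem_range, not_lt] at h
      exact hn ((br_eq_zero hloc a b).choose_spec n h))
    (by intros; ext n; simp [br, TensorProduct.add_tmul])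
    (by
      intros; ext n
      simp only [br, Finsupp.onFinset_apply, Finsupp.smul_apply, ← TensorProduct.smul_tmul',
        ← Finsupp.smul_single, map_smul])
    (by intros; ext n; simp [br, TensorProduct.tmul_add])
    (by
      intros; ext n
      simp only [br, Finsupp.onFinset_apply, Finsupp.smul_apply, TensorProduct.tmul_smul,
        ← Finsupp.smul_single, map_smul])

/-- The universal central extension. -/
abbrev conf : ConfData where
  carrier := Space B
  part i := ⨅ X : Ext B, (X.F.part i).comap (hom X)
  der := der hB
  prod := (brSeq hloc).compl₁₂ (proj hB) (proj hB)

theorem conf_prod (x y : Space B) (n : ℕ) :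
    (conf hB hloc).prod x y n = br (proj hB x) (proj hB y) n := rfl

theorem mem_conf_part (x : Space B) (i : ZMod 2) :
    x ∈ (conf hB hloc).part i ↔ ∀ X : Ext B, hom X x ∈ X.F.part i := by
  change x ∈ (⨅ X : Ext B, (X.F.part i).comap (hom X)) ↔ _
  simp only [Submodule.mem_iInf, Submodule.mem_comap]

theorem hom_prod (X : Ext B) (x y : Space B) (n : ℕ) :
    hom X ((conf hB hloc).prod x y n) = X.F.prod (hom X x) (hom X y) n := by
  rw [conf_prod, ← μ_hom X hB, ← μ_hom X hB, hom_br_lift X hB]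

theorem hom_isConfHom (X : Ext B) : IsConfHom (A := conf hB hloc) (hom X) where
  map_part i x hx := (mem_conf_part hB hloc x i).mp hx X
  map_prod := hom_prod hB hloc X
  map_der := hom_der X hB

theorem conf_isCompl : IsCompl ((conf hB hloc).part 0) ((conf hB hloc).part 1) := by
  refine ⟨Submodule.disjoint_def.mpr fun (x : Space B) h0 h1 => ext_hom fun X => ?_,
    codisjoint_iff.mpr (eq_top_iff.mpr fun (x : Space B) _ => ?_)⟩
  · rw [map_zero]
    exact Submodule.disjoint_def.mp X.isExt.isLie.isCompl.disjoint _
      ((mem_conf_part hB hloc x 0).mp h0 X) ((mem_conf_part hB hloc x 1).mp h1 X)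
  · have key : ∀ i j : ZMod 2, ∀ a ∈ B.part i, ∀ b ∈ B.part j, ∀ n,
        br a b n ∈ (conf hB hloc).part (i + j) := by
      intro i j a ha b hb n
      rw [mem_conf_part]
      intro X
      obtain ⟨x, hx, rfl⟩ := X.isExt.exists_lift_mem hB ha
      obtain ⟨y, hy, rfl⟩ := X.isExt.exists_lift_mem hB hb
      rw [hom_br_lift X hB]
      exact X.isExt.isLie.prod_mem i j x hx y hy n
    refine space_induction (motive := fun x : Space B =>
      x ∈ (conf hB hloc).part 0 ⊔ (conf hB hloc).part 1) (zero_mem _) (fun x y => add_mem)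
      (fun a b n => ?_) x
    obtain ⟨a₀, ha₀, a₁, ha₁, rfl⟩ := exists_hom_parts hB a
    obtain ⟨b₀, hb₀, b₁, hb₁, rfl⟩ := exists_hom_parts hB b
    have : br (a₀ + a₁) (b₀ + b₁) n =
        (br a₀ b₀ n + br a₁ b₁ n) + (br a₀ b₁ n + br a₁ b₀ n) := by
      simp only [br, TensorProduct.add_tmul, TensorProduct.tmul_add, Finsupp.single_add, map_add]
      abel
    rw [this]
    exact Submodule.add_mem_sup (add_mem (key 0 0 _ ha₀ _ hb₀ n) (key 1 1 _ ha₁ _ hb₁ n))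
      (add_mem (key 0 1 _ ha₀ _ hb₁ n) (key 1 0 _ ha₁ _ hb₀ n))

theorem conf_isLie : (conf hB hloc).IsLie where
  isCompl := conf_isCompl hB hloc
  der_mem i x hx := by
    rw [mem_conf_part] at hx ⊢
    intro X
    exact (hom_der X hB x).symm ▸ X.isExt.isLie.der_mem i _ (hx X)
  prod_mem i j x hx y hy n := by
    rw [mem_conf_part] at hx hy ⊢
    intro X
    exact (hom_prod hB hloc X x y n).symm ▸ X.isExt.isLie.prod_mem i j _ (hx X) _ (hy X) n
  der_prod x y n := ext_hom fun X => by
    have h := hom_isConfHom hB hloc X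
    rw [h.map_prod, h.map_der, X.isExt.isLie.der_prod, map_neg, map_smul, h.map_prod]
  prod_der x y n := ext_hom fun X => by
    have h := hom_isConfHom hB hloc X
    rw [h.map_prod, h.map_der, X.isExt.isLie.prod_der, map_add, map_smul, h.map_der, h.map_prod,
      h.map_prod]
  skew i j x hx y hy := by
    rw [← skewAt_iff]
    refine Finsupp.ext fun n => ext_hom fun X => ?_
    have h := hom_isConfHom hB hloc X
    exact SkewAt.map_eq (C := conf hB hloc) (hom X) h.map_prod h.map_der
      (X.isExt.isLie.skewAt (h.map_part i x hx) (h.map_part j y hy)) n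
  jacobi i j x hx y hy z m n := ext_hom fun X => by
    have h := hom_isConfHom hB hloc X
    exact JacobiAt.map_eq (C := conf hB hloc) (hom X) h.map_prod
      (X.isExt.isLie.jacobiAt (h.map_part i x hx) (h.map_part j y hy) _) m n

/-- Perfectness makes the projection onto `B` surjective, so each formal product is a genuine
product of two elements of the extension. Products in a central extension depend only on the images
in `B`, which leaves a morphism no choice on a spanning set. -/
theorem isUniversal (hperf : IsPerfect B) :
    IsUniversalCentralExt B (conf hB hloc) (proj hB) := by
  have hsurj : Function.Surjective (proj hB) := by
    rw [← LinearMap.range_eq_top, eq_top_iff, ← hperf, Submodule.span_le]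
    rintro _ ⟨a, b, n, rfl⟩
    exact ⟨br a b n, proj_br hB a b n⟩
  refine ⟨⟨conf_isLie hB hloc, hom_isConfHom hB hloc (Ext.triv hB), hsurj, fun x hx => ?_⟩,
    fun F μ h => ⟨hom ⟨F, μ, h⟩, ⟨hom_isConfHom hB hloc ⟨F, μ, h⟩, ?_⟩, ?_⟩⟩
  · have hx' : proj hB x = 0 := hx
    change (brSeq hloc).compl₁₂ (proj hB) (proj hB) x = 0
    refine LinearMap.ext fun y => ?_
    rw [LinearMap.compl₁₂_apply, hx', map_zero]
    rfl
  · exact LinearMap.ext fun x => μ_hom ⟨F, μ, h⟩ hB x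
  · rintro f ⟨hf, hμ⟩
    refine LinearMap.ext fun x => ?_
    refine space_induction (motive := fun x : Space B => f x = hom ⟨F, μ, h⟩ x) (by simp)
      (fun x y hx hy => ?_) (fun a b n => ?_) x
    · exact (map_add f x y).trans (by rw [hx, hy, map_add])
    · obtain ⟨x, rfl⟩ := hsurj a
      obtain ⟨y, rfl⟩ := hsurj b
      rw [← conf_prod hB hloc, hom_prod, hf.map_prod]
      refine DFunLike.congr_fun (h.prod_congr hB ?_ ?_) n
      · exact (LinearMap.congr_fun hμ x).trans (μ_hom ⟨F, μ, h⟩ hB x).symm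
      · exact (LinearMap.congr_fun hμ y).trans (μ_hom ⟨F, μ, h⟩ hB y).symm

end

end UCE

/-! ### Isomorphisms of universal central extensions -/

theorem IsUniversalCentralExt.hom_unique {B E : ConfData} {π : E.carrier →ₗ[ℂ] B.carrier}
    (h : IsUniversalCentralExt B E π) {f : E.carrier →ₗ[ℂ] E.carrier} (hf : IsConfHom f)
    (hπ : π ∘ₗ f = π) : f = LinearMap.id :=
  (h.2 E π h.1).unique ⟨hf, hπ⟩ ⟨IsConfHom.id E, rfl⟩

theorem IsCentralExt.comp_iso {B B' E : ConfData} {π : E.carrier →ₗ[ℂ] B.carrier}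
    (h : IsCentralExt B E π) {e : B.carrier ≃ₗ[ℂ] B'.carrier} (he : IsConfIso e) :
    IsCentralExt B' E ((e : B.carrier →ₗ[ℂ] B'.carrier) ∘ₗ π) where
  isLie := h.isLie
  isHom := he.1.comp h.isHom
  surjective := by
    rw [LinearMap.coe_comp]
    exact e.surjective.comp h.surjective
  ker_le x hx := h.ker_le (by
    rw [LinearMap.mem_ker, LinearMap.comp_apply] at hx
    exact e.map_eq_zero_iff.mp hx)

theorem iso_of_iso_base {B B' E E' : ConfData} {π : E.carrier →ₗ[ℂ] B.carrier}
    {π' : E'.carrier →ₗ[ℂ] B'.carrier} (h : IsUniversalCentralExt B E π)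
    (h' : IsUniversalCentralExt B' E' π') : Iso B B' → Iso E E' := by
  rintro ⟨e, he⟩
  obtain ⟨f, ⟨hf, hf'⟩, -⟩ := h.2 E' _ (h'.1.comp_iso (e := e.symm) ⟨he.2, he.1⟩)
  obtain ⟨g, ⟨hg, hg'⟩, -⟩ := h'.2 E _ (h.1.comp_iso he)
  have hf'' : ∀ x, e.symm (π' (f x)) = π x := LinearMap.congr_fun hf'
  have hg'' : ∀ x, e (π (g x)) = π' x := LinearMap.congr_fun hg'
  have h1 : g ∘ₗ f = LinearMap.id := h.hom_unique (hg.comp hf) (LinearMap.ext fun x => by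
    rw [LinearMap.comp_apply, LinearMap.comp_apply, ← hf'' x, ← hg'' (f x), e.symm_apply_apply])
  have h2 : f ∘ₗ g = LinearMap.id := h'.hom_unique (hf.comp hg) (LinearMap.ext fun x => by
    rw [LinearMap.comp_apply, LinearMap.comp_apply, ← hg'' x, ← hf'', e.apply_symm_apply])
  exact ⟨LinearEquiv.ofLinearMap f g h2 h1, hf, hg⟩

/-- A central element of `E` has a central image, which is zero. So the kernel can be read off from
`E` alone. -/
theorem IsCentralExt.ker_eq_centre {B E : ConfData} {π : E.carrier →ₗ[ℂ] B.carrier}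
    (h : IsCentralExt B E π) (hc : centre B = ⊥) : LinearMap.ker π = centre E := by
  refine le_antisymm h.ker_le fun x hx => ?_
  rw [LinearMap.mem_ker, ← Submodule.mem_bot ℂ, ← hc, centre, LinearMap.mem_ker]
  have hx' : E.prod x = 0 := hx
  refine LinearMap.ext fun b => Finsupp.ext fun n => ?_
  obtain ⟨y, rfl⟩ := h.surjective b
  rw [← h.isHom.map_prod, hx']
  simp

theorem centre_map_iso {E F : ConfData} {e : E.carrier ≃ₗ[ℂ] F.carrier} (he : IsConfIso e)
    {x : E.carrier} (hx : x ∈ centre E) : e x ∈ centre F := by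
  have hx' : E.prod x = 0 := hx
  change F.prod (e x) = 0
  refine LinearMap.ext fun b => Finsupp.ext fun n => ?_
  obtain ⟨y, rfl⟩ := e.surjective b
  have := he.1.map_prod x y n
  rw [hx'] at this
  simpa using this.symm

/-- An isomorphism preserves centres, which here are the kernels, and so descends to the quotients;
a linear section of π expresses the descended map. -/
theorem exists_hom_of_iso {B B' E E' : ConfData} {π : E.carrier →ₗ[ℂ] B.carrier}
    {π' : E'.carrier →ₗ[ℂ] B'.carrier} (h : IsCentralExt B E π) (h' : IsCentralExt B' E' π')
    (hB : B.IsLie) (hc : centre B = ⊥) (hc' : centre B' = ⊥)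
    {e : E.carrier ≃ₗ[ℂ] E'.carrier} (he : IsConfIso e) :
    ∃ f : B.carrier →ₗ[ℂ] B'.carrier, IsConfHom f ∧ ∀ x, f (π x) = π' (e x) := by
  obtain ⟨s, hs⟩ := π.exists_rightInverse_of_surjective (LinearMap.range_eq_top.mpr h.surjective)
  have hs' : ∀ b, π (s b) = b := LinearMap.congr_fun hs
  have key : ∀ x, π' (e (s (π x))) = π' (e x) := by
    intro x
    rw [← sub_eq_zero, ← map_sub, ← map_sub]
    have : s (π x) - x ∈ LinearMap.ker π := by
      rw [LinearMap.mem_ker, map_sub, hs', sub_self]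
    rw [h.ker_eq_centre hc] at this
    have h2 : e (s (π x) - x) ∈ centre E' := centre_map_iso he this
    rwa [← h'.ker_eq_centre hc', LinearMap.mem_ker] at h2
  refine ⟨π' ∘ₗ e.toLinearMap ∘ₗ s, ⟨fun i b hb => ?_, fun a b n => ?_, fun b => ?_⟩, key⟩
  · obtain ⟨x, hx, rfl⟩ := h.exists_lift_mem hB hb
    change π' (e (s (π x))) ∈ _
    rw [key]
    exact h'.isHom.map_part i _ (he.1.map_part i x hx)
  · obtain ⟨x, rfl⟩ := h.surjective a
    obtain ⟨y, rfl⟩ := h.surjective b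
    change π' (e (s (B.prod (π x) (π y) n))) = B'.prod (π' (e (s (π x)))) (π' (e (s (π y)))) n
    rw [← h.isHom.map_prod, key, key, key, ← h'.isHom.map_prod]
    exact congrArg π' (he.1.map_prod x y n)
  · obtain ⟨x, rfl⟩ := h.surjective b
    change π' (e (s (B.der (π x)))) = B'.der (π' (e (s (π x))))
    rw [← h.isHom.map_der, key, key, ← h'.isHom.map_der]
    exact congrArg π' (he.1.map_der x)

/-- Centreless algebras with isomorphic central extensions are isomorphic. -/
theorem iso_of_iso_ext {B B' E E' : ConfData} {π : E.carrier →ₗ[ℂ] B.carrier}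
    {π' : E'.carrier →ₗ[ℂ] B'.carrier} (h : IsCentralExt B E π) (h' : IsCentralExt B' E' π')
    (hB : B.IsLie) (hB' : B'.IsLie) (hc : centre B = ⊥) (hc' : centre B' = ⊥) :
    Iso E E' → Iso B B' := by
  rintro ⟨e, he⟩
  obtain ⟨f, hf, hf'⟩ := exists_hom_of_iso h h' hB hc hc' he
  obtain ⟨g, hg, hg'⟩ := exists_hom_of_iso h' h hB' hc' hc (e := e.symm) ⟨he.2, he.1⟩
  refine ⟨LinearEquiv.ofLinearMap f g ?_ ?_, hf, hg⟩
  · refine LinearMap.ext fun b => ?_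
    obtain ⟨x, rfl⟩ := h'.surjective b
    simp [hg', hf']
  · refine LinearMap.ext fun b => ?_
    obtain ⟨x, rfl⟩ := h.surjective b
    simp [hg', hf']

/-! ## Tables with a Virasoro element -/

namespace AffTable

variable {ι : Type} [Fintype ι] [DecidableEq ι] {t : AffTable ι}

variable (t) in
/-- The coefficient of `∂^n`. -/
def cf (n : ℕ) : t.conf.carrier →ₗ[ℂ] (ι → ℂ) :=
  LinearMap.pi fun k => Polynomial.lcoeff ℂ n ∘ₗ LinearMap.proj k ∘ₗ t.crd

theorem cf_apply (n : ℕ) (x : t.conf.carrier) (k : ι) : t.cf n x k = (t.crd x k).coeff n := rfl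

@[simp] theorem cf_der_zero (x : t.conf.carrier) : t.cf 0 (t.conf.der x) = 0 := by
  ext1 k; simp [cf_apply]

@[simp] theorem cf_der_succ (n : ℕ) (x : t.conf.carrier) :
    t.cf (n + 1) (t.conf.der x) = t.cf n x := by
  ext1 k; simp [cf_apply]

@[simp] theorem cf_vec_zero (w : ι → ℂ) : t.cf 0 (t.vec w) = w := by
  ext1 k; simp [cf_apply]

@[simp] theorem cf_vec_succ (n : ℕ) (w : ι → ℂ) : t.cf (n + 1) (t.vec w) = 0 := by
  ext1 k; simp [cf_apply, Polynomial.coeff_C]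

theorem eq_vec_cf {x : t.conf.carrier} (h : ∀ n, t.cf (n + 1) x = 0) : x = t.vec (t.cf 0 x) := by
  apply t.crd_injective
  ext1 k
  ext n
  rcases n with _ | n
  · simp [cf_apply]
  · rw [← cf_apply, h, ← cf_apply, cf_vec_succ]

theorem vec_injective : Function.Injective t.vec := fun u w h => by
  rw [← t.cf_vec_zero u, h, cf_vec_zero]

theorem prod_zero_left (u y : t.conf.carrier) :
    t.conf.prod u y 0 = t.conf.prod (t.vec (t.cf 0 u)) y 0 := by
  refine conf_induction (motive := fun u => t.conf.prod u y 0 =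
    t.conf.prod (t.vec (t.cf 0 u)) y 0) (by simp [vec_zero]) (fun u v hu hv => ?_)
    (fun c u hu => ?_) (fun u hu => ?_) (fun i => ?_) u
  · simp only [map_add, vec_add, LinearMap.add_apply, Finsupp.add_apply, ← hu, ← hv]
  · simp only [map_smul, vec_smul, LinearMap.smul_apply, Finsupp.smul_apply, ← hu]
  · rw [cf_der_zero, vec_zero, t.isSesqui.der_prod]; simp
  · rw [← vec_single, cf_vec_zero]

theorem prod_one_left (u y : t.conf.carrier) :
    t.conf.prod u y 1 =
      t.conf.prod (t.vec (t.cf 0 u)) y 1 - t.conf.prod (t.vec (t.cf 1 u)) y 0 := by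
  refine conf_induction (motive := fun u => t.conf.prod u y 1 =
    t.conf.prod (t.vec (t.cf 0 u)) y 1 - t.conf.prod (t.vec (t.cf 1 u)) y 0)
    (by simp [vec_zero]) (fun u v hu hv => ?_)
    (fun c u hu => ?_) (fun u hu => ?_) (fun i => ?_) u
  · simp only [map_add, vec_add, LinearMap.add_apply, Finsupp.add_apply, hu, hv]
    abel
  · simp only [map_smul, vec_smul, LinearMap.smul_apply, Finsupp.smul_apply, hu, smul_sub]
  · rw [cf_der_zero, cf_der_succ, vec_zero, t.isSesqui.der_prod, ← prod_zero_left]; simp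
  · rw [← vec_single, cf_vec_zero, cf_vec_succ]; simp [vec_zero]

/-- The properties of a Virasoro element `L`, of currents and of odd generators that the
classification of automorphisms uses. -/
structure IsVir (t : AffTable ι) (L : ι) (Δ : ι → ℂ) : Prop where
  lie : t.conf.IsLie
  parL : t.par L = 0
  aL : ∀ i, t.a L i = 0
  bL : ∀ i, t.b L i = Pi.single i 1
  cL : ∀ i, t.c L i = Pi.single i (Δ i)
  wtL : Δ L = 2
  wt_even : ∀ i, t.par i = 0 → i ≠ L → Δ i = 1
  wt_odd : ∀ i, t.par i = 1 → Δ i = 3 / 2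
  cur : ∀ i j, t.par i = 0 → i ≠ L → t.par j = 1 → t.b i j = 0
  faithful : ∀ q : ι → ℂ, (∀ i, t.par i = 1 → q i = 0) → q L = 0 →
    (∀ j, t.par j = 1 → form t.a q (Pi.single j 1) = 0) → q = 0
  exists_odd : ∃ j, t.par j = 1

theorem par_cases (p : ZMod 2) : p = 0 ∨ p = 1 := by revert p; decide

namespace IsVir

variable {L : ι} {Δ : ι → ℂ} (h : IsVir t L Δ)
include h

theorem form_a_L {S : Type} [CommRing S] [Algebra ℂ S] (f : S) (u : ι → S) :
    form t.a (Pi.single L f) u = 0 := by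
  ext1 k
  refine Finset.sum_eq_zero fun i _ => Finset.sum_eq_zero fun j _ => ?_
  by_cases hi : i = L
  · subst hi; simp [h.aL]
  · simp [hi]

theorem form_b_L {S : Type} [CommRing S] [Algebra ℂ S] (f : S) (u : ι → S) :
    form t.b (Pi.single L f) u = fun k => f * u k := by
  ext1 k
  rw [form, Finset.sum_eq_single L, Finset.sum_eq_single k]
  · simp [h.bL]
  · intro j _ hj
    simp [h.bL, hj.symm]
  · simp
  · intro i _ hi
    simp [hi]
  · simp

theorem form_c_L {S : Type} [CommRing S] [Algebra ℂ S] (f : S) (u : ι → S) :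
    form t.c (Pi.single L f) u = fun k => Δ k • (f * u k) := by
  ext1 k
  rw [form, Finset.sum_eq_single L, Finset.sum_eq_single k]
  · simp [h.cL]
  · intro j _ hj
    simp [h.cL, hj.symm]
  · simp
  · intro i _ hi
    simp [hi]
  · simp

theorem prod_L_zero (x : t.conf.carrier) : t.conf.prod (t.gen L) x 0 = t.conf.der x := by
  refine conf_induction (motive := fun x => t.conf.prod (t.gen L) x 0 = t.conf.der x) (by simp)
    (fun x y hx hy => ?_) (fun c x hx => ?_) (fun x hx => ?_) (fun i => ?_) x
  · rw [map_add, Finsupp.add_apply, hx, hy, map_add]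
  · rw [map_smul, Finsupp.smul_apply, hx, map_smul]
  · rw [t.isSesqui.prod_der, hx]; simp
  · rw [← vec_single, ← vec_single, prod_vec_zero, h.form_a_L, h.form_b_L, vec_zero, zero_add]
    simp

/-- The 1-product with L is the grading operator: ∂ raises the weight by one. All weights are
non-zero, which later gives perfectness and a trivial centre. -/
theorem cf_prod_L_one (x : t.conf.carrier) (n : ℕ) (k : ι) :
    t.cf n (t.conf.prod (t.gen L) x 1) k = (Δ k + n) * t.cf n x k := by
  revert n
  refine conf_induction (motive := fun x => ∀ n, t.cf n (t.conf.prod (t.gen L) x 1) k =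
    (Δ k + n) * t.cf n x k) (by simp) (fun x y hx hy n => ?_) (fun c x hx n => ?_)
    (fun x hx n => ?_) (fun i n => ?_) x
  · rw [map_add, Finsupp.add_apply, map_add, Pi.add_apply, hx, hy, map_add, Pi.add_apply, mul_add]
  · rw [map_smul, Finsupp.smul_apply, map_smul, Pi.smul_apply, hx, map_smul, Pi.smul_apply,
      smul_eq_mul, smul_eq_mul]
    ring
  · rw [t.isSesqui.prod_der, Nat.sub_self, h.prod_L_zero, map_add, Pi.add_apply, map_smul,
      Pi.smul_apply]
    rcases n with _ | n
    · simp
    · rw [cf_der_succ, cf_der_succ, hx]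
      push_cast
      simp
      ring
  · rw [← vec_single, ← vec_single, prod_vec_one, h.form_c_L]
    rcases n with _ | n
    · simp
    · rw [cf_vec_succ, cf_vec_succ]; simp

theorem wt_cases (k : ι) : Δ k = 2 ∨ Δ k = 1 ∨ Δ k = 3 / 2 := by
  rcases par_cases (t.par k) with hk | hk
  · by_cases hL : k = L
    · subst hL; exact Or.inl h.wtL
    · exact Or.inr (Or.inl (h.wt_even k hk hL))
  · exact Or.inr (Or.inr (h.wt_odd k hk))

theorem wt_add_ne_zero (k : ι) (n : ℕ) : Δ k + n ≠ 0 := by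
  have hn : (0 : ℝ) ≤ n := n.cast_nonneg
  intro h0
  have := congrArg Complex.re h0
  rcases h.wt_cases k with h1 | h1 | h1 <;> rw [h1] at this <;> simp at this
  · linarith
  · linarith
  · norm_num at this; linarith

theorem prod_L_one_injective : Function.Injective fun x => t.conf.prod (t.gen L) x 1 := by
  intro x y hxy
  apply t.crd_injective
  ext1 k
  ext n
  have := congrArg (fun z => t.cf n z k) hxy
  simp only [h.cf_prod_L_one] at this
  exact mul_left_cancel₀ (h.wt_add_ne_zero k n) this

/-! ### Automorphisms of an algebra with a Virasoro element -/

section Automorphism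

variable (σ : Aut t.conf)

omit h in
theorem aut_prod (x y : t.conf.carrier) (n : ℕ) :
    σ.1 (t.conf.prod x y n) = t.conf.prod (σ.1 x) (σ.1 y) n := σ.2.1.map_prod x y n

omit h in
theorem aut_der (x : t.conf.carrier) : σ.1 (t.conf.der x) = t.conf.der (σ.1 x) :=
  σ.2.1.map_der x

omit h in
theorem aut_part {x : t.conf.carrier} {p : ZMod 2} (hx : x ∈ t.conf.part p) :
    σ.1 x ∈ t.conf.part p := σ.2.1.map_part p x hx

omit h in
theorem cf_eq_zero_of_mem_part {x : t.conf.carrier} {p : ZMod 2} (hx : x ∈ t.conf.part p) (n : ℕ)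
    {k : ι} (hk : t.par k ≠ p) : t.cf n x k = 0 := by
  rw [cf_apply, (mem_part t x p).mp hx k hk, Polynomial.coeff_zero]

theorem aut_L_mem : σ.1 (t.gen L) ∈ t.conf.part 0 := by
  apply aut_part
  have := t.gen_mem_part L
  rwa [h.parL] at this

theorem prod_aut_L_zero (y : t.conf.carrier) :
    t.conf.prod (σ.1 (t.gen L)) y 0 = t.conf.der y := by
  obtain ⟨z, rfl⟩ := σ.1.surjective y
  rw [← aut_prod, h.prod_L_zero, aut_der]

theorem form_b_odd {q : ι → ℂ} (hq : ∀ i, t.par i = 1 → q i = 0) {j : ι} (hj : t.par j = 1) :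
    form t.b q (Pi.single j 1) = q L • Pi.single j 1 := by
  ext1 k
  rw [form, Finset.sum_eq_single L, Finset.sum_eq_single j]
  · simp [h.bL, mul_comm]
  · intro i _ hi; simp [hi]
  · simp
  · intro i _ hi
    refine Finset.sum_eq_zero fun l _ => ?_
    rcases par_cases (t.par i) with hp | hp
    · by_cases hl : l = j
      · subst hl; rw [h.cur i l hp hi hj]; simp
      · simp [hl]
    · rw [hq i hp]; simp
  · simp

theorem faithful' {q : ι → ℂ} (hq : ∀ i, t.par i = 1 → q i = 0)
    (ha : ∀ j, t.par j = 1 → form t.a q (Pi.single j 1) = 0) : q = Pi.single L (q L) := by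
  have key : ∀ j, form t.a (q - Pi.single L (q L)) (Pi.single j 1) =
      form t.a q (Pi.single j 1) := by
    intro j
    have h1 := h.form_a_L (q L) (Pi.single j 1)
    ext1 k
    have h2 := congrFun h1 k
    simp only [form, Pi.zero_apply] at h2 ⊢
    rw [← sub_zero (∑ i, ∑ l, t.a i l k • (q i * (Pi.single j 1 : ι → ℂ) l)), ← h2,
      ← Finset.sum_sub_distrib]
    refine Finset.sum_congr rfl fun i _ => ?_
    rw [← Finset.sum_sub_distrib]
    refine Finset.sum_congr rfl fun l _ => ?_
    simp only [Pi.sub_apply, smul_eq_mul]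
    ring
  have := h.faithful (q - Pi.single L (q L)) (fun i hi => ?_) (by simp)
    (fun j hj => by rw [key, ha j hj])
  · exact sub_eq_zero.mp this
  · have hL : i ≠ L := by rintro rfl; rw [h.parL] at hi; exact absurd hi (by decide)
    simp [hL, hq i hi]

/-- The 0-product with σ(L) is still ∂, and it depends only on the constant term of σ(L). On odd
generators currents act without ∂; comparing the terms free of ∂ shows that the currents in the
constant term act trivially, and comparing the coefficients of ∂ normalizes L. -/
theorem cf_zero_aut_L : t.cf 0 (σ.1 (t.gen L)) = Pi.single L 1 := by
  have hpar : ∀ i, t.par i = 1 → t.cf 0 (σ.1 (t.gen L)) i = 0 := fun i hi =>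
    cf_eq_zero_of_mem_part (h.aut_L_mem σ) 0 (by rw [hi]; decide)
  have key : ∀ j, t.par j = 1 →
      t.vec (form t.a (t.cf 0 (σ.1 (t.gen L))) (Pi.single j 1)) +
        t.conf.der (t.vec (t.cf 0 (σ.1 (t.gen L)) L • Pi.single j 1)) =
      t.conf.der (t.vec (Pi.single j 1)) := by
    intro j hj
    rw [← h.form_b_odd hpar hj, ← prod_vec_zero, ← prod_zero_left, h.prod_aut_L_zero]
  rw [h.faithful' hpar fun j hj => ?_]
  · congr 1
    obtain ⟨j, hj⟩ := h.exists_odd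
    have := congrFun (congrArg (t.cf 1) (key j hj)) j
    rw [map_add] at this
    simpa using this
  · have := congrArg (t.cf 0) (key j hj)
    rw [map_add] at this
    simpa using this

/-- σ(L) multiplies the image of an odd generator by 3/2 in its 1-product, and on constant terms of
odd elements L does so already. The ∂-coefficient of σ(L) therefore annihilates the constant terms
of all odd elements, and faithfulness applies. -/
theorem cf_one_aut_L : ∃ p : ℂ, t.cf 1 (σ.1 (t.gen L)) = Pi.single L p := by
  have hpar : ∀ i, t.par i = 1 → t.cf 1 (σ.1 (t.gen L)) i = 0 := fun i hi =>
    cf_eq_zero_of_mem_part (h.aut_L_mem σ) 1 (by rw [hi]; decide)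
  set ℓ := σ.1 (t.gen L) with hℓ
  refine ⟨_, h.faithful' hpar fun j hj => ?_⟩
  have cf0 : ∀ y, t.cf 0 (t.conf.prod (t.vec (t.cf 1 ℓ)) y 0) = form t.a (t.cf 1 ℓ) (t.cf 0 y) := by
    intro y
    refine conf_induction (motive := fun y => t.cf 0 (t.conf.prod (t.vec (t.cf 1 ℓ)) y 0) =
      form t.a (t.cf 1 ℓ) (t.cf 0 y)) ?_ (fun x y hx hy => ?_) (fun c x hx => ?_)
      (fun x hx => ?_) (fun i => ?_) y
    · ext1 k; simp [form]
    · rw [map_add, Finsupp.add_apply, map_add, hx, hy, map_add]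
      ext1 k
      simp [form, mul_add, Finset.sum_add_distrib]
    · rw [map_smul, Finsupp.smul_apply, map_smul, hx, map_smul]
      ext1 k
      simp only [form, Pi.smul_apply, smul_eq_mul, Finset.mul_sum]
      refine Finset.sum_congr rfl fun _ _ => Finset.sum_congr rfl fun _ _ => by ring
    · rw [t.isSesqui.prod_der, Nat.cast_zero, zero_smul, add_zero, cf_der_zero, cf_der_zero]
      ext1 k; simp [form]
    · rw [← vec_single, prod_vec_zero, map_add, cf_vec_zero, cf_der_zero, add_zero, cf_vec_zero]
  have key : ∀ z ∈ t.conf.part 1, form t.a (t.cf 1 ℓ) (t.cf 0 (σ.1 z)) = 0 := by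
    intro z hz
    refine part_induction (motive := fun z => form t.a (t.cf 1 ℓ) (t.cf 0 (σ.1 z)) = 0)
      ?_ (fun x y hx hy => ?_) (fun c x hx => ?_) (fun x hx => ?_) (fun i hi => ?_) hz
    · rw [← cf0]; simp
    · rw [← cf0] at hx hy ⊢
      rw [map_add, map_add, Finsupp.add_apply, map_add, hx, hy, add_zero]
    · rw [← cf0] at hx ⊢
      rw [map_smul, map_smul, Finsupp.smul_apply, map_smul, hx, smul_zero]
    · rw [aut_der, cf_der_zero]
      ext1 k; simp [form]
    · have e1 : t.conf.prod ℓ (σ.1 (t.gen i)) 1 = (3 / 2 : ℂ) • σ.1 (t.gen i) := by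
        rw [hℓ, ← aut_prod, ← map_smul]
        congr 1
        rw [← vec_single, ← vec_single, prod_vec_one, h.form_c_L, ← vec_smul]
        congr 1
        ext1 k
        by_cases hk : k = i
        · subst hk; simp [h.wt_odd k hi]
        · simp [hk]
      rw [prod_one_left, h.cf_zero_aut_L, vec_single] at e1
      have e2 := congrArg (t.cf 0) e1
      rw [map_sub, cf0, map_smul] at e2
      ext1 k
      have e3 := congrFun e2 k
      rw [Pi.sub_apply, h.cf_prod_L_one, Pi.smul_apply, smul_eq_mul] at e3
      rcases par_cases (t.par k) with hk | hk
      · have : t.cf 0 (σ.1 (t.gen i)) k = 0 :=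
          cf_eq_zero_of_mem_part (aut_part σ (t.gen_mem_part i)) 0 (by rw [hk, hi]; decide)
        rw [this] at e3
        simpa using e3
      · rw [h.wt_odd k hk] at e3
        rw [Pi.zero_apply]
        push_cast at e3
        linear_combination -e3
  obtain ⟨z, hz⟩ := σ.1.surjective (t.gen j)
  have hz' : z ∈ t.conf.part 1 := by
    have := σ.2.2.map_part 1 (t.gen j) (hj ▸ t.gen_mem_part j)
    rw [← hz] at this
    have e : σ.1.symm (σ.1 z) = z := σ.1.symm_apply_apply z
    rw [← e]; exact this
  have := key z hz'
  rwa [hz, ← vec_single, cf_vec_zero] at this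

theorem prod_aut_L_one (y : t.conf.carrier) :
    t.conf.prod (σ.1 (t.gen L)) y 1 = t.conf.prod (t.gen L) y 1 ∧
      t.cf 1 (σ.1 (t.gen L)) = 0 := by
  obtain ⟨p, hp⟩ := h.cf_one_aut_L σ
  have e0 : ∀ y, t.conf.prod (σ.1 (t.gen L)) y 1 =
      t.conf.prod (t.gen L) y 1 - p • t.conf.der y := by
    intro y
    have : (Pi.single L p : ι → ℂ) = p • Pi.single L 1 := by
      rw [← Pi.single_smul, smul_eq_mul, mul_one]
    rw [prod_one_left, h.cf_zero_aut_L, vec_single, hp, this, vec_smul, vec_single, map_smul,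
      LinearMap.smul_apply, Finsupp.smul_apply, h.prod_L_zero]
  -- σ(L) is an eigenvector of L_(1) - p∂ for the eigenvalue 2. Since L_(1) keeps the degree in ∂
  -- and ∂ raises it, the coefficient one above the top degree of the L-component forces p = 0.
  have hp0 : p = 0 := by
    set P := t.crd (σ.1 (t.gen L)) L with hP
    have hP0 : P.coeff 0 = 1 := by
      rw [hP, ← cf_apply, h.cf_zero_aut_L, Pi.single_eq_same]
    have hPne : P ≠ 0 := by rintro h0; rw [h0] at hP0; simp at hP0
    have e1 : t.conf.prod (σ.1 (t.gen L)) (σ.1 (t.gen L)) 1 = (2 : ℂ) • σ.1 (t.gen L) := by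
      rw [← aut_prod, ← map_smul]
      congr 1
      rw [← vec_single, prod_vec_one, h.form_c_L, ← vec_smul]
      congr 1
      ext1 k
      by_cases hk : k = L
      · subst hk; simp [h.wtL]
      · simp [hk]
    rw [e0] at e1
    by_contra hpne
    have e2 := congrFun (congrArg (t.cf (P.natDegree + 1)) e1) L
    rw [map_sub, map_smul, map_smul, Pi.sub_apply, Pi.smul_apply, Pi.smul_apply, h.cf_prod_L_one,
      cf_der_succ, cf_apply, cf_apply, ← hP,
      Polynomial.coeff_eq_zero_of_natDegree_lt (Nat.lt_succ_self _)] at e2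
    simp [hpne, hPne] at e2
  subst hp0
  refine ⟨by rw [e0]; simp, by rw [hp]; simp⟩

theorem aut_prod_L_one (x : t.conf.carrier) :
    σ.1 (t.conf.prod (t.gen L) x 1) = t.conf.prod (t.gen L) (σ.1 x) 1 := by
  rw [aut_prod, (h.prod_aut_L_one σ _).1]

/-- An automorphism commutes with the 1-product of L, hence preserves conformal weights. -/
theorem cf_aut_gen (j k : ι) (n : ℕ) (hne : Δ k + n ≠ Δ j) : t.cf n (σ.1 (t.gen j)) k = 0 := by
  have e : t.conf.prod (t.gen L) (t.gen j) 1 = Δ j • t.gen j := by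
    rw [← vec_single, ← vec_single, prod_vec_one, h.form_c_L, ← vec_smul]
    congr 1
    ext1 k
    by_cases hk : k = j
    · subst hk; simp
    · simp [hk]
  have e2 := h.aut_prod_L_one σ (t.gen j)
  rw [e, map_smul] at e2
  have e3 := congrFun (congrArg (t.cf n) e2) k
  rw [map_smul, h.cf_prod_L_one, Pi.smul_apply, smul_eq_mul] at e3
  have : (Δ k + n - Δ j) * t.cf n (σ.1 (t.gen j)) k = 0 := by linear_combination -e3
  exact (mul_eq_zero.mp this).resolve_left (sub_ne_zero.mpr hne)

theorem aut_L : σ.1 (t.gen L) = t.gen L := by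
  rw [eq_vec_cf (x := σ.1 (t.gen L)), h.cf_zero_aut_L, vec_single]
  intro n
  rcases n with _ | n
  · exact (h.prod_aut_L_one σ 0).2
  · ext1 k
    refine h.cf_aut_gen σ L k _ ?_
    rw [h.wtL]
    intro h0
    have := congrArg Complex.re h0
    have hn : (0 : ℝ) ≤ n := n.cast_nonneg
    rcases h.wt_cases k with h1 | h1 | h1 <;> rw [h1] at this <;> simp at this
    · linarith
    · linarith
    · norm_num at this; linarith

/-- For equal parity, a term with a positive power of ∂ would need a generator of smaller weight by
a positive integer. The only such pair is a current below L, and L is already known to be fixed. -/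
theorem aut_gen (j : ι) : σ.1 (t.gen j) = t.vec (t.cf 0 (σ.1 (t.gen j))) := by
  by_cases hL : j = L
  · subst hL; rw [h.aut_L σ, ← vec_single, cf_vec_zero]
  apply eq_vec_cf
  intro n
  ext1 k
  have hn : (0 : ℝ) ≤ n := n.cast_nonneg
  by_cases hk : t.par k = t.par j
  · refine h.cf_aut_gen σ j k _ fun h0 => ?_
    have := congrArg Complex.re h0
    rcases par_cases (t.par j) with hj | hj
    · rw [h.wt_even j hj hL] at this
      rcases h.wt_cases k with h1 | h1 | h1 <;> rw [h1] at this <;> simp at this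
      · linarith
      · linarith
      · norm_num at this; linarith
    · rw [h.wt_odd j hj, h.wt_odd k (hk.trans hj)] at this
      simp at this
      linarith
  · exact cf_eq_zero_of_mem_part (aut_part σ (t.gen_mem_part j)) _ hk

/-- Automorphisms are `∂`-linear extensions of linear maps of the space of generators. -/
theorem exists_const : ∃ M : (ι → ℂ) →ₗ[ℂ] (ι → ℂ), IsConstHom t t M ∧
    (∀ w, σ.1 (t.vec w) = t.vec (M w)) ∧ M (Pi.single L 1) = Pi.single L 1 ∧
    ∀ j k, Δ k ≠ Δ j → M (Pi.single j 1) k = 0 := by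
  let V : (ι → ℂ) →ₗ[ℂ] t.conf.carrier := ⟨⟨t.vec, t.vec_add⟩, t.vec_smul⟩
  let M : (ι → ℂ) →ₗ[ℂ] (ι → ℂ) := t.cf 0 ∘ₗ σ.1.toLinearMap ∘ₗ V
  have hM : ∀ w, M w = t.cf 0 (σ.1 (t.vec w)) := fun w => rfl
  have hσ : ∀ w, σ.1 (t.vec w) = t.vec (M w) := by
    intro w
    rw [hM, vec_eq_sum, map_sum, map_sum, vec_sum]
    refine Finset.sum_congr rfl fun i _ => ?_
    rw [map_smul, map_smul, vec_smul, ← h.aut_gen]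
  have h0 : ∀ x y, t.vec (form t.a (M x) (M y)) + t.conf.der (t.vec (form t.b (M x) (M y))) =
      t.vec (M (form t.a x y)) + t.conf.der (t.vec (M (form t.b x y))) := by
    intro x y
    rw [← prod_vec_zero, ← hσ, ← hσ, ← aut_prod, prod_vec_zero, map_add, aut_der, hσ, hσ]
  refine ⟨M, ⟨fun i k hk => ?_, fun x y => ?_, fun x y => ?_, fun x y => ?_⟩, hσ, ?_,
    fun j k hjk => ?_⟩
  · rw [hM, vec_single]
    exact cf_eq_zero_of_mem_part (aut_part σ (t.gen_mem_part i)) _ hk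
  · have := congrArg (t.cf 0) (h0 x y)
    rw [map_add, map_add] at this
    simpa using this
  · have := congrArg (t.cf 1) (h0 x y)
    rw [map_add, map_add] at this
    simpa using this
  · apply vec_injective (t := t)
    rw [← prod_vec_one, ← hσ, ← hσ, ← aut_prod, prod_vec_one, hσ]
  · rw [hM, vec_single, h.cf_zero_aut_L]
  · rw [hM, vec_single]
    exact h.cf_aut_gen σ j k 0 (by simpa using hjk)

end Automorphism

end IsVir

end AffTable

/-! ## Twisted loop algebras of tables with a Virasoro element -/

/-! ### Uniform locality -/

theorem LocalAt.mono {B : ConfData} {N N' : ℕ} {a b : B.carrier} (hN : LocalAt B N a b)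
    (hle : N ≤ N') : LocalAt B N' a b :=
  fun F μ hF x y hx hy n hn => hN F μ hF x y hx hy n (hle.trans hn)

theorem LocalAt.add_left {B : ConfData} (hB : B.IsLie) {N : ℕ} {a a' b : B.carrier}
    (h1 : LocalAt B N a b) (h2 : LocalAt B N a' b) : LocalAt B N (a + a') b := by
  intro F μ hF x y hx hy n hn
  obtain ⟨z, hz⟩ := hF.surjective a
  obtain ⟨z', hz'⟩ := hF.surjective a'
  rw [hF.prod_congr hB (x' := z + z') (y' := y) (by rw [map_add, hx, hz, hz']) rfl, map_add,
    LinearMap.add_apply, Finsupp.add_apply, h1 F μ hF z y hz hy n hn, h2 F μ hF z' y hz' hy n hn,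
    add_zero]

theorem LocalAt.smul_left {B : ConfData} (hB : B.IsLie) {N : ℕ} {a b : B.carrier} (c : ℂ)
    (h1 : LocalAt B N a b) : LocalAt B N (c • a) b := by
  intro F μ hF x y hx hy n hn
  obtain ⟨z, hz⟩ := hF.surjective a
  rw [hF.prod_congr hB (x' := c • z) (y' := y) (by rw [map_smul, hx, hz]) rfl, map_smul,
    LinearMap.smul_apply, Finsupp.smul_apply, h1 F μ hF z y hz hy n hn, smul_zero]

theorem LocalAt.der_left {B : ConfData} (hB : B.IsLie) {N : ℕ} {a b : B.carrier}
    (h1 : LocalAt B N a b) : LocalAt B (N + 1) (B.der a) b := by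
  intro F μ hF x y hx hy n hn
  obtain ⟨z, hz⟩ := hF.surjective a
  rw [hF.prod_congr hB (x' := F.der z) (y' := y) (by rw [hF.isHom.map_der, hx, hz]) rfl,
    hF.isLie.der_prod, h1 F μ hF z y hz hy (n - 1) (by omega), smul_zero, neg_zero]

theorem LocalAt.add_right {B : ConfData} (hB : B.IsLie) {N : ℕ} {a b b' : B.carrier}
    (h1 : LocalAt B N a b) (h2 : LocalAt B N a b') : LocalAt B N a (b + b') := by
  intro F μ hF x y hx hy n hn
  obtain ⟨z, hz⟩ := hF.surjective b
  obtain ⟨z', hz'⟩ := hF.surjective b'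
  rw [hF.prod_congr hB (x' := x) (y' := z + z') rfl (by rw [map_add, hy, hz, hz']), map_add,
    Finsupp.add_apply, h1 F μ hF x z hx hz n hn, h2 F μ hF x z' hx hz' n hn, add_zero]

theorem LocalAt.smul_right {B : ConfData} (hB : B.IsLie) {N : ℕ} {a b : B.carrier} (c : ℂ)
    (h1 : LocalAt B N a b) : LocalAt B N a (c • b) := by
  intro F μ hF x y hx hy n hn
  obtain ⟨z, hz⟩ := hF.surjective b
  rw [hF.prod_congr hB (x' := x) (y' := c • z) rfl (by rw [map_smul, hy, hz]), map_smul,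
    Finsupp.smul_apply, h1 F μ hF x z hx hz n hn, smul_zero]

theorem LocalAt.der_right {B : ConfData} (hB : B.IsLie) {N : ℕ} {a b : B.carrier}
    (h1 : LocalAt B N a b) : LocalAt B (N + 1) a (B.der b) := by
  intro F μ hF x y hx hy n hn
  obtain ⟨z, hz⟩ := hF.surjective b
  rw [hF.prod_congr hB (x' := x) (y' := F.der z) rfl (by rw [hF.isHom.map_der, hy, hz]),
    hF.isLie.prod_der, h1 F μ hF x z hx hz (n - 1) (by omega), h1 F μ hF x z hx hz n (by omega),
    smul_zero, map_zero, add_zero]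

theorem LocalAt.zero_left {B : ConfData} (b : B.carrier) : LocalAt B 0 0 b := by
  intro F μ hF x y hx hy n hn
  rw [hF.prod_left hx, Finsupp.zero_apply]

theorem LocalAt.zero_right {B : ConfData} (hB : B.IsLie) (a : B.carrier) : LocalAt B 0 a 0 := by
  intro F μ hF x y hx hy n hn
  rw [hF.prod_right hB hy, Finsupp.zero_apply]

namespace AffTable

variable {ι : Type} [Fintype ι] [DecidableEq ι] {t : AffTable ι}

namespace IsVir

variable {L : ι} {Δ : ι → ℂ} (h : IsVir t L Δ) (ξ : RootSystem) (d : Twist t.conf)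

/-! ### Generation of a twisted loop algebra by homogeneous elements -/

section Generation

/-- The element `∑_k w_k v_k ⊗ t^q`, of weight `δ`, belongs to the twisted loop algebra. -/
def IsHomog (ξ : RootSystem) (d : Twist t.conf) (Δ : ι → ℂ) (δ : ℂ) (w : ι → ℂ) (q : ℚ) : Prop :=
  (∀ k, w k ≠ 0 → Δ k = δ) ∧ d.σ.1 (t.vec w) = expQ ξ q • t.vec w

variable {ξ d}

theorem expQ_add_int (ξ : RootSystem) (q : ℚ) (n : ℤ) : expQ ξ (q + n) = expQ ξ q := by
  rw [expQ_add, expQ_int, mul_one]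

theorem IsHomog.add_int {δ : ℂ} {w : ι → ℂ} {q : ℚ} (hw : IsHomog ξ d Δ δ w q) (n : ℤ) :
    IsHomog ξ d Δ δ w (q + n) := ⟨hw.1, by rw [expQ_add_int, hw.2]⟩

theorem tmul_mem_loopSpace {A : ConfData} {d : Twist A} {a : A.carrier} {q : ℚ}
    (ha : d.σ.1 a = expQ ξ q • a) : a ⊗ₜ[ℂ] tpow q ∈ loopSpace ξ d := by
  rw [mem_loopSpace_iff, twisted_tmul, ha, galois_tpow, expQ_neg, TensorProduct.smul_tmul,
    smul_smul, mul_inv_cancel₀ (expQ_ne_zero ξ q), one_smul]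

theorem IsHomog.mem {δ : ℂ} {w : ι → ℂ} {q : ℚ} (hw : IsHomog ξ d Δ δ w q) :
    t.vec w ⊗ₜ[ℂ] tpow q ∈ loopSpace ξ d := tmul_mem_loopSpace hw.2

/-- The element of the twisted loop algebra with value `∑_k w_k v_k ⊗ t^q`. -/
def IsHomog.elt {δ : ℂ} {w : ι → ℂ} {q : ℚ} (hw : IsHomog ξ d Δ δ w q) : (loop ξ d).carrier :=
  ⟨_, hw.mem⟩

theorem IsHomog.loopVal_elt {δ : ℂ} {w : ι → ℂ} {q : ℚ} (hw : IsHomog ξ d Δ δ w q) :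
    loopVal ξ d hw.elt = t.vec w ⊗ₜ[ℂ] tpow q := rfl

theorem cf_aut_const {σ : Aut t.conf} {M : (ι → ℂ) →ₗ[ℂ] (ι → ℂ)}
    (hσ : ∀ w, σ.1 (t.vec w) = t.vec (M w)) (n : ℕ) (x : t.conf.carrier) :
    t.cf n (σ.1 x) = M (t.cf n x) := by
  revert n
  refine conf_induction (motive := fun x => ∀ n, t.cf n (σ.1 x) = M (t.cf n x)) (by simp)
    (fun x y hx hy n => ?_) (fun c x hx n => ?_) (fun x hx n => ?_) (fun i n => ?_) x
  · simp only [map_add, hx, hy]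
  · simp only [map_smul, hx]
  · rw [aut_der]
    rcases n with _ | n
    · simp
    · rw [cf_der_succ, cf_der_succ, hx]
  · rw [← vec_single, hσ]
    rcases n with _ | n
    · simp
    · simp

-- Since σ acts by a constant matrix that preserves weights, the coefficients of an eigenvector at
-- each power of ∂, and their components of each weight, are again eigenvectors for the same
-- eigenvalue. The derivation then produces the powers of ∂.
include h in
theorem loop_induction {motive : (loop ξ d).carrier → Prop} (h0 : motive 0)
    (hadd : ∀ x y, motive x → motive y → motive (x + y))
    (hsmul : ∀ (c : ℂ) x, motive x → motive (c • x))
    (hder : ∀ x, motive x → motive ((loop ξ d).der x))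
    (hgen : ∀ δ w q (hw : IsHomog ξ d Δ δ w q), δ ≠ 0 → motive hw.elt)
    (x : (loop ξ d).carrier) : motive x := by
  obtain ⟨M, hM, hσ, -, hΔ⟩ := h.exists_const d.σ
  let S : Submodule ℂ (t.conf.carrier ⊗[ℂ] SHat) :=
    { carrier := {y | ∃ x, loopVal ξ d x = y ∧ motive x}
      zero_mem' := ⟨0, map_zero _, h0⟩
      add_mem' := by
        rintro _ _ ⟨x, rfl, hx⟩ ⟨y, rfl, hy⟩
        exact ⟨x + y, map_add _ _ _, hadd _ _ hx hy⟩
      smul_mem' := by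
        rintro c _ ⟨x, rfl, hx⟩
        exact ⟨c • x, map_smul _ _ _, hsmul _ _ hx⟩ }
  have hSder : ∀ y ∈ S, hatDer t.conf y ∈ S := by
    rintro _ ⟨x, rfl, hx⟩
    exact ⟨_, loopVal_der ξ d x, hder _ hx⟩
  have hvec : ∀ (w : ι → ℂ) (q : ℚ), M w = expQ ξ q • w → t.vec w ⊗ₜ[ℂ] tpow q ∈ S := by
    intro w q hw
    let P : ℂ → (ι → ℂ) → (ι → ℂ) := fun δ w k => if Δ k = δ then w k else 0
    have hsum : w = ∑ δ ∈ Finset.univ.image Δ, P δ w := by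
      ext1 k
      rw [Finset.sum_apply, Finset.sum_eq_single (Δ k)]
      · simp [P]
      · intro δ _ hδ; simp [P, hδ.symm]
      · intro hk; exact absurd (Finset.mem_image_of_mem _ (Finset.mem_univ k)) hk
    have hMP : ∀ δ, M (P δ w) = P δ (M w) := by
      intro δ
      ext1 k
      have hMw : ∀ u : ι → ℂ, M u k = ∑ i, u i * M (Pi.single i 1) k := by
        intro u
        rw [LinearMap.pi_apply_eq_sum_univ M u, Finset.sum_apply]
        refine Finset.sum_congr rfl fun i _ => ?_
        have : (fun j => if i = j then (1 : ℂ) else 0) = Pi.single i 1 := by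
          ext j; simp [Pi.single_apply, eq_comm]
        rw [this, Pi.smul_apply, smul_eq_mul]
      rw [hMw]
      simp only [P]
      rw [hMw w]
      split_ifs with hk
      · refine Finset.sum_congr rfl fun i _ => ?_
        split_ifs with hi
        · rfl
        · rw [hΔ i k (by rw [hk]; exact fun e => hi e.symm)]; simp
      · refine Finset.sum_eq_zero fun i _ => ?_
        split_ifs with hi
        · rw [hΔ i k (by rw [hi]; exact hk), mul_zero]
        · rw [zero_mul]
    rw [hsum, vec_sum, TensorProduct.sum_tmul]
    refine Submodule.sum_mem _ fun δ hδ => ?_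
    obtain ⟨k, -, rfl⟩ := Finset.mem_image.mp hδ
    have hh : IsHomog ξ d Δ (Δ k) (P (Δ k) w) q := by
      refine ⟨fun l hl => ?_, ?_⟩
      · by_contra hne; exact hl (if_neg hne)
      · rw [hσ, hMP, hw, ← vec_smul]
        congr 1
        ext1 l
        simp [P]
    exact ⟨hh.elt, hh.loopVal_elt, hgen _ _ _ hh (by simpa using h.wt_add_ne_zero k 0)⟩
  have hcf : ∀ n x, t.cf n (d.σ.1 x) = M (t.cf n x) := cf_aut_const hσ
  have htop : loopSpace ξ d ≤ S := by
    rw [loopSpace, Submodule.span_le]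
    rintro _ ⟨i, a, ha, rfl⟩
    rw [← expQ_div ξ i d.pos] at ha
    generalize ((i : ℚ) / d.m) = q at ha
    have ha' : ∀ n, M (t.cf n a) = expQ ξ q • t.cf n a := fun n => by
      rw [← hcf, ha, map_smul]
    -- ∂ⁿ⁺¹v ⊗ t^q is the derivative of ∂ⁿv ⊗ t^q minus q ∂ⁿv ⊗ t^(q-1), and the exponent q - 1
    -- belongs to the same eigenvalue e(q).
    have hpow : ∀ (n : ℕ) (w : ι → ℂ) (q : ℚ), M w = expQ ξ q • w →
        ((t.conf.der ^ n) (t.vec w)) ⊗ₜ[ℂ] tpow q ∈ S := by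
      intro n
      induction n with
      | zero => exact hvec
      | succ n ih =>
        intro w q hw
        rw [pow_succ', Module.End.mul_apply, sm_der_hat, deltaT_tpow, TensorProduct.tmul_smul]
        refine sub_mem (hSder _ (ih w q hw)) (Submodule.smul_mem _ _ (ih w (q - 1) ?_))
        have := expQ_add_int ξ q (-1)
        rw [hw, ← this]
        norm_num [sub_eq_add_neg]
    obtain ⟨N, hN⟩ : ∃ N, ∀ k, (t.crd a k).natDegree < N :=
      ⟨(Finset.univ.sup fun k => (t.crd a k).natDegree) + 1, fun k =>
        Nat.lt_succ_of_le (Finset.le_sup (f := fun k => (t.crd a k).natDegree) (Finset.mem_univ k))⟩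
    have hder : ∀ (n : ℕ) (x : t.conf.carrier) (k : ι),
        t.crd ((t.conf.der ^ n) x) k = Polynomial.X ^ n * t.crd x k := by
      intro n
      induction n with
      | zero => intro x k; simp
      | succ n ih =>
        intro x k
        rw [pow_succ', Module.End.mul_apply, crd_der, ih, pow_succ', mul_assoc]
    have hsum : a = ∑ n ∈ Finset.range N, (t.conf.der ^ n) (t.vec (t.cf n a)) := by
      apply t.crd_injective
      ext1 k
      rw [map_sum, Finset.sum_apply, (t.crd a k).as_sum_range' N (hN k)]
      refine Finset.sum_congr rfl fun n _ => ?_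
      rw [hder, crd_vec, cf_apply, ← Polynomial.C_mul_X_pow_eq_monomial, mul_comm]
    rw [hsum, TensorProduct.sum_tmul]
    exact Submodule.sum_mem _ fun n _ => hpow n _ q (ha' n)
  obtain ⟨y, hy, hmy⟩ := htop (loopVal_mem ξ d x)
  rwa [← loopVal_injective ξ d hy]

end Generation

/-! ### Products with L ⊗ tⁿ, perfectness and centre -/

section Products

include h

theorem hatProd_L_zero (f g : SHat) {δ : ℂ} {w : ι → ℂ} (hw : ∀ k, w k ≠ 0 → Δ k = δ) :
    hatProd t.conf (t.gen L ⊗ₜ f) (t.vec w ⊗ₜ g) 0 =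
      hatDer t.conf (t.vec w ⊗ₜ (f * g)) - t.vec w ⊗ₜ deltaT (f * g) +
        δ • t.vec w ⊗ₜ (deltaT f * g) := by
  have e1 : (fun i => deltaT ((Pi.single L f : ι → SHat) i)) = Pi.single L (deltaT f) := by
    ext1 i
    by_cases hi : i = L
    · subst hi; simp
    · simp [hi]
  rw [← vecS_single, vec_tmul, hatProd_vecS_zero, e1, h.form_a_L, h.form_b_L, h.form_c_L, zero_add,
    map_sub, vec_tmul, vec_tmul, vec_tmul, ← map_smul]
  have e2 : (fun k => Δ k • (deltaT f * w k • g)) = δ • fun k => w k • (deltaT f * g) := by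
    ext1 k
    by_cases hk : w k = 0
    · simp [hk]
    · simp [hw k hk]
  have e3 : (fun k => f * w k • g) = fun k => w k • (f * g) := by
    ext1 k; simp
  rw [e2, e3]
  simp only [map_smul]
  abel

theorem hatProd_L_one (f g : SHat) {δ : ℂ} {w : ι → ℂ} (hw : ∀ k, w k ≠ 0 → Δ k = δ) :
    hatProd t.conf (t.gen L ⊗ₜ f) (t.vec w ⊗ₜ g) 1 = δ • t.vec w ⊗ₜ (f * g) := by
  rw [← vecS_single, vec_tmul, hatProd_vecS_one, h.form_c_L, vec_tmul, ← map_smul]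
  congr 1
  ext1 k
  by_cases hk : w k = 0
  · simp [hk]
  · simp [hw k hk]

omit h in
theorem hatProd_vec_add_two (u w : ι → ℂ) (f g : SHat) (n : ℕ) :
    hatProd t.conf (t.vec u ⊗ₜ f) (t.vec w ⊗ₜ g) (n + 2) = 0 := by
  rw [vec_tmul, vec_tmul, hatProd_vecS_add_two]

theorem isHomog_L (n : ℤ) : IsHomog ξ d Δ 2 (Pi.single L 1) n := by
  refine ⟨fun k hk => ?_, ?_⟩
  · by_cases hkL : k = L
    · subst hkL; exact h.wtL
    · simp [hkL] at hk
  · rw [vec_single, h.aut_L, expQ_int, one_smul]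

/-- The element `L ⊗ t^n` of the twisted loop algebra. -/
def LL (n : ℤ) : (loop ξ d).carrier := (h.isHomog_L ξ d n).elt

theorem loopVal_LL (n : ℤ) : loopVal ξ d (h.LL ξ d n) = t.gen L ⊗ₜ tpow n := by
  rw [LL, IsHomog.loopVal_elt, vec_single]

theorem LL_mem (n : ℤ) : h.LL ξ d n ∈ (loop ξ d).part 0 := by
  rw [mem_loop_part, loopVal_LL]
  refine tmul_mem_hatPart ?_ _
  have := t.gen_mem_part L
  rwa [h.parL] at this

theorem LL_prod_zero (n : ℤ) {δ : ℂ} {w : ι → ℂ} {q : ℚ} (hw : IsHomog ξ d Δ δ w q) :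
    (loop ξ d).prod (h.LL ξ d n) hw.elt 0 =
      (loop ξ d).der (hw.add_int n).elt - ((q + n : ℚ) : ℂ) • (hw.add_int (n - 1)).elt +
        (δ * n) • (hw.add_int (n - 1)).elt := by
  apply loopVal_injective ξ d
  rw [loopVal_prod, loopVal_LL, IsHomog.loopVal_elt, h.hatProd_L_zero _ _ hw.1, map_add, map_sub,
    map_smul, map_smul, loopVal_der, IsHomog.loopVal_elt, IsHomog.loopVal_elt, tpow_mul,
    deltaT_tpow, deltaT_tpow, smul_mul_assoc, tpow_mul, TensorProduct.tmul_smul,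
    TensorProduct.tmul_smul, smul_smul, show (n : ℚ) + q = q + n by ring,
    show (n : ℚ) - 1 + q = q + ((n - 1 : ℤ) : ℚ) by push_cast; ring,
    show q + (n : ℚ) - 1 = q + ((n - 1 : ℤ) : ℚ) by push_cast; ring]
  push_cast
  rfl

theorem LL_prod_one (n : ℤ) {δ : ℂ} {w : ι → ℂ} {q : ℚ} (hw : IsHomog ξ d Δ δ w q) :
    (loop ξ d).prod (h.LL ξ d n) hw.elt 1 = δ • (hw.add_int n).elt := by
  apply loopVal_injective ξ d
  rw [loopVal_prod, loopVal_LL, IsHomog.loopVal_elt, h.hatProd_L_one _ _ hw.1, map_smul,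
    IsHomog.loopVal_elt, tpow_mul, add_comm]

theorem LL_prod_add_two (m : ℤ) {δ : ℂ} {w : ι → ℂ} {q : ℚ} (hw : IsHomog ξ d Δ δ w q) (n : ℕ) :
    (loop ξ d).prod (h.LL ξ d m) hw.elt (n + 2) = 0 := by
  apply loopVal_injective ξ d
  rw [loopVal_prod, loopVal_LL, IsHomog.loopVal_elt, ← vec_single, hatProd_vec_add_two, map_zero]

omit h in
theorem elt_prod_add_two {δ δ' : ℂ} {w w' : ι → ℂ} {q q' : ℚ} (hw : IsHomog ξ d Δ δ w q)
    (hw' : IsHomog ξ d Δ δ' w' q') (n : ℕ) :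
    (loop ξ d).prod hw.elt hw'.elt (n + 2) = 0 := by
  apply loopVal_injective ξ d
  rw [loopVal_prod, IsHomog.loopVal_elt, IsHomog.loopVal_elt, hatProd_vec_add_two, map_zero]

/-- A homogeneous generator is a product: L ⊗ 1 multiplies it by its non-zero weight. The span of
products is stable under the derivation. -/
theorem isPerfect : IsPerfect (loop ξ d) := by
  rw [IsPerfect, eq_top_iff]
  intro x _
  set P := Submodule.span ℂ {x | ∃ a b n, x = (loop ξ d).prod a b n} with hP
  refine h.loop_induction (motive := (· ∈ P)) (zero_mem _) (fun _ _ => add_mem)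
    (fun c _ => Submodule.smul_mem _ c) (fun x hx => ?_) (fun δ w q hw hδ => ?_) x
  · induction hx using Submodule.span_induction with
    | mem x hx =>
      obtain ⟨a, b, n, rfl⟩ := hx
      have := (loop_isLie ξ d h.lie).prod_der a b n
      have e : (loop ξ d).der ((loop ξ d).prod a b n) =
          (loop ξ d).prod a ((loop ξ d).der b) n - (n : ℂ) • (loop ξ d).prod a b (n - 1) := by
        rw [this, add_sub_cancel_right]
      rw [e]
      exact sub_mem (Submodule.subset_span ⟨_, _, _, rfl⟩)
        (Submodule.smul_mem _ _ (Submodule.subset_span ⟨_, _, _, rfl⟩))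
    | zero => rw [map_zero]; exact zero_mem _
    | add x y _ _ hx hy => rw [map_add]; exact add_mem hx hy
    | smul c x _ hx => rw [map_smul]; exact Submodule.smul_mem _ _ hx
  · have e := h.LL_prod_one ξ d 0 hw
    have : hw.elt = δ⁻¹ • (loop ξ d).prod (h.LL ξ d 0) hw.elt 1 := by
      rw [e, smul_smul, inv_mul_cancel₀ hδ, one_smul]
      apply loopVal_injective ξ d
      rw [IsHomog.loopVal_elt, IsHomog.loopVal_elt]
      simp
    rw [this]
    exact Submodule.smul_mem _ _ (Submodule.subset_span ⟨_, _, _, rfl⟩)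

/-- With right factors `a ⊗ f`, the 1-product with L ⊗ 1 is the base change of the injective grading
operator, and the base change is flat over ℂ. -/
theorem hatProd_L_one_injective :
    Function.Injective fun x : t.conf.carrier ⊗[ℂ] SHat => hatProd t.conf (t.gen L ⊗ₜ 1) x 1 := by
  let ℓ : t.conf.carrier →ₗ[ℂ] t.conf.carrier := Finsupp.lapply 1 ∘ₗ t.conf.prod (t.gen L)
  have hℓ : Function.Injective ℓ := h.prod_L_one_injective
  have := Module.Flat.rTensor_preserves_injective_linearMap (M := SHat) ℓ hℓ
  convert this using 1
  ext1 x
  induction x using TensorProduct.induction_on with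
  | zero => simp
  | add x y hx hy => simp only [map_add, Finsupp.add_apply] at hx hy ⊢; rw [hx, hy]
  | tmul a f =>
    rw [tmul_eq_sm f a, hatProd_sm_right, hatProd_tmul_one, sm_tmul, mul_one]
    simp [ℓ]

theorem centre_eq_bot : centre (loop ξ d) = ⊥ := by
  rw [eq_bot_iff]
  intro x hx
  have hLie := loop_isLie ξ d h.lie
  have hx' : (loop ξ d).prod x = 0 := hx
  have hc : IsCentralExt (loop ξ d) (loop ξ d) LinearMap.id :=
    ⟨hLie, IsConfHom.id _, Function.surjective_id, by simp⟩
  have key : (loop ξ d).prod (h.LL ξ d 0) x = 0 := by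
    obtain ⟨a, ha, b, hb, rfl⟩ := exists_hom_parts hLie x
    have hL := h.LL_mem ξ d 0
    have e0 := hLie.skewAt hL ha
    have e1 := hLie.skewAt hL hb
    have k0 : ∀ j, koszul 0 j = 1 := fun j => if_neg (by simp)
    rw [SkewAt, k0] at e0 e1
    rw [map_add, e0, e1, ← neg_add, ← smul_add, ← map_add, ← LinearMap.add_apply, ← map_add, hx']
    simp
  have e := congrArg (loopVal ξ d) (DFunLike.congr_fun key 1)
  rw [loopVal_prod, loopVal_LL] at e
  rw [Submodule.mem_bot]
  apply loopVal_injective ξ d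
  apply h.hatProd_L_one_injective
  simp only [map_zero, Finsupp.zero_apply]
  simpa [tpow_zero] using e

end Products

/-! ### Locality, uniformly in all central extensions -/

section Locality

variable {ξ d}

include h

/-- In a central extension the products of degree at least 2 of lifted generators are central, so
most terms of a Jacobi identity with a lift of L ⊗ t^m disappear. What remains relates products in
degrees n + 3 and n + 4, with coefficients depending on `m`; two choices of `m` eliminate the first
and leave δ times the second. -/
theorem localAt_elt {δ δ' : ℂ} {w w' : ι → ℂ} {q q' : ℚ} (hw : IsHomog ξ d Δ δ w q)
    (hw' : IsHomog ξ d Δ δ' w' q') (hδ : δ ≠ 0) : LocalAt (loop ξ d) 4 hw.elt hw'.elt := by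
  intro F μ hF x y hx hy n hn
  have hB := loop_isLie ξ d h.lie
  obtain ⟨n, rfl⟩ := Nat.exists_eq_add_of_le' hn
  choose X hX using fun m : ℤ => hF.surjective (hw.add_int m).elt
  choose Λ hΛ0 hΛ using fun m : ℤ => hF.exists_lift_mem hB (h.LL_mem ξ d m)
  have hcent : ∀ z, μ z = 0 → ∀ u k, F.prod z u k = 0 := fun z hz u k => by
    rw [hF.prod_left hz, Finsupp.zero_apply]
  have hcent' : ∀ z, μ z = 0 → ∀ u k, F.prod u z k = 0 := fun z hz u k => by
    rw [hF.prod_right hB hz, Finsupp.zero_apply]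
  have e0 : ∀ m j : ℤ, μ (F.prod (Λ m) (X j) 0) = μ (F.der (X (j + m)) -
      ((q + j + m : ℚ) : ℂ) • X (j + m - 1) + (δ * m) • X (j + m - 1)) := by
    intro m j
    rw [hF.isHom.map_prod, hΛ, hX, h.LL_prod_zero, map_add, map_sub, hF.isHom.map_der, map_smul,
      map_smul, hX, hX]
    have a1 : ((hw.add_int j).add_int m).elt = (hw.add_int (j + m)).elt := by
      apply loopVal_injective ξ d
      simp only [IsHomog.loopVal_elt]
      congr 2; push_cast; ring
    have a2 : ((hw.add_int j).add_int (m - 1)).elt = (hw.add_int (j + m - 1)).elt := by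
      apply loopVal_injective ξ d
      simp only [IsHomog.loopVal_elt]
      congr 2; push_cast; ring
    rw [a1, a2]
  have e1 : ∀ m j : ℤ, μ (F.prod (Λ m) (X j) 1) = μ (δ • X (j + m)) := by
    intro m j
    rw [hF.isHom.map_prod, hΛ, hX, h.LL_prod_one, map_smul, hX]
    congr 1
    apply loopVal_injective ξ d
    simp only [IsHomog.loopVal_elt]
    congr 2; push_cast; ring
  have e2 : ∀ m j : ℤ, μ (F.prod (Λ m) (X j) 2) = 0 := by
    intro m j
    rw [hF.isHom.map_prod, hΛ, hX]
    exact h.LL_prod_add_two ξ d m _ 0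
  -- The Jacobi identity with degrees 2 and n + 2: the terms with a 2-product involving the lift of
  -- L, and the term with `(X j)_(n+2) y`, vanish by centrality.
  have jac : ∀ m j : ℤ, (2 * δ - (n + 4)) • F.prod (X (j + m)) y (n + 3) +
      (δ * m - (q + j + m : ℚ)) • F.prod (X (j + m - 1)) y (n + 4) = 0 := by
    intro m j
    have J := hF.isLie.jacobiAt_even (hΛ0 m) (X j) y 2 (n + 2)
    rw [hcent' (F.prod (X j) y (n + 2)), hcent' (F.prod (Λ m) y 2), Finset.sum_range_succ,
      Finset.sum_range_succ, Finset.sum_range_one, hcent (F.prod (Λ m) (X j) 2) (e2 m j),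
      hF.prod_congr hB (e0 m j) (rfl : μ y = μ y), hF.prod_congr hB (e1 m j) (rfl : μ y = μ y)] at J
    · simp only [map_add, map_sub, map_smul, LinearMap.add_apply, LinearMap.sub_apply,
        LinearMap.smul_apply, Finsupp.add_apply, Finsupp.sub_apply, Finsupp.smul_apply,
        hF.isLie.der_prod, Nat.choose_zero_right, Nat.choose_one_right, smul_zero, add_zero,
        show 2 + (n + 2) - 0 = n + 4 by omega, show 2 + (n + 2) - 1 = n + 3 by omega,
        show n + 4 - 1 = n + 3 by omega] at J
      push_cast at J ⊢
      rw [J]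
      module
    · rw [hF.isHom.map_prod, hΛ, hy]
      exact h.LL_prod_add_two ξ d m _ 0
    · rw [hF.isHom.map_prod, hX, hy]
      exact elt_prod_add_two ξ d _ _ n
  -- Both choices have j + m = 1, hence involve the same two products; only the coefficient δm
  -- differs.
  have j1 := jac 0 1
  have j2 := jac 1 0
  have hfin : δ • F.prod (X 0) y (n + 4) = 0 := by
    simp only [add_zero, zero_add, sub_self, Int.cast_one, Int.cast_zero] at j1 j2
    have := congrArg₂ (· - ·) j2 j1
    simp only [sub_zero] at this
    rw [← this]
    module
  have : F.prod x y = F.prod (X 0) y := by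
    refine hF.prod_congr hB ?_ rfl
    rw [hx, hX]
    apply loopVal_injective ξ d
    simp only [IsHomog.loopVal_elt]
    simp
  rw [this]
  exact (smul_eq_zero.mp hfin).resolve_left hδ

theorem exists_localAt (a b : (loop ξ d).carrier) : ∃ N, LocalAt (loop ξ d) N a b := by
  have hB := loop_isLie ξ d h.lie
  refine h.loop_induction (motive := fun a => ∃ N, LocalAt (loop ξ d) N a b)
    ⟨0, LocalAt.zero_left b⟩ ?_ ?_ ?_ ?_ a
  · rintro x y ⟨N, hN⟩ ⟨N', hN'⟩
    exact ⟨max N N', (hN.mono (le_max_left _ _)).add_left hB (hN'.mono (le_max_right _ _))⟩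
  · rintro c x ⟨N, hN⟩
    exact ⟨N, hN.smul_left hB c⟩
  · rintro x ⟨N, hN⟩
    exact ⟨N + 1, hN.der_left hB⟩
  · intro δ w q hw hδ
    refine h.loop_induction (motive := fun b => ∃ N, LocalAt (loop ξ d) N hw.elt b)
      ⟨0, LocalAt.zero_right hB _⟩ ?_ ?_ ?_ ?_ b
    · rintro x y ⟨N, hN⟩ ⟨N', hN'⟩
      exact ⟨max N N', (hN.mono (le_max_left _ _)).add_right hB (hN'.mono (le_max_right _ _))⟩
    · rintro c x ⟨N, hN⟩
      exact ⟨N, hN.smul_right hB c⟩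
    · rintro x ⟨N, hN⟩
      exact ⟨N + 1, hN.der_right hB⟩
    · intro δ' w' q' hw' _
      exact ⟨4, h.localAt_elt hw hw' hδ⟩

theorem exists_uce : ∃ E π, IsUniversalCentralExt (loop ξ d) E π :=
  ⟨_, _, UCE.isUniversal (loop_isLie ξ d h.lie) h.exists_localAt (h.isPerfect ξ d)⟩

end Locality

end IsVir

end AffTable

/-! ## The `N = 4` conformal superalgebra and its matrix model -/

namespace I4

theorem sum_univ {M : Type*} [AddCommMonoid M] (f : I4 → M) : ∑ i, f i =
    f .L + f (.J 0) + f (.J 1) + f (.J 2) + f (.G 0) + f (.G 1) + f (.Gbar 0) + f (.Gbar 1) := by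
  have : (Finset.univ : Finset I4) =
    {.L, .J 0, .J 1, .J 2, .G 0, .G 1, .Gbar 0, .Gbar 1} := by decide
  rw [this]
  simp [add_assoc]

/-- The structure constants of the currents. -/
def eps : Fin 3 → Fin 3 → Fin 3 → ℂ :=
  ![![![0, 0, 0], ![0, 0, Complex.I], ![0, -Complex.I, 0]],
    ![![0, 0, -Complex.I], ![0, 0, 0], ![Complex.I, 0, 0]],
    ![![0, Complex.I, 0], ![-Complex.I, 0, 0], ![0, 0, 0]]]

theorem Jcoord_eq (m n s : Fin 3) : Jcoord (Jmat m * Jmat n - Jmat n * Jmat m) s = eps m n s := by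
  fin_cases m <;> fin_cases n <;> fin_cases s <;>
    simp [Jcoord, Jmat, pauli, eps, Matrix.trace_fin_two, Matrix.mul_apply, Matrix.vecHead,
      Matrix.vecTail] <;> ring_nf

/-- The coefficients of `1` in the `λ`-brackets. -/
def ca : I4 → I4 → I4 → ℂ
  | .J m, .J n => ∑ s, Pi.single (.J s) (eps m n s)
  | .J s, .G a => ∑ b, Pi.single (.G b) (-(1 / 2) * pauli s a b)
  | .G a, .J s => ∑ b, Pi.single (.G b) (1 / 2 * pauli s a b)
  | .J s, .Gbar a => ∑ b, Pi.single (.Gbar b) (1 / 2 * pauli s b a)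
  | .Gbar a, .J s => ∑ b, Pi.single (.Gbar b) (-(1 / 2) * pauli s b a)
  | .G a, .Gbar b => Pi.single .L (if a = b then 2 else 0)
  | .Gbar b, .G a => Pi.single .L (if a = b then 2 else 0)
  | _, _ => 0

/-- The coefficients of `∂` in the `λ`-brackets. -/
def cb : I4 → I4 → I4 → ℂ
  | .L, i => Pi.single i 1
  | .G a, .L => Pi.single (.G a) (1 / 2)
  | .Gbar a, .L => Pi.single (.Gbar a) (1 / 2)
  | .G a, .Gbar b => ∑ s, Pi.single (.J s) (-2 * pauli s a b)
  | .Gbar b, .G a => ∑ s, Pi.single (.J s) (2 * pauli s a b)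
  | _, _ => 0

/-- The conformal weights. -/
def wt : I4 → ℂ
  | .L => 2
  | .J _ => 1
  | .G _ | .Gbar _ => 3 / 2

/-- The coefficients of `λ` in the `λ`-brackets. -/
def cc : I4 → I4 → I4 → ℂ
  | .L, i => Pi.single i (wt i)
  | i, .L => Pi.single i (wt i)
  | .G a, .Gbar b => ∑ s, Pi.single (.J s) (-4 * pauli s a b)
  | .Gbar b, .G a => ∑ s, Pi.single (.J s) (4 * pauli s a b)
  | _, _ => 0

theorem cst_smul (c : ℂ) (x : ℂ[X][X]) : c • x = cst c * x := Algebra.smul_def c x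

theorem cst_mul (a b : ℂ) : cst (a * b) = cst a * cst b := by simp [cst]
theorem cst_neg (a : ℂ) : cst (-a) = -cst a := by simp [cst]
theorem cst_zero : cst 0 = 0 := by simp [cst]
theorem cst_one : cst 1 = 1 := by simp [cst]
theorem cst_ofNat (n : ℕ) [n.AtLeastTwo] : cst ofNat(n) = ofNat(n) := by
  rw [cst, map_ofNat, map_ofNat]

theorem cst_single (i k : I4) (c : ℂ) :
    cst ((Pi.single i c : I4 → ℂ) k) = (Pi.single i (cst c) : I4 → ℂ[X][X]) k := by
  by_cases h : k = i
  · subst h; simp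
  · simp [h, cst_zero]

theorem single_mul (i k : I4) (x y : ℂ[X][X]) :
    (Pi.single i x : I4 → ℂ[X][X]) k * y = (Pi.single i (x * y) : I4 → ℂ[X][X]) k := by
  by_cases h : k = i
  · subst h; simp
  · simp [h]

theorem single_add' (i k : I4) (x y : ℂ[X][X]) :
    (Pi.single i x : I4 → ℂ[X][X]) k + (Pi.single i y : I4 → ℂ[X][X]) k =
      (Pi.single i (x + y) : I4 → ℂ[X][X]) k := by
  rw [Pi.single_add, Pi.add_apply]

theorem cst_sum {κ : Type*} (s : Finset κ) (f : κ → ℂ) : cst (∑ i ∈ s, f i) = ∑ i ∈ s, cst (f i) := by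
  simp [cst]

/-- The `λ`-brackets of the `N = 4` conformal superalgebra. -/
def table : AffTable I4 where
  par := par4
  T := table4
  a := ca
  b := cb
  c := cc
  T_eq i j k := by
    rcases i with _ | i | i | i <;> rcases j with _ | j | j | j <;>
      simp only [table4, ca, cb, cc, wt, Jcoord_eq, Finset.sum_apply, cst_sum, cst_single,
        Pi.zero_apply, cst_zero, zero_mul, add_zero, zero_add, Pi.add_apply, Pi.sub_apply,
        single_mul, Finset.sum_mul, single_add', cst_smul, cst_ofNat, cst_one, one_mul, cst_mul,
        cst_neg, neg_mul, ← Finset.sum_add_distrib, mul_zero]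
    · rw [sub_eq_add_neg, ← Finset.sum_neg_distrib, add_assoc, ← Finset.sum_add_distrib]
      congr 1
      · congr 2; split_ifs <;> simp [cst_ofNat, cst_zero]
      · refine Finset.sum_congr rfl fun c _ => ?_
        by_cases hk : k = .J c
        · subst hk; simp; ring
        · simp [hk]
    · rw [add_assoc, ← Finset.sum_add_distrib]
      congr 1
      · congr 2; split_ifs <;> simp [cst_ofNat, cst_zero]
      · refine Finset.sum_congr rfl fun c _ => ?_
        by_cases hk : k = .J c
        · subst hk; simp; ring
        · simp [hk]

section

variable (u w : I4 → ℂ)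

/-- The vector with given coordinates. -/
def mk (l j₀ j₁ j₂ g₀ g₁ b₀ b₁ : ℂ) : I4 → ℂ
  | .L => l
  | .J s => ![j₀, j₁, j₂] s
  | .G a => ![g₀, g₁] a
  | .Gbar a => ![b₀, b₁] a

theorem form_a : form table.a u w = mk
    (2 * (u (.G 0) * w (.Gbar 0) + u (.G 1) * w (.Gbar 1) + u (.Gbar 0) * w (.G 0) +
      u (.Gbar 1) * w (.G 1)))
    (Complex.I * (u (.J 1) * w (.J 2) - u (.J 2) * w (.J 1)))
    (Complex.I * (u (.J 2) * w (.J 0) - u (.J 0) * w (.J 2)))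
    (Complex.I * (u (.J 0) * w (.J 1) - u (.J 1) * w (.J 0)))
    (-(1 / 2) * ((u (.J 0) * w (.G 1) - u (.G 1) * w (.J 0)) +
      Complex.I * (u (.J 1) * w (.G 1) - u (.G 1) * w (.J 1)) +
      (u (.J 2) * w (.G 0) - u (.G 0) * w (.J 2))))
    (-(1 / 2) * ((u (.J 0) * w (.G 0) - u (.G 0) * w (.J 0)) -
      Complex.I * (u (.J 1) * w (.G 0) - u (.G 0) * w (.J 1)) -
      (u (.J 2) * w (.G 1) - u (.G 1) * w (.J 2))))
    (1 / 2 * ((u (.J 0) * w (.Gbar 1) - u (.Gbar 1) * w (.J 0)) -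
      Complex.I * (u (.J 1) * w (.Gbar 1) - u (.Gbar 1) * w (.J 1)) +
      (u (.J 2) * w (.Gbar 0) - u (.Gbar 0) * w (.J 2))))
    (1 / 2 * ((u (.J 0) * w (.Gbar 0) - u (.Gbar 0) * w (.J 0)) +
      Complex.I * (u (.J 1) * w (.Gbar 0) - u (.Gbar 0) * w (.J 1)) -
      (u (.J 2) * w (.Gbar 1) - u (.Gbar 1) * w (.J 2)))) := by
  ext1 k
  simp only [form, table, sum_univ, ca, eps, pauli, Finset.sum_apply, Fin.sum_univ_three,
    Fin.sum_univ_two, smul_eq_mul]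
  rcases k with _ | k | k | k
  · simp [mk]; ring
  all_goals fin_cases k <;> simp [mk] <;> ring

theorem form_b : form table.b u w = mk
    (u .L * w .L)
    (u .L * w (.J 0) - 2 * (u (.G 0) * w (.Gbar 1) - u (.Gbar 1) * w (.G 0) +
      (u (.G 1) * w (.Gbar 0) - u (.Gbar 0) * w (.G 1))))
    (u .L * w (.J 1) - 2 * Complex.I * (u (.G 1) * w (.Gbar 0) - u (.Gbar 0) * w (.G 1) -
      (u (.G 0) * w (.Gbar 1) - u (.Gbar 1) * w (.G 0))))
    (u .L * w (.J 2) - 2 * (u (.G 0) * w (.Gbar 0) - u (.Gbar 0) * w (.G 0) -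
      (u (.G 1) * w (.Gbar 1) - u (.Gbar 1) * w (.G 1))))
    (u .L * w (.G 0) + 1 / 2 * (u (.G 0) * w .L))
    (u .L * w (.G 1) + 1 / 2 * (u (.G 1) * w .L))
    (u .L * w (.Gbar 0) + 1 / 2 * (u (.Gbar 0) * w .L))
    (u .L * w (.Gbar 1) + 1 / 2 * (u (.Gbar 1) * w .L)) := by
  ext1 k
  simp only [form, table, sum_univ, cb, pauli, Finset.sum_apply, Fin.sum_univ_three,
    Fin.sum_univ_two, smul_eq_mul]
  rcases k with _ | k | k | k
  · simp [mk]
  all_goals fin_cases k <;> simp [mk] <;> ring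

theorem form_c : form table.c u w = mk
    (2 * (u .L * w .L))
    (u .L * w (.J 0) + u (.J 0) * w .L - 4 * (u (.G 0) * w (.Gbar 1) - u (.Gbar 1) * w (.G 0) +
      (u (.G 1) * w (.Gbar 0) - u (.Gbar 0) * w (.G 1))))
    (u .L * w (.J 1) + u (.J 1) * w .L - 4 * Complex.I *
      (u (.G 1) * w (.Gbar 0) - u (.Gbar 0) * w (.G 1) -
        (u (.G 0) * w (.Gbar 1) - u (.Gbar 1) * w (.G 0))))
    (u .L * w (.J 2) + u (.J 2) * w .L - 4 * (u (.G 0) * w (.Gbar 0) - u (.Gbar 0) * w (.G 0) -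
      (u (.G 1) * w (.Gbar 1) - u (.Gbar 1) * w (.G 1))))
    (3 / 2 * (u .L * w (.G 0) + u (.G 0) * w .L))
    (3 / 2 * (u .L * w (.G 1) + u (.G 1) * w .L))
    (3 / 2 * (u .L * w (.Gbar 0) + u (.Gbar 0) * w .L))
    (3 / 2 * (u .L * w (.Gbar 1) + u (.Gbar 1) * w .L)) := by
  ext1 k
  simp only [form, table, sum_univ, cc, wt, pauli, Finset.sum_apply, Fin.sum_univ_three,
    Fin.sum_univ_two, smul_eq_mul]
  rcases k with _ | k | k | k
  · simp [mk]
  all_goals fin_cases k <;> simp [mk] <;> ring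

end

/-- The isomorphism with the matrix model, on generators. -/
def toMat : (I4 → ℂ) →ₗ[ℂ] (K4 → ℂ) where
  toFun w := K4.mk (w .L) ((w (.J 0) - Complex.I * w (.J 1)) / 2) (w (.J 2) / 2)
    ((w (.J 0) + Complex.I * w (.J 1)) / 2) (-w (.G 1)) (w (.Gbar 0)) (w (.G 0)) (w (.Gbar 1))
  map_add' u w := by ext1 k; cases k <;> simp [K4.mk] <;> ring
  map_smul' c w := by ext1 k; cases k <;> simp [K4.mk] <;> ring

/-- The inverse of `toMat`. -/
def ofMat : (K4 → ℂ) →ₗ[ℂ] (I4 → ℂ) where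
  toFun w := mk (w .L) (w .E + w .F) (Complex.I * (w .E - w .F)) (2 * w .H) (w .x21) (-w .x11)
    (w .x12) (w .x22)
  map_add' u w := by
    ext1 k
    rcases k with _ | k | k | k
    · simp [mk]
    all_goals fin_cases k <;> simp [mk] <;> ring
  map_smul' c w := by
    ext1 k
    rcases k with _ | k | k | k
    · simp [mk]
    all_goals fin_cases k <;> simp [mk] <;> ring

theorem toMat_apply (w : I4 → ℂ) :
    toMat w = K4.mk (w .L) ((w (.J 0) - Complex.I * w (.J 1)) / 2) (w (.J 2) / 2)
      ((w (.J 0) + Complex.I * w (.J 1)) / 2) (-w (.G 1)) (w (.Gbar 0)) (w (.G 0)) (w (.Gbar 1)) :=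
  rfl

theorem ofMat_apply (w : K4 → ℂ) :
    ofMat w = mk (w .L) (w .E + w .F) (Complex.I * (w .E - w .F)) (2 * w .H) (w .x21) (-w .x11)
      (w .x12) (w .x22) := rfl

theorem ofMat_toMat (w : I4 → ℂ) : ofMat (toMat w) = w := by
  have hI := Complex.I_sq
  rw [ofMat_apply, toMat_apply]
  ext1 k
  rcases k with _ | k | k | k
  · simp [mk, K4.mk]
  · fin_cases k <;> simp [mk, K4.mk]
    · ring
    · linear_combination (-w (.J 1)) * hI
    · ring
  all_goals fin_cases k <;> simp [mk, K4.mk]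

theorem toMat_ofMat (w : K4 → ℂ) : toMat (ofMat w) = w := by
  have hI := Complex.I_sq
  rw [ofMat_apply, toMat_apply]
  ext1 k
  cases k <;> simp [mk, K4.mk]
  · linear_combination (-(w .E - w .F) / 2) * hI
  · linear_combination ((w .E - w .F) / 2) * hI

theorem toMat_isConstHom : AffTable.IsConstHom table K4.table toMat := by
  have hI := Complex.I_sq
  refine ⟨fun i k => ?_, fun x y => ?_, fun x y => ?_, fun x y => ?_⟩
  · change K4.par k ≠ par4 i → _
    rw [toMat_apply]
    intro h
    cases k <;> rcases i with _ | i | i | i <;> first | exact absurd rfl h | simp [K4.mk]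
  · rw [form_a, K4.form_a, toMat_apply, toMat_apply, toMat_apply]
    ext1 k
    cases k <;> simp only [mk, K4.mk, smul_eq_mul, Matrix.cons_val] <;> grind
  · rw [form_b, K4.form_b, toMat_apply, toMat_apply, toMat_apply]
    ext1 k
    cases k <;> simp only [mk, K4.mk, smul_eq_mul, Matrix.cons_val] <;> grind
  · rw [form_c, K4.form_c, toMat_apply, toMat_apply, toMat_apply]
    ext1 k
    cases k <;> simp only [mk, K4.mk, smul_eq_mul, Matrix.cons_val] <;> grind

/-- The currents go to half the Pauli matrices. The rows of the odd matrix are (-G², Ḡ¹) and (G¹,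
Ḡ²), so the outer action is right multiplication by the transpose of `X`. -/
theorem exists_matEquiv : ∃ e : table.conf.carrier ≃ₗ[ℂ] K4.table.conf.carrier, IsConfIso e ∧
    ∀ w, e (table.vec w) = K4.table.vec (toMat w) := by
  refine AffTable.exists_equiv toMat_isConstHom ofMat_toMat toMat_ofMat fun k i => ?_
  change par4 i ≠ K4.par k → _
  rw [ofMat_apply]
  intro h
  cases k <;> rcases i with _ | i | i | i <;> first | exact absurd rfl h | simp [mk]
  all_goals fin_cases i <;> simp

end I4

/-! ## Automorphisms of the matrix model -/

namespace AffTable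

variable {ι : Type} [Fintype ι] [DecidableEq ι] {t : AffTable ι}

theorem constMap_comp (M N : (ι → ℂ) →ₗ[ℂ] (ι → ℂ)) (x : t.conf.carrier) :
    constMap t t M (constMap t t N x) = constMap t t (M ∘ₗ N) x := by
  refine conf_hom_ext (f := constMap t t M ∘ₗ constMap t t N) (g := constMap t t (M ∘ₗ N))
    (fun x => ?_) (constMap_der _) (fun i => ?_) x
  · simp [constMap_der]
  · rw [LinearMap.comp_apply, constMap_gen, constMap_vec, constMap_gen, LinearMap.comp_apply]

/-- The automorphism defined by mutually inverse maps of generators that respect the structure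
constants. -/
def constAut (M M' : (ι → ℂ) →ₗ[ℂ] (ι → ℂ)) (h : IsConstHom t t M) (h' : IsConstHom t t M')
    (h₁ : ∀ w, M' (M w) = w) (h₂ : ∀ w, M (M' w) = w) : Aut t.conf :=
  ⟨LinearEquiv.ofLinearMap (constMap t t M) (constMap t t M')
    (LinearMap.ext fun x => constMap_constMap h₂ x) (LinearMap.ext fun x => constMap_constMap h₁ x),
    h.isConfHom, h'.isConfHom⟩

theorem constAut_apply {M M' : (ι → ℂ) →ₗ[ℂ] (ι → ℂ)} (h : IsConstHom t t M)
    (h' : IsConstHom t t M') (h₁ : ∀ w, M' (M w) = w) (h₂ : ∀ w, M (M' w) = w)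
    (x : t.conf.carrier) : (constAut M M' h h' h₁ h₂).1 x = constMap t t M x := rfl

theorem aut_ext {σ τ : Aut t.conf} (h : ∀ i, σ.1 (t.gen i) = τ.1 (t.gen i)) : σ = τ := by
  apply Subtype.ext
  ext x
  exact conf_hom_ext (f := σ.1.toLinearMap) (g := τ.1.toLinearMap) σ.2.1.map_der τ.2.1.map_der h x

end AffTable

namespace K4

/-- The action of a matrix on the multiplicity space of the odd part. -/
def outer (X : Matrix (Fin 2) (Fin 2) ℂ) : (K4 → ℂ) →ₗ[ℂ] (K4 → ℂ) where
  toFun w := mk (w .L) (w .E) (w .H) (w .F)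
    (w .x11 * X 0 0 + w .x12 * X 0 1) (w .x11 * X 1 0 + w .x12 * X 1 1)
    (w .x21 * X 0 0 + w .x22 * X 0 1) (w .x21 * X 1 0 + w .x22 * X 1 1)
  map_add' u w := by ext1 k; cases k <;> simp [mk] <;> ring
  map_smul' c w := by ext1 k; cases k <;> simp [mk] <;> ring

theorem outer_apply (X : Matrix (Fin 2) (Fin 2) ℂ) (w : K4 → ℂ) : outer X w =
    mk (w .L) (w .E) (w .H) (w .F)
      (w .x11 * X 0 0 + w .x12 * X 0 1) (w .x11 * X 1 0 + w .x12 * X 1 1)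
      (w .x21 * X 0 0 + w .x22 * X 0 1) (w .x21 * X 1 0 + w .x22 * X 1 1) := rfl

theorem outer_outer (X Y : Matrix (Fin 2) (Fin 2) ℂ) (w : K4 → ℂ) :
    outer X (outer Y w) = outer (X * Y) w := by
  simp only [outer_apply, Matrix.mul_apply, Fin.sum_univ_two]
  ext1 k
  cases k <;> simp only [mk] <;> ring

theorem outer_one (w : K4 → ℂ) : outer 1 w = w := by
  ext1 k
  cases k <;> simp [outer_apply, mk]

theorem det_eq (X : SL(2, ℂ)) : X.1 0 0 * X.1 1 1 - X.1 0 1 * X.1 1 0 = 1 := by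
  rw [← Matrix.det_fin_two, X.2]

theorem outer_isConstHom (X : SL(2, ℂ)) : AffTable.IsConstHom table table (outer X.1) := by
  have hX := det_eq X
  refine ⟨fun i k => ?_, fun x y => ?_, fun x y => ?_, fun x y => ?_⟩
  · change par k ≠ par i → _
    rw [outer_apply]
    intro h
    cases k <;> cases i <;> first | exact absurd rfl h | simp [mk]
  · rw [form_a, form_a, outer_apply, outer_apply, outer_apply]
    ext1 k
    cases k <;> simp only [mk, smul_eq_mul] <;> grind
  · rw [form_b, form_b, outer_apply, outer_apply, outer_apply]
    ext1 k
    cases k <;> simp only [mk, smul_eq_mul] <;> grind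
  · rw [form_c, form_c, outer_apply, outer_apply, outer_apply]
    ext1 k
    cases k <;> simp only [mk, smul_eq_mul] <;> grind

theorem mul_inv_val (X : SL(2, ℂ)) : X.1 * (X⁻¹).1 = 1 := congrArg Subtype.val (mul_inv_cancel X)

theorem inv_mul_val (X : SL(2, ℂ)) : (X⁻¹).1 * X.1 = 1 := congrArg Subtype.val (inv_mul_cancel X)

/-- The action of `SL₂(ℂ)` by outer automorphisms. -/
def outerAut : SL(2, ℂ) →* Aut table.conf where
  toFun X := AffTable.constAut (outer X.1) (outer (X⁻¹).1) (outer_isConstHom X)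
    (outer_isConstHom X⁻¹) (fun w => by rw [outer_outer, inv_mul_val, outer_one])
    (fun w => by rw [outer_outer, mul_inv_val, outer_one])
  map_one' := by
    refine AffTable.aut_ext fun i => ?_
    rw [AffTable.constAut_apply, AffTable.constMap_gen]
    change table.vec (outer 1 _) = table.gen i
    rw [outer_one, AffTable.vec_single]
  map_mul' X Y := by
    refine AffTable.aut_ext fun i => ?_
    change AffTable.constMap table table (outer (X.1 * Y.1)) (table.gen i) =
      AffTable.constMap table table (outer X.1) (AffTable.constMap table table (outer Y.1) (table.gen i))
    rw [AffTable.constMap_comp, AffTable.constMap_gen, AffTable.constMap_gen, LinearMap.comp_apply,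
      outer_outer]

theorem outerAut_vec (X : SL(2, ℂ)) (w : K4 → ℂ) :
    (outerAut X).1 (table.vec w) = table.vec (outer X.1 w) := AffTable.constMap_vec _ _

/-- The action of a matrix by conjugation on the currents and by multiplication on the odd part. -/
def inner (g : Matrix (Fin 2) (Fin 2) ℂ) : (K4 → ℂ) →ₗ[ℂ] (K4 → ℂ) where
  toFun w := mk (w .L)
    (g 0 0 ^ 2 * w .E - 2 * g 0 0 * g 0 1 * w .H - g 0 1 ^ 2 * w .F)
    ((g 0 0 * g 1 1 + g 0 1 * g 1 0) * w .H + g 0 1 * g 1 1 * w .F - g 0 0 * g 1 0 * w .E)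
    (g 1 1 ^ 2 * w .F + 2 * g 1 0 * g 1 1 * w .H - g 1 0 ^ 2 * w .E)
    (g 0 0 * w .x11 + g 0 1 * w .x21) (g 0 0 * w .x12 + g 0 1 * w .x22)
    (g 1 0 * w .x11 + g 1 1 * w .x21) (g 1 0 * w .x12 + g 1 1 * w .x22)
  map_add' u w := by ext1 k; cases k <;> simp [mk] <;> ring
  map_smul' c w := by ext1 k; cases k <;> simp [mk] <;> ring

theorem inner_apply (g : Matrix (Fin 2) (Fin 2) ℂ) (w : K4 → ℂ) : inner g w = mk (w .L)
    (g 0 0 ^ 2 * w .E - 2 * g 0 0 * g 0 1 * w .H - g 0 1 ^ 2 * w .F)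
    ((g 0 0 * g 1 1 + g 0 1 * g 1 0) * w .H + g 0 1 * g 1 1 * w .F - g 0 0 * g 1 0 * w .E)
    (g 1 1 ^ 2 * w .F + 2 * g 1 0 * g 1 1 * w .H - g 1 0 ^ 2 * w .E)
    (g 0 0 * w .x11 + g 0 1 * w .x21) (g 0 0 * w .x12 + g 0 1 * w .x22)
    (g 1 0 * w .x11 + g 1 1 * w .x21) (g 1 0 * w .x12 + g 1 1 * w .x22) := rfl

theorem inner_inner (g h : Matrix (Fin 2) (Fin 2) ℂ) (w : K4 → ℂ) :
    inner g (inner h w) = inner (g * h) w := by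
  simp only [inner_apply, Matrix.mul_apply, Fin.sum_univ_two]
  ext1 k
  cases k <;> simp only [mk] <;> ring

theorem inner_one (w : K4 → ℂ) : inner 1 w = w := by
  ext1 k
  cases k <;> simp [inner_apply, mk]

theorem inner_outer (g X : Matrix (Fin 2) (Fin 2) ℂ) (w : K4 → ℂ) :
    inner g (outer X w) = outer X (inner g w) := by
  simp only [inner_apply, outer_apply]
  ext1 k
  cases k <;> simp only [mk] <;> ring

theorem inner_isConstHom (g : SL(2, ℂ)) : AffTable.IsConstHom table table (inner g.1) := by
  have hg := det_eq g
  refine ⟨fun i k => ?_, fun x y => ?_, fun x y => ?_, fun x y => ?_⟩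
  · change par k ≠ par i → _
    rw [inner_apply]
    intro h
    cases k <;> cases i <;> first | exact absurd rfl h | simp [mk]
  · rw [form_a, form_a, inner_apply, inner_apply, inner_apply]
    ext1 k
    cases k <;> simp only [mk, smul_eq_mul] <;> grind
  · rw [form_b, form_b, inner_apply, inner_apply, inner_apply]
    ext1 k
    cases k <;> simp only [mk, smul_eq_mul] <;> grind
  · rw [form_c, form_c, inner_apply, inner_apply, inner_apply]
    ext1 k
    cases k <;> simp only [mk, smul_eq_mul] <;> grind

/-- The action of `SL₂(ℂ)` by inner automorphisms. -/
def innerAut : SL(2, ℂ) →* Aut table.conf where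
  toFun X := AffTable.constAut (inner X.1) (inner (X⁻¹).1) (inner_isConstHom X)
    (inner_isConstHom X⁻¹) (fun w => by rw [inner_inner, inv_mul_val, inner_one])
    (fun w => by rw [inner_inner, mul_inv_val, inner_one])
  map_one' := by
    refine AffTable.aut_ext fun i => ?_
    rw [AffTable.constAut_apply, AffTable.constMap_gen]
    change table.vec (inner 1 _) = table.gen i
    rw [inner_one, AffTable.vec_single]
  map_mul' X Y := by
    refine AffTable.aut_ext fun i => ?_
    change AffTable.constMap table table (inner (X.1 * Y.1)) (table.gen i) =
      AffTable.constMap table table (inner X.1) (AffTable.constMap table table (inner Y.1) (table.gen i))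
    rw [AffTable.constMap_comp, AffTable.constMap_gen, AffTable.constMap_gen, LinearMap.comp_apply,
      inner_inner]

theorem innerAut_vec (X : SL(2, ℂ)) (w : K4 → ℂ) :
    (innerAut X).1 (table.vec w) = table.vec (inner X.1 w) := AffTable.constMap_vec _ _

theorem innerAut_outerAut (g X : SL(2, ℂ)) : innerAut g * outerAut X = outerAut X * innerAut g := by
  refine AffTable.aut_ext fun i => ?_
  change (innerAut g).1 ((outerAut X).1 (table.gen i)) = (outerAut X).1 ((innerAut g).1 (table.gen i))
  rw [← AffTable.vec_single, outerAut_vec, innerAut_vec, innerAut_vec, outerAut_vec, inner_outer]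

theorem isVir : AffTable.IsVir table .L wt where
  lie := isLie
  parL := rfl
  aL i := by cases i <;> rfl
  bL i := rfl
  cL i := rfl
  wtL := rfl
  wt_even i := by
    change par i = 0 → _
    cases i <;> simp [par, wt]
  wt_odd i := by
    change par i = 1 → _
    cases i <;> simp [par, wt]
  cur i j := by
    change par i = 0 → _ → par j = 1 → cb i j = 0
    cases i <;> cases j <;> simp [par, cb, co]
  faithful q h0 hL ha := by
    have a1 := ha .x11 rfl
    have a2 := ha .x21 rfl
    rw [form_a] at a1 a2
    have b1 := congrFun a1 .x11
    have b2 := congrFun a1 .x21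
    have b3 := congrFun a2 .x11
    simp [mk] at b1 b2 b3
    have c1 : q .x11 = 0 := h0 _ rfl
    have c2 : q .x12 = 0 := h0 _ rfl
    have c3 : q .x21 = 0 := h0 _ rfl
    have c4 : q .x22 = 0 := h0 _ rfl
    ext1 k
    cases k <;> simp_all
  exists_odd := ⟨.x11, rfl⟩

end K4

theorem I2.isVir : AffTable.IsVir I2.table .L I2.wt where
  lie := I2.isLie
  parL := rfl
  aL i := by cases i <;> rfl
  bL i := rfl
  cL i := rfl
  wtL := rfl
  wt_even i := by
    change par2 i = 0 → _
    cases i <;> simp [par2, I2.wt]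
  wt_odd i := by
    change par2 i = 1 → _
    cases i <;> simp [par2, I2.wt]
  cur i j := by
    change par2 i = 0 → _ → par2 j = 1 → I2.cb i j = 0
    cases i <;> cases j <;> simp [par2, I2.cb]
  faithful q h0 hL ha := by
    have a1 := ha .Gp rfl
    rw [I2.form_a] at a1
    have b1 := congrFun a1 .Gp
    simp [I2.mk] at b1
    have c1 : q .Gp = 0 := h0 _ rfl
    have c2 : q .Gm = 0 := h0 _ rfl
    ext1 k
    cases k <;> simp_all
  exists_odd := ⟨.Gp, rfl⟩

/-! ### Gauge transformations by powers of t -/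

theorem deltaT_tpow' (q : ℚ) : deltaT (tpow q) = (q : ℂ) • (tpow (-1) * tpow q) := by
  rw [deltaT_tpow, tpow_mul, show q - 1 = -1 + q by ring]

theorem tpow_mul_tpow_neg (q : ℚ) : tpow q * tpow (-q) = 1 := by
  rw [tpow_mul, add_neg_cancel, tpow_zero]


namespace AffTable

variable {ι : Type} [Fintype ι] [DecidableEq ι] {t : AffTable ι}

theorem twisted_vecS (ξ : RootSystem) {e : Twist t.conf} {M : (ι → ℂ) →ₗ[ℂ] (ι → ℂ)}
    (h : ∀ w, e.σ.1 (t.vec w) = t.vec (M w)) (w : ι → SHat) : twisted ξ e (t.vecS w) =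
      t.vecS (∑ i, fun k => M (Pi.single i 1) k • galois ξ (w i)) := by
  rw [vecS_apply, map_sum, map_sum]
  refine Finset.sum_congr rfl fun i _ => ?_
  rw [twisted_tmul, ← vec_single, h, vec_tmul]

/-- The last hypothesis says that over the ring of fractional powers of `t` the two automorphisms
become equivalent: `U` carries the action defined by `M` to the one defined by `N` combined with the
Galois action. -/
theorem loop_iso_of_gauge (ξ : RootSystem) (hLie : t.conf.IsLie) {d e : Twist t.conf}
    {U V : (ι → ℂ) →ₗ[ℂ] (ι → SHat)} {M N : (ι → ℂ) →ₗ[ℂ] (ι → ℂ)} (hU : IsLoopHom t t U)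
    (hV : IsLoopHom t t V)
    (h₁ : ∀ i, ∑ k, (fun j => U (Pi.single i 1) k * V (Pi.single k 1) j) = Pi.single i 1)
    (h₂ : ∀ i, ∑ k, (fun j => V (Pi.single i 1) k * U (Pi.single k 1) j) = Pi.single i 1)
    (hd : ∀ w, d.σ.1 (t.vec w) = t.vec (M w)) (he : ∀ w, e.σ.1 (t.vec w) = t.vec (N w))
    (h : ∀ w, U (M w) = ∑ i, fun k => N (Pi.single i 1) k • galois ξ (U w i)) :
    Iso (loop ξ d) (loop ξ e) := by
  refine loop_iso_of_loopHom ξ hLie hU hV h₁ h₂ fun i => ?_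
  rw [twisted_vecS ξ he, ← h, ← vec_single, hd, loopMap_tmul, lift_vec_vecS, sm_one]

end AffTable

namespace I2

/-- The gauge transformation by `t^s`. -/
def gauge (s : ℚ) : (I2 → ℂ) →ₗ[ℂ] (I2 → SHat) where
  toFun w := mk (w .L • 1) (w .J • 1 + (w .L * s) • tpow (-1)) (w .Gp • tpow s) (w .Gm • tpow (-s))
  map_add' u w := by ext1 k; cases k <;> simp [mk] <;> module
  map_smul' c w := by ext1 k; cases k <;> simp [mk] <;> module

theorem gauge_apply (s : ℚ) (w : I2 → ℂ) : gauge s w =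
    mk (w .L • 1) (w .J • 1 + (w .L * s) • tpow (-1)) (w .Gp • tpow s) (w .Gm • tpow (-s)) := rfl

/-- The summand s t⁻¹ J in the image of L is the logarithmic derivative of t^s. It compensates for
the derivative of t^{±s} in the images of G^±, so that the image of L still acts by its 0-product as
the derivation on these images. -/
theorem gauge_isLoopHom (s : ℚ) : AffTable.IsLoopHom table table (gauge s) := by
  -- With d/dt written as multiplication by a multiple of t⁻¹ on each power involved, every
  -- condition becomes a polynomial identity in t^s, t^{-s}, t⁻¹ and the relation t^s t^{-s} = 1.
  have hT := tpow_mul_tpow_neg s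
  have hr := deltaT_tpow' (-1)
  have h1 := deltaT_tpow' s
  have h2 := deltaT_tpow' (-s)
  have h0 := deltaT_one
  have hh : (2 : SHat) * algebraMap ℂ SHat (1 / 2) = 1 := by
    rw [← map_ofNat (algebraMap ℂ SHat) 2, ← map_mul, show (2 : ℂ) * (1 / 2) = 1 by norm_num, map_one]
  have h3 : algebraMap ℂ SHat (3 / 2) = 3 * algebraMap ℂ SHat (1 / 2) := by
    rw [show (3 / 2 : ℂ) = 3 * (1 / 2) by norm_num, map_mul, map_ofNat]
  have hs : ((-s : ℚ) : ℂ) = -(s : ℂ) := by push_cast; rfl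
  have h11 : ((-1 : ℚ) : ℂ) = -1 := by push_cast; rfl
  rw [hs] at h2
  rw [h11] at hr
  refine ⟨fun i k => ?_, fun x y => ?_, fun x y => ?_, fun x y => ?_⟩
  · change par2 k ≠ par2 i → _
    rw [gauge_apply]
    intro h
    cases k <;> cases i <;> first | exact absurd rfl h | simp [mk]
  · rw [form_a, form_a, form_b, form_c, gauge_apply, gauge_apply, gauge_apply]
    ext1 k
    cases k <;> simp only [mk, Pi.add_apply, Pi.sub_apply, map_add, map_sub, map_smul, deltaT_mul,
      h0, h1, h2, hr, smul_eq_mul, smul_zero, mul_zero, zero_mul, add_zero, zero_add]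
    · simp only [Algebra.smul_def, map_add, map_mul, map_sub, map_neg, map_one, map_ofNat, h3]
      grind
    · simp only [Algebra.smul_def, map_add, map_mul, map_sub, map_neg, map_one, map_ofNat, h3]
      grind
    · simp only [Algebra.smul_def, map_add, map_mul, map_sub, map_neg, map_one, map_ofNat, h3]
      grind
    · simp only [Algebra.smul_def, map_add, map_mul, map_sub, map_neg, map_one, map_ofNat, h3]
      grind
  · rw [form_b, form_b, gauge_apply, gauge_apply, gauge_apply]
    ext1 k
    cases k <;> simp only [mk, smul_eq_mul, mul_one, map_ofNat] <;>
      simp only [Algebra.smul_def, map_add, map_mul, map_sub, map_neg, map_one, map_ofNat, h3] <;>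
      grind
  · rw [form_c, form_c, gauge_apply, gauge_apply, gauge_apply]
    ext1 k
    cases k <;> simp only [mk, smul_eq_mul, mul_one, map_ofNat] <;>
      simp only [Algebra.smul_def, map_add, map_mul, map_sub, map_neg, map_one, map_ofNat, h3] <;>
      grind

theorem sum_gauge (s : ℚ) (w : I2 → SHat) : ∑ i, (fun k => w i * gauge s (Pi.single i 1) k) =
    mk (w .L) (w .J + (s : ℂ) • (w .L * tpow (-1))) (w .Gp * tpow s) (w .Gm * tpow (-s)) := by
  ext1 k
  rw [Finset.sum_apply, sum_univ]
  cases k <;> simp [gauge_apply, mk]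
  ring

theorem gauge_gauge (s r : ℚ) (h : s + r = 0) (i : I2) :
    ∑ k, (fun j => gauge s (Pi.single i 1) k * gauge r (Pi.single k 1) j) = Pi.single i 1 := by
  have hr : r = -s := by linarith
  subst hr
  rw [sum_gauge]
  have h1 := tpow_mul_tpow_neg s
  have h2 : tpow (-s) * tpow s = 1 := by rw [mul_comm, h1]
  ext1 k
  cases k <;> cases i <;> simp [gauge_apply, mk, h1, h2]

/-- An automorphism that fixes `L` and `J` gives the untwisted loop algebra. -/
theorem loop_iso_one (ξ : RootSystem) (q : ℚ) (d e : Twist table.conf)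
    (hd : ∀ w, d.σ.1 (table.vec w) =
      table.vec (mk (w .L) (w .J) (expQ ξ q * w .Gp) (expQ ξ (-q) * w .Gm)))
    (he : e.σ = 1) : Iso (loop ξ d) (loop ξ e) := by
  let M : (I2 → ℂ) →ₗ[ℂ] (I2 → ℂ) :=
    { toFun := fun w => mk (w .L) (w .J) (expQ ξ q * w .Gp) (expQ ξ (-q) * w .Gm)
      map_add' := fun u w => by ext1 k; cases k <;> simp [mk] <;> ring
      map_smul' := fun c w => by ext1 k; cases k <;> simp [mk] <;> ring }
  -- The exponent is -q because the Galois action multiplies t^{-q} by e(q), the eigenvalue to be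
  -- removed.
  refine AffTable.loop_iso_of_gauge ξ isLie (U := gauge (-q)) (V := gauge q) (M := M)
    (N := LinearMap.id) (gauge_isLoopHom _) (gauge_isLoopHom _) (gauge_gauge _ _ (by ring))
    (gauge_gauge _ _ (by ring)) hd (fun w => by rw [he]; rfl) fun w => ?_
  have h1 : galois ξ (tpow (-1)) = tpow (-1) := by
    rw [galois_tpow, neg_neg, ← Int.cast_one, expQ_int, one_smul]
  ext1 k
  rw [Finset.sum_apply, sum_univ]
  simp only [gauge_apply]
  cases k <;> simp [M, mk, galois_tpow, h1, smul_smul, mul_comm]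

end I2

namespace K4

/-- The gauge transformation by the diagonal matrix with entries `t^s` and `t^{-s}`. -/
def gauge (s : ℚ) : (K4 → ℂ) →ₗ[ℂ] (K4 → SHat) where
  toFun w := mk (w .L • 1) (w .E • (tpow s * tpow s)) (w .H • 1 + (w .L * s) • tpow (-1))
    (w .F • (tpow (-s) * tpow (-s))) (w .x11 • tpow s) (w .x12 • tpow s) (w .x21 • tpow (-s))
    (w .x22 • tpow (-s))
  map_add' u w := by ext1 k; cases k <;> simp [mk] <;> module
  map_smul' c w := by ext1 k; cases k <;> simp [mk] <;> module

theorem gauge_apply (s : ℚ) (w : K4 → ℂ) : gauge s w =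
    mk (w .L • 1) (w .E • (tpow s * tpow s)) (w .H • 1 + (w .L * s) • tpow (-1))
    (w .F • (tpow (-s) * tpow (-s))) (w .x11 • tpow s) (w .x12 • tpow s) (w .x21 • tpow (-s))
    (w .x22 • tpow (-s)) := rfl

set_option maxHeartbeats 1000000 in
theorem gauge_isLoopHom (s : ℚ) : AffTable.IsLoopHom table table (gauge s) := by
  have hT := tpow_mul_tpow_neg s
  have hr := deltaT_tpow' (-1)
  have h1 := deltaT_tpow' s
  have h2 := deltaT_tpow' (-s)
  have h0 := deltaT_one
  have hh : (2 : SHat) * algebraMap ℂ SHat (1 / 2) = 1 := by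
    rw [← map_ofNat (algebraMap ℂ SHat) 2, ← map_mul, show (2 : ℂ) * (1 / 2) = 1 by norm_num, map_one]
  have h3 : algebraMap ℂ SHat (3 / 2) = 3 * algebraMap ℂ SHat (1 / 2) := by
    rw [show (3 / 2 : ℂ) = 3 * (1 / 2) by norm_num, map_mul, map_ofNat]
  have hs : ((-s : ℚ) : ℂ) = -(s : ℂ) := by push_cast; rfl
  have h11 : ((-1 : ℚ) : ℂ) = -1 := by push_cast; rfl
  rw [hs] at h2
  rw [h11] at hr
  refine ⟨fun i k => ?_, fun x y => ?_, fun x y => ?_, fun x y => ?_⟩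
  · change par k ≠ par i → _
    rw [gauge_apply]
    intro h
    cases k <;> cases i <;> first | exact absurd rfl h | simp [mk]
  · rw [form_a, form_a, form_b, form_c, gauge_apply, gauge_apply, gauge_apply]
    ext1 k
    cases k <;> simp only [mk, Pi.add_apply, Pi.sub_apply, map_add, map_sub, map_smul, deltaT_mul,
      h0, h1, h2, hr, smul_eq_mul, smul_zero, mul_zero, zero_mul, add_zero, zero_add] <;>
    · simp only [Algebra.smul_def, map_add, map_mul, map_sub, map_neg, map_one, map_ofNat, h3]
      grind
  · rw [form_b, form_b, gauge_apply, gauge_apply, gauge_apply]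
    ext1 k
    cases k <;> simp only [mk, smul_eq_mul, mul_one, map_ofNat] <;>
      simp only [Algebra.smul_def, map_add, map_mul, map_sub, map_neg, map_one, map_ofNat, h3] <;>
      grind
  · rw [form_c, form_c, gauge_apply, gauge_apply, gauge_apply]
    ext1 k
    cases k <;> simp only [mk, smul_eq_mul, mul_one, map_ofNat] <;>
      simp only [Algebra.smul_def, map_add, map_mul, map_sub, map_neg, map_one, map_ofNat, h3] <;>
      grind

theorem sum_gauge (s : ℚ) (w : K4 → SHat) : ∑ i, (fun k => w i * gauge s (Pi.single i 1) k) =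
    mk (w .L) (w .E * (tpow s * tpow s)) (w .H + (s : ℂ) • (w .L * tpow (-1)))
      (w .F * (tpow (-s) * tpow (-s))) (w .x11 * tpow s) (w .x12 * tpow s) (w .x21 * tpow (-s))
      (w .x22 * tpow (-s)) := by
  ext1 k
  rw [Finset.sum_apply, sum_univ]
  cases k <;> simp [gauge_apply, mk]
  ring

theorem gauge_gauge (s r : ℚ) (h : s + r = 0) (i : K4) :
    ∑ k, (fun j => gauge s (Pi.single i 1) k * gauge r (Pi.single k 1) j) = Pi.single i 1 := by
  have hr : r = -s := by linarith
  subst hr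
  rw [sum_gauge]
  have h1 := tpow_mul_tpow_neg s
  have h2 : tpow (-s) * tpow s = 1 := by rw [mul_comm, h1]
  have h3 : tpow s * tpow s * (tpow (-s) * tpow (-s)) = 1 := by rw [mul_mul_mul_comm, h1, one_mul]
  have h4 : tpow (-s) * tpow (-s) * (tpow s * tpow s) = 1 := by
    rw [mul_mul_mul_comm, h2, one_mul]
  ext1 k
  cases k <;> cases i <;> simp [gauge_apply, mk, h1, h2, h3, h4]

theorem sum_outer (X : Matrix (Fin 2) (Fin 2) ℂ) (w : K4 → SHat) :
    ∑ i, (fun k => outer X (Pi.single i 1) k • w i) = mk (w .L) (w .E) (w .H) (w .F)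
      (X 0 0 • w .x11 + X 0 1 • w .x12) (X 1 0 • w .x11 + X 1 1 • w .x12)
      (X 0 0 • w .x21 + X 0 1 • w .x22) (X 1 0 • w .x21 + X 1 1 • w .x22) := by
  ext1 k
  rw [Finset.sum_apply, sum_univ]
  cases k <;> simp [outer_apply, mk]

/-- The diagonal matrix with entries `a` and `a⁻¹`. -/
def torus (a : ℂ) (ha : a ≠ 0) : SL(2, ℂ) := ⟨!![a, 0; 0, a⁻¹], by simp [ha]⟩

/-- Inner automorphisms in the torus do not change the isomorphism class of a loop algebra. -/
theorem loop_iso_outer (ξ : RootSystem) (q : ℚ) (X : SL(2, ℂ)) (d e : Twist table.conf)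
    (hd : d.σ = innerAut (torus (expQ ξ q) (expQ_ne_zero ξ q)) * outerAut X)
    (he : e.σ = outerAut X) : Iso (loop ξ d) (loop ξ e) := by
  refine AffTable.loop_iso_of_gauge ξ isLie (U := gauge (-q)) (V := gauge q)
    (M := inner (torus (expQ ξ q) (expQ_ne_zero ξ q)).1 ∘ₗ outer X.1)
    (N := outer X.1) (gauge_isLoopHom _) (gauge_isLoopHom _) (gauge_gauge _ _ (by ring))
    (gauge_gauge _ _ (by ring)) (fun w => ?_) (fun w => by rw [he, outerAut_vec]) fun w => ?_
  · rw [hd, LinearMap.comp_apply, ← innerAut_vec, ← outerAut_vec]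
    rfl
  have h1 : galois ξ (tpow (-1)) = tpow (-1) := by
    rw [galois_tpow, neg_neg, ← Int.cast_one, expQ_int, one_smul]
  have h2 := expQ_neg ξ q
  rw [sum_outer, LinearMap.comp_apply]
  simp only [gauge_apply, inner_apply, outer_apply, torus]
  ext1 k
  cases k <;> simp [mk, galois_tpow, h1, h2, smul_smul, mul_inv_cancel₀ (expQ_ne_zero ξ q)] <;> try module

end K4

/-! ## Automorphisms of the `N = 2` conformal superalgebra -/

theorem loop_iso_of_conj (ξ : RootSystem) {A : ConfData} (τ : Aut A) {d d' : Twist A}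
    (h : τ * d.σ = d'.σ * τ) : Iso (loop ξ d) (loop ξ d') :=
  loop_iso_of_equiv ξ (e := τ.1) τ.2 fun a =>
    congrArg (fun s : Aut A => s.1 a) h

/-- Two automorphisms that agree on the generators are equal. -/
theorem AffTable.aut_ext_vec {ι : Type} [Fintype ι] [DecidableEq ι] {t : AffTable ι}
    {σ τ : Aut t.conf} (h : ∀ w, σ.1 (t.vec w) = τ.1 (t.vec w)) : σ = τ :=
  AffTable.aut_ext fun i => by rw [← AffTable.vec_single, h]

namespace I2

/-- The rescaling `G⁺ ↦ a G⁺`, `G⁻ ↦ b G⁻`. -/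
def scale (a b : ℂ) : (I2 → ℂ) →ₗ[ℂ] (I2 → ℂ) where
  toFun w := mk (w .L) (w .J) (a * w .Gp) (b * w .Gm)
  map_add' u w := by ext1 k; cases k <;> simp [mk] <;> ring
  map_smul' c w := by ext1 k; cases k <;> simp [mk] <;> ring

theorem scale_apply (a b : ℂ) (w : I2 → ℂ) :
    scale a b w = mk (w .L) (w .J) (a * w .Gp) (b * w .Gm) := rfl

theorem scale_isConstHom {a b : ℂ} (hab : a * b = 1) :
    AffTable.IsConstHom table table (scale a b) := by
  refine ⟨fun i k => ?_, fun x y => ?_, fun x y => ?_, fun x y => ?_⟩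
  · change par2 k ≠ par2 i → _
    rw [scale_apply]
    intro h
    cases k <;> cases i <;> first | exact absurd rfl h | simp [mk]
  · rw [form_a, form_a, scale_apply, scale_apply, scale_apply]
    ext1 k
    cases k <;> simp only [mk, smul_eq_mul] <;> grind
  · rw [form_b, form_b, scale_apply, scale_apply, scale_apply]
    ext1 k
    cases k <;> simp only [mk, smul_eq_mul] <;> grind
  · rw [form_c, form_c, scale_apply, scale_apply, scale_apply]
    ext1 k
    cases k <;> simp only [mk, smul_eq_mul] <;> grind

theorem scale_scale {a b : ℂ} (hab : a * b = 1) (w : I2 → ℂ) : scale b a (scale a b w) = w := by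
  rw [scale_apply, scale_apply]
  ext1 k
  cases k <;> simp only [mk] <;> grind

def scaleAut {a b : ℂ} (hab : a * b = 1) : Aut table.conf :=
  AffTable.constAut (scale a b) (scale b a) (scale_isConstHom hab)
    (scale_isConstHom ((mul_comm b a).trans hab)) (scale_scale hab)
    (scale_scale ((mul_comm b a).trans hab))

theorem scaleAut_vec {a b : ℂ} (hab : a * b = 1) (w : I2 → ℂ) :
    (scaleAut hab).1 (table.vec w) = table.vec (scale a b w) := AffTable.constMap_vec _ _

/-- The map `J ↦ -J`, `G⁺ ↔ G⁻`. -/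
def swap : (I2 → ℂ) →ₗ[ℂ] (I2 → ℂ) where
  toFun w := mk (w .L) (-w .J) (w .Gm) (w .Gp)
  map_add' u w := by ext1 k; cases k <;> simp [mk]; ring
  map_smul' c w := by ext1 k; cases k <;> simp [mk]

theorem swap_apply (w : I2 → ℂ) : swap w = mk (w .L) (-w .J) (w .Gm) (w .Gp) := rfl

theorem swap_isConstHom : AffTable.IsConstHom table table swap := by
  refine ⟨fun i k => ?_, fun x y => ?_, fun x y => ?_, fun x y => ?_⟩
  · change par2 k ≠ par2 i → _
    rw [swap_apply]
    intro h
    cases k <;> cases i <;> first | exact absurd rfl h | simp [mk]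
  · rw [form_a, form_a, swap_apply, swap_apply, swap_apply]
    ext1 k
    cases k <;> simp only [mk, smul_eq_mul] <;> ring
  · rw [form_b, form_b, swap_apply, swap_apply, swap_apply]
    ext1 k
    cases k <;> simp only [mk, smul_eq_mul] <;> ring
  · rw [form_c, form_c, swap_apply, swap_apply, swap_apply]
    ext1 k
    cases k <;> simp only [mk, smul_eq_mul] <;> ring

theorem swap_swap (w : I2 → ℂ) : swap (swap w) = w := by
  rw [swap_apply, swap_apply]
  ext1 k
  cases k <;> simp [mk]

def omega : Aut table.conf :=
  AffTable.constAut swap swap swap_isConstHom swap_isConstHom swap_swap swap_swap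

theorem omega_vec (w : I2 → ℂ) : omega.1 (table.vec w) = table.vec (swap w) :=
  AffTable.constMap_vec _ _

theorem omega_sq : omega ^ 2 = 1 := by
  refine AffTable.aut_ext_vec fun w => ?_
  rw [pow_two]
  change omega.1 (omega.1 (table.vec w)) = table.vec w
  rw [omega_vec, omega_vec, swap_swap]

theorem omega_isOmega : IsOmega omega := by
  have hs : ∀ i w, swap (Pi.single i 1) = w → omega.1 (table.gen i) = table.vec w := by
    intro i w h
    rw [← h, ← omega_vec, AffTable.vec_single]
  have hL : omega.1 (table.gen .L) = table.gen .L := by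
    rw [hs .L (Pi.single .L 1) (by ext1 k; cases k <;> simp [swap_apply, mk]), AffTable.vec_single]
  have hJ : omega.1 (table.gen .J) = -table.gen .J := by
    rw [hs .J (-Pi.single .J 1) (by ext1 k; cases k <;> simp [swap_apply, mk]),
      AffTable.vec_neg, AffTable.vec_single]
  have hp : omega.1 (table.gen .Gp) = table.gen .Gm := by
    rw [hs .Gp (Pi.single .Gm 1) (by ext1 k; cases k <;> simp [swap_apply, mk]),
      AffTable.vec_single]
  have hm : omega.1 (table.gen .Gm) = table.gen .Gp := by
    rw [hs .Gm (Pi.single .Gp 1) (by ext1 k; cases k <;> simp [swap_apply, mk]),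
      AffTable.vec_single]
  exact ⟨hL, hJ, hp, hm⟩

theorem eq_sum (w : I2 → ℂ) : w =
    w .L • (Pi.single .L 1 : I2 → ℂ) + w .J • (Pi.single .J 1 : I2 → ℂ) +
    w .Gp • (Pi.single .Gp 1 : I2 → ℂ) + w .Gm • (Pi.single .Gm 1 : I2 → ℂ) := by
  ext1 k
  cases k <;> simp

/-- Preservation of weights makes J an eigenvector and the span of G⁺, G⁻ stable. The brackets [J,
G^±] = ±G^± force J ↦ ±J and send G^± to multiples of themselves or of each other, and [G⁺, G⁻]
fixes the product of the two factors. -/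
theorem aut_cases (σ : Aut table.conf) : ∃ a b : ℂ, a * b = 1 ∧
    ((∀ w, σ.1 (table.vec w) = table.vec (scale a b w)) ∨
      ∀ w, σ.1 (table.vec w) = table.vec (scale a b (swap w))) := by
  obtain ⟨M, hM, hσ, hL, hΔ⟩ := isVir.exists_const σ
  have hJ : M (Pi.single .J 1) = mk 0 (M (Pi.single .J 1) .J) 0 0 := by
    ext1 k
    cases k
    · exact hΔ _ _ (by norm_num [wt])
    · rfl
    · exact hΔ _ _ (by norm_num [wt])
    · exact hΔ _ _ (by norm_num [wt])
  have hp : M (Pi.single .Gp 1) = mk 0 0 (M (Pi.single .Gp 1) .Gp) (M (Pi.single .Gp 1) .Gm) := by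
    ext1 k
    cases k
    · exact hΔ _ _ (by norm_num [wt])
    · exact hΔ _ _ (by norm_num [wt])
    · rfl
    · rfl
  have hm : M (Pi.single .Gm 1) = mk 0 0 (M (Pi.single .Gm 1) .Gp) (M (Pi.single .Gm 1) .Gm) := by
    ext1 k
    cases k
    · exact hΔ _ _ (by norm_num [wt])
    · exact hΔ _ _ (by norm_num [wt])
    · rfl
    · rfl
  generalize M (Pi.single .J 1) .J = j at hJ
  generalize M (Pi.single .Gp 1) .Gp = a at hp
  generalize M (Pi.single .Gp 1) .Gm = b at hp
  generalize M (Pi.single .Gm 1) .Gp = c at hm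
  generalize M (Pi.single .Gm 1) .Gm = d at hm
  have e1 := hM.ha (Pi.single .J 1) (Pi.single .Gp 1)
  have e2 := hM.ha (Pi.single .J 1) (Pi.single .Gm 1)
  have e3 := hM.ha (Pi.single .Gp 1) (Pi.single .Gm 1)
  rw [AffTable.form_single, show table.a .J .Gp = Pi.single .Gp 1 from rfl, hJ, hp, form_a] at e1
  rw [AffTable.form_single, show table.a .J .Gm = -Pi.single .Gm 1 from
    (Pi.single_neg _ _), map_neg, hJ, hm, form_a] at e2
  rw [AffTable.form_single, show table.a .Gp .Gm = Pi.single .L 1 from rfl, hp, hm, hL, form_a] at e3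
  have f1 := congrFun e1 .Gp
  have f2 := congrFun e1 .Gm
  have f3 := congrFun e2 .Gp
  have f4 := congrFun e2 .Gm
  have f5 := congrFun e3 .L
  simp only [mk, Pi.neg_apply, Pi.single_eq_same, zero_mul, mul_zero, sub_zero, zero_sub] at f1 f2 f3 f4 f5
  by_cases ha : a = 0
  · subst ha
    have hj : j = -1 := by grind
    have hd : d = 0 := by grind
    subst hj hd
    refine ⟨c, b, by grind, .inr fun w => ?_⟩
    rw [hσ]
    congr 1
    conv_lhs => rw [eq_sum w]
    simp only [map_add, map_smul, hL, hJ, hp, hm, scale_apply, swap_apply]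
    ext1 k
    cases k <;> simp [mk] <;> ring
  · have hj : j = 1 := by grind
    have hb : b = 0 := by grind
    have hc : c = 0 := by grind
    subst hj hb hc
    refine ⟨a, d, by grind, .inl fun w => ?_⟩
    rw [hσ]
    congr 1
    conv_lhs => rw [eq_sum w]
    simp only [map_add, map_smul, hL, hJ, hp, hm, scale_apply]
    ext1 k
    cases k <;> simp [mk] <;> ring

/-- Every twisted loop algebra is the untwisted one or that of `ω`. -/
theorem loop_iso_cases (ξ : RootSystem) (d : Twist table.conf) :
    Iso (loop ξ d) (loop ξ ⟨(1 : Aut table.conf), 1, one_pos, one_pow 1⟩) ∨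
      Iso (loop ξ d) (loop ξ ⟨omega, 2, two_pos, omega_sq⟩) := by
  obtain ⟨a, b, hab, h | h⟩ := aut_cases d.σ
  · left
    have h1 : d.σ.1 (table.vec (Pi.single .Gp 1)) = a • table.vec (Pi.single .Gp 1) := by
      rw [h, ← AffTable.vec_smul]
      congr 1
      ext1 k
      cases k <;> simp [scale_apply, mk]
    have h2 := d.pow_apply _ _ h1
    rw [← AffTable.vec_smul] at h2
    have h3 := congrFun (table.vec_injective h2) .Gp
    simp only [Pi.single_eq_same, Pi.smul_apply, smul_eq_mul, mul_one] at h3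
    -- The finite order of σ makes the scaling factor a root of unity.
    obtain ⟨q, hq⟩ := exists_expQ_eq ξ d.pos h3.symm
    refine loop_iso_one ξ q d _ (fun w => ?_) rfl
    have hb : expQ ξ (-q) = b := by
      rw [expQ_neg, hq]
      exact inv_eq_of_mul_eq_one_right hab
    rw [h, hb, hq, scale_apply]
  · right
    -- Conjugation by the scaling (c, c⁻¹) multiplies the factor in σ(G⁺) = b G⁻ by c⁻², so a square
    -- root of `b` is needed.
    obtain ⟨c, hc⟩ := IsAlgClosed.exists_pow_nat_eq b two_pos
    have hb0 : b ≠ 0 := right_ne_zero_of_mul_eq_one hab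
    have hc0 : c ≠ 0 := by rintro rfl; apply hb0; rw [← hc]; simp
    refine loop_iso_of_conj ξ (scaleAut (mul_inv_cancel₀ hc0)) (AffTable.aut_ext_vec fun w => ?_)
    change (scaleAut (mul_inv_cancel₀ hc0)).1 (d.σ.1 (table.vec w)) =
      omega.1 ((scaleAut (mul_inv_cancel₀ hc0)).1 (table.vec w))
    rw [h, scaleAut_vec, scaleAut_vec, omega_vec]
    congr 1
    have hi := mul_inv_cancel₀ hc0
    ext1 k
    cases k <;> simp only [scale_apply, swap_apply, mk] <;> grind

end I2

/-! ## The automorphism group of the matrix model -/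

namespace K4

theorem eq_sum (w : K4 → ℂ) : w =
    w .L • (Pi.single .L 1 : K4 → ℂ) + w .E • (Pi.single .E 1 : K4 → ℂ) +
    w .H • (Pi.single .H 1 : K4 → ℂ) + w .F • (Pi.single .F 1 : K4 → ℂ) +
    w .x11 • (Pi.single .x11 1 : K4 → ℂ) + w .x12 • (Pi.single .x12 1 : K4 → ℂ) +
    w .x21 • (Pi.single .x21 1 : K4 → ℂ) + w .x22 • (Pi.single .x22 1 : K4 → ℂ) := by
  ext1 k
  cases k <;> simp

/-- The matrix of a current. -/
def cm (w : K4 → ℂ) : Matrix (Fin 2) (Fin 2) ℂ := !![w .H, w .E; w .F, -w .H]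

/-- The matrix of an odd element. -/
def om (w : K4 → ℂ) : Matrix (Fin 2) (Fin 2) ℂ := !![w .x11, w .x12; w .x21, w .x22]

/-- Elements without odd part act on the odd matrices by left multiplication; this identifies the
currents with 2×2 matrices. -/
theorem om_form_a {u : K4 → ℂ} (h : om u = 0) (w : K4 → ℂ) :
    om (form table.a u w) = cm u * om w := by
  have h1 : u .x11 = 0 := congrFun (congrFun h 0) 0
  have h2 : u .x12 = 0 := congrFun (congrFun h 0) 1
  have h3 : u .x21 = 0 := congrFun (congrFun h 1) 0
  have h4 : u .x22 = 0 := congrFun (congrFun h 1) 1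
  rw [form_a]
  ext i j
  fin_cases i <;> fin_cases j <;> simp [om, cm, mk, Matrix.mul_apply, h1, h2, h3, h4] <;> ring

/-- A system of matrices with the multiplication table of `E, H, F` is conjugate to it. -/
theorem exists_conj_of_triple {NE NH NF : Matrix (Fin 2) (Fin 2) ℂ} (htr : NH.trace = 0)
    (hHH : NH * NH = 1) (hHF : NH * NF = -NF) (hEH : NE * NH = -NE) (hFF : NF * NF = 0)
    (hEF : NE * NF + NF * NE = 1) : ∃ g : SL(2, ℂ), NE * g.1 = g.1 * !![0, 1; 0, 0] ∧
      NH * g.1 = g.1 * !![1, 0; 0, -1] ∧ NF * g.1 = g.1 * !![0, 0; 1, 0] := by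
  obtain ⟨v, hv0, hv⟩ : ∃ v : Fin 2 → ℂ, v ≠ 0 ∧ NH.mulVec v = v := by
    -- The columns of NH + 1 are eigenvectors for 1 or zero. If all were zero, NH would be -1,
    -- contradicting trace 0.
    have h0 : NH * (NH + 1) = NH + 1 := by rw [mul_add, hHH, mul_one, add_comm]
    by_contra! hno
    have hcol : ∀ j, (fun i => (NH + 1) i j) = 0 := by
      intro j
      by_contra hne
      refine hno _ hne ?_
      ext i
      exact congrFun (congrFun h0 i) j
    have h1 := congrFun (hcol 0) 0
    have h2 := congrFun (hcol 1) 1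
    rw [Matrix.trace_fin_two] at htr
    simp at h1 h2
    have : (2 : ℂ) = 0 := by linear_combination h1 + h2 - htr
    norm_num at this
  set w := NF.mulVec v with hw
  have hHw : NH.mulVec w = -w := by
    rw [hw, Matrix.mulVec_mulVec, hHF, Matrix.neg_mulVec]
  have hFw : NF.mulVec w = 0 := by
    rw [hw, Matrix.mulVec_mulVec, hFF, Matrix.zero_mulVec]
  have hEv : NE.mulVec v = 0 := by
    have : NE.mulVec v = -NE.mulVec v := by
      conv_lhs => rw [← hv, Matrix.mulVec_mulVec, hEH, Matrix.neg_mulVec]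
    exact eq_zero_of_eq_neg this
  have hEw : NE.mulVec w = v := by
    have h1 := congrArg (fun A => Matrix.mulVec A v) hEF
    simp only [Matrix.add_mulVec, ← Matrix.mulVec_mulVec, hEv, Matrix.mulVec_zero, add_zero,
      Matrix.one_mulVec] at h1
    exact h1
  have hdet : v 0 * w 1 - w 0 * v 1 ≠ 0 := by
    intro hdet
    obtain ⟨c, hc⟩ : ∃ c : ℂ, w = c • v := by
      by_cases h0 : v 0 = 0
      · have h1 : v 1 ≠ 0 := by
          intro h1
          apply hv0
          ext i
          fin_cases i <;> assumption
        refine ⟨w 1 / v 1, ?_⟩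
        ext i
        fin_cases i
        · simp only [Fin.zero_eta, Pi.smul_apply, smul_eq_mul, h0, mul_zero]
          rw [h0, zero_mul, zero_sub, neg_eq_zero] at hdet
          exact (mul_eq_zero.mp hdet).resolve_right h1
        · simp [h1]
      · refine ⟨w 0 / v 0, ?_⟩
        ext i
        fin_cases i
        · simp [h0]
        · simp only [Fin.mk_one, Pi.smul_apply, smul_eq_mul]
          field_simp
          linear_combination hdet
    have h1 : w = 0 := by
      apply eq_zero_of_eq_neg
      rw [← hHw, hc, Matrix.mulVec_smul, hv]
    apply hv0
    rw [← hEw, h1, Matrix.mulVec_zero]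
  -- Dividing both vectors by a square root of their determinant puts the conjugating matrix into
  -- SL₂.
  obtain ⟨s, hs⟩ := IsAlgClosed.exists_pow_nat_eq (v 0 * w 1 - w 0 * v 1) two_pos
  have hs0 : s ≠ 0 := by rintro rfl; apply hdet; rw [← hs]; simp
  have e1 : ∀ i, NE i 0 * v 0 + NE i 1 * v 1 = 0 := fun i => by
    simpa [Matrix.mulVec, dotProduct] using congrFun hEv i
  have e2 : ∀ i, NE i 0 * w 0 + NE i 1 * w 1 = v i := fun i => by
    simpa [Matrix.mulVec, dotProduct] using congrFun hEw i
  have e3 : ∀ i, NH i 0 * v 0 + NH i 1 * v 1 = v i := fun i => by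
    simpa [Matrix.mulVec, dotProduct] using congrFun hv i
  have e4 : ∀ i, NH i 0 * w 0 + NH i 1 * w 1 = -w i := fun i => by
    simpa [Matrix.mulVec, dotProduct] using congrFun hHw i
  have e5 : ∀ i, NF i 0 * v 0 + NF i 1 * v 1 = w i := fun i => by
    rw [hw]; fin_cases i <;> simp [Matrix.mulVec, dotProduct]
  have e6 : ∀ i, NF i 0 * w 0 + NF i 1 * w 1 = 0 := fun i => by
    simpa [Matrix.mulVec, dotProduct] using congrFun hFw i
  refine ⟨⟨!![s⁻¹ * v 0, s⁻¹ * w 0; s⁻¹ * v 1, s⁻¹ * w 1], ?_⟩, ?_, ?_, ?_⟩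
  · rw [Matrix.det_fin_two_of]
    field_simp
    linear_combination -hs
  all_goals
    ext i j
    fin_cases i <;> fin_cases j <;> simp [Matrix.mul_apply]
  · linear_combination s⁻¹ * e1 0
  · linear_combination s⁻¹ * e2 0
  · linear_combination s⁻¹ * e1 1
  · linear_combination s⁻¹ * e2 1
  · linear_combination s⁻¹ * e3 0
  · linear_combination s⁻¹ * e4 0
  · linear_combination s⁻¹ * e3 1
  · linear_combination s⁻¹ * e4 1
  · linear_combination s⁻¹ * e5 0
  · linear_combination s⁻¹ * e6 0
  · linear_combination s⁻¹ * e5 1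
  · linear_combination s⁻¹ * e6 1

theorem eq_current {M : (K4 → ℂ) →ₗ[ℂ] (K4 → ℂ)}
    (hΔ : ∀ j k, wt k ≠ wt j → M (Pi.single j 1) k = 0) {j : K4} (hj : wt j = 1) :
    om (M (Pi.single j 1)) = 0 ∧ M (Pi.single j 1) .L = 0 := by
  constructor
  · ext a b
    fin_cases a <;> fin_cases b <;> exact hΔ _ _ (by rw [hj]; norm_num [wt])
  · exact hΔ _ _ (by rw [hj]; norm_num [wt])

theorem inner_eq_of_conj {g : SL(2, ℂ)} {u y : K4 → ℂ} (hu : om u = 0) (hL : u .L = 0)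
    (hy : om y = 0) (hyL : y .L = 0) (h : cm u * g.1 = g.1 * cm y) : u = inner g.1 y := by
  have h1 : u .x11 = 0 := congrFun (congrFun hu 0) 0
  have h2 : u .x12 = 0 := congrFun (congrFun hu 0) 1
  have h3 : u .x21 = 0 := congrFun (congrFun hu 1) 0
  have h4 : u .x22 = 0 := congrFun (congrFun hu 1) 1
  have k1 : y .x11 = 0 := congrFun (congrFun hy 0) 0
  have k2 : y .x12 = 0 := congrFun (congrFun hy 0) 1
  have k3 : y .x21 = 0 := congrFun (congrFun hy 1) 0
  have k4 : y .x22 = 0 := congrFun (congrFun hy 1) 1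
  have hg := det_eq g
  have a1 := congrFun (congrFun h 0) 0
  have a2 := congrFun (congrFun h 0) 1
  have a3 := congrFun (congrFun h 1) 0
  have a4 := congrFun (congrFun h 1) 1
  simp only [cm, Matrix.mul_apply, Fin.sum_univ_two, Matrix.of_apply, Matrix.cons_val', Matrix.cons_val_zero,
    Matrix.cons_val_one, Matrix.cons_val_fin_one] at a1 a2 a3 a4
  rw [inner_apply]
  ext1 k
  cases k <;> simp only [mk, h1, h2, h3, h4, k1, k2, k3, k4, hL, hyL, mul_zero, add_zero]
  · linear_combination (-u .E) * hg - g.1 0 1 * a1 + g.1 0 0 * a2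
  · linear_combination (-u .H) * hg + g.1 1 1 * a1 - g.1 1 0 * a2
  · linear_combination (-u .F) * hg + g.1 1 1 * a3 - g.1 1 0 * a4

/-- The matrices of the images of E, H, F satisfy the same relations as E, H, F, because they
represent the same action on the odd part. Two such systems are conjugate, and the conjugating
matrix is `g`. -/
theorem exists_inner (σ : Aut table.conf) : ∃ g : SL(2, ℂ), ∀ j, wt j = 1 →
    σ.1 (table.gen j) = (innerAut g).1 (table.gen j) := by
  obtain ⟨M, hM, hσ, hL, hΔ⟩ := isVir.exists_const σ
  obtain ⟨M', hM', hσ', hL', hΔ'⟩ := isVir.exists_const σ⁻¹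
  have hMM : ∀ w, M (M' w) = w := by
    intro w
    apply table.vec_injective
    rw [← hσ, ← hσ']
    exact LinearEquiv.apply_symm_apply σ.1 _
  -- With `M x` the identity matrix, the matrix of the image of a current is read off by letting the
  -- current act on `x`, and products of such matrices by acting twice.
  obtain ⟨x, hx⟩ : ∃ x, x = M' (Pi.single K4.x11 1 + Pi.single K4.x22 1) := ⟨_, rfl⟩
  have hx1 : om (M x) = 1 := by
    rw [hx, hMM]
    ext i j
    fin_cases i <;> fin_cases j <;> simp [om]
  have hev : ∀ k, wt k ≠ 3 / 2 → x k = 0 := by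
    intro k hk
    rw [hx, map_add, Pi.add_apply, hΔ' _ _ hk, hΔ' _ _ hk, add_zero]
  have xE : x .E = 0 := hev _ (by norm_num [wt])
  have xH : x .H = 0 := hev _ (by norm_num [wt])
  have xF : x .F = 0 := hev _ (by norm_num [wt])
  have xL : x .L = 0 := hev _ (by norm_num [wt])
  have hact : ∀ j, wt j = 1 → ∀ w, om (M (form table.a (Pi.single j 1) w)) =
      cm (M (Pi.single j 1)) * om (M w) := by
    intro j hj w
    rw [← hM.ha, om_form_a (eq_current hΔ hj).1]
  have hone : ∀ j, wt j = 1 → om (M (form table.a (Pi.single j 1) x)) =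
      cm (M (Pi.single j 1)) := by
    intro j hj
    rw [hact j hj, hx1, mul_one]
  have htwo : ∀ i j, wt i = 1 → wt j = 1 →
      cm (M (Pi.single i 1)) * cm (M (Pi.single j 1)) =
        om (M (form table.a (Pi.single i 1) (form table.a (Pi.single j 1) x))) := by
    intro i j hi hj
    rw [hact i hi, hone j hj]
  have om_neg : ∀ w, om (-w) = -om w := by
    intro w; ext i j; fin_cases i <;> fin_cases j <;> simp [om]
  have om_add : ∀ u w, om (u + w) = om u + om w := by
    intro u w; ext i j; fin_cases i <;> fin_cases j <;> simp [om]
  have om_zero : om 0 = 0 := by ext i j; fin_cases i <;> fin_cases j <;> simp [om]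
  have htr : (cm (M (Pi.single .H 1))).trace = 0 := by simp [cm, Matrix.trace_fin_two]
  have hHH : cm (M (Pi.single .H 1)) * cm (M (Pi.single .H 1)) = 1 := by
    rw [htwo _ _ rfl rfl, ← hx1]
    congr 2
    simp only [form_a]
    ext1 k
    cases k <;> simp [mk, xE, xH, xF, xL]
  have hHF : cm (M (Pi.single .H 1)) * cm (M (Pi.single .F 1)) = -cm (M (Pi.single .F 1)) := by
    rw [htwo _ _ rfl rfl, ← hone _ rfl, ← om_neg, ← map_neg]
    congr 2
    simp only [form_a]
    ext1 k
    cases k <;> simp [mk, xE, xH, xF, xL]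
  have hEH : cm (M (Pi.single .E 1)) * cm (M (Pi.single .H 1)) = -cm (M (Pi.single .E 1)) := by
    rw [htwo _ _ rfl rfl, ← hone _ rfl, ← om_neg, ← map_neg]
    congr 2
    simp only [form_a]
    ext1 k
    cases k <;> simp [mk, xE, xH, xF, xL]
  have hFF : cm (M (Pi.single .F 1)) * cm (M (Pi.single .F 1)) = 0 := by
    rw [htwo _ _ rfl rfl, ← om_zero, ← map_zero M]
    congr 2
    simp only [form_a]
    ext1 k
    cases k <;> simp [mk, xE, xH, xF, xL]
  have hEF : cm (M (Pi.single .E 1)) * cm (M (Pi.single .F 1)) +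
      cm (M (Pi.single .F 1)) * cm (M (Pi.single .E 1)) = 1 := by
    rw [htwo _ _ rfl rfl, htwo _ _ rfl rfl, ← om_add, ← map_add, ← hx1]
    congr 2
    simp only [form_a]
    ext1 k
    cases k <;> simp [mk, xE, xH, xF, xL]
  obtain ⟨g, hE, hH, hF⟩ := exists_conj_of_triple htr hHH hHF hEH hFF hEF
  have key : ∀ j, wt j = 1 → cm (M (Pi.single j 1)) * g.1 = g.1 * cm (Pi.single j 1) →
      σ.1 (table.gen j) = (innerAut g).1 (table.gen j) := by
    intro j hj h
    rw [← AffTable.vec_single, hσ, innerAut_vec]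
    congr 1
    refine inner_eq_of_conj (eq_current hΔ hj).1 (eq_current hΔ hj).2 ?_ ?_ h
    · exact (eq_current (M := LinearMap.id) (fun j k h => Pi.single_eq_of_ne (by
        rintro rfl; exact h rfl) _) hj).1
    · exact (eq_current (M := LinearMap.id) (fun j k h => Pi.single_eq_of_ne (by
        rintro rfl; exact h rfl) _) hj).2
  refine ⟨g, fun j hj => key j hj ?_⟩
  cases j
  · norm_num [wt] at hj
  · rw [hE]; simp [cm]
  · rw [hH]; simp [cm]
  · rw [hF]; simp [cm]
  all_goals norm_num [wt] at hj

/-- Commuting with sl₂, the automorphism acts on the odd part through the two-dimensional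
multiplicity space only. The bracket of x₁₁ with x₂₂, a multiple of the fixed element L, forces
determinant one. -/
theorem exists_outer {τ : Aut table.conf} (h : ∀ j, wt j = 1 → τ.1 (table.gen j) = table.gen j) :
    ∃ X : SL(2, ℂ), τ = outerAut X := by
  obtain ⟨M, hM, hσ, hL, hΔ⟩ := isVir.exists_const τ
  have hfix : ∀ j, wt j = 1 → M (Pi.single j 1) = Pi.single j 1 := by
    intro j hj
    apply table.vec_injective
    rw [← hσ, AffTable.vec_single, h j hj]
  have hact : ∀ j, wt j = 1 → ∀ w, form table.a (Pi.single j 1) (M w) =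
      M (form table.a (Pi.single j 1) w) := by
    intro j hj w
    rw [← hM.ha, hfix j hj]
  have a1 := hact .H rfl (Pi.single .x11 1)
  have a2 := hact .H rfl (Pi.single .x12 1)
  have b1 := hact .F rfl (Pi.single .x11 1)
  have b2 := hact .F rfl (Pi.single .x12 1)
  have c1 := hM.ha (Pi.single .x11 1) (Pi.single .x22 1)
  rw [AffTable.form_single, show table.a .H .x11 = Pi.single .x11 1 from rfl, form_a] at a1
  rw [AffTable.form_single, show table.a .H .x12 = Pi.single .x12 1 from rfl, form_a] at a2
  rw [AffTable.form_single, show table.a .F .x11 = Pi.single .x21 1 from rfl, form_a] at b1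
  rw [AffTable.form_single, show table.a .F .x12 = Pi.single .x22 1 from rfl, form_a] at b2
  rw [AffTable.form_single, show table.a .x11 .x22 = (-2 : ℂ) • Pi.single .L 1 by
    rw [← Pi.single_smul]; simp; rfl, map_smul, hL, form_a] at c1
  have z : ∀ j, wt j = 3 / 2 → M (Pi.single j 1) .L = 0 ∧ M (Pi.single j 1) .E = 0 ∧
      M (Pi.single j 1) .H = 0 ∧ M (Pi.single j 1) .F = 0 := fun j hj =>
    ⟨hΔ _ _ (by rw [hj]; norm_num [wt]), hΔ _ _ (by rw [hj]; norm_num [wt]),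
      hΔ _ _ (by rw [hj]; norm_num [wt]), hΔ _ _ (by rw [hj]; norm_num [wt])⟩
  have m11 : M (Pi.single .x11 1) =
      mk 0 0 0 0 (M (Pi.single .x11 1) .x11) (M (Pi.single .x11 1) .x12) 0 0 := by
    have e1 := congrFun a1 .x21
    have e2 := congrFun a1 .x22
    simp [mk] at e1 e2
    ext1 k
    cases k
    · exact (z _ rfl).1
    · exact (z _ rfl).2.1
    · exact (z _ rfl).2.2.1
    · exact (z _ rfl).2.2.2
    · rfl
    · rfl
    · exact eq_zero_of_eq_neg e1.symm
    · exact eq_zero_of_eq_neg e2.symm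
  have m12 : M (Pi.single .x12 1) =
      mk 0 0 0 0 (M (Pi.single .x12 1) .x11) (M (Pi.single .x12 1) .x12) 0 0 := by
    have e1 := congrFun a2 .x21
    have e2 := congrFun a2 .x22
    simp [mk] at e1 e2
    ext1 k
    cases k
    · exact (z _ rfl).1
    · exact (z _ rfl).2.1
    · exact (z _ rfl).2.2.1
    · exact (z _ rfl).2.2.2
    · rfl
    · rfl
    · exact eq_zero_of_eq_neg e1.symm
    · exact eq_zero_of_eq_neg e2.symm
  generalize M (Pi.single .x11 1) .x11 = p at m11
  generalize M (Pi.single .x11 1) .x12 = q at m11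
  generalize M (Pi.single .x12 1) .x11 = r at m12
  generalize M (Pi.single .x12 1) .x12 = s at m12
  have m21 : M (Pi.single .x21 1) = mk 0 0 0 0 0 0 p q := by
    rw [← b1, m11]
    ext1 k
    cases k <;> simp [mk]
  have m22 : M (Pi.single .x22 1) = mk 0 0 0 0 0 0 r s := by
    rw [← b2, m12]
    ext1 k
    cases k <;> simp [mk]
  have hdet : p * s - r * q = 1 := by
    have := congrFun c1 .L
    rw [m11, m22] at this
    simp [mk] at this
    linear_combination (-1 / 2 : ℂ) * this
  obtain ⟨X, hX⟩ : ∃ X : SL(2, ℂ), X.1 = !![p, r; q, s] :=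
    ⟨⟨!![p, r; q, s], by rw [Matrix.det_fin_two_of, hdet]⟩, rfl⟩
  refine ⟨X, AffTable.aut_ext_vec fun w => ?_⟩
  rw [hσ, outerAut_vec, hX]
  congr 1
  conv_lhs => rw [eq_sum w]
  simp only [map_add, map_smul, hL, hfix .E rfl, hfix .H rfl, hfix .F rfl, m11, m12, m21, m22,
    outer_apply]
  ext1 k
  cases k <;> simp [mk]

/-- Every automorphism is the product of an inner and an outer one. -/
theorem exists_inner_mul_outer (σ : Aut table.conf) :
    ∃ g X : SL(2, ℂ), σ = innerAut g * outerAut X := by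
  obtain ⟨g, hg⟩ := exists_inner σ
  obtain ⟨X, hX⟩ := exists_outer (τ := (innerAut g)⁻¹ * σ) fun j hj => by
    change (innerAut g).1.symm (σ.1 (table.gen j)) = table.gen j
    rw [hg j hj]
    exact LinearEquiv.symm_apply_apply _ _
  exact ⟨g, X, by rw [← hX, mul_inv_cancel_left]⟩

end K4

/-! ## Elements of finite order of `SL₂(ℂ)` -/

namespace K4

theorem torus_val (a : ℂ) (ha : a ≠ 0) : (torus a ha).1 = !![a, 0; 0, a⁻¹] := rfl

theorem torus_pow (a : ℂ) (ha : a ≠ 0) (n : ℕ) :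
    torus a ha ^ n = torus (a ^ n) (pow_ne_zero n ha) := by
  induction n with
  | zero =>
    apply Subtype.ext
    rw [torus_val]
    ext i j
    fin_cases i <;> fin_cases j <;> simp
  | succ n ih =>
    rw [pow_succ, ih]
    apply Subtype.ext
    rw [Matrix.SpecialLinearGroup.coe_mul, torus_val, torus_val, torus_val]
    ext i j
    fin_cases i <;> fin_cases j <;> simp [pow_succ, mul_comm]

/-- A matrix with independent eigenvectors is diagonalizable in `SL₂(ℂ)`. -/
theorem exists_diag_of_eigen {g : Matrix (Fin 2) (Fin 2) ℂ} {a b : ℂ} {v w : Fin 2 → ℂ}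
    (hab : a ≠ b) (hv0 : v ≠ 0) (hw0 : w ≠ 0) (hv : g.mulVec v = a • v) (hw : g.mulVec w = b • w) :
    ∃ h : SL(2, ℂ), g * h.1 = h.1 * !![a, 0; 0, b] := by
  have e1 : ∀ i, g i 0 * v 0 + g i 1 * v 1 = a * v i := fun i => by
    simpa [Matrix.mulVec, dotProduct] using congrFun hv i
  have e2 : ∀ i, g i 0 * w 0 + g i 1 * w 1 = b * w i := fun i => by
    simpa [Matrix.mulVec, dotProduct] using congrFun hw i
  have hdet : v 0 * w 1 - w 0 * v 1 ≠ 0 := by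
    intro hdet
    have h1 : ∀ i j, (a - b) * (w i * v j) = 0 := by
      have hd : ∀ i j, w i * v j = w j * v i := by
        intro i j
        fin_cases i <;> fin_cases j <;> simp <;> grind
      intro i j
      have f1 := e1 j
      have f2 := e2 j
      have d0 := hd i 0
      have d1 := hd i 1
      have dj := hd i j
      linear_combination -w i * f1 + v i * f2 + g j 0 * d0 + g j 1 * d1 - b * dj
    have h2 : ∀ i j, w i * v j = 0 := fun i j =>
      (mul_eq_zero.mp (h1 i j)).resolve_left (sub_ne_zero.mpr hab)
    obtain ⟨j, hj⟩ := Function.ne_iff.mp hv0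
    exact hw0 (funext fun i => (mul_eq_zero.mp (h2 i j)).resolve_right hj)
  obtain ⟨s, hs⟩ := IsAlgClosed.exists_pow_nat_eq (v 0 * w 1 - w 0 * v 1) two_pos
  have hs0 : s ≠ 0 := by rintro rfl; apply hdet; rw [← hs]; simp
  refine ⟨⟨!![s⁻¹ * v 0, s⁻¹ * w 0; s⁻¹ * v 1, s⁻¹ * w 1], ?_⟩, ?_⟩
  · rw [Matrix.det_fin_two_of]
    field_simp
    linear_combination -hs
  · ext i j
    fin_cases i <;> fin_cases j <;> simp [Matrix.mul_apply]
    · linear_combination s⁻¹ * e1 0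
    · linear_combination s⁻¹ * e2 0
    · linear_combination s⁻¹ * e1 1
    · linear_combination s⁻¹ * e2 1

/-- By the Cayley–Hamilton relation every non-zero column of g - b is an eigenvector for `a`; the
trace excludes g = b when a ≠ b. -/
theorem exists_eigenvector {g : Matrix (Fin 2) (Fin 2) ℂ} {a b : ℂ} (hab : a ≠ b)
    (htr : g.trace = a + b) (h : g * (g - b • 1) = a • (g - b • 1)) :
    ∃ v : Fin 2 → ℂ, v ≠ 0 ∧ g.mulVec v = a • v := by
  by_contra! hno
  have hcol : ∀ j, (fun i => (g - b • (1 : Matrix (Fin 2) (Fin 2) ℂ)) i j) = 0 := by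
    intro j
    by_contra hne
    refine hno _ hne ?_
    ext i
    exact congrFun (congrFun h i) j
  have h1 := congrFun (hcol 0) 0
  have h2 := congrFun (hcol 1) 1
  rw [Matrix.trace_fin_two] at htr
  simp at h1 h2
  apply hab
  linear_combination h1 + h2 - htr

/-- A matrix of finite order over ℂ is diagonalizable, and its eigenvalues are roots of unity a,
a⁻¹. -/
theorem exists_torus (ξ : RootSystem) {g : SL(2, ℂ)} {n : ℕ} (hn : 0 < n) (h : g ^ n = 1) :
    ∃ (k : SL(2, ℂ)) (q : ℚ), g = k * torus (expQ ξ q) (expQ_ne_zero ξ q) * k⁻¹ := by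
  have hg := det_eq g
  obtain ⟨s, hs⟩ := IsAlgClosed.exists_pow_nat_eq ((g.1 0 0 + g.1 1 1) ^ 2 - 4) two_pos
  obtain ⟨a, ha⟩ : ∃ a, a = (g.1 0 0 + g.1 1 1 + s) / 2 := ⟨_, rfl⟩
  obtain ⟨b, hb⟩ : ∃ b, b = (g.1 0 0 + g.1 1 1 - s) / 2 := ⟨_, rfl⟩
  have hsum : g.1 0 0 + g.1 1 1 = a + b := by rw [ha, hb]; ring
  have hprod : a * b = 1 := by rw [ha, hb]; linear_combination (-1 / 4 : ℂ) * hs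
  have htr : g.1.trace = a + b := by rw [Matrix.trace_fin_two, hsum]
  have ha0 : a ≠ 0 := left_ne_zero_of_mul_eq_one hprod
  have hinv : a⁻¹ = b := inv_eq_of_mul_eq_one_right hprod
  have hpow : g.1 ^ n = 1 := by
    rw [← Matrix.SpecialLinearGroup.coe_pow, h, Matrix.SpecialLinearGroup.coe_one]
  have hCH : ∀ c d : ℂ, g.1 0 0 + g.1 1 1 = c + d → c * d = 1 →
      g.1 * (g.1 - d • 1) = c • (g.1 - d • 1) := by
    intro c d h1 h2
    ext i j
    fin_cases i <;> fin_cases j <;> simp [Matrix.mul_apply] <;> grind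
  by_cases hab : a = b
  -- With a double eigenvalue, (g - a)² = 0 gives gᵏ = aᵏ + k aᵏ⁻¹ (g - a), stated here multiplied
  -- by `a`. Then gⁿ = 1 forces first aⁿ = 1 by the trace, and then g = a.
  · have hk : ∀ k : ℕ, a • g.1 ^ k = a ^ (k + 1) • (1 : Matrix (Fin 2) (Fin 2) ℂ) +
        (k * a ^ k) • (g.1 - a • 1) := by
      intro k
      induction k with
      | zero => simp
      | succ k ih =>
        have h1 := hCH a a (by rw [hsum, ← hab]) (by rw [← hprod, ← hab])
        rw [pow_succ', ← mul_smul_comm, ih, mul_add, mul_smul_comm, mul_smul_comm, h1, mul_one]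
        push_cast
        module
    have h2 := hk n
    rw [hpow] at h2
    have t1 := congrFun (congrFun h2 0) 0
    have t2 := congrFun (congrFun h2 1) 1
    have t3 := congrFun (congrFun h2 0) 1
    have t4 := congrFun (congrFun h2 1) 0
    simp at t1 t2 t3 t4
    have hn0 : (n : ℂ) * a ^ n ≠ 0 := mul_ne_zero (by exact_mod_cast hn.ne') (pow_ne_zero n ha0)
    have hone : a ^ n = 1 := by
      have : a * a ^ n = a * 1 := by
        rw [hab] at t1 t2 hsum ⊢
        linear_combination (-1 / 2 : ℂ) * (t1 + t2) - (1 / 2 * n * b ^ n : ℂ) * hsum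
      exact mul_left_cancel₀ ha0 this
    obtain ⟨q, hq⟩ := exists_expQ_eq ξ hn hone
    refine ⟨1, q, ?_⟩
    rw [one_mul, inv_one, mul_one]
    apply Subtype.ext
    rw [torus_val, hq, hinv, ← hab]
    have f1 : g.1 0 0 = a := by
      have : (n * a ^ n : ℂ) * (g.1 0 0 - a) = 0 := by
        rw [pow_succ, hone] at t1
        rw [hone]
        linear_combination -t1
      exact sub_eq_zero.mp ((mul_eq_zero.mp this).resolve_left hn0)
    have f2 : g.1 1 1 = a := by
      have : (n * a ^ n : ℂ) * (g.1 1 1 - a) = 0 := by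
        rw [pow_succ, hone] at t2
        rw [hone]
        linear_combination -t2
      exact sub_eq_zero.mp ((mul_eq_zero.mp this).resolve_left hn0)
    have f3 : g.1 0 1 = 0 := by
      rcases t3 with (t3 | t3) | t3
      · exact absurd t3 hn.ne'
      · exact absurd t3.1 ha0
      · exact t3
    have f4 : g.1 1 0 = 0 := by
      rcases t4 with (t4 | t4) | t4
      · exact absurd t4 hn.ne'
      · exact absurd t4.1 ha0
      · exact t4
    ext i j
    fin_cases i <;> fin_cases j <;> simp [f1, f2, f3, f4]
  · obtain ⟨v, hv0, hv⟩ := exists_eigenvector hab htr (hCH a b hsum hprod)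
    obtain ⟨w, hw0, hw⟩ := exists_eigenvector (Ne.symm hab) (by rw [htr, add_comm])
      (hCH b a (by rw [hsum, add_comm]) (by rw [mul_comm, hprod]))
    obtain ⟨k, hk⟩ := exists_diag_of_eigen hab hv0 hw0 hv hw
    have hone : a ^ n = 1 := by
      have h1 : ∀ m : ℕ, (g.1 ^ m).mulVec v = a ^ m • v := by
        intro m
        induction m with
        | zero => simp
        | succ m ih => rw [pow_succ, ← Matrix.mulVec_mulVec, hv, Matrix.mulVec_smul, ih, smul_smul,
            pow_succ']
      have h2 := h1 n
      rw [hpow, Matrix.one_mulVec] at h2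
      obtain ⟨j, hj⟩ := Function.ne_iff.mp hv0
      have h3 := congrFun h2 j
      rw [Pi.smul_apply, smul_eq_mul] at h3
      exact mul_right_cancel₀ hj (by rw [← h3, one_mul])
    obtain ⟨q, hq⟩ := exists_expQ_eq ξ hn hone
    refine ⟨k, q, ?_⟩
    rw [eq_mul_inv_iff_mul_eq]
    apply Subtype.ext
    rw [Matrix.SpecialLinearGroup.coe_mul, Matrix.SpecialLinearGroup.coe_mul, hk, torus_val, hq, hinv]

/-- The two groups overlap in their scalars: on an odd matrix the product acts by g on the left and
the transpose of X on the right, which is trivial only for scalar matrices ±1 of the same sign. -/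
theorem sq_eq_one_of_inner_mul_outer {g X : SL(2, ℂ)} (h : innerAut g * outerAut X = 1) :
    g ^ 2 = 1 ∧ X ^ 2 = 1 := by
  have h1 : ∀ w, inner g.1 (outer X.1 w) = w := by
    intro w
    apply table.vec_injective
    rw [← innerAut_vec, ← outerAut_vec]
    exact congrArg (fun s : Aut table.conf => s.1 (table.vec w)) h
  have h11 := h1 (Pi.single .x11 1)
  have h12 := h1 (Pi.single .x12 1)
  have h21 := h1 (Pi.single .x21 1)
  rw [inner_apply, outer_apply] at h11 h12 h21
  have a1 := congrFun h11 .x11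
  have a2 := congrFun h11 .x12
  have a3 := congrFun h11 .x21
  have b1 := congrFun h12 .x12
  have b2 := congrFun h12 .x11
  have c1 := congrFun h21 .x21
  have c2 := congrFun h21 .x11
  have hg := det_eq g
  have hX := det_eq X
  simp [mk] at a1 a2 a3 b1 b2 c1 c2
  have g0 : g.1 0 0 ≠ 0 := left_ne_zero_of_mul_eq_one a1
  have X0 : X.1 0 0 ≠ 0 := right_ne_zero_of_mul_eq_one a1
  constructor
  · have z1 : g.1 1 0 = 0 := a3.resolve_right X0
    have z2 : g.1 0 1 = 0 := c2.resolve_right X0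
    apply Subtype.ext
    rw [pow_two, Matrix.SpecialLinearGroup.coe_mul]
    ext i j
    fin_cases i <;> fin_cases j <;> simp [Matrix.mul_apply, z1, z2] <;> grind
  · have z1 : X.1 1 0 = 0 := a2.resolve_left g0
    have z2 : X.1 0 1 = 0 := b2.resolve_left g0
    apply Subtype.ext
    rw [pow_two, Matrix.SpecialLinearGroup.coe_mul]
    ext i j
    fin_cases i <;> fin_cases j <;> simp [Matrix.mul_apply, z1, z2] <;> grind

/-- The twist by an outer automorphism. -/
def outerTwist (X : SL(2, ℂ)) {n : ℕ} (hn : 0 < n) (h : X ^ n = 1) : Twist table.conf :=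
  ⟨outerAut X, n, hn, by rw [← map_pow, h, map_one]⟩

/-- Since the two factors commute, the finite order of σ passes to both, up to doubling the period.
The inner factor is then conjugate to a torus element, which a gauge transformation removes. -/
theorem loop_iso_outerTwist (ξ : RootSystem) (d : Twist table.conf) :
    ∃ (X : SL(2, ℂ)) (n : ℕ) (hn : 0 < n) (h : X ^ n = 1),
      Iso (loop ξ d) (loop ξ (outerTwist X hn h)) := by
  obtain ⟨g, X, hσ⟩ := exists_inner_mul_outer d.σ
  have h1 : innerAut (g ^ d.m) * outerAut (X ^ d.m) = 1 := by
    have hc : Commute (innerAut g) (outerAut X) := innerAut_outerAut g X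
    rw [map_pow, map_pow, ← hc.mul_pow, ← hσ, d.pow_eq_one]
  obtain ⟨h2, h3⟩ := sq_eq_one_of_inner_mul_outer h1
  rw [← pow_mul] at h2 h3
  have hpos : 0 < d.m * 2 := Nat.mul_pos d.pos two_pos
  obtain ⟨k, q, hk⟩ := exists_torus ξ hpos h2
  refine ⟨X, d.m * 2, hpos, h3, ?_⟩
  set T := torus (expQ ξ q) (expQ_ne_zero ξ q) with hT
  have hconj : innerAut k⁻¹ * d.σ = innerAut T * outerAut X * innerAut k⁻¹ := by
    rw [mul_assoc, ← innerAut_outerAut k⁻¹ X, hσ, hk, ← mul_assoc, ← mul_assoc, ← map_mul, ← map_mul]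
    congr 2
    group
  have hpow : (innerAut T * outerAut X) ^ d.m = 1 := by
    rw [← mul_inv_eq_iff_eq_mul] at hconj
    rw [← hconj, conj_pow, d.pow_eq_one, mul_one, mul_inv_cancel]
  exact (loop_iso_of_conj ξ (innerAut k⁻¹) (d' := ⟨_, d.m, d.pos, hpow⟩) hconj).trans
    (loop_iso_outer ξ q X _ _ rfl rfl)

theorem outerAut_neg (X : SL(2, ℂ)) : outerAut (-X) = innerAut (-1) * outerAut X := by
  refine AffTable.aut_ext_vec fun w => ?_
  change (outerAut (-X)).1 (table.vec w) = (innerAut (-1)).1 ((outerAut X).1 (table.vec w))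
  rw [outerAut_vec, outerAut_vec, innerAut_vec]
  congr 1
  rw [inner_apply, outer_apply, outer_apply]
  ext1 k
  cases k <;> simp [mk] <;> ring

theorem expQ_half (ξ : RootSystem) : expQ ξ (1 / 2) = -1 := by
  have h1 : expQ ξ (1 / 2) ^ 2 = 1 := by
    rw [← expQ_nat_mul, expQ_eq_one_iff]
    exact ⟨1, by norm_num⟩
  rcases mul_self_eq_one_iff.mp ((pow_two _).symm.trans h1) with h | h
  · rw [expQ_eq_one_iff] at h
    obtain ⟨n, hn⟩ := h
    have h2 : (1 : ℚ) = ((2 * n : ℤ) : ℚ) := by push_cast; rw [← hn]; norm_num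
    have h3 : (1 : ℤ) = 2 * n := by exact_mod_cast h2
    omega
  · exact h

/-- X and -X differ by the inner automorphism -1, which is the torus element e(1/2) and can be
gauged away. -/
theorem loop_outer_neg_iso (ξ : RootSystem) {X : SL(2, ℂ)} {n m : ℕ} (hn : 0 < n) (h : X ^ n = 1)
    (hm : 0 < m) (h' : (-X) ^ m = 1) :
    Iso (loop ξ (outerTwist (-X) hm h')) (loop ξ (outerTwist X hn h)) := by
  refine loop_iso_outer ξ (1 / 2) X _ _ ?_ rfl
  change outerAut (-X) = _
  rw [outerAut_neg]
  congr 2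
  apply Subtype.ext
  rw [torus_val, expQ_half]
  ext i j
  fin_cases i <;> fin_cases j <;> simp [inv_neg]

theorem loop_outer_conj_iso (ξ : RootSystem) {X Y k : SL(2, ℂ)} {n m : ℕ} (hn : 0 < n)
    (h : X ^ n = 1) (hm : 0 < m) (h' : Y ^ m = 1) (hk : k * X = Y * k) :
    Iso (loop ξ (outerTwist X hn h)) (loop ξ (outerTwist Y hm h')) :=
  loop_iso_of_conj ξ (outerAut k) (by
    change outerAut k * outerAut X = outerAut Y * outerAut k
    rw [← map_mul, ← map_mul, hk])

end K4

/-! ## Coefficients with respect to `∂` in a base change -/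

instance : NoZeroDivisors SHat := inferInstanceAs (NoZeroDivisors (AddMonoidAlgebra ℂ ℚ))

/-- The derivation `1 ⊗ d/dt`. -/
def hatDelta (A : ConfData) : (A.carrier ⊗[ℂ] SHat) →ₗ[ℂ] (A.carrier ⊗[ℂ] SHat) :=
  TensorProduct.map LinearMap.id deltaT

/-- The operator `∂ ⊗ 1`. -/
def hatD (A : ConfData) : (A.carrier ⊗[ℂ] SHat) →ₗ[ℂ] (A.carrier ⊗[ℂ] SHat) :=
  TensorProduct.map A.der LinearMap.id

@[simp] theorem hatDelta_tmul {A : ConfData} (a : A.carrier) (f : SHat) :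
    hatDelta A (a ⊗ₜ f) = a ⊗ₜ deltaT f := rfl

@[simp] theorem hatD_tmul {A : ConfData} (a : A.carrier) (f : SHat) :
    hatD A (a ⊗ₜ f) = A.der a ⊗ₜ f := rfl

theorem hatDer_eq {A : ConfData} (x : A.carrier ⊗[ℂ] SHat) :
    hatDer A x = hatD A x + hatDelta A x := rfl

theorem hatDelta_hatProd {A : ConfData} (a : A.carrier) (f : SHat) (y : A.carrier ⊗[ℂ] SHat)
    (n : ℕ) : hatDelta A (hatProd A (a ⊗ₜ f) y n) =
      hatProd A (a ⊗ₜ deltaT f) y n + hatProd A (a ⊗ₜ f) (hatDelta A y) n := by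
  induction y using TensorProduct.induction_on with
  | zero => simp
  | add y y' hy hy' =>
    simp only [map_add, Finsupp.add_apply, hy, hy']
    abel
  | tmul b g =>
    obtain ⟨N, hN⟩ := exists_bound (A.prod a b)
    rw [hatDelta_tmul, hatProd_tmul_range _ _ _ _ _ N hN, hatProd_tmul_range _ _ _ _ _ N hN,
      hatProd_tmul_range _ _ _ _ _ N hN, map_sum, ← Finset.sum_add_distrib]
    refine Finset.sum_congr rfl fun j _ => ?_
    rw [hatDelta_tmul, deltaT_mul, TensorProduct.tmul_add, dpow_apply_self, apply_dpow]

/-- ∂ ⊗ 1 commutes with a 0-product only up to the derivative of the left coefficient, since the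
total derivation and d/dt both obey the Leibniz rule. The defect does not raise the degree in ∂ by
more than the product itself does. -/
theorem hatProd_hatD {A : ConfData} (hA : A.IsLie) (a : A.carrier) (f : SHat)
    (y : A.carrier ⊗[ℂ] SHat) : hatProd A (a ⊗ₜ f) (hatD A y) 0 =
      hatD A (hatProd A (a ⊗ₜ f) y 0) + hatProd A (a ⊗ₜ deltaT f) y 0 := by
  have h1 := (hat_isLie hA).prod_der (a ⊗ₜ f) y 0
  change hatProd A (a ⊗ₜ f) (hatDer A y) 0 = hatDer A (hatProd A (a ⊗ₜ f) y 0) +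
    ((0 : ℕ) : ℂ) • hatProd A (a ⊗ₜ f) y (0 - 1) at h1
  rw [hatDer_eq, hatDer_eq, map_add, Finsupp.add_apply, hatDelta_hatProd] at h1
  simp only [Nat.cast_zero, zero_smul, add_zero] at h1
  rw [← add_assoc] at h1
  exact add_right_cancel h1

namespace AffTable

variable {ι : Type} [Fintype ι] [DecidableEq ι] {t : AffTable ι}

variable (t) in
/-- The coefficient of `∂^n` in the base change. -/
def hcf (n : ℕ) : t.conf.carrier ⊗[ℂ] SHat →ₗ[ℂ] (ι → SHat) :=
  LinearMap.pi fun k => TensorProduct.lift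
    (LinearMap.lsmul ℂ SHat ∘ₗ LinearMap.proj k ∘ₗ t.cf n)

@[simp] theorem hcf_tmul (n : ℕ) (a : t.conf.carrier) (f : SHat) (k : ι) :
    t.hcf n (a ⊗ₜ f) k = t.cf n a k • f := rfl

@[simp] theorem hcf_hatD_zero (x : t.conf.carrier ⊗[ℂ] SHat) : t.hcf 0 (hatD t.conf x) = 0 := by
  induction x using TensorProduct.induction_on with
  | zero => simp
  | add x y hx hy => rw [map_add, map_add, hx, hy, add_zero]
  | tmul a f => ext1 k; simp

@[simp] theorem hcf_hatD_succ (n : ℕ) (x : t.conf.carrier ⊗[ℂ] SHat) :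
    t.hcf (n + 1) (hatD t.conf x) = t.hcf n x := by
  induction x using TensorProduct.induction_on with
  | zero => simp
  | add x y hx hy => rw [map_add, map_add, hx, hy, map_add]
  | tmul a f => ext1 k; simp

theorem hcf_hatDelta (n : ℕ) (x : t.conf.carrier ⊗[ℂ] SHat) (k : ι) :
    t.hcf n (hatDelta t.conf x) k = deltaT (t.hcf n x k) := by
  induction x using TensorProduct.induction_on with
  | zero => simp
  | add x y hx hy => simp only [map_add, Pi.add_apply, hx, hy]
  | tmul a f => simp

theorem hcf_sm (n : ℕ) (f : SHat) (x : t.conf.carrier ⊗[ℂ] SHat) (k : ι) :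
    t.hcf n (sm f x) k = f * t.hcf n x k := by
  induction x using TensorProduct.induction_on with
  | zero => simp
  | add x y hx hy => simp only [map_add, Pi.add_apply, hx, hy, mul_add]
  | tmul a g => simp

@[simp] theorem hcf_vecS_zero (w : ι → SHat) : t.hcf 0 (t.vecS w) = w := by
  ext1 k
  rw [vecS_apply, map_sum, Finset.sum_apply, Finset.sum_eq_single k]
  · rw [hcf_tmul, ← vec_single, cf_vec_zero]; simp
  · intro i _ hi
    rw [hcf_tmul, ← vec_single, cf_vec_zero]; simp [hi.symm]
  · simp

@[simp] theorem hcf_vecS_succ (n : ℕ) (w : ι → SHat) : t.hcf (n + 1) (t.vecS w) = 0 := by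
  ext1 k
  rw [vecS_apply, map_sum, Finset.sum_apply]
  refine Finset.sum_eq_zero fun i _ => ?_
  rw [hcf_tmul, ← vec_single, cf_vec_succ]; simp

theorem vecS_injective : Function.Injective t.vecS := fun u w h => by
  rw [← hcf_vecS_zero (t := t) u, h, hcf_vecS_zero]

theorem cf_compQ (n : ℕ) (q : ℚ) (x : t.conf.carrier ⊗[ℂ] SHat) (k : ι) :
    t.cf n (compQ q x) k = tcoeff q (t.hcf n x k) := by
  induction x using TensorProduct.induction_on with
  | zero => simp
  | add x y hx hy => simp only [map_add, Pi.add_apply, hx, hy]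
  | tmul a f => simp [compQ_tmul, mul_comm]

theorem eq_zero_of_hcf {x : t.conf.carrier ⊗[ℂ] SHat} (h : ∀ n, t.hcf n x = 0) : x = 0 := by
  obtain ⟨s, hs⟩ := exists_sum_compQ x
  rw [hs s subset_rfl]
  refine Finset.sum_eq_zero fun q _ => ?_
  have : compQ q x = 0 := by
    apply t.crd_injective
    ext1 k
    ext n
    rw [← cf_apply, cf_compQ, h]
    simp
  rw [this, TensorProduct.zero_tmul]

theorem exists_hcf_bound (x : t.conf.carrier ⊗[ℂ] SHat) : ∃ N, ∀ n, N ≤ n → t.hcf n x = 0 := by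
  induction x using TensorProduct.induction_on with
  | zero => exact ⟨0, by simp⟩
  | add x y hx hy =>
    obtain ⟨N, hN⟩ := hx
    obtain ⟨N', hN'⟩ := hy
    exact ⟨max N N', fun n hn => by
      rw [map_add, hN n (le_of_max_le_left hn), hN' n (le_of_max_le_right hn), add_zero]⟩
  | tmul a f =>
    refine ⟨(Finset.univ.sup fun k => (t.crd a k).natDegree) + 1, fun n hn => ?_⟩
    ext1 k
    have hk := Finset.le_sup (f := fun k => (t.crd a k).natDegree) (Finset.mem_univ k)
    rw [hcf_tmul, cf_apply, Polynomial.coeff_eq_zero_of_natDegree_lt (lt_of_le_of_lt hk hn)]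
    simp

/-- The coefficient of the highest power of `∂` that occurs in `x` is `z`, with exponent `K`. -/
def IsTop (x : t.conf.carrier ⊗[ℂ] SHat) (K : ℕ) (z : ι → SHat) : Prop :=
  t.hcf K x = z ∧ ∀ n, K < n → t.hcf n x = 0

theorem exists_isTop {x : t.conf.carrier ⊗[ℂ] SHat} (hx : x ≠ 0) :
    ∃ K z, z ≠ 0 ∧ IsTop x K z := by
  classical
  obtain ⟨N, hN⟩ := exists_hcf_bound x
  have hex : ∃ n, t.hcf n x ≠ 0 := by
    by_contra! hno
    exact hx (eq_zero_of_hcf hno)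
  have hb : ∀ n, t.hcf n x ≠ 0 → n ≤ N := fun n hn => by
    by_contra hlt
    exact hn (hN n (by omega))
  obtain ⟨n₀, hn₀⟩ := hex
  refine ⟨Nat.findGreatest (fun n => t.hcf n x ≠ 0) N, _, ?_, rfl, fun n hn => ?_⟩
  · exact Nat.findGreatest_spec (P := fun n => t.hcf n x ≠ 0) (hb n₀ hn₀) hn₀
  · by_contra hne
    have := Nat.le_findGreatest (P := fun n => t.hcf n x ≠ 0) (hb n hne) hne
    omega

theorem eq_sum_hatD {x : t.conf.carrier ⊗[ℂ] SHat} {K : ℕ} (h : ∀ n, K < n → t.hcf n x = 0) :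
    x = ∑ n ∈ Finset.range (K + 1), (hatD t.conf ^ n) (t.vecS (t.hcf n x)) := by
  have h1 : ∀ (n m : ℕ) (z : ι → SHat), t.hcf m ((hatD t.conf ^ n) (t.vecS z)) =
      if m = n then z else 0 := by
    intro n
    induction n with
    | zero =>
      intro m z
      rcases m with _ | m
      · simp
      · simp
    | succ n ih =>
      intro m z
      rw [pow_succ', Module.End.mul_apply]
      rcases m with _ | m
      · simp
      · rw [hcf_hatD_succ, ih]; simp
  rw [← sub_eq_zero]
  refine eq_zero_of_hcf fun m => ?_
  rw [map_sub, map_sum, sub_eq_zero]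
  by_cases hm : K < m
  · rw [h m hm, Finset.sum_eq_zero]
    intro n hn
    rw [h1, if_neg]
    have := Finset.mem_range.mp hn
    omega
  · rw [Finset.sum_eq_single m]
    · rw [h1, if_pos rfl]
    · intro n _ hn
      rw [h1, if_neg hn.symm]
    · intro hm'
      exact absurd (Finset.mem_range.mpr (by omega)) hm'

theorem hatProd_vecS_hatD (hLie : t.conf.IsLie) (w : ι → SHat) (y : t.conf.carrier ⊗[ℂ] SHat) :
    hatProd t.conf (t.vecS w) (hatD t.conf y) 0 = hatD t.conf (hatProd t.conf (t.vecS w) y 0) +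
      hatProd t.conf (t.vecS fun i => deltaT (w i)) y 0 := by
  simp only [vecS_apply, map_sum, LinearMap.sum_apply, Finsupp.finsetSum_apply,
    ← Finset.sum_add_distrib]
  exact Finset.sum_congr rfl fun i _ => hatProd_hatD hLie _ _ _

theorem hatProd_vecS_vecS (u w : ι → SHat) : hatProd t.conf (t.vecS u) (t.vecS w) 0 =
    t.vecS (form t.a u w + form t.c (fun i => deltaT (u i)) w) +
      hatD t.conf (t.vecS (form t.b u w)) := by
  have h1 : hatDelta t.conf (t.vecS (form t.b u w)) = t.vecS fun k => deltaT (form t.b u w k) := by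
    rw [vecS_apply, vecS_apply, map_sum]
    rfl
  rw [hatProd_vecS_zero, hatDer_eq, h1, map_sub]
  abel

/-- The restrictions of the brackets to odd elements: `L` acts with weight `3/2`, and all other
generators act without derivatives. -/
structure OddAction (t : AffTable ι) (L : ι) : Prop where
  lie : t.conf.IsLie
  vir : ∀ x : t.conf.carrier, t.conf.prod (t.gen L) x 0 = t.conf.der x
  b_eq : ∀ (w z : ι → SHat) (k : ι), (∀ i, t.par i ≠ 1 → z i = 0) → t.par k = 1 →
    form t.b w z k = w L * z k
  c_eq : ∀ (w z : ι → SHat) (k : ι), (∀ i, t.par i ≠ 1 → z i = 0) → t.par k = 1 →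
    w L = 0 → form t.c w z k = 0

namespace OddAction

variable {L : ι} (h : OddAction t L)
include h

/-- On odd elements only L raises the degree in ∂, and by exactly one. The derivatives of
coefficients that arise from moving ∂ out of the product live in lower degree. -/
theorem hcf_prod_pow (n : ℕ) (w z : ι → SHat) (hz : ∀ i, t.par i ≠ 1 → z i = 0) (k : ι)
    (hk : t.par k = 1) (m : ℕ) (hm : n < m) :
    t.hcf m (hatProd t.conf (t.vecS w) ((hatD t.conf ^ n) (t.vecS z)) 0) k =
      if m = n + 1 then w L * z k else 0 := by
  induction n generalizing w m with
  | zero =>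
    obtain ⟨m, rfl⟩ := Nat.exists_eq_add_of_le' hm
    rw [pow_zero, Module.End.one_apply, hatProd_vecS_vecS, map_add, hcf_vecS_succ, zero_add,
      hcf_hatD_succ]
    rcases m with _ | m
    · rw [hcf_vecS_zero, if_pos rfl, h.b_eq w z k hz hk]
    · rw [hcf_vecS_succ, if_neg (by omega)]; rfl
  | succ n ih =>
    obtain ⟨m, rfl⟩ := Nat.exists_eq_add_of_le' (show 1 ≤ m by omega)
    rw [pow_succ', Module.End.mul_apply, hatProd_vecS_hatD h.lie, map_add, hcf_hatD_succ,
      Pi.add_apply, ih w m (by omega), ih _ (m + 1) (by omega)]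
    rw [if_neg (show ¬m + 1 = n + 1 by omega), add_zero]
    simp

/-- Without an L-component the degree does not rise, and the top coefficient is transformed by the
constant action of the currents alone. -/
theorem hcf_prod_pow_current (n : ℕ) (w z : ι → SHat) (hw : w L = 0)
    (hz : ∀ i, t.par i ≠ 1 → z i = 0) (k : ι) (hk : t.par k = 1) (m : ℕ) (hm : n ≤ m) :
    t.hcf m (hatProd t.conf (t.vecS w) ((hatD t.conf ^ n) (t.vecS z)) 0) k =
      if m = n then form t.a w z k else 0 := by
  rcases hm.lt_or_eq with hlt | rfl
  · rw [h.hcf_prod_pow n w z hz k hk m hlt, hw, zero_mul, ite_self, if_neg hlt.ne']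
  · rw [if_pos rfl]
    induction n generalizing w with
    | zero =>
      rw [pow_zero, Module.End.one_apply, hatProd_vecS_vecS, map_add, hcf_hatD_zero, add_zero,
        hcf_vecS_zero, Pi.add_apply, h.c_eq _ z k hz hk (by rw [hw, map_zero]), add_zero]
    | succ n ih =>
      rw [pow_succ', Module.End.mul_apply, hatProd_vecS_hatD h.lie, map_add, hcf_hatD_succ,
        Pi.add_apply, ih w hw le_rfl, h.hcf_prod_pow n _ z hz k hk (n + 1) (by omega), if_pos rfl,
        hw, map_zero, zero_mul, add_zero]

variable {x : t.conf.carrier ⊗[ℂ] SHat} {K : ℕ} {z : ι → SHat}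

omit h in
theorem hcf_eq_zero_of_odd (hx : x ∈ hatPart t.conf 1) (n : ℕ) (i : ι) (hi : t.par i ≠ 1) :
    t.hcf n x i = 0 := by
  refine hatPart_induction (motive := fun x => t.hcf n x i = 0) (by simp)
    (fun x y hx hy => by rw [map_add, Pi.add_apply, hx, hy, add_zero]) (fun a ha g => ?_) hx
  rw [hcf_tmul, cf_apply, (mem_part t a 1).mp ha i hi]
  simp

theorem hcf_prod_top (hx : x ∈ hatPart t.conf 1) (hK : IsTop x K z) (w : ι → SHat) (k : ι)
    (hk : t.par k = 1) :
    t.hcf (K + 1) (hatProd t.conf (t.vecS w) x 0) k = w L * z k := by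
  conv_lhs => rw [eq_sum_hatD hK.2]
  rw [map_sum, Finsupp.finsetSum_apply, map_sum, Finset.sum_apply, Finset.sum_eq_single K]
  · rw [h.hcf_prod_pow K _ _ (hcf_eq_zero_of_odd hx K) k hk _ (by omega), if_pos rfl, hK.1]
  · intro n hn hne
    have := Finset.mem_range.mp hn
    rw [h.hcf_prod_pow n _ _ (hcf_eq_zero_of_odd hx n) k hk _ (by omega), if_neg (by omega)]
  · intro hn
    exact absurd (Finset.mem_range.mpr (by omega)) hn

theorem hcf_prod_top_current (hx : x ∈ hatPart t.conf 1) (hK : IsTop x K z) (w : ι → SHat)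
    (hw : w L = 0) (k : ι) (hk : t.par k = 1) :
    t.hcf K (hatProd t.conf (t.vecS w) x 0) k = form t.a w z k := by
  conv_lhs => rw [eq_sum_hatD hK.2]
  rw [map_sum, Finsupp.finsetSum_apply, map_sum, Finset.sum_apply, Finset.sum_eq_single K]
  · rw [h.hcf_prod_pow_current K _ _ hw (hcf_eq_zero_of_odd hx K) k hk _ le_rfl, if_pos rfl, hK.1]
  · intro n hn hne
    have := Finset.mem_range.mp hn
    rw [h.hcf_prod_pow_current n _ _ hw (hcf_eq_zero_of_odd hx n) k hk _ (by omega),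
      if_neg (by omega)]
  · intro hn
    exact absurd (Finset.mem_range.mpr (by omega)) hn

omit h in
theorem exists_odd_ne (hx : x ∈ hatPart t.conf 1) (hK : IsTop x K z) (hz : z ≠ 0) :
    ∃ k, t.par k = 1 ∧ z k ≠ 0 := by
  obtain ⟨k, hk⟩ := Function.ne_iff.mp hz
  refine ⟨k, ?_, hk⟩
  by_contra hp
  apply hk
  rw [← hK.1, hcf_eq_zero_of_odd hx K k hp]
  rfl

/-- The leading coefficient of an eigenvector of a `0`-product. -/
theorem eigen (hx : x ∈ hatPart t.conf 1) (hK : IsTop x K z) (hz : z ≠ 0) {w : ι → SHat} {c : ℂ}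
    (he : hatProd t.conf (t.vecS w) x 0 = c • x) :
    w L = 0 ∧ ∀ k, t.par k = 1 → form t.a w z k = c • z k := by
  obtain ⟨k, hk, hzk⟩ := exists_odd_ne hx hK hz
  -- An L-component would create a term of degree K + 1, while a multiple of `x` has none.
  have hw : w L = 0 := by
    have h1 := h.hcf_prod_top hx hK w k hk
    rw [he, map_smul, hK.2 _ (by omega), smul_zero] at h1
    exact (mul_eq_zero.mp h1.symm).resolve_right hzk
  refine ⟨hw, fun k hk => ?_⟩
  rw [← h.hcf_prod_top_current hx hK w hw k hk, he, map_smul, hK.1]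
  rfl

/-- The leading coefficient of a solution of a differential equation. -/
theorem deriv_eigen (hx : x ∈ hatPart t.conf 1) (hK : IsTop x K z) (hz : z ≠ 0) {w : ι → SHat}
    {c : ℂ} {r : SHat} (hr : r ≠ 0)
    (he : sm r (hatDer t.conf x - hatProd t.conf (t.vecS w) x 0) = c • x) :
    ∀ k, t.par k = 1 →
      r * (deltaT (z k) - form t.a (w - Pi.single L 1) z k) = c • z k := by
  obtain ⟨k, hk, hzk⟩ := exists_odd_ne hx hK hz
  -- The derivation also raises the degree by one; its top term must cancel against that of the
  -- 0-product, which normalizes the L-component to 1.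
  have hw : w L = 1 := by
    have h1 := congrArg (fun y => t.hcf (K + 1) y k) he
    simp only [hcf_sm, map_sub, Pi.sub_apply, h.hcf_prod_top hx hK w k hk, hatDer_eq, map_add,
      Pi.add_apply, hcf_hatD_succ, hcf_hatDelta, hK.1, map_smul, Pi.smul_apply,
      hK.2 (K + 1) (by omega), Pi.zero_apply, map_zero, add_zero, smul_zero] at h1
    have h2 : (1 - w L) * z k = 0 := by
      refine (mul_eq_zero.mp ?_).resolve_left hr
      linear_combination h1
    exact (sub_eq_zero.mp ((mul_eq_zero.mp h2).resolve_right hzk)).symm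
  -- The 0-product with L ⊗ 1 is ∂ ⊗ 1. After it is split off, the operator is d/dt minus the action
  -- of the currents, and the degree is preserved.
  have hL : hatProd t.conf (t.vecS (Pi.single L 1)) x 0 = hatD t.conf x := by
    rw [vecS_single]
    clear hK he hx
    induction x using TensorProduct.induction_on with
    | zero => simp
    | add x y hx hy => rw [map_add, Finsupp.add_apply, hx, hy, map_add]
    | tmul a f => rw [tmul_eq_sm f, hatProd_sm_right, hatProd_tmul_one, h.vir]; simp
  intro k hk
  have h0 : (w - Pi.single L 1 : ι → SHat) L = 0 := by rw [Pi.sub_apply, Pi.single_eq_same, hw, sub_self]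
  rw [← h.hcf_prod_top_current hx hK _ h0 k hk, map_sub, map_sub, LinearMap.sub_apply,
    Finsupp.sub_apply, hL, ← hK.1, ← hcf_hatDelta, ← Pi.sub_apply, ← map_sub, ← hcf_sm,
    show hatDelta t.conf x - (hatProd t.conf (t.vecS w) x 0 - hatD t.conf x) =
      hatDer t.conf x - hatProd t.conf (t.vecS w) x 0 by rw [hatDer_eq]; abel, he, map_smul]
  rfl

end OddAction

/-- Modulo total derivatives, every element of a twisted loop algebra is free of `∂`. -/
theorem IsVir.exists_vecS {L : ι} {Δ : ι → ℂ} (h : IsVir t L Δ) (ξ : RootSystem)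
    (d : Twist t.conf) (x : (loop ξ d).carrier) : ∃ w : ι → SHat, t.vecS w ∈ loopSpace ξ d ∧
      ∀ y, hatProd t.conf (loopVal ξ d x) y 0 = hatProd t.conf (t.vecS w) y 0 := by
  refine h.loop_induction (motive := fun x => ∃ w : ι → SHat, t.vecS w ∈ loopSpace ξ d ∧
      ∀ y, hatProd t.conf (loopVal ξ d x) y 0 = hatProd t.conf (t.vecS w) y 0)
    ⟨0, by simp, by simp⟩ ?_ ?_ ?_ ?_ x
  · rintro x y ⟨w, hw, h1⟩ ⟨w', hw', h1'⟩
    refine ⟨w + w', by rw [map_add]; exact add_mem hw hw', fun z => ?_⟩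
    simp only [map_add, LinearMap.add_apply, Finsupp.add_apply, h1, h1']
  · rintro c x ⟨w, hw, h1⟩
    refine ⟨c • w, by rw [map_smul]; exact Submodule.smul_mem _ _ hw, fun z => ?_⟩
    simp only [map_smul, LinearMap.smul_apply, Finsupp.smul_apply, h1]
  · rintro x -
    -- The 0-product with a total derivative is zero.
    refine ⟨0, by simp, fun z => ?_⟩
    have h1 := (hat_isLie h.lie).der_prod (loopVal ξ d x) z 0
    rw [Nat.cast_zero, zero_smul, neg_zero] at h1
    rw [loopVal_der]
    simpa using h1
  · intro δ w q hw _
    refine ⟨fun k => w k • tpow q, ?_, fun z => ?_⟩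
    · rw [← vec_tmul]; exact hw.mem
    · rw [← vec_tmul]; rfl

end AffTable

/-! ## The two twisted loop algebras of the `N = 2` conformal superalgebra are not isomorphic -/

theorem mem_loopSpace_vecS (ξ : RootSystem) {ι : Type} [Fintype ι] [DecidableEq ι] {t : AffTable ι}
    {d : Twist t.conf} {M : (ι → ℂ) →ₗ[ℂ] (ι → ℂ)} (h : ∀ w, d.σ.1 (t.vec w) = t.vec (M w))
    {w : ι → SHat} (hw : t.vecS w ∈ loopSpace ξ d) (k : ι) :
    ∑ i, M (Pi.single i 1) k • galois ξ (w i) = w k := by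
  rw [mem_loopSpace_iff, AffTable.twisted_vecS ξ h] at hw
  have := congrFun (AffTable.vecS_injective hw) k
  rwa [Finset.sum_apply] at this

theorem hatProd_one_tmul {A : ConfData} (a b : A.carrier) (f : SHat) (n : ℕ) :
    hatProd A (a ⊗ₜ 1) (b ⊗ₜ f) n = A.prod a b n ⊗ₜ f := by
  rw [tmul_eq_sm f, hatProd_sm_right, hatProd_tmul_one, ← tmul_eq_sm]

/-- Some element acts by its `0`-product as the identity on a non-zero odd element. -/
def HasUnitAction (B : ConfData) : Prop :=
  ∃ u x : B.carrier, x ∈ B.part 1 ∧ x ≠ 0 ∧ B.prod u x 0 = x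

theorem HasUnitAction.of_iso {B C : ConfData} (h : HasUnitAction B) (hBC : Iso B C) :
    HasUnitAction C := by
  obtain ⟨e, he⟩ := hBC
  obtain ⟨u, x, hx, hx0, hux⟩ := h
  refine ⟨e u, e x, he.1.map_part 1 x hx, fun h0 => hx0 ((map_eq_zero_iff e e.injective).mp h0), ?_⟩
  have := he.1.map_prod u x 0
  rw [hux] at this
  exact this.symm

theorem AffTable.gen_ne_zero {ι : Type} [Fintype ι] [DecidableEq ι] (t : AffTable ι) (i : ι) :
    t.gen i ≠ 0 := fun h => by
  rw [← AffTable.vec_single] at h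
  have := congrFun (t.vec_injective (h.trans t.vec_zero.symm)) i
  simp at this

theorem AffTable.tmul_tpow_ne_zero {ι : Type} [Fintype ι] [DecidableEq ι] (t : AffTable ι) (i : ι)
    (q : ℚ) : t.gen i ⊗ₜ[ℂ] tpow q ≠ 0 := fun h => by
  have h1 := congrArg (compQ q) h
  rw [compQ_tmul, tcoeff_tpow, if_pos rfl, one_smul, map_zero] at h1
  exact t.gen_ne_zero i h1

namespace I2

theorem oddAction : AffTable.OddAction table .L where
  lie := isLie
  vir := isVir.prod_L_zero
  b_eq w z k hz hk := by
    have h1 : z .L = 0 := hz _ (by decide)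
    rw [form_b]
    cases k <;> first | (exact absurd hk (by decide)) | simp [mk, h1]
  c_eq w z k hz hk hw := by
    have h1 : z .L = 0 := hz _ (by decide)
    rw [form_c]
    cases k <;> first | (exact absurd hk (by decide)) | simp [mk, h1, hw]

theorem hasUnitAction_one (ξ : RootSystem) :
    HasUnitAction (loop ξ ⟨(1 : Aut table.conf), 1, one_pos, one_pow 1⟩) := by
  have hmem : ∀ i, table.gen i ⊗ₜ[ℂ] tpow 0 ∈
      loopSpace ξ ⟨(1 : Aut table.conf), 1, one_pos, one_pow 1⟩ := fun i =>
    AffTable.IsVir.tmul_mem_loopSpace (by rw [expQ_zero, one_smul]; rfl)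
  obtain ⟨u, hu⟩ := exists_loopVal ξ _ (hmem .J)
  obtain ⟨x, hx⟩ := exists_loopVal ξ _ (hmem .Gp)
  refine ⟨u, x, ?_, fun h0 => ?_, ?_⟩
  · rw [mem_loop_part, hx]
    exact tmul_mem_hatPart (table.gen_mem_part .Gp) _
  · rw [h0, map_zero] at hx
    exact table.tmul_tpow_ne_zero .Gp 0 hx.symm
  · apply loopVal_injective
    rw [loopVal_prod, hu, hx, tpow_zero, hatProd_one_tmul, ← AffTable.vec_single,
      ← AffTable.vec_single, AffTable.prod_vec_zero, AffTable.form_single, AffTable.form_single,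
      show table.a .J .Gp = Pi.single .Gp 1 from rfl, show table.b .J .Gp = 0 from rfl,
      AffTable.vec_zero, map_zero, add_zero]

/-- Up to total derivatives the acting element is free of ∂, and acting as the identity on a leading
coefficient would make its J-component equal to 1 or -1. But ω sends J to -J, so in the twisted
algebra the Galois action must negate this component, while it fixes constants. -/
theorem not_hasUnitAction_omega (ξ : RootSystem) :
    ¬HasUnitAction (loop ξ ⟨omega, 2, two_pos, omega_sq⟩) := by
  rintro ⟨u, x, hx, hx0, hux⟩
  obtain ⟨w, hw, hwu⟩ := isVir.exists_vecS ξ _ u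
  have hJ := mem_loopSpace_vecS ξ (M := swap) omega_vec hw .J
  rw [sum_univ] at hJ
  simp [swap_apply, mk] at hJ
  have hx0' : loopVal ξ _ x ≠ 0 := fun h0 =>
    hx0 (loopVal_injective ξ _ (by rw [h0, map_zero]))
  obtain ⟨K, z, hz, hK⟩ := AffTable.exists_isTop hx0'
  rw [mem_loop_part] at hx
  have he : hatProd table.conf (table.vecS w) (loopVal ξ _ x) 0 = (1 : ℂ) • loopVal ξ _ x := by
    rw [← hwu, ← loopVal_prod, hux, one_smul]
  obtain ⟨-, hform⟩ := oddAction.eigen hx hK hz he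
  obtain ⟨k, hk, hzk⟩ := AffTable.OddAction.exists_odd_ne hx hK hz
  have zJ : z .J = 0 := by
    rw [← hK.1]; exact AffTable.OddAction.hcf_eq_zero_of_odd hx K .J (by decide)
  have hk' := hform k hk
  rw [form_a] at hk'
  have hne : (1 : SHat) ≠ 0 := fun h0 => hzk (by rw [← one_mul (z k), h0, zero_mul])
  cases k
  · exact absurd hk (by decide)
  · exact absurd hk (by decide)
  · simp only [mk, zJ, mul_zero, sub_zero, one_smul] at hk'
    have h1 : w .J = 1 := mul_right_cancel₀ hzk (by rw [hk', one_mul])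
    rw [h1, map_one] at hJ
    exact hne (eq_zero_of_eq_neg hJ.symm)
  · simp only [mk, zJ, mul_zero, zero_sub, one_smul] at hk'
    have h1 : w .J = -1 := mul_right_cancel₀ hzk (by linear_combination -hk')
    rw [h1, map_neg, map_one, neg_neg] at hJ
    exact hne (eq_zero_of_eq_neg hJ)

theorem not_iso_omega (ξ : RootSystem) :
    ¬Iso (loop ξ ⟨(1 : Aut table.conf), 1, one_pos, one_pow 1⟩)
      (loop ξ ⟨omega, 2, two_pos, omega_sq⟩) := fun h =>
  not_hasUnitAction_omega ξ ((hasUnitAction_one ξ).of_iso h)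

end I2

/-! ## Leading exponents -/

/-- The elements all of whose exponents are smaller than `μ`. -/
def lowExp (μ : ℚ) : Submodule ℂ SHat := Submodule.span ℂ {f | ∃ q < μ, f = tpow q}

/-- `f` is the sum of `c t^μ` and of terms with smaller exponents. -/
def HasLead (f : SHat) (μ : ℚ) (c : ℂ) : Prop := f - c • tpow μ ∈ lowExp μ

theorem tpow_mem_lowExp {p μ : ℚ} (h : p < μ) : tpow p ∈ lowExp μ := Submodule.subset_span ⟨p, h, rfl⟩

theorem tpow_mul_mem_lowExp {g : SHat} {ν μ p : ℚ} (hg : g ∈ lowExp ν) (h : p ≤ μ) :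
    tpow p * g ∈ lowExp (μ + ν) := by
  induction hg using Submodule.span_induction with
  | mem g hg =>
    obtain ⟨q, hq, rfl⟩ := hg
    rw [tpow_mul]
    exact tpow_mem_lowExp (by linarith)
  | zero => simp
  | add x y _ _ hx hy => rw [mul_add]; exact add_mem hx hy
  | smul c x _ hx => rw [mul_smul_comm]; exact Submodule.smul_mem _ _ hx

theorem mul_mem_lowExp {f g : SHat} {μ ν : ℚ} (hf : f ∈ lowExp μ) (hg : g ∈ lowExp ν) :
    f * g ∈ lowExp (μ + ν) := by
  induction hf using Submodule.span_induction with
  | mem f hf =>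
    obtain ⟨q, hq, rfl⟩ := hf
    exact tpow_mul_mem_lowExp hg hq.le
  | zero => simp
  | add x y _ _ hx hy => rw [add_mul]; exact add_mem hx hy
  | smul c x _ hx => rw [smul_mul_assoc]; exact Submodule.smul_mem _ _ hx

theorem HasLead.mul {f g : SHat} {μ ν : ℚ} {c d : ℂ} (hf : HasLead f μ c) (hg : HasLead g ν d) :
    HasLead (f * g) (μ + ν) (c * d) := by
  have h1 := mul_mem_lowExp hf hg
  have h2 := tpow_mul_mem_lowExp hg le_rfl (μ := μ)
  have h3 := tpow_mul_mem_lowExp hf le_rfl (μ := ν)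
  rw [add_comm] at h3
  have : f * g - (c * d) • tpow (μ + ν) = (f - c • tpow μ) * (g - d • tpow ν) +
      c • (tpow μ * (g - d • tpow ν)) + d • (tpow ν * (f - c • tpow μ)) := by
    rw [← tpow_mul]
    algebra
  rw [HasLead, this]
  exact add_mem (add_mem h1 (Submodule.smul_mem _ _ h2)) (Submodule.smul_mem _ _ h3)

theorem HasLead.sub {f g : SHat} {μ : ℚ} {c d : ℂ} (hf : HasLead f μ c) (hg : HasLead g μ d) :
    HasLead (f - g) μ (c - d) := by
  have := sub_mem hf hg
  rw [HasLead]
  convert this using 1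
  module

theorem HasLead.smul {f : SHat} {μ : ℚ} {c : ℂ} (hf : HasLead f μ c) (a : ℂ) :
    HasLead (a • f) μ (a * c) := by
  have := Submodule.smul_mem _ a hf
  rw [HasLead]
  convert this using 1
  module

theorem HasLead.deltaT {f : SHat} {μ : ℚ} {c : ℂ} (hf : HasLead f μ c) :
    HasLead (deltaT f) (μ - 1) (c * μ) := by
  have h : ∀ g ∈ lowExp μ, SuperConf.deltaT g ∈ lowExp (μ - 1) := by
    intro g hg
    induction hg using Submodule.span_induction with
    | mem g hg =>
      obtain ⟨q, hq, rfl⟩ := hg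
      rw [deltaT_tpow]
      exact Submodule.smul_mem _ _ (tpow_mem_lowExp (by linarith))
    | zero => simp
    | add x y _ _ hx hy => rw [map_add]; exact add_mem hx hy
    | smul c x _ hx => rw [map_smul]; exact Submodule.smul_mem _ _ hx
  have := h _ hf
  rwa [map_sub, map_smul, deltaT_tpow, smul_smul] at this

theorem HasLead.tcoeff_eq {f : SHat} {μ : ℚ} {c : ℂ} (hf : HasLead f μ c) : tcoeff μ f = c := by
  have h : ∀ g ∈ lowExp μ, tcoeff μ g = 0 := by
    intro g hg
    induction hg using Submodule.span_induction with
    | mem g hg =>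
      obtain ⟨q, hq, rfl⟩ := hg
      rw [tcoeff_tpow, if_neg hq.ne]
    | zero => simp
    | add x y _ _ hx hy => rw [map_add, hx, hy, add_zero]
    | smul c x _ hx => rw [map_smul, hx, smul_zero]
  have := h _ hf
  rw [map_sub, map_smul, tcoeff_tpow, if_pos rfl, smul_eq_mul, mul_one] at this
  exact sub_eq_zero.mp this

theorem exists_hasLead {f : SHat} (hf : f ≠ 0) : ∃ μ c, c ≠ 0 ∧ HasLead f μ c := by
  classical
  obtain ⟨s, hs⟩ : ∃ s : Finset ℚ, s = f.coeff.support := ⟨_, rfl⟩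
  have hne : s.Nonempty := by
    rw [hs, Finsupp.support_nonempty_iff]
    intro h0
    exact hf (AddMonoidAlgebra.coeff_injective h0)
  have hsum : f = ∑ q ∈ s, tcoeff q f • tpow q := by
    apply tcoeff_ext
    intro p
    rw [map_sum]
    simp only [map_smul, tcoeff_tpow, smul_eq_mul, mul_ite, mul_one, mul_zero]
    rw [Finset.sum_ite_eq']
    split_ifs with hp
    · rfl
    · rw [hs, Finsupp.mem_support_iff, not_not] at hp
      exact hp
  refine ⟨s.max' hne, tcoeff (s.max' hne) f, ?_, ?_⟩
  · have h1 : ∀ q ∈ s, tcoeff q f ≠ 0 := fun q hq => by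
      rw [hs, Finsupp.mem_support_iff] at hq
      exact hq
    exact h1 _ (s.max'_mem hne)
  · rw [HasLead]
    have h1 := Finset.add_sum_erase s (fun q => tcoeff q f • tpow q) (s.max'_mem hne)
    have h2 : f - tcoeff (s.max' hne) f • tpow (s.max' hne) =
        ∑ q ∈ s.erase (s.max' hne), tcoeff q f • tpow q := by
      rw [sub_eq_iff_eq_add, add_comm]
      exact hsum.trans h1.symm
    rw [h2]
    refine Submodule.sum_mem _ fun q hq => Submodule.smul_mem _ _ (tpow_mem_lowExp ?_)
    exact Finset.lt_max'_of_mem_erase_max' s hne hq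

/-- Such an `r` is `t` plus a constant: d/dt is injective on all powers of `t` except t⁰. -/
theorem hasLead_of_deltaT_eq_one {r : SHat} (h : deltaT r = 1) : HasLead r 1 1 := by
  have h0 : ∀ q : ℚ, q ≠ 0 → tcoeff q (r - tpow 1) = 0 := by
    intro q hq
    have h1 : deltaT (r - tpow 1) = 0 := by
      rw [map_sub, h, deltaT_tpow, sub_self, tpow_zero]; simp
    have h2 : ∀ g : SHat, tcoeff (q - 1) (deltaT g) = q * tcoeff q g := by
      intro g
      induction g using SHat.induction with
      | h0 => simp
      | hadd f g hf hg => simp only [map_add, hf, hg, mul_add]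
      | hmono c p =>
        rw [map_smul, map_smul, map_smul, deltaT_tpow, map_smul, tcoeff_tpow, tcoeff_tpow]
        by_cases hp : p = q
        · subst hp; simp; ring
        · rw [if_neg hp, if_neg (by intro h'; apply hp; linarith)]; simp
    have h3 := h2 (r - tpow 1)
    rw [h1, map_zero] at h3
    exact (mul_eq_zero.mp h3.symm).resolve_left (by exact_mod_cast hq)
  have h1 : r - tpow 1 = tcoeff 0 (r - tpow 1) • tpow 0 := by
    apply tcoeff_ext
    intro q
    rw [map_smul, tcoeff_tpow]
    by_cases hq : q = 0
    · subst hq; simp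
    · rw [h0 q hq, if_neg (Ne.symm hq), smul_zero]
  rw [HasLead, one_smul, h1]
  exact Submodule.smul_mem _ _ (tpow_mem_lowExp one_pos)

/-- The leading exponents of two functions whose Wronskian is proportional to their product. -/
theorem sub_eq_of_wronskian {r f g : SHat} {a : ℂ} {μ ν : ℚ} {c d : ℂ} (hr : deltaT r = 1)
    (h : r * (deltaT f * g - f * deltaT g) = a • (f * g)) (hf : HasLead f μ c) (hg : HasLead g ν d)
    (hc : c ≠ 0) (hd : d ≠ 0) : ((μ - ν : ℚ) : ℂ) = a := by
  -- The leading terms of f'g and fg' have the same exponent, with coefficients μcd and νcd, so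
  -- their difference is compared with `a` times the leading coefficient cd of fg.
  have h1 := hf.deltaT.mul hg
  have h2 := hf.mul hg.deltaT
  rw [show μ + (ν - 1) = μ - 1 + ν by ring] at h2
  have h3 := (hasLead_of_deltaT_eq_one hr).mul (h1.sub h2)
  rw [h, show 1 + (μ - 1 + ν) = μ + ν by ring] at h3
  have h4 := h3.tcoeff_eq
  rw [((hf.mul hg).smul a).tcoeff_eq] at h4
  have h5 : c * d ≠ 0 := mul_ne_zero hc hd
  apply mul_right_cancel₀ h5
  push_cast
  linear_combination -h4

/-! ## Invariants of the twisted loop algebras of the matrix model -/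

/-- Elements of `B` with prescribed eigenvalues, up to sign, of a differential operator. -/
structure IsSpectral (B : ConfData) (a : ℂ) (χ : B.carrier →ₗ[ℂ] B.carrier)
    (l h x y : B.carrier) (c : ℂ) : Prop where
  comm : ∀ u v n, χ (B.prod u v n) = B.prod u (χ v) n
  der : ∀ v, B.der (χ v) = χ (B.der v) + v
  x_mem : x ∈ B.part 1
  y_mem : y ∈ B.part 1
  x_ne : x ≠ 0
  y_ne : y ≠ 0
  c_ne : c ≠ 0
  prod_x : B.prod h x 0 = c • x
  prod_y : B.prod h y 0 = c • y
  eigen_x : χ (B.der x - B.prod l x 0) = a • x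
  eigen_y : χ (B.der y - B.prod l y 0) = (-a) • y

/-- χ stands for multiplication by `t` and χ(∂ - l_(0)) for t d/dt. The common eigenvalue under
h_(0) makes the leading coefficients of `x` and `y` parallel, so that the sum of the unknown choices
cancels in a comparison of the two. -/
def HasSpectral (B : ConfData) (a : ℂ) : Prop := ∃ χ l h x y c, IsSpectral B a χ l h x y c

theorem HasSpectral.of_iso {B C : ConfData} {a : ℂ} (h : HasSpectral B a) (hBC : Iso B C) :
    HasSpectral C a := by
  obtain ⟨e, he⟩ := hBC
  obtain ⟨χ, l, h, x, y, c, H⟩ := h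
  have hp : ∀ u v n, e (B.prod u v n) = C.prod (e u) (e v) n := he.1.map_prod
  have hd : ∀ v, e (B.der v) = C.der (e v) := he.1.map_der
  have hp' : ∀ u v n, e.symm (C.prod u v n) = B.prod (e.symm u) (e.symm v) n := he.2.map_prod
  have hd' : ∀ v, e.symm (C.der v) = B.der (e.symm v) := he.2.map_der
  refine ⟨e.toLinearMap ∘ₗ χ ∘ₗ e.symm.toLinearMap, e l, e h, e x, e y, c, ?_, ?_, ?_, ?_, ?_, ?_,
    H.c_ne, ?_, ?_, ?_, ?_⟩
  · intro u v n
    simp only [LinearMap.comp_apply, LinearEquiv.coe_coe, hp', H.comm, hp, e.apply_symm_apply]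
  · intro v
    simp only [LinearMap.comp_apply, LinearEquiv.coe_coe, hd', ← hd, H.der, map_add,
      e.apply_symm_apply]
  · exact he.1.map_part 1 x H.x_mem
  · exact he.1.map_part 1 y H.y_mem
  · exact fun h0 => H.x_ne ((map_eq_zero_iff e e.injective).mp h0)
  · exact fun h0 => H.y_ne ((map_eq_zero_iff e e.injective).mp h0)
  · rw [← hp, H.prod_x, map_smul]
  · rw [← hp, H.prod_y, map_smul]
  · rw [← hp, ← hd, ← map_sub, LinearMap.comp_apply, LinearMap.comp_apply, LinearEquiv.coe_coe,
      LinearEquiv.coe_coe, e.symm_apply_apply, H.eigen_x, map_smul]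
  · rw [← hp, ← hd, ← map_sub, LinearMap.comp_apply, LinearMap.comp_apply, LinearEquiv.coe_coe,
      LinearEquiv.coe_coe, e.symm_apply_apply, H.eigen_y, map_smul]

theorem AffTable.hcf_twisted (ξ : RootSystem) {ι : Type} [Fintype ι] [DecidableEq ι]
    {t : AffTable ι} {d : Twist t.conf} {M : (ι → ℂ) →ₗ[ℂ] (ι → ℂ)}
    (h : ∀ w, d.σ.1 (t.vec w) = t.vec (M w)) (n : ℕ) (x : t.conf.carrier ⊗[ℂ] SHat) :
    t.hcf n (twisted ξ d x) = ∑ i, fun k => M (Pi.single i 1) k • galois ξ (t.hcf n x i) := by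
  ext1 k
  rw [Finset.sum_apply]
  induction x using TensorProduct.induction_on with
  | zero => simp
  | add x y hx hy =>
    simp only [map_add, Pi.add_apply, smul_add, Finset.sum_add_distrib, hx, hy]
  | tmul a f =>
    rw [twisted_tmul, hcf_tmul, IsVir.cf_aut_const h, LinearMap.pi_apply_eq_sum_univ M,
      Finset.sum_apply, Finset.sum_smul]
    refine Finset.sum_congr rfl fun i _ => ?_
    have : (fun j => if i = j then (1 : ℂ) else 0) = Pi.single i 1 := by
      ext j; simp [Pi.single_apply, eq_comm]
    rw [this, hcf_tmul, map_smul, smul_smul, Pi.smul_apply, smul_eq_mul, mul_comm]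

theorem AffTable.IsVir.hcf_prod_L_one {ι : Type} [Fintype ι] [DecidableEq ι] {t : AffTable ι}
    {L : ι} {Δ : ι → ℂ} (h : IsVir t L Δ) (x : t.conf.carrier ⊗[ℂ] SHat) (n : ℕ) (k : ι) :
    t.hcf n (hatProd t.conf (t.gen L ⊗ₜ 1) x 1) k = (Δ k + n) • t.hcf n x k := by
  induction x using TensorProduct.induction_on with
  | zero => simp
  | add x y hx hy => simp only [map_add, Finsupp.add_apply, Pi.add_apply, hx, hy, smul_add]
  | tmul a f => rw [hatProd_one_tmul, hcf_tmul, h.cf_prod_L_one, hcf_tmul, smul_smul]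

/-- The Galois condition allows only exponents in γ + ℤ, in particular for the leading term. -/
theorem expQ_eq_of_hasLead (ξ : RootSystem) {f : SHat} {γ μ : ℚ} {c : ℂ}
    (h : expQ ξ γ • galois ξ f = f) (hf : HasLead f μ c) (hc : c ≠ 0) : expQ ξ μ = expQ ξ γ := by
  have h1 := congrArg (tcoeff μ) h
  rw [map_smul, tcoeff_galois, hf.tcoeff_eq, smul_eq_mul, expQ_neg] at h1
  have h2 := expQ_ne_zero ξ μ
  have h3 : expQ ξ γ * (expQ ξ μ)⁻¹ = 1 := mul_right_cancel₀ hc (by rw [one_mul, mul_assoc, h1])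
  exact (eq_of_mul_inv_eq_one h3).symm

/-- Solutions of a first order system that are eigenvectors of a traceless matrix are parallel. -/
theorem exists_wronskian {r w₁ w₂ z₁ z₂ p q s p' q' s' : SHat} {a c : ℂ} (hc : c ≠ 0)
    (hw₁ : p * w₁ + q * w₂ = c • w₁) (hw₂ : s * w₁ - p * w₂ = c • w₂)
    (hz₁ : p * z₁ + q * z₂ = c • z₁) (hz₂ : s * z₁ - p * z₂ = c • z₂)
    (dw₁ : r * (deltaT w₁ - (p' * w₁ + q' * w₂)) = a • w₁)
    (dw₂ : r * (deltaT w₂ - (s' * w₁ - p' * w₂)) = a • w₂)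
    (dz₁ : r * (deltaT z₁ - (p' * z₁ + q' * z₂)) = (-a) • z₁)
    (dz₂ : r * (deltaT z₂ - (s' * z₁ - p' * z₂)) = (-a) • z₂)
    (hw : w₁ ≠ 0 ∨ w₂ ≠ 0) (hz : z₁ ≠ 0 ∨ z₂ ≠ 0) :
    ∃ f g, (f = w₁ ∨ f = w₂) ∧ (g = z₁ ∨ g = z₂) ∧ f ≠ 0 ∧ g ≠ 0 ∧
      r * (deltaT f * g - f * deltaT g) = (2 * a) • (f * g) := by
  -- For c ≠ 0 a traceless 2×2 matrix has the eigenvalues c and -c, so its eigenspace for c has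
  -- dimension at most one.
  have hpar : w₁ * z₂ = w₂ * z₁ := by
    have h1 : (2 * c) • (w₁ * z₂ - w₂ * z₁) = 0 := by
      simp only [Algebra.smul_def, map_mul, map_ofNat] at *
      linear_combination -z₂ * hw₁ + w₂ * hz₁ + z₁ * hw₂ - w₁ * hz₂
    exact sub_eq_zero.mp ((smul_eq_zero.mp h1).resolve_left (mul_ne_zero two_ne_zero hc))
  simp only [Algebra.smul_def, map_mul, map_ofNat, map_neg] at *
  -- Parallel non-zero vectors have a common non-zero coordinate. In its Wronskian the diagonal
  -- entry p' cancels and the off-diagonal entry is multiplied by the vanishing determinant.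
  by_cases h1 : w₁ = 0
  · have h2 : w₂ ≠ 0 := hw.resolve_left (not_not.mpr h1)
    have h3 : z₁ = 0 := by
      rw [h1, zero_mul] at hpar
      exact (mul_eq_zero.mp hpar.symm).resolve_left h2
    have h4 : z₂ ≠ 0 := hz.resolve_left (not_not.mpr h3)
    exact ⟨w₂, z₂, .inr rfl, .inr rfl, h2, h4, by
      linear_combination z₂ * dw₂ - w₂ * dz₂ + r * s' * hpar⟩
  · have h3 : z₁ ≠ 0 := by
      intro h3
      rw [h3, mul_zero] at hpar
      exact (hz.resolve_left (not_not.mpr h3)) ((mul_eq_zero.mp hpar).resolve_left h1)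
    exact ⟨w₁, z₁, .inl rfl, .inl rfl, h1, h3, by
      linear_combination z₁ * dw₁ - w₁ * dz₁ - r * q' * hpar⟩

namespace K4

theorem oddAction : AffTable.OddAction table .L where
  lie := isLie
  vir := isVir.prod_L_zero
  b_eq w z k hz hk := by
    have h1 : z .L = 0 := hz _ (by decide)
    rw [form_b]
    cases k <;> first | (exact absurd hk (by decide)) | simp [mk, h1]
  c_eq w z k hz hk hw := by
    have h1 : z .L = 0 := hz _ (by decide)
    rw [form_c]
    cases k <;> first | (exact absurd hk (by decide)) | simp [mk, h1, hw]

/-- The twist by an outer automorphism in the torus. -/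
abbrev torusTwist (ξ : RootSystem) (q : ℚ) {n : ℕ} (hn : 0 < n)
    (h : torus (expQ ξ q) (expQ_ne_zero ξ q) ^ n = 1) : Twist table.conf :=
  outerTwist (torus (expQ ξ q) (expQ_ne_zero ξ q)) hn h

theorem torusTwist_vec (ξ : RootSystem) (q : ℚ) {n : ℕ} (hn : 0 < n)
    (h : torus (expQ ξ q) (expQ_ne_zero ξ q) ^ n = 1) (w : K4 → ℂ) :
    (torusTwist ξ q hn h).σ.1 (table.vec w) =
      table.vec (outer (torus (expQ ξ q) (expQ_ne_zero ξ q)).1 w) := outerAut_vec _ _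

variable {ξ : RootSystem} {q : ℚ} {n : ℕ} {hn : 0 < n}
  {h : torus (expQ ξ q) (expQ_ne_zero ξ q) ^ n = 1}

theorem exists_gen_tmul {i : K4} {p : ℚ}
    (hi : outer (torus (expQ ξ q) (expQ_ne_zero ξ q)).1 (Pi.single i 1) =
      expQ ξ p • Pi.single i 1) :
    ∃ x, loopVal ξ (torusTwist ξ q hn h) x = table.gen i ⊗ₜ tpow p := by
  refine exists_loopVal ξ _ (AffTable.IsVir.tmul_mem_loopSpace ?_)
  rw [← AffTable.vec_single, torusTwist_vec, hi, AffTable.vec_smul]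

theorem exists_gen_L : ∃ x, loopVal ξ (torusTwist ξ q hn h) x = table.gen .L ⊗ₜ 1 := by
  rw [← tpow_zero]
  refine exists_gen_tmul ?_
  rw [expQ_zero, one_smul]
  ext1 k
  cases k <;> simp [outer_apply, mk]

theorem exists_gen_H : ∃ x, loopVal ξ (torusTwist ξ q hn h) x = table.gen .H ⊗ₜ 1 := by
  rw [← tpow_zero]
  refine exists_gen_tmul ?_
  rw [expQ_zero, one_smul]
  ext1 k
  cases k <;> simp [outer_apply, mk]

theorem prod_H_gen {i : K4} {c : ℂ} (ha : table.a .H i = Pi.single i c) (hb : table.b .H i = 0) :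
    table.conf.prod (table.gen .H) (table.gen i) 0 = c • table.gen i := by
  rw [← AffTable.vec_single, ← AffTable.vec_single, AffTable.prod_vec_zero, AffTable.form_single,
    AffTable.form_single, ha, hb, AffTable.vec_zero, map_zero, add_zero, ← AffTable.vec_smul,
    ← Pi.single_smul, smul_eq_mul, mul_one]

/-- The witnesses are x₂₁ ⊗ t^q and x₂₂ ⊗ t^{-q}, with χ multiplication by `t`. They lie in one row,
so H gives both the eigenvalue -1, and in different columns, on which the torus element acts by e(q)
and e(-q). -/
theorem hasSpectral_torus : HasSpectral (loop ξ (torusTwist ξ q hn h)) q := by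
  obtain ⟨l, hl⟩ := exists_gen_L (ξ := ξ) (q := q) (hn := hn) (h := h)
  obtain ⟨u, hu⟩ := exists_gen_H (ξ := ξ) (q := q) (hn := hn) (h := h)
  obtain ⟨x, hx⟩ := exists_gen_tmul (ξ := ξ) (q := q) (hn := hn) (h := h) (i := .x21) (p := q) (by
    ext1 k
    cases k <;> simp [outer_apply, mk, torus_val])
  obtain ⟨y, hy⟩ := exists_gen_tmul (ξ := ξ) (q := q) (hn := hn) (h := h) (i := .x22) (p := -q) (by
    ext1 k
    cases k <;> simp [outer_apply, mk, torus_val, expQ_neg])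
  have ht : galois ξ (tpow 1) = tpow 1 := by
    rw [galois_tpow, show (-1 : ℚ) = ((-1 : ℤ) : ℚ) by norm_num, expQ_int, one_smul]
  have hd : deltaT (tpow 1) = 1 := by rw [deltaT_tpow, sub_self, tpow_zero]; simp
  have hmem : ∀ v ∈ loopSpace ξ (torusTwist ξ q hn h),
      sm (tpow 1) v ∈ loopSpace ξ (torusTwist ξ q hn h) := by
    intro v hv
    rw [mem_loopSpace_iff] at hv ⊢
    rw [AffTable.twisted_sm, ht, hv]
  let χ : (loop ξ (torusTwist ξ q hn h)).carrier →ₗ[ℂ] (loop ξ (torusTwist ξ q hn h)).carrier :=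
    (sm (tpow 1)).restrict hmem
  have hχ : ∀ v, loopVal ξ (torusTwist ξ q hn h) (χ v) = sm (tpow 1) (loopVal ξ _ v) :=
    fun _ => rfl
  have heig : ∀ (i : K4) (p : ℚ), sm (tpow 1) (hatDer table.conf (table.gen i ⊗ₜ tpow p) -
      hatProd table.conf (table.gen .L ⊗ₜ 1) (table.gen i ⊗ₜ tpow p) 0) =
      (p : ℂ) • table.gen i ⊗ₜ tpow p := by
    intro i p
    rw [hatDer_tmul, hatProd_one_tmul, isVir.prod_L_zero, add_sub_cancel_left, sm_tmul, deltaT_tpow,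
      mul_smul_comm, tpow_mul, add_sub_cancel, TensorProduct.tmul_smul]
  refine ⟨χ, l, u, x, y, -1, ?_, ?_, ?_, ?_, ?_, ?_, by norm_num, ?_, ?_, ?_, ?_⟩
  · intro u v n
    apply loopVal_injective
    rw [hχ, loopVal_prod, loopVal_prod, hχ, hatProd_sm_right]
  · intro v
    apply loopVal_injective
    rw [map_add, hχ, loopVal_der, loopVal_der, hχ, hatDer_sm, hd, sm_one, add_comm]
  · rw [mem_loop_part, hx]
    exact tmul_mem_hatPart (table.gen_mem_part .x21) _
  · rw [mem_loop_part, hy]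
    exact tmul_mem_hatPart (table.gen_mem_part .x22) _
  · intro h0
    rw [h0, map_zero] at hx
    exact table.tmul_tpow_ne_zero .x21 q hx.symm
  · intro h0
    rw [h0, map_zero] at hy
    exact table.tmul_tpow_ne_zero .x22 (-q) hy.symm
  · apply loopVal_injective
    rw [map_smul, loopVal_prod, hu, hx, hatProd_one_tmul, prod_H_gen rfl rfl,
      TensorProduct.smul_tmul']
  · apply loopVal_injective
    rw [map_smul, loopVal_prod, hu, hy, hatProd_one_tmul, prod_H_gen rfl rfl,
      TensorProduct.smul_tmul']
  · apply loopVal_injective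
    rw [hχ, map_sub, loopVal_der, loopVal_prod, map_smul, hl, hx, heig]
  · apply loopVal_injective
    rw [hχ, map_sub, loopVal_der, loopVal_prod, map_smul, hl, hy, heig]
    push_cast
    rfl

/-- Its purpose is to write every odd element as a product with H, so that an operator commuting
with products is known on the odd part once it is known on H. -/
theorem prod_H_prod_H {x : table.conf.carrier ⊗[ℂ] SHat} (hx : x ∈ hatPart table.conf 1) :
    hatProd table.conf (table.gen .H ⊗ₜ 1) (hatProd table.conf (table.gen .H ⊗ₜ 1) x 0) 0 = x := by
  refine hatPart_induction (motive := fun x => hatProd table.conf (table.gen .H ⊗ₜ 1)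
    (hatProd table.conf (table.gen .H ⊗ₜ 1) x 0) 0 = x) (by simp)
    (fun x y hx hy => ?_) (fun a ha g => ?_) hx
  · rw [map_add, Finsupp.add_apply, map_add, Finsupp.add_apply, hx, hy]
  · rw [hatProd_one_tmul, hatProd_one_tmul]
    congr 1
    refine AffTable.part_induction (motive := fun a => table.conf.prod (table.gen .H)
      (table.conf.prod (table.gen .H) a 0) 0 = a) (by simp) (fun x y hx hy => ?_)
      (fun c x hx => ?_) (fun x hx => ?_) (fun i hi => ?_) ha
    · rw [map_add, Finsupp.add_apply, map_add, Finsupp.add_apply, hx, hy]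
    · rw [map_smul, Finsupp.smul_apply, map_smul, Finsupp.smul_apply, hx]
    · rw [isLie.prod_der, Nat.cast_zero, zero_smul, add_zero, isLie.prod_der, Nat.cast_zero,
        zero_smul, add_zero, hx]
    · cases i
      all_goals first | (exact absurd hi (by decide)) | skip
      all_goals
        rw [prod_H_gen rfl rfl, map_smul, Finsupp.smul_apply, prod_H_gen rfl rfl, smul_smul]
        simp

/-- An operator that commutes with all products is the multiplication by a function on the
odd part. -/
theorem exists_mult {χ : (loop ξ (torusTwist ξ q hn h)).carrier →ₗ[ℂ]
      (loop ξ (torusTwist ξ q hn h)).carrier}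
    (comm : ∀ u v n, χ ((loop ξ (torusTwist ξ q hn h)).prod u v n) =
      (loop ξ (torusTwist ξ q hn h)).prod u (χ v) n)
    (der : ∀ v, (loop ξ (torusTwist ξ q hn h)).der (χ v) =
      χ ((loop ξ (torusTwist ξ q hn h)).der v) + v) :
    ∃ r, deltaT r = 1 ∧ ∀ x ∈ (loop ξ (torusTwist ξ q hn h)).part 1, ∀ u,
      loopVal ξ _ (χ ((loop ξ (torusTwist ξ q hn h)).der x -
        (loop ξ (torusTwist ξ q hn h)).prod u x 0)) =
      sm r (hatDer table.conf (loopVal ξ _ x) -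
        hatProd table.conf (loopVal ξ _ u) (loopVal ξ _ x) 0) := by
  obtain ⟨l, hl⟩ := exists_gen_L (ξ := ξ) (q := q) (hn := hn) (h := h)
  obtain ⟨u, hu⟩ := exists_gen_H (ξ := ξ) (q := q) (hn := hn) (h := h)
  obtain ⟨v, hv⟩ : ∃ v, v = loopVal ξ _ (χ u) := ⟨_, rfl⟩
  -- The image of H ⊗ 1 under χ has weight 1 for the 1-product of L and is annihilated by the
  -- 0-product of H. This forces it to be H ⊗ r for a function `r`.
  have h1 : hatProd table.conf (table.gen .L ⊗ₜ 1) v 1 = v := by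
    have : (loop ξ (torusTwist ξ q hn h)).prod l u 1 = u := by
      apply loopVal_injective
      rw [loopVal_prod, hl, hu, hatProd_one_tmul, ← AffTable.vec_single, ← AffTable.vec_single,
        AffTable.prod_vec_one, AffTable.form_single, show table.c .L .H = Pi.single .H 1 from rfl]
    rw [hv, ← hl, ← loopVal_prod, ← comm, this]
  have h2 : hatProd table.conf (table.gen .H ⊗ₜ 1) v 0 = 0 := by
    have : (loop ξ (torusTwist ξ q hn h)).prod u u 0 = 0 := by
      apply loopVal_injective
      rw [loopVal_prod, hu, hatProd_one_tmul, prod_H_gen (c := 0) (by rw [Pi.single_zero]; rfl) rfl,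
        zero_smul, TensorProduct.zero_tmul, map_zero]
    rw [hv, ← hu, ← loopVal_prod, ← comm, this, map_zero, map_zero]
  have h3 : ∀ (n : ℕ) k, wt k + n ≠ 1 → table.hcf n v k = 0 := by
    intro n k hne
    have h4 := isVir.hcf_prod_L_one v n k
    rw [h1] at h4
    have h5 : (wt k + n - 1) • table.hcf n v k = 0 := by rw [sub_smul, ← h4, one_smul, sub_self]
    exact (smul_eq_zero.mp h5).resolve_left (sub_ne_zero.mpr hne)
  obtain ⟨z, hz⟩ : ∃ z, z = table.hcf 0 v := ⟨_, rfl⟩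
  have hvz : v = table.vecS z := by
    have h4 := AffTable.eq_sum_hatD (t := table) (x := v) (K := 0) (fun n hn => by
      ext1 k
      refine h3 n k fun h0 => ?_
      have := congrArg Complex.re h0
      have hn' : (1 : ℝ) ≤ n := by exact_mod_cast hn
      cases k <;> norm_num [wt] at this <;> linarith)
    rw [h4, zero_add, Finset.sum_range_one, pow_zero, Module.End.one_apply, hz]
  have hodd : ∀ k, wt k ≠ 1 → z k = 0 := fun k hk => by
    rw [hz]; exact h3 0 k (by simpa using hk)
  rw [hvz, ← AffTable.vecS_single, AffTable.hatProd_vecS_vecS] at h2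
  have h4 := congrArg (table.hcf 0) h2
  rw [map_add, AffTable.hcf_vecS_zero, AffTable.hcf_hatD_zero, map_zero, add_zero, form_a,
    form_c] at h4
  have hE := congrFun h4 .E
  have hF := congrFun h4 .F
  simp [mk, deltaT_one] at hE hF
  have hvr : v = table.gen .H ⊗ₜ z .H := by
    rw [hvz, ← AffTable.vecS_single]
    congr 1
    ext1 k
    cases k
    · exact hodd _ (by norm_num [wt])
    · simpa using hE
    · simp
    · simpa using hF
    all_goals exact hodd _ (by norm_num [wt])
  -- The 0-product with L ⊗ 1 commutes with χ and agrees with the derivation on H ⊗ 1. The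
  -- commutator of the derivation with χ, which is the identity, therefore differentiates `r` alone.
  have hr : deltaT (z .H) = 1 := by
    have hd : (loop ξ (torusTwist ξ q hn h)).der u =
        (loop ξ (torusTwist ξ q hn h)).prod l u 0 := by
      apply loopVal_injective
      rw [loopVal_der, loopVal_prod, hl, hu, hatProd_one_tmul, isVir.prod_L_zero, hatDer_tmul,
        deltaT_one, TensorProduct.tmul_zero, add_zero]
    have h5 := congrArg (loopVal ξ _) (der u)
    rw [hd, comm, map_add, loopVal_der, loopVal_prod, ← hv, hl, hu, hvr, hatProd_one_tmul,
      isVir.prod_L_zero, hatDer_tmul] at h5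
    have h6 := congrFun (congrArg (table.hcf 0) (add_left_cancel h5)) .H
    rw [← AffTable.vecS_single, ← AffTable.vecS_single, AffTable.hcf_vecS_zero,
      AffTable.hcf_vecS_zero, Pi.single_eq_same, Pi.single_eq_same] at h6
    exact h6
  -- The elements on which χ is multiplication by `r`. This space contains H ⊗ 1 and is stable under
  -- the derivation and under products from the left.
  let S : Submodule ℂ (loop ξ (torusTwist ξ q hn h)).carrier :=
    LinearMap.ker (loopVal ξ _ ∘ₗ χ - sm (z .H) ∘ₗ loopVal ξ _)
  have hS : ∀ y, y ∈ S ↔ loopVal ξ _ (χ y) = sm (z .H) (loopVal ξ _ y) := fun y => by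
    rw [LinearMap.mem_ker, LinearMap.sub_apply, sub_eq_zero]; rfl
  have hSprod : ∀ u y n, y ∈ S → (loop ξ (torusTwist ξ q hn h)).prod u y n ∈ S := by
    intro u y n hy
    rw [hS] at hy ⊢
    rw [comm, loopVal_prod, hy, hatProd_sm_right, ← loopVal_prod]
  have hSder : ∀ y ∈ S, (loop ξ (torusTwist ξ q hn h)).der y ∈ S := by
    intro y hy
    rw [hS] at hy ⊢
    rw [← sub_eq_iff_eq_add.mpr (der y), map_sub, loopVal_der, hy, hatDer_sm, hr, sm_one,
      add_sub_cancel_left, loopVal_der]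
  have hSu : u ∈ S := by
    rw [hS, ← hv, hvr, hu, sm_tmul, mul_one]
  have hSdpow : ∀ l, ∀ y ∈ S, dpow (loop ξ (torusTwist ξ q hn h)).der l y ∈ S := by
    intro l y hy
    rw [dpow_apply]
    refine Submodule.smul_mem _ _ ?_
    induction l with
    | zero => simpa using hy
    | succ l ih => rw [pow_succ', Module.End.mul_apply]; exact hSder _ ih
  have hu0 : u ∈ (loop ξ (torusTwist ξ q hn h)).part 0 := by
    rw [mem_loop_part, hu]
    exact tmul_mem_hatPart (table.gen_mem_part .H) _
  have hSodd : ∀ y ∈ (loop ξ (torusTwist ξ q hn h)).part 1, y ∈ S := by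
    intro y hy
    have hlie := loop_isLie ξ (torusTwist ξ q hn h) isLie
    have h5 : (loop ξ (torusTwist ξ q hn h)).prod u
        ((loop ξ (torusTwist ξ q hn h)).prod u y 0) 0 = y := by
      apply loopVal_injective
      rw [loopVal_prod, loopVal_prod, hu]
      exact prod_H_prod_H ((mem_loop_part ξ _ y 1).mp hy)
    have h6 : (loop ξ (torusTwist ξ q hn h)).prod u y 0 ∈
        (loop ξ (torusTwist ξ q hn h)).part 1 := by
      have := hlie.prod_mem 0 1 u hu0 y hy 0
      rwa [zero_add] at this
    -- The assumption on χ concerns the right factor; skew-symmetry moves H there, up to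
    -- derivatives.
    rw [← h5, hlie.skew 0 1 u hu0 _ h6 0]
    refine Submodule.neg_mem _ (Submodule.smul_mem _ _ ?_)
    refine finsum_induction (· ∈ S) (zero_mem _) (fun _ _ => add_mem) fun l => ?_
    exact Submodule.smul_mem _ _ (hSdpow _ _ (hSprod _ _ _ hSu))
  refine ⟨z .H, hr, fun x hx u => ?_⟩
  have hx' := hSodd x hx
  rw [(hS _).mp (sub_mem (hSder _ hx') (hSprod u x 0 hx')), map_sub, loopVal_der, loopVal_prod]

theorem eq_zero_of_odd {x : table.conf.carrier ⊗[ℂ] SHat} (hx : x ∈ hatPart table.conf 1) {K : ℕ}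
    {z : K4 → SHat} (hK : AffTable.IsTop x K z) : z .E = 0 ∧ z .H = 0 ∧ z .F = 0 := by
  rw [← hK.1]
  exact ⟨AffTable.OddAction.hcf_eq_zero_of_odd hx K .E (by decide),
    AffTable.OddAction.hcf_eq_zero_of_odd hx K .H (by decide),
    AffTable.OddAction.hcf_eq_zero_of_odd hx K .F (by decide)⟩

/-- The exponents that occur in the two columns of an element of the twisted loop algebra. -/
theorem exponents {x : (loop ξ (torusTwist ξ q hn h)).carrier} {K : ℕ} {z : K4 → SHat}
    (hK : AffTable.IsTop (loopVal ξ _ x) K z) :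
    (∀ f, f = z .x11 ∨ f = z .x21 → expQ ξ q • galois ξ f = f) ∧
      ∀ f, f = z .x12 ∨ f = z .x22 → expQ ξ (-q) • galois ξ f = f := by
  have h1 := AffTable.hcf_twisted ξ (torusTwist_vec ξ q hn h) K (loopVal ξ _ x)
  rw [(mem_loopSpace_iff ξ _ _).mp (loopVal_mem ξ _ x), hK.1, sum_outer, torus_val] at h1
  have a1 := congrFun h1 .x11
  have a2 := congrFun h1 .x12
  have a3 := congrFun h1 .x21
  have a4 := congrFun h1 .x22
  simp [mk] at a1 a2 a3 a4
  rw [expQ_neg]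
  constructor
  · rintro f (rfl | rfl)
    · exact a1.symm
    · exact a3.symm
  · rintro f (rfl | rfl)
    · exact a2.symm
    · exact a4.symm

/-- The leading coefficients of the two elements, restricted to suitable columns, give functions
`f`, `g` whose leading exponents differ by exactly 2p. Each exponent lies in q + ℤ or in -q + ℤ,
according to the column; the three alternatives are the possible differences. -/
theorem HasSpectral.expQ_eq {p : ℚ} (H : HasSpectral (loop ξ (torusTwist ξ q hn h)) p) :
    expQ ξ (2 * p) = 1 ∨ expQ ξ (2 * p) = expQ ξ (2 * q) ∨
      expQ ξ (2 * p) = expQ ξ (-(2 * q)) := by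
  obtain ⟨χ, l, u, x, y, c, H⟩ := H
  obtain ⟨r, hr, hχ⟩ := exists_mult H.comm H.der
  have hr0 : r ≠ 0 := by
    rintro rfl
    rw [map_zero] at hr
    have := congrArg (tcoeff 0) hr
    rw [← tpow_zero, tcoeff_tpow, if_pos rfl, map_zero] at this
    exact zero_ne_one this
  obtain ⟨wl, -, hwl⟩ := isVir.exists_vecS ξ _ l
  obtain ⟨wu, -, hwu⟩ := isVir.exists_vecS ξ _ u
  have hx := (mem_loop_part ξ _ x 1).mp H.x_mem
  have hy := (mem_loop_part ξ _ y 1).mp H.y_mem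
  obtain ⟨K, z, hz0, hK⟩ := AffTable.exists_isTop (t := table) (x := loopVal ξ _ x)
    fun h0 => H.x_ne (loopVal_injective ξ _ (by rw [h0, map_zero]))
  obtain ⟨K', z', hz0', hK'⟩ := AffTable.exists_isTop (t := table) (x := loopVal ξ _ y)
    fun h0 => H.y_ne (loopVal_injective ξ _ (by rw [h0, map_zero]))
  have ex := (oddAction.eigen hx hK hz0 (w := wu) (c := c) (by
    rw [← hwu, ← loopVal_prod, H.prod_x, map_smul])).2
  have ey := (oddAction.eigen hy hK' hz0' (w := wu) (c := c) (by
    rw [← hwu, ← loopVal_prod, H.prod_y, map_smul])).2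
  have dx := oddAction.deriv_eigen hx hK hz0 (w := wl) (c := (p : ℂ)) hr0 (by
    rw [← hwl, ← hχ x H.x_mem, H.eigen_x, map_smul])
  have dy := oddAction.deriv_eigen hy hK' hz0' (w := wl) (c := -(p : ℂ)) hr0 (by
    rw [← hwl, ← hχ y H.y_mem, H.eigen_y, map_smul])
  obtain ⟨zE, zH, zF⟩ := eq_zero_of_odd hx hK
  obtain ⟨zE', zH', zF'⟩ := eq_zero_of_odd hy hK'
  generalize wl - Pi.single .L 1 = m at dx dy
  simp only [form_a] at ex ey dx dy
  -- The currents act on both columns of an odd matrix by the same 2×2 matrix, so any column of `z`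
  -- can be compared with any column of `z'`.
  have key : ∀ (i j i' j' : K4), (i = .x11 ∧ j = .x21 ∨ i = .x12 ∧ j = .x22) →
      (i' = .x11 ∧ j' = .x21 ∨ i' = .x12 ∧ j' = .x22) → (z i ≠ 0 ∨ z j ≠ 0) →
      (z' i' ≠ 0 ∨ z' j' ≠ 0) → ∃ f g, (f = z i ∨ f = z j) ∧ (g = z' i' ∨ g = z' j') ∧ f ≠ 0 ∧
        g ≠ 0 ∧ r * (deltaT f * g - f * deltaT g) = (2 * (p : ℂ)) • (f * g) := by
    intro i j i' j' hij hij' hne hne'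
    have cx : wu .H * z i + wu .E * z j = c • z i ∧ wu .F * z i - wu .H * z j = c • z j ∧
        r * (deltaT (z i) - (m .H * z i + m .E * z j)) = (p : ℂ) • z i ∧
        r * (deltaT (z j) - (m .F * z i - m .H * z j)) = (p : ℂ) • z j := by
      rcases hij with ⟨rfl, rfl⟩ | ⟨rfl, rfl⟩
      · have e1 := ex .x11 rfl
        have e2 := ex .x21 rfl
        have e3 := dx .x11 rfl
        have e4 := dx .x21 rfl
        simp only [mk, zE, zH, zF, mul_zero, sub_zero, add_zero] at e1 e2 e3 e4
        exact ⟨by rw [add_comm, e1], e2, by rw [add_comm (m .H * _), e3], e4⟩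
      · have e1 := ex .x12 rfl
        have e2 := ex .x22 rfl
        have e3 := dx .x12 rfl
        have e4 := dx .x22 rfl
        simp only [mk, zE, zH, zF, mul_zero, sub_zero, add_zero] at e1 e2 e3 e4
        exact ⟨by rw [add_comm, e1], e2, by rw [add_comm (m .H * _), e3], e4⟩
    have cy : wu .H * z' i' + wu .E * z' j' = c • z' i' ∧
        wu .F * z' i' - wu .H * z' j' = c • z' j' ∧
        r * (deltaT (z' i') - (m .H * z' i' + m .E * z' j')) = (-(p : ℂ)) • z' i' ∧
        r * (deltaT (z' j') - (m .F * z' i' - m .H * z' j')) = (-(p : ℂ)) • z' j' := by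
      rcases hij' with ⟨rfl, rfl⟩ | ⟨rfl, rfl⟩
      · have e1 := ey .x11 rfl
        have e2 := ey .x21 rfl
        have e3 := dy .x11 rfl
        have e4 := dy .x21 rfl
        simp only [mk, zE', zH', zF', mul_zero, sub_zero, add_zero] at e1 e2 e3 e4
        exact ⟨by rw [add_comm, e1], e2, by rw [add_comm (m .H * _), e3], e4⟩
      · have e1 := ey .x12 rfl
        have e2 := ey .x22 rfl
        have e3 := dy .x12 rfl
        have e4 := dy .x22 rfl
        simp only [mk, zE', zH', zF', mul_zero, sub_zero, add_zero] at e1 e2 e3 e4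
        exact ⟨by rw [add_comm, e1], e2, by rw [add_comm (m .H * _), e3], e4⟩
    exact exists_wronskian H.c_ne cx.1 cx.2.1 cy.1 cy.2.1 cx.2.2.1 cx.2.2.2 cy.2.2.1 cy.2.2.2
      hne hne'
  have hcol : ∀ {x : (loop ξ (torusTwist ξ q hn h)).carrier} {K : ℕ} {z : K4 → SHat},
      loopVal ξ _ x ∈ hatPart table.conf 1 → AffTable.IsTop (loopVal ξ _ x) K z → z ≠ 0 →
      ∃ i j γ, (i = .x11 ∧ j = .x21 ∨ i = .x12 ∧ j = .x22) ∧ (z i ≠ 0 ∨ z j ≠ 0) ∧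
        (γ = q ∨ γ = -q) ∧ ∀ f, f = z i ∨ f = z j → expQ ξ γ • galois ξ f = f := by
    intro x K z hx hK hz
    obtain ⟨k, hk, hzk⟩ := AffTable.OddAction.exists_odd_ne hx hK hz
    cases k
    all_goals first | (exact absurd hk (by decide)) | skip
    · exact ⟨.x11, .x21, q, .inl ⟨rfl, rfl⟩, .inl hzk, .inl rfl, (exponents hK).1⟩
    · exact ⟨.x12, .x22, -q, .inr ⟨rfl, rfl⟩, .inl hzk, .inr rfl, (exponents hK).2⟩
    · exact ⟨.x11, .x21, q, .inl ⟨rfl, rfl⟩, .inr hzk, .inl rfl, (exponents hK).1⟩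
    · exact ⟨.x12, .x22, -q, .inr ⟨rfl, rfl⟩, .inr hzk, .inr rfl, (exponents hK).2⟩
  obtain ⟨i, j, γ, hij, hne, hγ, hf⟩ := hcol hx hK hz0
  obtain ⟨i', j', γ', hij', hne', hγ', hg⟩ := hcol hy hK' hz0'
  obtain ⟨f, g, hfm, hgm, hf0, hg0, hfg⟩ := key i j i' j' hij hij' hne hne'
  obtain ⟨μ, a, ha, hμ⟩ := exists_hasLead hf0
  obtain ⟨ν, b, hb, hν⟩ := exists_hasLead hg0
  have h1 := expQ_eq_of_hasLead ξ (hf f hfm) hμ ha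
  have h2 := expQ_eq_of_hasLead ξ (hg g hgm) hν hb
  have h3 : μ - ν = 2 * p := by
    have := sub_eq_of_wronskian hr hfg hμ hν ha hb
    exact_mod_cast this
  rw [← h3, sub_eq_add_neg, expQ_add, expQ_neg, h1, h2, ← expQ_neg, ← expQ_add]
  rcases hγ with rfl | rfl <;> rcases hγ' with rfl | rfl
  · left; rw [add_neg_cancel, expQ_zero]
  · right; left; congr 1; ring
  · right; right; congr 1; ring
  · left; rw [add_neg_cancel, expQ_zero]

/-- The twist of an isomorphism class of twisted loop algebras is determined up to sign. -/
theorem expQ_eq_of_iso {p : ℚ} {m : ℕ} {hm : 0 < m}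
    {h' : torus (expQ ξ p) (expQ_ne_zero ξ p) ^ m = 1}
    (H : Iso (loop ξ (torusTwist ξ p hm h')) (loop ξ (torusTwist ξ q hn h))) :
    expQ ξ (2 * p) = expQ ξ (2 * q) ∨ expQ ξ (2 * p) = expQ ξ (-(2 * q)) := by
  -- The alternative e(2p) = 1 is settled by the same statement for the inverse isomorphism, which
  -- then yields e(2q) = 1.
  have h1 := HasSpectral.expQ_eq (hasSpectral_torus.of_iso H)
  have h2 := HasSpectral.expQ_eq (hasSpectral_torus.of_iso H.symm)
  rcases h1 with h1 | h1
  · left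
    rcases h2 with h2 | h2 | h2
    · rw [h1, h2]
    · exact h2.symm
    · rw [h2, expQ_neg, h1, inv_one]
  · exact h1

end K4

/-! ## Transport along the isomorphism with the matrix model -/

/-- Transport of automorphisms along an isomorphism. -/
def autCongr {A B : ConfData} {e : A.carrier ≃ₗ[ℂ] B.carrier} (he : IsConfIso e) :
    Aut B →* Aut A where
  toFun τ := ⟨(e.trans τ.1).trans e.symm,
    he.2.comp (τ.2.1.comp he.1), he.2.comp (τ.2.2.comp he.1)⟩
  map_one' := Subtype.ext <| LinearEquiv.ext fun x => e.symm_apply_apply x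
  map_mul' τ τ' := Subtype.ext <| LinearEquiv.ext fun x =>
    congrArg (fun y => e.symm (τ.1 y)) (e.apply_symm_apply (τ'.1 (e x))).symm

theorem apply_autCongr {A B : ConfData} {e : A.carrier ≃ₗ[ℂ] B.carrier} (he : IsConfIso e)
    (τ : Aut B) (x : A.carrier) : e ((autCongr he τ).1 x) = τ.1 (e x) := e.apply_symm_apply _

/-- Transport of twists along an isomorphism. -/
def twistCongr {A B : ConfData} {e : A.carrier ≃ₗ[ℂ] B.carrier} (he : IsConfIso e)
    (d : Twist B) : Twist A :=
  ⟨autCongr he d.σ, d.m, d.pos, by rw [← map_pow, d.pow_eq_one, map_one]⟩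

theorem loop_twistCongr (ξ : RootSystem) {A B : ConfData} {e : A.carrier ≃ₗ[ℂ] B.carrier}
    (he : IsConfIso e) (d : Twist B) : Iso (loop ξ (twistCongr he d)) (loop ξ d) :=
  loop_iso_of_equiv ξ he (apply_autCongr he d.σ)

theorem IsUniversalCentralExt.comp_iso {B B' E : ConfData} {π : E.carrier →ₗ[ℂ] B.carrier}
    (h : IsUniversalCentralExt B E π) {e : B.carrier ≃ₗ[ℂ] B'.carrier} (he : IsConfIso e) :
    IsUniversalCentralExt B' E (e.toLinearMap ∘ₗ π) := by
  refine ⟨h.1.comp_iso he, fun F μ hμ => ?_⟩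
  obtain ⟨f, ⟨hf, hf'⟩, hu⟩ := h.2 F _ (hμ.comp_iso (e := e.symm) ⟨he.2, he.1⟩)
  have key : ∀ g : E.carrier →ₗ[ℂ] F.carrier,
      (e.symm.toLinearMap ∘ₗ μ) ∘ₗ g = π ↔ μ ∘ₗ g = e.toLinearMap ∘ₗ π := by
    intro g
    simp only [LinearMap.ext_iff, LinearMap.comp_apply, LinearEquiv.coe_coe,
      LinearEquiv.symm_apply_eq]
  exact ⟨f, ⟨hf, (key f).1 hf'⟩, fun g hg => hu g ⟨hg.1, (key g).2 hg.2⟩⟩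

/-- A loop algebra of the `N = 2` or `N = 4` conformal superalgebra is isomorphic to a centreless
Lie conformal superalgebra with a universal central extension. -/
theorem exists_iso_centreless (ξ : RootSystem) {A : ConfData} (hA : A = N2 ∨ A = N4) (d : Twist A) :
    ∃ B, Iso B (loop ξ d) ∧ B.IsLie ∧ centre B = ⊥ ∧ ∃ E π, IsUniversalCentralExt B E π := by
  rcases hA with rfl | rfl
  · exact ⟨_, Iso.refl _, loop_isLie ξ (A := I2.table.conf) d I2.isVir.lie,
      I2.isVir.centre_eq_bot ξ d, I2.isVir.exists_uce⟩
  · obtain ⟨e, he, -⟩ := I4.exists_matEquiv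
    exact ⟨_, loop_twistCongr ξ (A := K4.table.conf) (B := I4.table.conf) (e := e.symm)
      ⟨he.2, he.1⟩ d, loop_isLie ξ _ K4.isVir.lie, K4.isVir.centre_eq_bot ξ _,
      K4.isVir.exists_uce⟩

theorem loop_exists_uce (ξ : RootSystem) {A : ConfData} (hA : A = N2 ∨ A = N4) (d : Twist A) :
    ∃ E π, IsUniversalCentralExt (loop ξ d) E π := by
  obtain ⟨B, ⟨e, he⟩, -, -, E, π, h⟩ := exists_iso_centreless ξ hA d
  exact ⟨E, _, h.comp_iso he⟩

/-- An isomorphism of loop algebras lifts by universality. Conversely each loop algebra is, up to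
isomorphism, the quotient of its extension by the centre. -/
theorem loop_iso_iff_uce_iso (ξ : RootSystem) {A B : ConfData} (hA : A = N2 ∨ A = N4)
    (hB : B = N2 ∨ B = N4) {d : Twist A} {d' : Twist B} {E F : ConfData}
    {π : E.carrier →ₗ[ℂ] (loop ξ d).carrier} {μ : F.carrier →ₗ[ℂ] (loop ξ d').carrier}
    (h : IsUniversalCentralExt (loop ξ d) E π) (h' : IsUniversalCentralExt (loop ξ d') F μ) :
    Iso (loop ξ d) (loop ξ d') ↔ Iso E F := by
  refine ⟨iso_of_iso_base h h', fun H => ?_⟩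
  obtain ⟨C, ⟨e, he⟩, hC, hC', -⟩ := exists_iso_centreless ξ hA d
  obtain ⟨D, ⟨f, hf⟩, hD, hD', -⟩ := exists_iso_centreless ξ hB d'
  have h1 : Iso C D := iso_of_iso_ext (h.1.comp_iso (e := e.symm) ⟨he.2, he.1⟩)
    (h'.1.comp_iso (e := f.symm) ⟨hf.2, hf.1⟩) hC hD hC' hD' H
  exact (Iso.symm ⟨e, he⟩).trans (h1.trans ⟨f, hf⟩)

namespace I4

/-- The isomorphism with the matrix model. -/
def matEquiv : table.conf.carrier ≃ₗ[ℂ] K4.table.conf.carrier := exists_matEquiv.choose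

theorem matEquiv_isConfIso : IsConfIso matEquiv := exists_matEquiv.choose_spec.1

theorem matEquiv_vec (w : I4 → ℂ) : matEquiv (table.vec w) = K4.table.vec (toMat w) :=
  exists_matEquiv.choose_spec.2 w

/-- The action of `SL₂(ℂ)` on the `N = 4` conformal superalgebra. -/
def outerAut : SL(2, ℂ) →* Aut table.conf := (autCongr matEquiv_isConfIso).comp K4.outerAut

theorem outerAut_vec (X : SL(2, ℂ)) {w w' : I4 → ℂ}
    (h : K4.outer X.1 (toMat w) = toMat w') :
    (outerAut X).1 (table.vec w) = table.vec w' := by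
  refine matEquiv.injective ?_
  have h1 := apply_autCongr matEquiv_isConfIso (K4.outerAut X) (table.vec w)
  rw [matEquiv_vec, K4.outerAut_vec, h, ← matEquiv_vec] at h1
  exact h1

theorem outerAut_gen (X : SL(2, ℂ)) :
    (outerAut X).1 (table.gen .L) = table.gen .L ∧
    (∀ s, (outerAut X).1 (table.gen (.J s)) = table.gen (.J s)) ∧
    (outerAut X).1 (table.gen (.G 0)) =
      X.1 0 0 • table.gen (.G 0) + X.1 1 0 • table.gen (.Gbar 1) ∧
    (outerAut X).1 (table.gen (.Gbar 1)) =
      X.1 0 1 • table.gen (.G 0) + X.1 1 1 • table.gen (.Gbar 1) ∧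
    (outerAut X).1 (table.gen (.G 1)) =
      X.1 0 0 • table.gen (.G 1) - X.1 1 0 • table.gen (.Gbar 0) ∧
    (outerAut X).1 (table.gen (.Gbar 0)) =
      -(X.1 0 1 • table.gen (.G 1)) + X.1 1 1 • table.gen (.Gbar 0) := by
  simp only [← AffTable.vec_single, ← AffTable.vec_smul, ← AffTable.vec_add, ← AffTable.vec_sub,
    ← AffTable.vec_neg]
  refine ⟨?_, fun s => ?_, ?_, ?_, ?_, ?_⟩ <;> refine outerAut_vec X ?_ <;>
    simp only [toMat_apply, K4.outer_apply] <;> ext1 k <;>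
    (cases k <;> simp [K4.mk])

theorem loop_outer_iso (ξ : RootSystem) (X : SL(2, ℂ)) {n : ℕ} (hn : 0 < n) (h : X ^ n = 1)
    (h' : outerAut X ^ n = 1) :
    Iso (loop ξ ⟨outerAut X, n, hn, h'⟩) (loop ξ (K4.outerTwist X hn h)) :=
  loop_twistCongr ξ matEquiv_isConfIso (K4.outerTwist X hn h)

theorem exists_loop_outer_iso (ξ : RootSystem) (d : Twist table.conf) :
    ∃ (X : SL(2, ℂ)) (n : ℕ) (hn : 0 < n) (h : X ^ n = 1),
      Iso (loop ξ d) (loop ξ (K4.outerTwist X hn h)) := by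
  have he : IsConfIso matEquiv.symm := ⟨matEquiv_isConfIso.2, matEquiv_isConfIso.1⟩
  obtain ⟨X, n, hn, h, hX⟩ := K4.loop_iso_outerTwist ξ (twistCongr he d)
  exact ⟨X, n, hn, h, (loop_twistCongr ξ he d).symm.trans hX⟩

end I4

/-! ## Conjugacy classes in `PGL₂(ℂ)` -/

section ProjectiveGroup

open Matrix.SpecialLinearGroup

theorem toPGL_surjective : Function.Surjective (toPGL : SL(2, ℂ) →* PGL(2, ℂ)) := by
  intro g
  obtain ⟨x, rfl⟩ := Matrix.ProjectiveSpecialLinearGroup.toPGL_surj_of_roots (n := Fin 2) (R := ℂ)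
    (fun r => by
      obtain ⟨z, hz⟩ := IsAlgClosed.exists_pow_nat_eq (r : ℂ) two_pos
      have hz0 : z ≠ 0 := by
        rintro rfl
        exact r.ne_zero (by rw [← hz, zero_pow two_ne_zero])
      exact ⟨Units.mk0 z hz0, Units.ext (by simpa using hz)⟩) g
  obtain ⟨X, rfl⟩ := QuotientGroup.mk_surjective x
  exact ⟨X, rfl⟩

theorem toPGL_eq_one_iff (X : SL(2, ℂ)) : toPGL X = 1 ↔ X = 1 ∨ X = -1 := by
  rw [← MonoidHom.mem_ker, toPGL_ker, mem_center_iff]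
  constructor
  · rintro ⟨r, hr, hX⟩
    rcases mul_self_eq_one_iff.mp ((pow_two r).symm.trans hr) with rfl | rfl
    · left; apply Subtype.ext; rw [← hX]; simp
    · right; apply Subtype.ext; rw [← hX, map_neg, map_one]; rfl
  · rintro (rfl | rfl)
    · exact ⟨1, by simp, by simp⟩
    · exact ⟨-1, by simp, by rw [map_neg, map_one]; rfl⟩

theorem toPGL_neg (X : SL(2, ℂ)) : toPGL (-X) = toPGL X := by
  rw [← neg_one_mul, map_mul, (toPGL_eq_one_iff (-1)).mpr (.inr rfl), one_mul]

/-- An element of finite order of `PGL₂(ℂ)` lifts to an element of finite order of `SL₂(ℂ)`. -/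
theorem exists_toPGL_eq {g : PGL(2, ℂ)} (hg : IsOfFinOrder g) :
    ∃ (X : SL(2, ℂ)) (n : ℕ), 0 < n ∧ X ^ n = 1 ∧ toPGL X = g := by
  obtain ⟨X, rfl⟩ := toPGL_surjective g
  obtain ⟨n, hn, h⟩ := isOfFinOrder_iff_pow_eq_one.mp hg
  rw [← map_pow, toPGL_eq_one_iff] at h
  refine ⟨X, n * 2, Nat.mul_pos hn two_pos, ?_, rfl⟩
  rw [pow_mul]
  rcases h with h | h <;> rw [h] <;> simp

/-- SL₂ maps onto PGL₂ with kernel ±1, so conjugacy lifts up to a sign. -/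
theorem isConj_toPGL_iff (X Y : SL(2, ℂ)) :
    IsConj (toPGL X) (toPGL Y) ↔ ∃ k : SL(2, ℂ), k * X = Y * k ∨ k * X = -Y * k := by
  rw [isConj_iff]
  constructor
  · rintro ⟨c, hc⟩
    obtain ⟨k, rfl⟩ := toPGL_surjective c
    rw [← mul_inv_eq_one, ← map_inv, ← map_inv, ← map_mul, ← map_mul, ← map_mul,
      toPGL_eq_one_iff, mul_inv_eq_one, mul_inv_eq_iff_eq_mul, mul_inv_eq_iff_eq_mul,
      mul_inv_eq_iff_eq_mul, neg_one_mul] at hc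
    exact ⟨k, hc⟩
  · rintro ⟨k, hk⟩
    refine ⟨toPGL k, ?_⟩
    rw [mul_inv_eq_iff_eq_mul]
    rcases hk with hk | hk
    · rw [← map_mul, hk, map_mul]
    · rw [← map_mul, hk, map_mul, toPGL_neg]

end ProjectiveGroup

namespace K4

open Matrix.SpecialLinearGroup

theorem loop_outer_iso_of_isConj (ξ : RootSystem) {X Y : SL(2, ℂ)} {n m : ℕ} (hn : 0 < n)
    (h : X ^ n = 1) (hm : 0 < m) (h' : Y ^ m = 1) (hXY : IsConj (toPGL X) (toPGL Y)) :
    Iso (loop ξ (outerTwist X hn h)) (loop ξ (outerTwist Y hm h')) := by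
  obtain ⟨k, hk | hk⟩ := (isConj_toPGL_iff X Y).mp hXY
  · exact loop_outer_conj_iso ξ hn h hm h' hk
  · have hY : (-Y) ^ (2 * m) = 1 := by rw [pow_mul, neg_sq, ← pow_mul, mul_comm, pow_mul, h', one_pow]
    have hm' : 0 < 2 * m := Nat.mul_pos two_pos hm
    exact (loop_outer_conj_iso ξ hn h hm' hY hk).trans (loop_outer_neg_iso ξ hm h' hm' hY)

theorem toPGL_torus_eq {a b : ℂ} (ha : a ≠ 0) (hb : b ≠ 0) (h : a ^ 2 = b ^ 2) :
    toPGL (torus a ha) = toPGL (torus b hb) := by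
  rcases sq_eq_sq_iff_eq_or_eq_neg.mp h with rfl | rfl
  · rfl
  · rw [← toPGL_neg (torus b hb)]
    congr 1
    apply Subtype.ext
    rw [torus_val, coe_neg, torus_val]
    ext i j
    fin_cases i <;> fin_cases j <;> simp [inv_neg]

theorem isConj_torus_inv {a : ℂ} (ha : a ≠ 0) :
    IsConj (torus a ha) (torus a⁻¹ (inv_ne_zero ha)) := by
  obtain ⟨k, hk⟩ : ∃ k : SL(2, ℂ), k.1 = !![0, 1; -1, 0] := ⟨⟨!![0, 1; -1, 0], by simp⟩, rfl⟩
  refine isConj_iff.mpr ⟨k, ?_⟩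
  rw [mul_inv_eq_iff_eq_mul]
  apply Subtype.ext
  rw [coe_mul, coe_mul, torus_val, torus_val]
  rw [hk]
  ext i j
  fin_cases i <;> fin_cases j <;> simp

/-- Both elements are diagonalizable with eigenvalues e(±p) and e(±q), and the loop algebra
determines e(2p) up to inversion. -/
theorem isConj_of_loop_outer_iso (ξ : RootSystem) {X Y : SL(2, ℂ)} {n m : ℕ} (hn : 0 < n)
    (h : X ^ n = 1) (hm : 0 < m) (h' : Y ^ m = 1)
    (H : Iso (loop ξ (outerTwist X hn h)) (loop ξ (outerTwist Y hm h'))) :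
    IsConj (toPGL X) (toPGL Y) := by
  obtain ⟨k, p, hX⟩ := exists_torus ξ hn h
  obtain ⟨l, q, hY⟩ := exists_torus ξ hm h'
  have hk : X * k = k * torus (expQ ξ p) (expQ_ne_zero ξ p) := by rw [hX]; group
  have hl : l * torus (expQ ξ q) (expQ_ne_zero ξ q) = Y * l := by rw [hY]; group
  have cX : IsConj (torus (expQ ξ p) (expQ_ne_zero ξ p)) X := isConj_iff.mpr ⟨k, hX.symm⟩
  have cY : IsConj (torus (expQ ξ q) (expQ_ne_zero ξ q)) Y := isConj_iff.mpr ⟨l, hY.symm⟩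
  have pX : torus (expQ ξ p) (expQ_ne_zero ξ p) ^ n = 1 := by
    rw [hX, conj_pow, conj_eq_one_iff] at h
    exact h
  have pY : torus (expQ ξ q) (expQ_ne_zero ξ q) ^ m = 1 := by
    rw [hY, conj_pow, conj_eq_one_iff] at h'
    exact h'
  have H' : Iso (loop ξ (torusTwist ξ p hn pX)) (loop ξ (torusTwist ξ q hm pY)) :=
    (loop_outer_conj_iso ξ hn pX hn h hk.symm).trans
      (H.trans (loop_outer_conj_iso ξ hm pY hm h' hl).symm)
  refine ((toPGL.map_isConj cX).symm.trans ?_).trans (toPGL.map_isConj cY)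
  -- Equal squares mean equality up to sign, which is invisible in PGL₂; in the inverse case the
  -- Weyl element exchanges the two eigenvalues.
  rcases expQ_eq_of_iso H' with e | e
  · rw [← Nat.cast_ofNat, expQ_nat_mul, expQ_nat_mul] at e
    rw [toPGL_torus_eq _ (expQ_ne_zero ξ q) e]
  · rw [expQ_neg, ← Nat.cast_ofNat, expQ_nat_mul, expQ_nat_mul, ← inv_pow] at e
    rw [toPGL_torus_eq _ (inv_ne_zero (expQ_ne_zero ξ q)) e]
    exact (toPGL.map_isConj (isConj_torus_inv _)).symm

theorem loop_outer_iso_iff (ξ : RootSystem) {X Y : SL(2, ℂ)} {n m : ℕ} (hn : 0 < n)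
    (h : X ^ n = 1) (hm : 0 < m) (h' : Y ^ m = 1) :
    Iso (loop ξ (outerTwist X hn h)) (loop ξ (outerTwist Y hm h')) ↔
      IsConj (toPGL X) (toPGL Y) :=
  ⟨isConj_of_loop_outer_iso ξ hn h hm h', loop_outer_iso_of_isConj ξ hn h hm h'⟩

end K4

namespace I4

open Matrix.SpecialLinearGroup

theorem loop_outer_iso_iff (ξ : RootSystem) {X Y : SL(2, ℂ)} {n m : ℕ} (hn : 0 < n)
    (h : X ^ n = 1) (hm : 0 < m) (h' : Y ^ m = 1) (hX : outerAut X ^ n = 1)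
    (hY : outerAut Y ^ m = 1) :
    Iso (loop ξ ⟨outerAut X, n, hn, hX⟩) (loop ξ ⟨outerAut Y, m, hm, hY⟩) ↔
      IsConj (toPGL X) (toPGL Y) := by
  rw [← K4.loop_outer_iso_iff ξ hn h hm h']
  have a := loop_outer_iso ξ X hn h hX
  have b := loop_outer_iso ξ Y hm h' hY
  exact ⟨fun H => a.symm.trans (H.trans b), fun H => a.trans (H.trans b.symm)⟩

theorem outerAut_pow {X : SL(2, ℂ)} {n : ℕ} (h : X ^ n = 1) : outerAut X ^ n = 1 := by
  rw [← map_pow, h, map_one]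

theorem exists_equiv_loopClass (ξ : RootSystem) :
    ∃ F : FinOrderClasses ≃ LoopClass ξ table.conf,
      ∀ (c : FinOrderClasses) (X : SL(2, ℂ)) (n : ℕ) (hn : 0 < n) (h : X ^ n = 1),
        c.1 = ConjClasses.mk (toPGL X) → F c = loopClass ξ (outerAut X) n hn (outerAut_pow h) := by
  have key : ∀ c : FinOrderClasses, ∃ (X : SL(2, ℂ)) (n : ℕ), 0 < n ∧ X ^ n = 1 ∧
      ConjClasses.mk (toPGL X) = c.1 := by
    rintro ⟨_, g, hg, rfl⟩
    obtain ⟨X, n, hn, h, rfl⟩ := exists_toPGL_eq hg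
    exact ⟨X, n, hn, h, rfl⟩
  choose x N hN hx hc using key
  -- Read from left to right this gives independence of the chosen representative, and from right to
  -- left injectivity.
  have main : ∀ (c : FinOrderClasses) (X : SL(2, ℂ)) (n : ℕ) (hn : 0 < n) (h : X ^ n = 1),
      c.1 = ConjClasses.mk (toPGL X) ↔ loopClass ξ (outerAut (x c)) (N c) (hN c)
        (outerAut_pow (hx c)) = loopClass ξ (outerAut X) n hn (outerAut_pow h) := by
    intro c X n hn h
    rw [← hc c, ConjClasses.mk_eq_mk_iff_isConj, ← loop_outer_iso_iff ξ (hN c) (hx c) hn h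
      (outerAut_pow (hx c)) (outerAut_pow h)]
    exact (Quotient.eq (r := loopSetoid ξ table.conf)).symm
  refine ⟨Equiv.ofBijective (fun c => loopClass ξ (outerAut (x c)) (N c) (hN c)
    (outerAut_pow (hx c))) ⟨fun c c' H => ?_, fun z => ?_⟩, fun c X n hn h => (main c X n hn h).1⟩
  · exact Subtype.ext (((main c _ _ (hN c') (hx c')).2 H).trans (hc c'))
  · obtain ⟨d, rfl⟩ := Quotient.exists_rep z
    obtain ⟨X, n, hn, h, H⟩ := exists_loop_outer_iso ξ d
    have hfin : IsOfFinOrder (toPGL X) :=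
      toPGL.isOfFinOrder (isOfFinOrder_iff_pow_eq_one.mpr ⟨n, hn, h⟩)
    refine ⟨⟨ConjClasses.mk (toPGL X), _, hfin, rfl⟩, ?_⟩
    refine ((main _ X n hn h).1 rfl).trans ?_
    exact Quotient.sound (H.trans (loop_outer_iso ξ X hn h (outerAut_pow h)).symm).symm

theorem infinite_loopClass (ξ : RootSystem) : Infinite (LoopClass ξ table.conf) := by
  have hpow : ∀ k : ℕ, K4.torus (expQ ξ (1 / (2 * (k + 3) : ℕ))) (expQ_ne_zero ξ _) ^
      (2 * (k + 3)) = 1 := by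
    intro k
    apply Subtype.ext
    have : expQ ξ (1 / (2 * (k + 3) : ℕ)) ^ (2 * (k + 3)) = 1 := by
      rw [← expQ_nat_mul, expQ_eq_one_iff]
      exact ⟨1, by field_simp; simp⟩
    rw [K4.torus_pow, K4.torus_val, this]
    ext i j
    fin_cases i <;> fin_cases j <;> simp
  have hpos : ∀ k : ℕ, 0 < 2 * (k + 3) := fun k => by omega
  refine Infinite.of_injective (fun k : ℕ => loopClass ξ (outerAut _) (2 * (k + 3)) (hpos k)
    (outerAut_pow (hpow k))) fun k l H => ?_
  have h1 : Iso (loop ξ _) (loop ξ _) := Quotient.exact H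
  have h2 : Iso (loop ξ (K4.torusTwist ξ _ (hpos k) (hpow k)))
      (loop ξ (K4.torusTwist ξ _ (hpos l) (hpow l))) :=
    (loop_outer_iso ξ _ (hpos k) (hpow k) _).symm.trans
      (h1.trans (loop_outer_iso ξ _ (hpos l) (hpow l) _))
  -- The doubled exponents 1/(k + 3) lie strictly between 0 and 1/2, where a number is determined by
  -- its class modulo ℤ up to sign.
  have hdiv : ∀ k : ℕ, 2 * (1 / ((2 * (k + 3) : ℕ) : ℚ)) = 1 / (k + 3) := by
    intro k
    push_cast
    field_simp
  have hlt : ∀ k : ℕ, 0 < 1 / ((k : ℚ) + 3) ∧ 1 / ((k : ℚ) + 3) < 1 / 2 := by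
    intro k
    have : (0 : ℚ) ≤ k := k.cast_nonneg
    exact ⟨by positivity, one_div_lt_one_div_of_lt two_pos (by linarith)⟩
  obtain ⟨a1, a2⟩ := hlt k
  obtain ⟨b1, b2⟩ := hlt l
  have h3 := K4.expQ_eq_of_iso h2
  rw [hdiv, hdiv, expQ_eq_iff, expQ_eq_iff] at h3
  rcases h3 with ⟨n, h4⟩ | ⟨n, h4⟩
  · have h5 : (-1 : ℚ) < n := by linarith
    have h6 : (n : ℚ) < 1 := by linarith
    have h7 : n = 0 := by
      have : -1 < n := by exact_mod_cast h5
      have : n < 1 := by exact_mod_cast h6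
      omega
    rw [h7, Int.cast_zero, add_zero, one_div, one_div, inv_inj, add_left_inj] at h4
    exact_mod_cast h4
  · have h5 : (0 : ℚ) < n := by linarith
    have h6 : (n : ℚ) < 1 := by linarith
    have : 0 < n := by exact_mod_cast h5
    have : n < 1 := by exact_mod_cast h6
    omega

end I4

end SuperConf

end

/-! ### The main theorem -/

theorem mainTheorem9 (ξ : SuperConf.RootSystem) :
    -- `N = 2`: exactly two isomorphism classes, those of the identity and of `ω`
    (∃ ω : SuperConf.Aut SuperConf.N2, SuperConf.IsOmega ω ∧ ∃ h : ω ^ 2 = 1,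
      SuperConf.loopClass ξ (1 : SuperConf.Aut SuperConf.N2) 1 one_pos (one_pow 1) ≠
        SuperConf.loopClass ξ ω 2 two_pos h ∧
      ∀ c : SuperConf.LoopClass ξ SuperConf.N2,
        c = SuperConf.loopClass ξ 1 1 one_pos (one_pow 1) ∨
          c = SuperConf.loopClass ξ ω 2 two_pos h) ∧
    -- `N = 4`: infinitely many isomorphism classes, parametrized by the conjugacy classes of
    -- elements of finite order of `PGL₂(ℂ)`
    Infinite (SuperConf.LoopClass ξ SuperConf.N4) ∧
    (∃ ρ : Matrix.SpecialLinearGroup (Fin 2) ℂ →* SuperConf.Aut SuperConf.N4,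
      SuperConf.IsOuterAction ρ ∧
      ∃ Φ : SuperConf.FinOrderClasses ≃ SuperConf.LoopClass ξ SuperConf.N4,
        ∀ (c : SuperConf.FinOrderClasses) (X : Matrix.SpecialLinearGroup (Fin 2) ℂ)
          (n : ℕ) (hn : 0 < n) (h : X ^ n = 1),
          c.1 = ConjClasses.mk (Matrix.SpecialLinearGroup.toPGL X) →
            Φ c = SuperConf.loopClass ξ (ρ X) n hn (by rw [← map_pow, h, map_one])) ∧
    -- Universal central extensions exist, and they detect isomorphism
    (∀ A B : SuperConf.ConfData,
      (A = SuperConf.N2 ∨ A = SuperConf.N4) → (B = SuperConf.N2 ∨ B = SuperConf.N4) →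
      ∀ (d : SuperConf.Twist A) (e : SuperConf.Twist B),
        (∃ E π, SuperConf.IsUniversalCentralExt (SuperConf.loop ξ d) E π) ∧
        ∀ E π F μ, SuperConf.IsUniversalCentralExt (SuperConf.loop ξ d) E π →
          SuperConf.IsUniversalCentralExt (SuperConf.loop ξ e) F μ →
          (SuperConf.Iso (SuperConf.loop ξ d) (SuperConf.loop ξ e) ↔ SuperConf.Iso E F)) := by
  -- `N2` and `N4` are by definition the algebras of `I2.table` and `I4.table`, so the results for
  -- tables apply without transport.
  refine ⟨⟨SuperConf.I2.omega, SuperConf.I2.omega_isOmega, SuperConf.I2.omega_sq, fun H => ?_,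
    fun c => ?_⟩, SuperConf.I4.infinite_loopClass ξ,
    ⟨SuperConf.I4.outerAut, SuperConf.I4.outerAut_gen, SuperConf.I4.exists_equiv_loopClass ξ⟩,
    fun A B hA hB d e => ⟨SuperConf.loop_exists_uce ξ hA d,
      fun E π F μ h h' => SuperConf.loop_iso_iff_uce_iso ξ hA hB h h'⟩⟩
  · exact SuperConf.I2.not_iso_omega ξ (Quotient.exact H)
  · obtain ⟨d, rfl⟩ := Quotient.exists_rep c
    exact (SuperConf.I2.loop_iso_cases ξ d).imp (fun h => Quotient.sound h)
      (fun h => Quotient.sound h)
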